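/- **Proposition 7.1 (stability of the semi-discretization).** *Exact flow.* Let $\Gamma^0\subset\mathbb R^3$ be a smooth closed surface and $X:\Gamma^0\times[0,T]\to\mathbb R^3$ ($T>0$) a sufficiently smooth solution of mean curvature flow (it suffices that $X$ is jointly of class $C^{k+4}$): $X(p,0)=p$, each $X(\cdot,t)$ is an embedding with image $\Gamma(t)$, and $\partial_tX(p,t)=v(X(p,t),t)$ with $v=-H\nu$, where $\nu(\cdot,t)$ is the unit outer normal of $\Gamma(t)$ and $H=\operatorname{tr}\nabla_{\Gamma(t)}\nu$. Put $u=(\nu,H)$. *Finite elements.* Take a conforming triangulation by flat triangles with vertices on $\Gamma^0$ that the nearest-point projection maps bijectively onto $\Gamma^0$. Let $h$ be its maximal triangle diameter and assume that it is admissible (shape regular and quasi-uniform) with constant $\sigma>0$: every triangle contains a disc of radius $h/\sigma$. Its nodes $p_1,\dots,p_N\in\Gamma^0$ are the nearest points on $\Gamma^0$ of the degree-$k$ Lagrange nodes of the flat triangles. A nodal vector $\mathbf x\in\mathbb R^{3N}$ defines, by piecewise polynomial interpolation of degree $k$ on the reference triangle, the discrete surface $\Gamma_h[\mathbf x]$ with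 nodal basis functions $\phi_j[\mathbf x]$ spanning $S_h[\mathbf x]$. Let $$\mathbf M(\mathbf x)_{ij}=\int_{\Gamma_h[\mathbf x]}\phi_i\phi_j,\qquad \mathbf A(\mathbf x)_{ij}=\int_{\Gamma_h[\mathbf x]}\nabla_{\Gamma_h[\mathbf x]}\phi_i\cdot\nabla_{\Gamma_h[\mathbf x]}\phi_j,\qquad \mathbf K=\mathbf M+\mathbf A,$$ acting componentwise on vectors in $\mathbb R^{dN}$. For $\mathbf u\in\mathbb R^{4N}$ with finite element function $u_h=(\nu_h,H_h)$ on $\Gamma_h[\mathbf x]$ let $\mathbf f(\mathbf x,\mathbf u)\in\mathbb R^{4N}$ have the entries $\int|\nabla\nu_h|^2(\nu_h)_\ell\,\phi_j$ $(\ell=1,2,3)$ and $\int|\nabla\nu_h|^2H_h\,\phi_j$, and let $\mathbf g(\mathbf x,\mathbf u)\in\mathbb R^{3N}$ have the entries $-\int H_h(\nu_h)_\ell\,\phi_j-\int\nabla(H_h(\nu_h)_\ell)\cdot\nabla\phi_j$, where the integrals and tangential gradients are over $\Gamma_h[\mathbf x]$. *Semi-discretization.* $(\mathbf x,\mathbf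 v,\mathbf u)$ solves, with $\mathbf x(0)=(p_j)$, $$\mathbf K(\mathbf x)\mathbf v=\mathbf g(\mathbf x,\mathbf u),\qquad \mathbf M(\mathbf x)\dot{\mathbf u}+\mathbf A(\mathbf x)\mathbf u=\mathbf f(\mathbf x,\mathbf u),\qquad \dot{\mathbf x}=\mathbf v .$$ *Reference values and defects.* Let $\mathbf x^*(t),\mathbf v^*(t)$ collect the values $X(p_j,t)$ and $v(X(p_j,t),t)$, and let $\mathbf u^*(t)$ be the nodal vector of the Ritz projection $u_h^*\in S_h[\mathbf x^*]^4$ of $u$, $$\int_{\Gamma_h[\mathbf x^*]}\nabla u_h^*\cdot\nabla\varphi_h+\int_{\Gamma_h[\mathbf x^*]}u_h^*\cdot\varphi_h=\int_{\Gamma(t)}\nabla u\cdot\nabla\varphi_h^l+\int_{\Gamma(t)}u\cdot\varphi_h^l\qquad\text{for all }\varphi_h\in S_h[\mathbf x^*]^4,$$ where $\varphi_h^l$ is the lift of $\varphi_h$ to $\Gamma(t)$ by the nearest-point projection. The defects $\mathbf d_{\mathbf v},\mathbf d_{\mathbf u}$ on $[0,T]$ are given by $$\mathbf K(\mathbf x^*)\mathbf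 v^*=\mathbf g(\mathbf x^*,\mathbf u^*)+\mathbf M(\mathbf x^*)\mathbf d_{\mathbf v},\qquad \mathbf M(\mathbf x^*)\dot{\mathbf u}^*+\mathbf A(\mathbf x^*)\mathbf u^*=\mathbf f(\mathbf x^*,\mathbf u^*)+\mathbf M(\mathbf x^*)\mathbf d_{\mathbf u}.$$ The errors are $\mathbf e_{\mathbf x}=\mathbf x-\mathbf x^*$, $\mathbf e_{\mathbf v}=\mathbf v-\mathbf v^*$, $\mathbf e_{\mathbf u}=\mathbf u-\mathbf u^*$. Write $\|\mathbf w\|_{\mathbf M}^2=\mathbf w^T\mathbf M\mathbf w$, $\|\mathbf w\|_{\mathbf K}^2=\mathbf w^T\mathbf K\mathbf w$ and $\|\mathbf w\|_{\star,\mathbf x^*}^2=\mathbf w^T\mathbf M(\mathbf x^*)\mathbf K(\mathbf x^*)^{-1}\mathbf M(\mathbf x^*)\mathbf w$ (the $L^2$ norm, the $H^1$ norm and the discrete dual norm $H_h^{-1}$ of the finite element function). *Claim.* There is a constant $C$, depending only on the exact solution (including $T$), on $k$ and on $\sigma$, such that for all real $\kappa$ with $1<\kappa\le k$ and all $c$ there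 is $h_0>0$ with the following property for all such triangulations with $h\le h_0$. Suppose that $$\|\mathbf d_{\mathbf v}(t)\|_{\star,\mathbf x^*(t)}\le ch^\kappa,\qquad \|\mathbf d_{\mathbf u}(t)\|_{\mathbf M(\mathbf x^*(t))}\le ch^\kappa\qquad(0\le t\le T),$$ and $\|\mathbf e_{\mathbf u}(0)\|_{\mathbf K(\mathbf x^*(0))}\le ch^\kappa$. Then, for every solution of the semi-discretization on $[0,T]$ (or on any interval $[0,S]$ with $0<S\le T$), at all times $t$ of that interval, $$\begin{aligned}&\|\mathbf e_{\mathbf x}(t)\|_{\mathbf K(\mathbf x^*(t))}^2+\|\mathbf e_{\mathbf v}(t)\|_{\mathbf K(\mathbf x^*(t))}^2+\|\mathbf e_{\mathbf u}(t)\|_{\mathbf K(\mathbf x^*(t))}^2\\&\quad\le C\|\mathbf e_{\mathbf u}(0)\|_{\mathbf K(\mathbf x^*(0))}^2+C\max_{0\le s\le t}\|\mathbf d_{\mathbf v}(s)\|_{\star,\mathbf x^*(s)}^2+C\int_0^t\|\mathbf d_{\mathbf u}(s)\|_{\mathbf M(\mathbf x^*(s))}^2\,ds .\end{aligned}$$ 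-/

import Mathlib

open Set Filter Topology MeasureTheory
open scoped Kronecker Matrix ContDiff

noncomputable section

namespace ESFEM

/-- Ambient Euclidean three-space. -/
abbrev E3 := EuclideanSpace ℝ (Fin 3)

/-- The plane containing the reference triangle. -/
abbrev Plane := Fin 2 → ℝ

/-! ### Surfaces in three-space -/

/-- A smooth closed surface: a nonempty compact set which is locally the regular zero level set of a
smooth function (so it has no boundary). -/
def IsSmoothClosedSurface (Γ : Set E3) : Prop :=
  IsCompact Γ ∧ Γ.Nonempty ∧
    ∀ p ∈ Γ, ∃ U : Set E3, ∃ φ : E3 → ℝ, IsOpen U ∧ p ∈ U ∧ ContDiffOn ℝ ∞ φ U ∧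
      (∀ y ∈ U, fderiv ℝ φ y ≠ 0) ∧ Γ ∩ U = {y ∈ U | φ y = 0}

/-- The points not on `Γ` whose connected component in the complement of `Γ` is unbounded. -/
def outside (Γ : Set E3) : Set E3 :=
  {y | y ∉ Γ ∧ ¬ Bornology.IsBounded (connectedComponentIn Γᶜ y)}

/-- The points not on `Γ` whose connected component in the complement of `Γ` is bounded. -/
def inside (Γ : Set E3) : Set E3 :=
  {y | y ∉ Γ ∧ Bornology.IsBounded (connectedComponentIn Γᶜ y)}

/-- `n` is the unit outer normal to `Γ` at `x`. On a regular surface the tangent cone at `x` is the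
tangent plane. -/
structure IsOuterUnitNormal (Γ : Set E3) (x n : E3) : Prop where
  norm_eq_one : ‖n‖ = 1
  orthogonal : ∀ w ∈ tangentConeAt ℝ Γ x, inner ℝ n w = 0
  outward : ∀ᶠ s in 𝓝[>] (0 : ℝ), x + s • n ∈ outside Γ ∧ x - s • n ∈ inside Γ

/-- The extended Weingarten map `∇_Γ ν` at `x`: the derivative of the normal field `ν` along `Γ` on
tangent vectors, and zero on the normal `ν x`. -/
def weingarten (Γ : Set E3) (ν : E3 → E3) (x : E3) : E3 →L[ℝ] E3 :=
  (fderivWithin ℝ ν Γ x).comp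
    (ContinuousLinearMap.id ℝ E3 - (innerSL ℝ (ν x)).smulRight (ν x))

/-- The mean curvature `H = tr (∇_Γ ν)`, the sum of the principal curvatures. -/
def meanCurvature (Γ : Set E3) (ν : E3 → E3) (x : E3) : ℝ :=
  LinearMap.trace ℝ E3 (weingarten Γ ν x : E3 →ₗ[ℝ] E3)

/-- The nearest point on `Γ` (unique when `Γ` is a regular compact surface and `x` is close to it).
It is the point `y ∈ Γ` with `x = y + d(x) ν(y)`, where `d` is the signed distance. -/
def nearestPoint (Γ : Set E3) (x : E3) : E3 :=
  Classical.epsilon fun y => y ∈ Γ ∧ dist x y = Metric.infDist x Γ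

/-- A solution of mean curvature flow on `[0, T]`, of class `C^m` jointly in space and time, that
starts at `Γ₀`: the flow map `X` with the outer normal field `ν t` on the surface at time `t`. Only
the values of `X` on `Γ₀ × [0, T]` and of `ν t` on the surface at time `t` matter. -/
structure MeanCurvatureFlow (Γ₀ : Set E3) (T : ℝ) (m : ℕ) where
  /-- the flow map -/
  X : E3 → ℝ → E3
  /-- the normal field -/
  ν : ℝ → E3 → E3
  contDiffOn : ContDiffOn ℝ m (Function.uncurry X) (Γ₀ ×ˢ Icc 0 T)
  initial : ∀ p ∈ Γ₀, X p 0 = p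
  injOn : ∀ t ∈ Icc 0 T, InjOn (fun p => X p t) Γ₀
  immersion : ∀ t ∈ Icc 0 T, ∀ p ∈ Γ₀, ∀ w ∈ tangentConeAt ℝ Γ₀ p,
    fderivWithin ℝ (fun q => X q t) Γ₀ p w = 0 → w = 0
  normal : ∀ t ∈ Icc 0 T, ∀ x ∈ (fun p => X p t) '' Γ₀,
    IsOuterUnitNormal ((fun p => X p t) '' Γ₀) x (ν t x)
  velocity : ∀ t ∈ Icc 0 T, ∀ p ∈ Γ₀,
    HasDerivWithinAt (X p)
      (-(meanCurvature ((fun q => X q t) '' Γ₀) (ν t) (X p t)) • ν t (X p t)) (Icc 0 T) t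

namespace MeanCurvatureFlow

variable {Γ₀ : Set E3} {T : ℝ} {m : ℕ} (F : MeanCurvatureFlow Γ₀ T m)

/-- The exact surface `Γ(t)`. -/
def surface (t : ℝ) : Set E3 := (fun p => F.X p t) '' Γ₀

/-- The mean curvature `H(·, t)` of `Γ(t)`. -/
def H (t : ℝ) (x : E3) : ℝ := meanCurvature (F.surface t) (F.ν t) x

/-- The velocity `v = - H ν` of the surface. -/
def v (t : ℝ) (x : E3) : E3 := -(F.H t x) • F.ν t x

/-- The four components of `u = (ν, H)`. -/
def u (t : ℝ) (x : E3) : Fin 4 → ℝ := ![F.ν t x 0, F.ν t x 1, F.ν t x 2, F.H t x]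

end MeanCurvatureFlow

/-! ### Lagrange elements on the reference triangle -/

/-- The closed reference triangle. -/
def refTriangle : Set Plane := {ξ | 0 ≤ ξ 0 ∧ 0 ≤ ξ 1 ∧ ξ 0 + ξ 1 ≤ 1}

/-- Indices `(a, b)` of the degree `k` Lagrange nodes `(a/k, b/k)` of the reference triangle. -/
abbrev LagIdx (k : ℕ) := {α : Fin (k + 1) × Fin (k + 1) // α.1.val + α.2.val ≤ k}

/-- The nodal polynomial of degree `k` on the reference triangle which is one at the node
`(a/k, b/k)` and zero at the other nodes, written in barycentric coordinates. -/
def shape (k : ℕ) (α : LagIdx k) (ξ : Plane) : ℝ :=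
  (∏ i ∈ Finset.range α.1.1.val, ((k : ℝ) * ξ 0 - i) / ((α.1.1.val : ℝ) - i)) *
  (∏ i ∈ Finset.range α.1.2.val, ((k : ℝ) * ξ 1 - i) / ((α.1.2.val : ℝ) - i)) *
  (∏ i ∈ Finset.range (k - α.1.1.val - α.1.2.val),
    ((k : ℝ) * (1 - ξ 0 - ξ 1) - i) / (((k - α.1.1.val - α.1.2.val : ℕ) : ℝ) - i))

/-! ### Calculus on parametrized surface patches

A patch is given by a map `Y` from the plane to three-space, restricted to the reference triangle; a
function on it is given by its pullback `w` to the plane. -/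

/-- Partial derivatives of a patch. -/
def patchDeriv (Y : Plane → E3) (ξ : Plane) (a : Fin 2) : E3 := fderiv ℝ Y ξ (Pi.single a 1)

/-- The first fundamental form of a patch. -/
def gram (Y : Plane → E3) (ξ : Plane) : Matrix (Fin 2) (Fin 2) ℝ :=
  Matrix.of fun a b => inner ℝ (patchDeriv Y ξ a) (patchDeriv Y ξ b)

/-- The area element of a patch. -/
def areaElement (Y : Plane → E3) (ξ : Plane) : ℝ := √(gram Y ξ).det

/-- The tangential gradient, a vector in three-space, of the function with pullback `w`. -/
def tgrad (Y : Plane → E3) (w : Plane → ℝ) (ξ : Plane) : E3 :=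
  ∑ a, ∑ b, ((gram Y ξ)⁻¹ a b * fderiv ℝ w ξ (Pi.single b 1)) • patchDeriv Y ξ a

/-- The surface integral over the surface made up of the patches `Y T`. -/
def surfaceIntegral {τ : Type*} [Fintype τ] (Y : τ → Plane → E3) (f : τ → Plane → ℝ) : ℝ :=
  ∑ T, ∫ ξ in refTriangle, f T ξ * areaElement (Y T) ξ

/-- `∫ w z` -/
def massForm {τ : Type*} [Fintype τ] (Y : τ → Plane → E3) (w z : τ → Plane → ℝ) : ℝ :=
  surfaceIntegral Y fun T ξ => w T ξ * z T ξ

/-- `∫ ∇w · ∇z` (tangential gradients) -/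
def stiffnessForm {τ : Type*} [Fintype τ] (Y : τ → Plane → E3) (w z : τ → Plane → ℝ) : ℝ :=
  surfaceIntegral Y fun T ξ => inner ℝ (tgrad (Y T) (w T) ξ) (tgrad (Y T) (z T) ξ)

/-- `d` copies of a matrix, `I_d ⊗ A`. -/
abbrev blk (d : ℕ) {N : ℕ} (A : Matrix (Fin N) (Fin N) ℝ) :
    Matrix (Fin d × Fin N) (Fin d × Fin N) ℝ :=
  (1 : Matrix (Fin d) (Fin d) ℝ) ⊗ₖ A

/-- The (semi)norm `‖w‖_A = (wᵀ A w)^{1/2}`. -/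
def matNorm {n : Type*} [Fintype n] (A : Matrix n n ℝ) (w : n → ℝ) : ℝ := √(w ⬝ᵥ A *ᵥ w)

/-! ### Triangulations and evolving surface finite elements -/

/-- A triangulation of the surface `Γ` for finite elements of degree `k`: a conforming polyhedral
surface made up of flat triangles with vertices on `Γ`, mapped bijectively onto `Γ` by the nearest
point map, with a numbering of its Lagrange nodes of degree `k`. -/
structure Triangulation (Γ : Set E3) (k : ℕ) where
  /-- number of nodes -/
  N : ℕ
  /-- number of triangles -/
  n : ℕ
  /-- the vertices of each flat triangle -/
  vertex : Fin n → Fin 3 → E3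
  vertex_mem : ∀ T i, vertex T i ∈ Γ
  affineIndependent : ∀ T, AffineIndependent ℝ (vertex T)
  distinct : Function.Injective fun T => range (vertex T)
  conforming : ∀ T T', T ≠ T' →
    convexHull ℝ (range (vertex T)) ∩ convexHull ℝ (range (vertex T')) =
      convexHull ℝ (range (vertex T) ∩ range (vertex T'))
  bijOn : BijOn (nearestPoint Γ) (⋃ T, convexHull ℝ (range (vertex T))) Γ
  /-- the Lagrange nodes on the flat triangles -/
  flatNode : Fin N → E3
  flatNode_injective : Function.Injective flatNode
  /-- the local-to-global numbering of the nodes -/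
  loc : Fin n → LagIdx k → Fin N
  flatNode_loc : ∀ T (α : LagIdx k), flatNode (loc T α) =
    vertex T 0 + ((α.1.1.val : ℝ) / k) • (vertex T 1 - vertex T 0) +
      ((α.1.2.val : ℝ) / k) • (vertex T 2 - vertex T 0)
  loc_surjective : ∀ j, ∃ T α, loc T α = j

namespace Triangulation

variable {Γ : Set E3} {k : ℕ} (𝒯 : Triangulation Γ k)

/-- The mesh size `h`: the maximal diameter of the triangles. -/
def h : ℝ := ⨆ T : Fin 𝒯.n, Metric.diam (convexHull ℝ (range (𝒯.vertex T)))

/-- Shape regularity and quasi-uniformity with constant `σ`: every triangle contains a disc (in its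
plane) of radius `h / σ`, where `h` is the mesh size of the whole triangulation. -/
def IsAdmissible (σ : ℝ) : Prop :=
  ∀ T, ∃ c ∈ affineSpan ℝ (range (𝒯.vertex T)), ∀ y ∈ affineSpan ℝ (range (𝒯.vertex T)),
    dist y c ≤ 𝒯.h / σ → y ∈ convexHull ℝ (range (𝒯.vertex T))

/-- The nodes `p_j` on `Γ`. -/
def node (j : Fin 𝒯.N) : E3 := nearestPoint Γ (𝒯.flatNode j)

/-- Pullbacks to the reference triangle of the finite element function with nodal values `w`. -/
def fe (w : Fin 𝒯.N → ℝ) (T : Fin 𝒯.n) (ξ : Plane) : ℝ :=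
  ∑ α : LagIdx k, w (𝒯.loc T α) * shape k α ξ

/-- Pullbacks to the reference triangle of the nodal basis function `φ_j`. -/
def basisFn (j : Fin 𝒯.N) : Fin 𝒯.n → Plane → ℝ := 𝒯.fe (Pi.single j 1)

/-- The patches of the discrete surface `Γ_h[x]` with nodal vector `x`. -/
def patch (x : Fin 3 × Fin 𝒯.N → ℝ) (T : Fin 𝒯.n) (ξ : Plane) : E3 :=
  WithLp.toLp 2 fun ℓ => 𝒯.fe (fun j => x (ℓ, j)) T ξ

/-- The mass matrix `M(x)`. -/
def massMatrix (x : Fin 3 × Fin 𝒯.N → ℝ) : Matrix (Fin 𝒯.N) (Fin 𝒯.N) ℝ :=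
  Matrix.of fun i j => massForm (𝒯.patch x) (𝒯.basisFn i) (𝒯.basisFn j)

/-- The stiffness matrix `A(x)`. -/
def stiffnessMatrix (x : Fin 3 × Fin 𝒯.N → ℝ) : Matrix (Fin 𝒯.N) (Fin 𝒯.N) ℝ :=
  Matrix.of fun i j => stiffnessForm (𝒯.patch x) (𝒯.basisFn i) (𝒯.basisFn j)

/-- The matrix `M^{[d]}(x)`. -/
def M (d : ℕ) (x : Fin 3 × Fin 𝒯.N → ℝ) : Matrix (Fin d × Fin 𝒯.N) (Fin d × Fin 𝒯.N) ℝ :=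
  blk d (𝒯.massMatrix x)

/-- The matrix `A^{[d]}(x)`. -/
def A (d : ℕ) (x : Fin 3 × Fin 𝒯.N → ℝ) : Matrix (Fin d × Fin 𝒯.N) (Fin d × Fin 𝒯.N) ℝ :=
  blk d (𝒯.stiffnessMatrix x)

/-- The matrix `K^{[d]}(x)`. -/
def K (d : ℕ) (x : Fin 3 × Fin 𝒯.N → ℝ) : Matrix (Fin d × Fin 𝒯.N) (Fin d × Fin 𝒯.N) ℝ :=
  blk d (𝒯.massMatrix x + 𝒯.stiffnessMatrix x)

/-- Component `ℓ` of the finite element function `u_h = (ν_h, H_h)` (components `0, 1, 2` are `ν_h`,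
component `3` is `H_h`). -/
def comp (u : Fin 4 × Fin 𝒯.N → ℝ) (ℓ : Fin 4) : Fin 𝒯.n → Plane → ℝ := 𝒯.fe fun j => u (ℓ, j)

/-- `α_h² = |∇ν_h|²` on the discrete surface with nodal vector `x`. -/
def alphaSq (x : Fin 3 × Fin 𝒯.N → ℝ) (u : Fin 4 × Fin 𝒯.N → ℝ) (T : Fin 𝒯.n) (ξ : Plane) : ℝ :=
  ∑ ℓ : Fin 3, ‖tgrad (𝒯.patch x T) (𝒯.comp u ℓ.castSucc T) ξ‖ ^ 2

/-- The vector `f(x, u)`, with entries `∫ α_h² (ν_h)_ℓ φ_j` and `∫ α_h² H_h φ_j`. -/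
def f (x : Fin 3 × Fin 𝒯.N → ℝ) (u : Fin 4 × Fin 𝒯.N → ℝ) : Fin 4 × Fin 𝒯.N → ℝ := fun q =>
  surfaceIntegral (𝒯.patch x) fun T ξ =>
    𝒯.alphaSq x u T ξ * 𝒯.comp u q.1 T ξ * 𝒯.basisFn q.2 T ξ

/-- The vector `g(x, u)`, with entries `- ∫ H_h (ν_h)_ℓ φ_j - ∫ ∇(H_h (ν_h)_ℓ) · ∇φ_j`. -/
def g (x : Fin 3 × Fin 𝒯.N → ℝ) (u : Fin 4 × Fin 𝒯.N → ℝ) : Fin 3 × Fin 𝒯.N → ℝ := fun q =>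
  -massForm (𝒯.patch x) (fun T ξ => 𝒯.comp u 3 T ξ * 𝒯.comp u q.1.castSucc T ξ) (𝒯.basisFn q.2)
  - stiffnessForm (𝒯.patch x) (fun T ξ => 𝒯.comp u 3 T ξ * 𝒯.comp u q.1.castSucc T ξ)
      (𝒯.basisFn q.2)

/-- `(x, v, u)` solves the semi-discrete system on the time interval `[0, S]`, with the nodes of the
triangulation as initial positions. -/
structure IsSemidiscreteSolution (S : ℝ) (x v : ℝ → Fin 3 × Fin 𝒯.N → ℝ)
    (u : ℝ → Fin 4 × Fin 𝒯.N → ℝ) : Prop where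
  initial : x 0 = fun q => 𝒯.node q.2 q.1
  position : ∀ t ∈ Icc 0 S, HasDerivWithinAt x (v t) (Icc 0 S) t
  velocity : ∀ t ∈ Icc 0 S, 𝒯.K 3 (x t) *ᵥ v t = 𝒯.g (x t) (u t)
  geometry : ∀ t ∈ Icc 0 S, ∃ u' : Fin 4 × Fin 𝒯.N → ℝ, HasDerivWithinAt u u' (Icc 0 S) t ∧
    𝒯.M 4 (x t) *ᵥ u' + 𝒯.A 4 (x t) *ᵥ u t = 𝒯.f (x t) (u t)

end Triangulation

/-! ### Reference values from the exact solution, and defects -/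

section Reference

variable {Γ₀ : Set E3} {T : ℝ} {m k : ℕ} (F : MeanCurvatureFlow Γ₀ T m) (𝒯 : Triangulation Γ₀ k)

/-- The nodal vector `x*(t)` of exact positions of the nodes. -/
def xStar (t : ℝ) : Fin 3 × Fin 𝒯.N → ℝ := fun q => F.X (𝒯.node q.2) t q.1

/-- The nodal vector `v*(t)` of exact velocities of the nodes. -/
def vStar (t : ℝ) : Fin 3 × Fin 𝒯.N → ℝ := fun q => F.v t (F.X (𝒯.node q.2) t) q.1

/-- The patches of the interpolated surface `Γ_h[x*(t)]`, lifted to the exact surface `Γ(t)`. The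
pullback of a function on the interpolated surface under its patches is the pullback of the lifted
function under the lifted patches. -/
def liftedPatch (t : ℝ) (P : Fin 𝒯.n) (ξ : Plane) : E3 :=
  nearestPoint (F.surface t) (𝒯.patch (xStar F 𝒯 t) P ξ)

/-- `us` is the nodal vector of the Ritz projection `u_h*` of `u = (ν, H)` at time `t`:
`∫ ∇u_h* · ∇φ_h + ∫ u_h* · φ_h` over the interpolated surface equals `∫ ∇u · ∇φ_h^l + ∫ u · φ_h^l`
over the exact surface, for all finite element functions `φ_h` with four components. -/
def IsRitzProjection (t : ℝ) (us : Fin 4 × Fin 𝒯.N → ℝ) : Prop :=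
  ∀ φ : Fin 4 × Fin 𝒯.N → ℝ,
    ∑ ℓ, (stiffnessForm (𝒯.patch (xStar F 𝒯 t)) (𝒯.comp us ℓ) (𝒯.comp φ ℓ) +
          massForm (𝒯.patch (xStar F 𝒯 t)) (𝒯.comp us ℓ) (𝒯.comp φ ℓ)) =
    ∑ ℓ, (stiffnessForm (liftedPatch F 𝒯 t) (fun P ξ => F.u t (liftedPatch F 𝒯 t P ξ) ℓ)
            (𝒯.comp φ ℓ) +
          massForm (liftedPatch F 𝒯 t) (fun P ξ => F.u t (liftedPatch F 𝒯 t P ξ) ℓ)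
            (𝒯.comp φ ℓ))

/-- `dv` and `du` are the defects on `[0, T]` obtained by inserting `x*`, `v*` and `us = u*` into the
semi-discrete system. -/
structure AreDefects (us : ℝ → Fin 4 × Fin 𝒯.N → ℝ) (dv : ℝ → Fin 3 × Fin 𝒯.N → ℝ)
    (du : ℝ → Fin 4 × Fin 𝒯.N → ℝ) : Prop where
  velocity : ∀ t ∈ Icc 0 T, 𝒯.K 3 (xStar F 𝒯 t) *ᵥ vStar F 𝒯 t =
    𝒯.g (xStar F 𝒯 t) (us t) + 𝒯.M 3 (xStar F 𝒯 t) *ᵥ dv t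
  geometry : ∀ t ∈ Icc 0 T,
    𝒯.M 4 (xStar F 𝒯 t) *ᵥ derivWithin us (Icc 0 T) t + 𝒯.A 4 (xStar F 𝒯 t) *ᵥ us t =
      𝒯.f (xStar F 𝒯 t) (us t) + 𝒯.M 4 (xStar F 𝒯 t) *ᵥ du t

/-- The norm `‖w‖_{M(x*(t))}`, that is the `L²` norm on the interpolated surface. -/
def normM {d : ℕ} (t : ℝ) (w : Fin d × Fin 𝒯.N → ℝ) : ℝ := matNorm (𝒯.M d (xStar F 𝒯 t)) w

/-- The norm `‖w‖_{K(x*(t))}`, that is the `H¹` norm on the interpolated surface. -/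
def normK {d : ℕ} (t : ℝ) (w : Fin d × Fin 𝒯.N → ℝ) : ℝ := matNorm (𝒯.K d (xStar F 𝒯 t)) w

/-- The discrete dual norm `(wᵀ M K⁻¹ M w)^{1/2}` at `x*(t)`. -/
def normStar {d : ℕ} (t : ℝ) (w : Fin d × Fin 𝒯.N → ℝ) : ℝ :=
  matNorm (𝒯.M d (xStar F 𝒯 t) * (𝒯.K d (xStar F 𝒯 t))⁻¹ * 𝒯.M d (xStar F 𝒯 t)) w

end Reference

end ESFEM

end

open ESFEM

/-! The nodal errors are estimated by the energy method, and the errors of the surface are kept small by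
an inverse estimate.

All matrices and nonlinear terms of the scheme are sums `h² ∑ₚ ∫ V(X, U) · Z` over the triangles, where the
integral is over the reference triangle, `V` is a smooth function, and `X`, `U`, `Z` are the *jets* of the
positions, of the finite element function and of the test function: their values together with `h⁻¹` times
their partial derivatives. On jets `X` in a compact set on which the area element is bounded below
(`goodJets L μ`), the integrands and their derivatives are bounded uniformly in the triangulation, so that
differences of the matrices on the exact and the discrete surface are estimated pointwise. The `H¹` norm is
equivalent to `h² ∑ₚ ∫ ‖Z‖²` (`exists_inner_kV_bounds`), and the inverse estimate bounds `h² ‖Z‖²` at each point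
by this quantity (`exists_inverse_estimate_jet`).

*Stability.* The velocity equation, tested with `e_v`, bounds the `H¹` norm of `e_v` by those of `e_x` and `e_u`
and by the dual norm of the defect `d_v` (`exists_NH_velocity_le`). The equation of the geometry, tested with the
time derivative of `e_u`, gives a differential inequality for an energy which is equivalent to the sum of the
squared `H¹` norms of `e_x` and `e_u` (`exists_energyRate_le`, `exists_energy_equiv`); Gronwall's inequality
then gives the asserted bound as long as the jets of the errors are small (`exists_error_bound`). The bound is of
order `h ^ (2 * κ)`, so the inverse estimate bounds the jets of the errors by a multiple of `h ^ (κ - 1)`. As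
`κ > 1`, a continuity argument shows that they stay small (`exists_stability_bound`). All this only requires
of the reference values what is listed in `IsReference`: the equations with the defects, bounds for their jets
and those of their time derivatives, and a lower bound for the area element.

*Reference values.* The exact flow provides such values, for `h` small (`exists_isReference`). The nearest
point projections to `Γ(t)` are smooth in space and time by the implicit function theorem. The normal is, up to
a sign, the vector product of derivatives of the flow map; the sign is locally constant because points outside of
a surface remain outside of the nearby ones, and the curvature is `-v · ν` (`contDiffOn_u`,
`exists_contDiffOn_lift`). Interpolation therefore gives nodal values with bounded jets, which are Lipschitz
continuous in time (`exists_reference_regularity`); the area element is bounded below, as the triangles contain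
discs of radius `h / σ` and the flow map is an immersion (`exists_mul_norm_le_dx_Xe`). The Ritz projection and the
interpolation of `u` differ by a jet which is of order `h` in the mean over all triangles, and the number of
triangles is of order `h⁻²` (`exists_card_le`). Hence the inverse estimate bounds the jets of the Ritz
projection and their Lipschitz constants in time (`exists_lipBdd_ritz`). No convergence of higher order of
the Ritz projection is needed, as the defects are given.

The interpolation needs `k ≥ 1`; for `k = 0` there is no `κ` with `1 < κ ≤ k`. -/

noncomputable section

namespace ESFEM

/-! ### Lagrange shape functions -/

/-- The binomial coefficient `x (x - 1) ⋯ (x - n + 1) / n!`, in the product form in which it occurs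
in the shape functions. -/
def binom (x : ℝ) (n : ℕ) : ℝ := ∏ i ∈ Finset.range n, (x - i) / ((n : ℝ) - i)

lemma prod_range_sub_cast (n : ℕ) : ∏ i ∈ Finset.range n, ((n : ℝ) - i) = n.factorial := by
  have h := descPochhammer_eval_eq_prod_range (R := ℝ) n (n : ℝ)
  rw [← h, descPochhammer_eval_eq_descFactorial, Nat.descFactorial_self]

lemma binom_eq_choose (x : ℝ) (n : ℕ) : binom x n = Ring.choose x n := by
  have h1 := Ring.descPochhammer_eq_factorial_smul_choose x n
  have h2 : ∀ n : ℕ, (descPochhammer ℤ n).smeval x = ∏ i ∈ Finset.range n, (x - i) := by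
    intro n
    induction n with
    | zero => simp
    | succ n ih =>
      rw [descPochhammer_succ_right, Polynomial.smeval_mul, ih, Finset.prod_range_succ,
        Polynomial.smeval_sub, Polynomial.smeval_X, Polynomial.smeval_natCast]
      simp
  unfold binom
  rw [Finset.prod_div_distrib, prod_range_sub_cast, ← h2, h1]
  have : (n.factorial : ℝ) ≠ 0 := by positivity
  field_simp
  simp

lemma sum_binom_mul (x y : ℝ) (n : ℕ) :
    ∑ p ∈ Finset.HasAntidiagonal.antidiagonal n, binom x p.1 * binom y p.2 = binom (x + y) n := by
  simp only [binom_eq_choose]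
  exact (Ring.add_choose_eq n (Commute.all x y)).symm

lemma binom_self (n : ℕ) : binom n n = 1 := by
  unfold binom
  refine Finset.prod_eq_one fun i hi => div_self ?_
  have : (i : ℝ) < n := by exact_mod_cast Finset.mem_range.1 hi
  linarith

lemma binom_eq_zero {m n : ℕ} (h : m < n) : binom m n = 0 :=
  Finset.prod_eq_zero (Finset.mem_range.2 h) (by simp)

lemma succ_mul_binom_succ (x : ℝ) (n : ℕ) :
    ((n : ℝ) + 1) * binom x (n + 1) = x * binom (x - 1) n := by
  unfold binom
  rw [Finset.prod_div_distrib, prod_range_sub_cast, Finset.prod_div_distrib, prod_range_sub_cast,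
    Finset.prod_range_succ']
  have h : ∀ i : ℕ, x - ((i + 1 : ℕ) : ℝ) = x - 1 - i := fun i => by push_cast; ring
  simp only [h, Nat.factorial_succ]
  have : (n.factorial : ℝ) ≠ 0 := by positivity
  have : (n : ℝ) + 1 ≠ 0 := by positivity
  push_cast
  field_simp
  ring

lemma shape_eq (k : ℕ) (α : LagIdx k) (ξ : Plane) :
    shape k α ξ = binom (k * ξ 0) α.1.1 * binom (k * ξ 1) α.1.2 *
      binom (k * (1 - ξ 0 - ξ 1)) (k - α.1.1 - α.1.2) := rfl

lemma sum_lagIdx (k : ℕ) (g : ℕ → ℕ → ℕ → ℝ) :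
    ∑ α : LagIdx k, g α.1.1 α.1.2 (k - α.1.1 - α.1.2) =
      ∑ p ∈ Finset.HasAntidiagonal.antidiagonal k, ∑ q ∈ Finset.HasAntidiagonal.antidiagonal p.2, g p.1 q.1 q.2 := by
  rw [Finset.sum_sigma']
  refine Finset.sum_bij' (fun α _ => ⟨(α.1.1.val, k - α.1.1), (α.1.2.val, k - α.1.1 - α.1.2)⟩)
    (fun p hp => ⟨(⟨p.1.1, ?_⟩, ⟨p.2.1, ?_⟩), ?_⟩) ?_ ?_ ?_ ?_ ?_
  · simp only [Finset.mem_sigma, Finset.HasAntidiagonal.mem_antidiagonal] at hp; omega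
  · simp only [Finset.mem_sigma, Finset.HasAntidiagonal.mem_antidiagonal] at hp; omega
  · simp only [Finset.mem_sigma, Finset.HasAntidiagonal.mem_antidiagonal] at hp; show p.1.1 + p.2.1 ≤ k; omega
  · intro α _
    have := α.2
    simp only [Finset.mem_sigma, Finset.HasAntidiagonal.mem_antidiagonal]; omega
  · intro p hp; simp
  · intro α _; rfl
  · rintro ⟨⟨a, m⟩, ⟨b, c⟩⟩ hp
    simp only [Finset.mem_sigma, Finset.HasAntidiagonal.mem_antidiagonal] at hp
    obtain ⟨h1, h2⟩ := hp
    have h3 : k - a = m := by omega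
    have h4 : m - b = c := by omega
    subst h3; subst h4; rfl
  · intro α _; rfl

/-- The node of the reference triangle with index `α`. -/
def refNode (k : ℕ) (α : LagIdx k) : Plane := ![(α.1.1 : ℝ) / k, (α.1.2 : ℝ) / k]

lemma sum_shape (k : ℕ) (ξ : Plane) : ∑ α, shape k α ξ = 1 := by
  simp only [shape_eq]
  rw [sum_lagIdx k fun a b c => binom (k * ξ 0) a * binom (k * ξ 1) b *
      binom (k * (1 - ξ 0 - ξ 1)) c]
  simp only [mul_assoc, ← Finset.mul_sum, sum_binom_mul]
  rw [show (k : ℝ) * ξ 0 + (k * ξ 1 + k * (1 - ξ 0 - ξ 1)) = k by ring, binom_self]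

lemma sum_mul_binom (x y : ℝ) (n : ℕ) :
    ∑ p ∈ Finset.HasAntidiagonal.antidiagonal (n + 1), (p.1 : ℝ) * binom x p.1 * binom y p.2 =
      x * binom (x + y - 1) n := by
  rw [Finset.Nat.sum_antidiagonal_succ]
  simp only [Nat.cast_zero, zero_mul, zero_add, Nat.cast_add, Nat.cast_one, succ_mul_binom_succ,
    mul_assoc, ← Finset.mul_sum, sum_binom_mul]
  rw [show x - 1 + y = x + y - 1 by ring]

/-- Degree `k ≥ 1` interpolation reproduces the first coordinate. -/
lemma sum_refNode_zero_mul_shape {k : ℕ} (hk : 1 ≤ k) (ξ : Plane) :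
    ∑ α, refNode k α 0 * shape k α ξ = ξ 0 := by
  obtain ⟨n, rfl⟩ : ∃ n, k = n + 1 := ⟨k - 1, by omega⟩
  have hk0 : ((n + 1 : ℕ) : ℝ) ≠ 0 := by positivity
  simp only [shape_eq, refNode, Matrix.cons_val_zero, div_mul_eq_mul_div, ← Finset.sum_div]
  rw [div_eq_iff hk0]
  rw [sum_lagIdx (n + 1) fun a b c => (a : ℝ) * (binom (((n + 1 : ℕ) : ℝ) * ξ 0) a *
    binom (((n + 1 : ℕ) : ℝ) * ξ 1) b * binom (((n + 1 : ℕ) : ℝ) * (1 - ξ 0 - ξ 1)) c)]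
  simp only [mul_assoc, ← Finset.mul_sum, sum_binom_mul]
  simp only [← mul_assoc]
  rw [sum_mul_binom]
  have h : ((n + 1 : ℕ) : ℝ) * ξ 0 + (((n + 1 : ℕ) : ℝ) * ξ 1 + ((n + 1 : ℕ) : ℝ) * (1 - ξ 0 - ξ 1)) - 1
      = n := by push_cast; ring
  rw [h, binom_self]; ring

/-- Degree `k ≥ 1` interpolation reproduces the second coordinate. -/
lemma sum_refNode_one_mul_shape {k : ℕ} (hk : 1 ≤ k) (ξ : Plane) :
    ∑ α, refNode k α 1 * shape k α ξ = ξ 1 := by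
  obtain ⟨n, rfl⟩ : ∃ n, k = n + 1 := ⟨k - 1, by omega⟩
  have hk0 : ((n + 1 : ℕ) : ℝ) ≠ 0 := by positivity
  simp only [shape_eq, refNode, Matrix.cons_val_one, Matrix.cons_val_fin_one, div_mul_eq_mul_div,
    ← Finset.sum_div]
  rw [div_eq_iff hk0]
  rw [sum_lagIdx (n + 1) fun a b c => (b : ℝ) * (binom (((n + 1 : ℕ) : ℝ) * ξ 0) a *
    binom (((n + 1 : ℕ) : ℝ) * ξ 1) b * binom (((n + 1 : ℕ) : ℝ) * (1 - ξ 0 - ξ 1)) c)]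
  rw [Finset.Nat.sum_antidiagonal_succ']
  have h0 : ∀ (x y z : ℝ), ∀ p ∈ Finset.HasAntidiagonal.antidiagonal n,
      ∑ q ∈ Finset.HasAntidiagonal.antidiagonal (p.2 + 1), (q.1 : ℝ) * (binom x p.1 * binom y q.1 * binom z q.2)
        = binom x p.1 * binom (y + z - 1) p.2 * y := by
    intro x y z p _
    calc _ = binom x p.1 * ∑ q ∈ Finset.HasAntidiagonal.antidiagonal (p.2 + 1),
          (q.1 : ℝ) * binom y q.1 * binom z q.2 := by
          rw [Finset.mul_sum]; exact Finset.sum_congr rfl fun q _ => by ring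
      _ = _ := by rw [sum_mul_binom]; ring
  rw [Finset.sum_congr rfl (h0 _ _ _)]
  simp only [Finset.Nat.antidiagonal_zero, Finset.sum_singleton, Nat.cast_zero, zero_mul, zero_add,
    ← Finset.sum_mul, sum_binom_mul]
  have h : ((n + 1 : ℕ) : ℝ) * ξ 0 +
      (((n + 1 : ℕ) : ℝ) * ξ 1 + ((n + 1 : ℕ) : ℝ) * (1 - ξ 0 - ξ 1) - 1)
      = n := by push_cast; ring
  rw [h, binom_self]; ring

lemma sum_shape_smul_refNode {k : ℕ} (hk : 1 ≤ k) (ξ : Plane) :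
    ∑ α, shape k α ξ • refNode k α = ξ := by
  ext i
  simp only [Finset.sum_apply, Pi.smul_apply, smul_eq_mul]
  fin_cases i
  · simpa [mul_comm] using sum_refNode_zero_mul_shape hk ξ
  · simpa [mul_comm] using sum_refNode_one_mul_shape hk ξ

lemma refNode_mem {k : ℕ} (hk : 1 ≤ k) (α : LagIdx k) : refNode k α ∈ refTriangle := by
  have hk0 : (0 : ℝ) < k := by exact_mod_cast hk
  refine ⟨by simp [refNode]; positivity, by simp [refNode]; positivity, ?_⟩
  simp only [refNode, Matrix.cons_val_zero, Matrix.cons_val_one, Matrix.cons_val_fin_one]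
  rw [← add_div, div_le_one hk0]
  exact_mod_cast α.2

lemma shape_refNode {k : ℕ} (hk : 1 ≤ k) (α β : LagIdx k) :
    shape k α (refNode k β) = if α = β then 1 else 0 := by
  have hk0 : (k : ℝ) ≠ 0 := by positivity
  have hα := α.2
  have hβ := β.2
  have e0 : (k : ℝ) * refNode k β 0 = (β.1.1.val : ℝ) := by simp [refNode]; field_simp
  have e1 : (k : ℝ) * refNode k β 1 = (β.1.2.val : ℝ) := by simp [refNode]; field_simp
  have e2 : (k : ℝ) * (1 - refNode k β 0 - refNode k β 1) =
      ((k - β.1.1.val - β.1.2.val : ℕ) : ℝ) := by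
    rw [Nat.cast_sub (by omega), Nat.cast_sub (by omega), mul_sub, mul_sub, e0, e1, mul_one]
  rw [shape_eq, e0, e1, e2]
  split_ifs with h
  · subst h; simp [binom_self]
  · have h' : α.1.1.val ≠ β.1.1.val ∨ α.1.2.val ≠ β.1.2.val := by
      by_contra hc
      push Not at hc
      exact h (Subtype.ext (Prod.ext (Fin.ext hc.1) (Fin.ext hc.2)))
    rcases lt_or_ge β.1.1.val α.1.1.val with h1 | h1
    · simp [binom_eq_zero h1]
    rcases lt_or_ge β.1.2.val α.1.2.val with h2 | h2
    · simp [binom_eq_zero h2]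
    · rw [binom_eq_zero (m := k - β.1.1.val - β.1.2.val) (n := k - α.1.1.val - α.1.2.val) (by omega)]
      simp

lemma contDiff_shape (k : ℕ) (α : LagIdx k) : ContDiff ℝ ∞ (shape k α) := by
  have h0 : ContDiff ℝ ∞ fun ξ : Plane => ξ 0 := contDiff_apply ℝ ℝ 0
  have h1 : ContDiff ℝ ∞ fun ξ : Plane => ξ 1 := contDiff_apply ℝ ℝ 1
  unfold shape
  refine (ContDiff.mul (contDiff_prod fun i _ => ?_) (contDiff_prod fun i _ => ?_)).mul
    (contDiff_prod fun i _ => ?_)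
  · exact ((contDiff_const.mul h0).sub contDiff_const).div_const _
  · exact ((contDiff_const.mul h1).sub contDiff_const).div_const _
  · exact ((contDiff_const.mul ((contDiff_const.sub h0).sub h1)).sub contDiff_const).div_const _

/-- Partial derivatives of the shape functions. -/
def dshape (k : ℕ) (α : LagIdx k) (a : Fin 2) (ξ : Plane) : ℝ :=
  fderiv ℝ (shape k α) ξ (Pi.single a 1)

lemma hasFDerivAt_shape (k : ℕ) (α : LagIdx k) (ξ : Plane) :
    HasFDerivAt (shape k α) (fderiv ℝ (shape k α) ξ) ξ :=
  ((contDiff_shape k α).differentiable (by simp) ξ).hasFDerivAt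

lemma continuous_shape (k : ℕ) (α : LagIdx k) : Continuous (shape k α) := (contDiff_shape k α).continuous

lemma continuous_fderiv_shape (k : ℕ) (α : LagIdx k) : Continuous (fderiv ℝ (shape k α)) :=
  (contDiff_shape k α).continuous_fderiv (by simp)

lemma continuous_dshape (k : ℕ) (α : LagIdx k) (a : Fin 2) : Continuous (dshape k α a) :=
  (continuous_fderiv_shape k α).clm_apply continuous_const

lemma sum_fderiv_shape (k : ℕ) (ξ : Plane) : ∑ α, fderiv ℝ (shape k α) ξ = 0 := by
  have h : HasFDerivAt (fun ξ => ∑ α, shape k α ξ) (∑ α, fderiv ℝ (shape k α) ξ) ξ :=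
    HasFDerivAt.fun_sum fun α _ => hasFDerivAt_shape k α ξ
  have h2 : (fun ξ => ∑ α, shape k α ξ) = fun _ => (1 : ℝ) := funext fun ξ => sum_shape k ξ
  rw [h2] at h
  exact h.unique (hasFDerivAt_const _ _)

lemma sum_dshape (k : ℕ) (a : Fin 2) (ξ : Plane) : ∑ α, dshape k α a ξ = 0 := by
  have := congrArg (fun L : Plane →L[ℝ] ℝ => L (Pi.single a 1)) (sum_fderiv_shape k ξ)
  simpa [dshape] using this

/-! ### The reference triangle -/

lemma isClosed_refTriangle : IsClosed refTriangle := by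
  have h0 : Continuous fun ξ : Plane => ξ 0 := continuous_apply 0
  have h1 : Continuous fun ξ : Plane => ξ 1 := continuous_apply 1
  exact (isClosed_le continuous_const h0).inter ((isClosed_le continuous_const h1).inter
    (isClosed_le (h0.add h1) continuous_const))

lemma refTriangle_subset : refTriangle ⊆ Icc 0 1 := by
  rintro ξ ⟨h0, h1, h2⟩
  constructor <;> intro i <;> fin_cases i <;> simp <;> linarith

lemma isCompact_refTriangle : IsCompact refTriangle :=
  isCompact_Icc.of_isClosed_subset isClosed_refTriangle refTriangle_subset

lemma norm_le_of_mem_refTriangle {ξ : Plane} (h : ξ ∈ refTriangle) : ‖ξ‖ ≤ 1 := by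
  have := refTriangle_subset h
  rw [pi_norm_le_iff_of_nonneg zero_le_one]
  intro i
  rw [Real.norm_eq_abs, abs_le]
  have h0 : 0 ≤ ξ i := this.1 i
  exact ⟨by linarith, this.2 i⟩

lemma zero_mem_refTriangle : (0 : Plane) ∈ refTriangle := by simp [refTriangle]

lemma convex_refTriangle : Convex ℝ refTriangle := by
  rintro x ⟨hx0, hx1, hx2⟩ y ⟨hy0, hy1, hy2⟩ a b ha hb hab
  refine ⟨?_, ?_, ?_⟩ <;> simp only [Pi.add_apply, Pi.smul_apply, smul_eq_mul]
  · positivity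
  · positivity
  · nlinarith

lemma measurableSet_refTriangle : MeasurableSet refTriangle := isClosed_refTriangle.measurableSet

lemma volume_refTriangle_le : volume refTriangle ≤ 1 := by
  refine (measure_mono refTriangle_subset).trans ?_
  rw [Real.volume_Icc_pi]; simp

instance isFiniteMeasure_refTriangle : IsFiniteMeasure (volume.restrict refTriangle) :=
  ⟨by rw [Measure.restrict_apply_univ]; exact volume_refTriangle_le.trans_lt (by simp)⟩

lemma refTriangle_subset_closure_interior : refTriangle ⊆ closure (interior refTriangle) := by
  have hne : (interior refTriangle).Nonempty := by
    refine ⟨![1/4, 1/4], mem_interior.2 ⟨{ξ | 0 < ξ 0 ∧ 0 < ξ 1 ∧ ξ 0 + ξ 1 < 1}, ?_, ?_, ?_⟩⟩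
    · exact fun ξ h => ⟨h.1.le, h.2.1.le, h.2.2.le⟩
    · have h0 : Continuous fun ξ : Plane => ξ 0 := continuous_apply 0
      have h1 : Continuous fun ξ : Plane => ξ 1 := continuous_apply 1
      exact (isOpen_lt continuous_const h0).inter ((isOpen_lt continuous_const h1).inter
        (isOpen_lt (h0.add h1) continuous_const))
    · norm_num
  exact (convex_refTriangle.closure_interior_eq_closure_of_nonempty_interior hne) ▸ subset_closure

lemma eq_zero_of_setIntegral_refTriangle_eq_zero {f : Plane → ℝ} (hf : Continuous f)
    (h0 : ∀ ξ, 0 ≤ f ξ) (h : ∫ ξ in refTriangle, f ξ = 0) : ∀ ξ ∈ refTriangle, f ξ = 0 := by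
  have hint : IntegrableOn f refTriangle := hf.continuousOn.integrableOn_compact isCompact_refTriangle
  rw [setIntegral_eq_zero_iff_of_nonneg_ae (ae_of_all _ h0) hint] at h
  have h1 : f =ᵐ[volume.restrict (interior refTriangle)] 0 :=
    ae_restrict_of_ae_restrict_of_subset interior_subset h
  have h2 : EqOn f 0 (interior refTriangle) :=
    Measure.eqOn_open_of_ae_eq h1 isOpen_interior hf.continuousOn continuousOn_const
  intro ξ hξ
  have h3 := h2.closure hf continuous_const
  exact h3 (refTriangle_subset_closure_interior hξ)

lemma setIntegral_refTriangle_mono {f g : Plane → ℝ} (hf : ContinuousOn f refTriangle)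
    (hg : ContinuousOn g refTriangle) (h : ∀ ξ ∈ refTriangle, f ξ ≤ g ξ) :
    ∫ ξ in refTriangle, f ξ ≤ ∫ ξ in refTriangle, g ξ :=
  setIntegral_mono_on (hf.integrableOn_compact isCompact_refTriangle)
    (hg.integrableOn_compact isCompact_refTriangle) measurableSet_refTriangle h

/-! ### Inverse estimates on the reference triangle -/

/-- A continuous positive definite function of degree two on a finite dimensional space is bounded
below by a multiple of the squared norm. -/
lemma exists_pos_mul_sq_le {V : Type*} [NormedAddCommGroup V] [NormedSpace ℝ V]
    [FiniteDimensional ℝ V] {Q : V → ℝ} (hQ : Continuous Q)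
    (hs : ∀ (s : ℝ) v, Q (s • v) = s ^ 2 * Q v) (hpos : ∀ v, v ≠ 0 → 0 < Q v) :
    ∃ c > 0, ∀ v, c * ‖v‖ ^ 2 ≤ Q v := by
  have : ProperSpace V := FiniteDimensional.proper ℝ V
  rcases (Metric.sphere (0 : V) 1).eq_empty_or_nonempty with he | hne
  · refine ⟨1, one_pos, fun v => ?_⟩
    have hv : v = 0 := by
      by_contra hv
      have : (‖v‖⁻¹ • v) ∈ Metric.sphere (0 : V) 1 := by
        simp [norm_smul, inv_mul_cancel₀ (norm_ne_zero_iff.2 hv)]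
      rw [he] at this; exact this
    have := hs 0 v
    rw [zero_smul] at this
    rw [hv, this]; simp
  · obtain ⟨u, hu, hmin⟩ := (isCompact_sphere (0 : V) 1).exists_isMinOn hne hQ.continuousOn
    have hu1 : ‖u‖ = 1 := by simpa using hu
    refine ⟨Q u, hpos u (by intro h; simp [h] at hu1), fun v => ?_⟩
    by_cases hv : v = 0
    · have := hs 0 v
      rw [zero_smul] at this
      rw [hv, this]; simp
    have hv' : ‖v‖ ≠ 0 := norm_ne_zero_iff.2 hv
    have hm : (‖v‖⁻¹ • v) ∈ Metric.sphere (0 : V) 1 := by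
      simp [norm_smul, inv_mul_cancel₀ hv']
    have h1 := hmin hm
    simp only [mem_ofPred_eq, hs] at h1
    calc Q u * ‖v‖ ^ 2 ≤ (‖v‖⁻¹ ^ 2 * Q v) * ‖v‖ ^ 2 := by gcongr
      _ = Q v := by field_simp

/-- A linear combination of the shape functions. -/
def lag (k : ℕ) (W : LagIdx k → ℝ) (ξ : Plane) : ℝ := ∑ α, W α * shape k α ξ

/-- The partial derivatives of a linear combination of the shape functions. -/
def dlag (k : ℕ) (W : LagIdx k → ℝ) (a : Fin 2) (ξ : Plane) : ℝ := ∑ α, W α * dshape k α a ξ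

lemma continuous_lag_uncurry (k : ℕ) : Continuous fun p : (LagIdx k → ℝ) × Plane => lag k p.1 p.2 :=
  continuous_finsetSum _ fun α _ => ((continuous_apply α).comp continuous_fst).mul
    ((continuous_shape k α).comp continuous_snd)

lemma continuous_dlag_uncurry (k : ℕ) (a : Fin 2) :
    Continuous fun p : (LagIdx k → ℝ) × Plane => dlag k p.1 a p.2 :=
  continuous_finsetSum _ fun α _ => ((continuous_apply α).comp continuous_fst).mul
    ((continuous_dshape k α a).comp continuous_snd)

lemma lag_refNode {k : ℕ} (hk : 1 ≤ k) (W : LagIdx k → ℝ) (β : LagIdx k) :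
    lag k W (refNode k β) = W β := by
  simp [lag, shape_refNode hk]

lemma hasFDerivAt_lag (k : ℕ) (W : LagIdx k → ℝ) (ξ : Plane) :
    HasFDerivAt (lag k W) (∑ α, W α • fderiv ℝ (shape k α) ξ) ξ :=
  HasFDerivAt.fun_sum fun α _ => (hasFDerivAt_shape k α ξ).const_mul (W α)

lemma fderiv_lag_single (k : ℕ) (W : LagIdx k → ℝ) (ξ : Plane) (a : Fin 2) :
    fderiv ℝ (lag k W) ξ (Pi.single a 1) = dlag k W a ξ := by
  rw [(hasFDerivAt_lag k W ξ).fderiv]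
  simp [dlag, dshape]

lemma plane_eq (η : Plane) : η = η 0 • Pi.single 0 1 + η 1 • Pi.single 1 1 := by
  ext i; fin_cases i <;> simp

lemma continuous_setIntegral_refTriangle {V : Type*} [TopologicalSpace V] [FirstCountableTopology V]
    [LocallyCompactSpace V] {F : V × Plane → ℝ} (hF : Continuous F) :
    Continuous fun v => ∫ ξ in refTriangle, F (v, ξ) := by
  refine continuous_iff_continuousAt.2 fun v₀ => ?_
  exact (continuous_parametric_integral_of_continuous (f := fun v ξ => F (v, ξ)) hF
    isCompact_refTriangle).continuousAt

/-- Inverse estimate for values and for first derivatives of polynomials of degree `k`. -/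
lemma exists_inverse_estimate {k : ℕ} (hk : 1 ≤ k) : ∃ C > 0, ∀ (W : LagIdx k → ℝ), ∀ ξ ∈ refTriangle,
    lag k W ξ ^ 2 ≤ C * ∫ η in refTriangle, lag k W η ^ 2 ∧
    ∀ a, dlag k W a ξ ^ 2 ≤ C * ∫ η in refTriangle, (dlag k W 0 η ^ 2 + dlag k W 1 η ^ 2) := by
  -- bounds for the shape functions
  obtain ⟨S, hS⟩ : ∃ S, ∀ α, ∀ ξ ∈ refTriangle, |shape k α ξ| ≤ S ∧ ∀ a, |dshape k α a ξ| ≤ S := by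
    have h : ∀ α : LagIdx k, ∃ S, ∀ ξ ∈ refTriangle,
        |shape k α ξ| + (|dshape k α 0 ξ| + |dshape k α 1 ξ|) ≤ S := fun α => by
      obtain ⟨S, hS⟩ := isCompact_refTriangle.exists_bound_of_continuousOn
        (f := fun ξ => |shape k α ξ| + (|dshape k α 0 ξ| + |dshape k α 1 ξ|))
        (((continuous_shape k α).abs.add ((continuous_dshape k α 0).abs.add
          (continuous_dshape k α 1).abs)).continuousOn)
      exact ⟨S, fun ξ hξ => (le_abs_self _).trans (hS ξ hξ)⟩
    choose S hS using h
    refine ⟨∑ α, |S α|, fun α ξ hξ => ?_⟩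
    have h1 : |S α| ≤ ∑ α, |S α| :=
      Finset.single_le_sum (f := fun α => |S α|) (fun _ _ => abs_nonneg _) (Finset.mem_univ α)
    have h2 := hS α ξ hξ
    have h3 := le_abs_self (S α)
    have := abs_nonneg (shape k α ξ)
    have := abs_nonneg (dshape k α 0 ξ)
    have := abs_nonneg (dshape k α 1 ξ)
    refine ⟨by linarith, fun a => ?_⟩
    fin_cases a <;> simp only [Fin.zero_eta, Fin.mk_one] <;> linarith
  have hS0 : 0 ≤ S := (abs_nonneg _).trans
    (hS ⟨(0, 0), by simp⟩ 0 zero_mem_refTriangle).1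
  set n : ℝ := (Fintype.card (LagIdx k) : ℝ)
  have hsum : ∀ (W g : LagIdx k → ℝ), (∀ α, |g α| ≤ S) → (∑ α, W α * g α) ^ 2 ≤ (n * S) ^ 2 * ‖W‖ ^ 2 := by
    intro W g hg
    have : |∑ α, W α * g α| ≤ n * (‖W‖ * S) := by
      refine (Finset.abs_sum_le_sum_abs _ _).trans ((Finset.sum_le_card_nsmul _ _ (‖W‖ * S)
        fun α _ => ?_).trans (by simp [n]))
      rw [abs_mul]
      exact mul_le_mul (norm_le_pi_norm W α) (hg α) (abs_nonneg _) (norm_nonneg _)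
    rw [← sq_abs]
    calc _ ≤ (n * (‖W‖ * S)) ^ 2 := by gcongr
      _ = _ := by ring
  -- values
  obtain ⟨c1, hc1, h1⟩ : ∃ c > 0, ∀ W : LagIdx k → ℝ,
      c * ‖W‖ ^ 2 ≤ ∫ η in refTriangle, lag k W η ^ 2 := by
    have hc : Continuous fun p : (LagIdx k → ℝ) × Plane => lag k p.1 p.2 ^ 2 :=
      (continuous_lag_uncurry k).pow 2
    refine exists_pos_mul_sq_le (continuous_setIntegral_refTriangle hc) (fun s W => ?_)
      fun W hW => ?_
    · rw [← integral_const_mul]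
      congr 1; ext ξ
      simp only [lag, Pi.smul_apply, smul_eq_mul, mul_assoc, ← Finset.mul_sum]; ring
    · refine lt_of_le_of_ne (integral_nonneg fun ξ => sq_nonneg _) fun h => hW ?_
      have h2 := eq_zero_of_setIntegral_refTriangle_eq_zero
        (hc.comp (Continuous.prodMk_right W)) (fun ξ => sq_nonneg _) h.symm
      ext β
      have h3 := h2 (refNode k β) (refNode_mem hk β)
      simpa [lag_refNode hk] using h3
  -- derivatives
  let α₀ : LagIdx k := ⟨(0, 0), by simp⟩
  have hα₀ : refNode k α₀ = 0 := by ext i; fin_cases i <;> simp [refNode, α₀]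
  have hcd : Continuous fun p : (LagIdx k → ℝ) × Plane => dlag k p.1 0 p.2 ^ 2 + dlag k p.1 1 p.2 ^ 2 :=
    ((continuous_dlag_uncurry k 0).pow 2).add ((continuous_dlag_uncurry k 1).pow 2)
  obtain ⟨c2, hc2, h2⟩ : ∃ c > 0, ∀ W : LagIdx k → ℝ,
      c * ‖W‖ ^ 2 ≤ (∫ η in refTriangle, (dlag k W 0 η ^ 2 + dlag k W 1 η ^ 2)) + W α₀ ^ 2 := by
    refine exists_pos_mul_sq_le ((continuous_setIntegral_refTriangle hcd).add
      ((continuous_apply α₀).pow 2)) (fun s W => ?_) fun W hW => ?_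
    · rw [mul_add, ← integral_const_mul]
      congr 1
      · congr 1; ext ξ
        simp only [dlag, Pi.smul_apply, smul_eq_mul, mul_assoc, ← Finset.mul_sum]; ring
      · simp only [Pi.smul_apply, smul_eq_mul]; ring
    · have hn : 0 ≤ ∫ η in refTriangle, (dlag k W 0 η ^ 2 + dlag k W 1 η ^ 2) :=
        integral_nonneg fun ξ => by positivity
      refine lt_of_le_of_ne (by positivity) fun h => hW ?_
      have ha : W α₀ = 0 := by nlinarith [sq_nonneg (W α₀)]
      have hb : ∫ η in refTriangle, (dlag k W 0 η ^ 2 + dlag k W 1 η ^ 2) = 0 := by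
        rw [ha] at h; linarith
      have h3 := eq_zero_of_setIntegral_refTriangle_eq_zero
        (hcd.comp (Continuous.prodMk_right W))
        (fun ξ => add_nonneg (sq_nonneg _) (sq_nonneg _)) hb
      have h4 : ∀ ξ ∈ refTriangle, fderivWithin ℝ (lag k W) refTriangle ξ = 0 := by
        intro ξ hξ
        have hu : UniqueDiffWithinAt ℝ refTriangle ξ := uniqueDiffWithinAt_convex convex_refTriangle
          (closure_nonempty_iff.1 ⟨ξ, refTriangle_subset_closure_interior hξ⟩)
          (subset_closure hξ)
        rw [((hasFDerivAt_lag k W ξ).hasFDerivWithinAt).fderivWithin hu,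
          ← (hasFDerivAt_lag k W ξ).fderiv]
        have h5 := h3 ξ hξ
        simp only [Function.comp_apply] at h5
        have h6 : dlag k W 0 ξ = 0 := by nlinarith [sq_nonneg (dlag k W 0 ξ), sq_nonneg (dlag k W 1 ξ)]
        have h7 : dlag k W 1 ξ = 0 := by nlinarith [sq_nonneg (dlag k W 0 ξ), sq_nonneg (dlag k W 1 ξ)]
        ext η
        rw [plane_eq η, map_add, map_smul, map_smul, fderiv_lag_single, fderiv_lag_single, h6, h7]
        simp
      have h5 : ∀ ξ ∈ refTriangle, lag k W ξ = 0 := by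
        intro ξ hξ
        have := convex_refTriangle.is_const_of_fderivWithin_eq_zero (𝕜 := ℝ) (f := lag k W)
          (fun ξ _ => (hasFDerivAt_lag k W ξ).differentiableAt.differentiableWithinAt) h4 hξ
          zero_mem_refTriangle
        rw [this, ← hα₀, lag_refNode hk, ha]
      ext β
      rw [← lag_refNode hk W β, h5 _ (refNode_mem hk β)]; rfl
  refine ⟨(n * S) ^ 2 * c1⁻¹ + (n * S) ^ 2 * c2⁻¹ + 1, by positivity, fun W ξ hξ => ⟨?_, fun a => ?_⟩⟩
  · have hi : 0 ≤ ∫ η in refTriangle, lag k W η ^ 2 := integral_nonneg fun ξ => sq_nonneg _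
    calc lag k W ξ ^ 2 ≤ (n * S) ^ 2 * ‖W‖ ^ 2 := hsum W _ fun α => (hS α ξ hξ).1
      _ ≤ (n * S) ^ 2 * (c1⁻¹ * ∫ η in refTriangle, lag k W η ^ 2) := by
          gcongr; rw [inv_mul_eq_div, le_div_iff₀ hc1, mul_comm]; exact h1 W
      _ ≤ _ := by
          rw [← mul_assoc]; gcongr
          nlinarith [inv_pos.2 hc2, sq_nonneg (n * S), mul_nonneg (sq_nonneg (n * S)) (inv_pos.2 hc2).le]
  · set W' : LagIdx k → ℝ := fun α => W α - W α₀ with hW'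
    have hd : ∀ a η, dlag k W' a η = dlag k W a η := by
      intro a η
      simp only [dlag, hW', sub_mul, Finset.sum_sub_distrib, ← Finset.mul_sum, sum_dshape]; ring
    have h3 := h2 W'
    have hi : 0 ≤ ∫ η in refTriangle, (dlag k W 0 η ^ 2 + dlag k W 1 η ^ 2) :=
      integral_nonneg fun ξ => by positivity
    simp only [hd] at h3
    have h0 : W' α₀ = 0 := by simp [hW']
    rw [h0] at h3
    rw [← hd]
    calc dlag k W' a ξ ^ 2 ≤ (n * S) ^ 2 * ‖W'‖ ^ 2 := hsum W' _ fun α => (hS α ξ hξ).2 a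
      _ ≤ (n * S) ^ 2 * (c2⁻¹ * ∫ η in refTriangle, (dlag k W 0 η ^ 2 + dlag k W 1 η ^ 2)) := by
          gcongr; rw [inv_mul_eq_div, le_div_iff₀ hc2, mul_comm]; linarith
      _ ≤ _ := by
          rw [← mul_assoc]; gcongr
          nlinarith [inv_pos.2 hc1, sq_nonneg (n * S), mul_nonneg (sq_nonneg (n * S)) (inv_pos.2 hc1).le]

/-! ### Scaled jets and the local integrands -/

/-- First order jets of functions with `d` components on the reference triangle: the entry `(ℓ, 0)`
is the value of the component `ℓ`, the entries `(ℓ, 1)` and `(ℓ, 2)` are its partial derivatives. -/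
abbrev Jet (d : ℕ) := EuclideanSpace ℝ (Fin d × Fin 3)

/-- The jet whose entries with component `ℓ` are `c ℓ 0`, `c ℓ 1`, `c ℓ 2`. -/
def mkJet {d : ℕ} (c0 c1 c2 : Fin d → ℝ) : Jet d :=
  WithLp.toLp 2 fun q => ![c0 q.1, c1 q.1, c2 q.1] q.2

@[simp] lemma mkJet_zero {d : ℕ} (c0 c1 c2 : Fin d → ℝ) (ℓ : Fin d) : mkJet c0 c1 c2 (ℓ, 0) = c0 ℓ := rfl
@[simp] lemma mkJet_one {d : ℕ} (c0 c1 c2 : Fin d → ℝ) (ℓ : Fin d) : mkJet c0 c1 c2 (ℓ, 1) = c1 ℓ := rfl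
@[simp] lemma mkJet_two {d : ℕ} (c0 c1 c2 : Fin d → ℝ) (ℓ : Fin d) : mkJet c0 c1 c2 (ℓ, 2) = c2 ℓ := rfl

lemma Jet.ext' {d : ℕ} {X Y : Jet d} (h : ∀ ℓ, X (ℓ, 0) = Y (ℓ, 0) ∧ X (ℓ, 1) = Y (ℓ, 1) ∧
    X (ℓ, 2) = Y (ℓ, 2)) : X = Y := by
  ext ⟨ℓ, i⟩
  fin_cases i
  · exact (h ℓ).1
  · exact (h ℓ).2.1
  · exact (h ℓ).2.2

lemma Jet.inner_eq {d : ℕ} (X Y : Jet d) : inner ℝ X Y =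
    ∑ ℓ, (X (ℓ, 0) * Y (ℓ, 0) + X (ℓ, 1) * Y (ℓ, 1) + X (ℓ, 2) * Y (ℓ, 2)) := by
  rw [PiLp.inner_apply, Fintype.sum_prod_type]
  refine Finset.sum_congr rfl fun ℓ _ => ?_
  rw [Fin.sum_univ_three]
  simp [mul_comm]

lemma Jet.norm_sq_eq {d : ℕ} (X : Jet d) : ‖X‖ ^ 2 =
    ∑ ℓ, (X (ℓ, 0) ^ 2 + X (ℓ, 1) ^ 2 + X (ℓ, 2) ^ 2) := by
  rw [← real_inner_self_eq_norm_sq, Jet.inner_eq]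
  exact Finset.sum_congr rfl fun ℓ _ => by ring

/-- The jet at `ξ`, with derivatives scaled by `h⁻¹`, of a function with components `f ℓ`. -/
def jetOf (h : ℝ) {d : ℕ} (f : Fin d → Plane → ℝ) (ξ : Plane) : Jet d :=
  mkJet (fun ℓ => f ℓ ξ) (fun ℓ => h⁻¹ * fderiv ℝ (f ℓ) ξ (Pi.single 0 1))
    (fun ℓ => h⁻¹ * fderiv ℝ (f ℓ) ξ (Pi.single 1 1))

/-- Entries of the first fundamental form of a patch with jet `X`. -/
def EE (X : Jet 3) : ℝ := ∑ ℓ, X (ℓ, 1) ^ 2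
/-- Entries of the first fundamental form of a patch with jet `X`. -/
def FF (X : Jet 3) : ℝ := ∑ ℓ, X (ℓ, 1) * X (ℓ, 2)
/-- Entries of the first fundamental form of a patch with jet `X`. -/
def GG (X : Jet 3) : ℝ := ∑ ℓ, X (ℓ, 2) ^ 2
/-- The determinant of the first fundamental form of a patch with jet `X`. -/
def dd (X : Jet 3) : ℝ := EE X * GG X - FF X ^ 2
/-- The area element of a patch with jet `X`. -/
def JJ (X : Jet 3) : ℝ := √(dd X)

/-- The mass integrand at a patch with jet `X`, applied to `W`: its inner product with the jet of a test
function is the integrand of the mass form. -/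
def mV {d : ℕ} (X : Jet 3) (W : Jet d) : Jet d := mkJet (fun ℓ => JJ X * W (ℓ, 0)) 0 0

/-- The stiffness integrand at a patch with jet `X`, applied to `W`: its inner product with the jet of a
test function is the integrand of the stiffness form. -/
def aV {d : ℕ} (X : Jet 3) (W : Jet d) : Jet d :=
  mkJet 0 (fun ℓ => (GG X * W (ℓ, 1) - FF X * W (ℓ, 2)) / JJ X)
    (fun ℓ => (EE X * W (ℓ, 2) - FF X * W (ℓ, 1)) / JJ X)

/-- The jet of the function `H ν` when `U` is the jet of `u = (ν, H)`. -/
def prodJet (U : Jet 4) : Jet 3 :=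
  mkJet (fun ℓ => U (3, 0) * U (ℓ.castSucc, 0))
    (fun ℓ => U (3, 0) * U (ℓ.castSucc, 1) + U (ℓ.castSucc, 0) * U (3, 1))
    (fun ℓ => U (3, 0) * U (ℓ.castSucc, 2) + U (ℓ.castSucc, 0) * U (3, 2))

/-- The integrand of the right-hand side `g` of the velocity equation. -/
def gV (X : Jet 3) (U : Jet 4) : Jet 3 := -(mV X (prodJet U) + aV X (prodJet U))

/-- The integrand of `|∇ν|²`, weighted by the area element. -/
def alphaV (X : Jet 3) (U : Jet 4) : ℝ := ∑ ℓ : Fin 3,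
  (GG X * U (ℓ.castSucc, 1) ^ 2 - 2 * FF X * U (ℓ.castSucc, 1) * U (ℓ.castSucc, 2)
    + EE X * U (ℓ.castSucc, 2) ^ 2) / JJ X

/-- The integrand of the right-hand side `f` of the equation for `u = (ν, H)`. -/
def fV (X : Jet 3) (U : Jet 4) : Jet 4 := mkJet (fun m => alphaV X U * U (m, 0)) 0 0

lemma contDiff_mkJet {E : Type*} [NormedAddCommGroup E] [NormedSpace ℝ E] {n : WithTop ℕ∞} {d : ℕ}
    {c0 c1 c2 : E → Fin d → ℝ} {s : Set E} (h0 : ∀ ℓ, ContDiffOn ℝ n (fun x => c0 x ℓ) s)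
    (h1 : ∀ ℓ, ContDiffOn ℝ n (fun x => c1 x ℓ) s) (h2 : ∀ ℓ, ContDiffOn ℝ n (fun x => c2 x ℓ) s) :
    ContDiffOn ℝ n (fun x => mkJet (c0 x) (c1 x) (c2 x)) s := by
  rw [contDiffOn_euclidean]
  rintro ⟨ℓ, i⟩
  fin_cases i
  · exact h0 ℓ
  · exact h1 ℓ
  · exact h2 ℓ

lemma contDiff_coord {d : ℕ} (q : Fin d × Fin 3) : ContDiff ℝ ∞ fun X : Jet d => X q :=
  (EuclideanSpace.proj (𝕜 := ℝ) q).contDiff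

lemma contDiff_EE : ContDiff ℝ ∞ EE := ContDiff.sum fun _ _ => (contDiff_coord _).pow 2
lemma contDiff_FF : ContDiff ℝ ∞ FF := ContDiff.sum fun _ _ => (contDiff_coord _).mul (contDiff_coord _)
lemma contDiff_GG : ContDiff ℝ ∞ GG := ContDiff.sum fun _ _ => (contDiff_coord _).pow 2
lemma contDiff_dd : ContDiff ℝ ∞ dd := (contDiff_EE.mul contDiff_GG).sub (contDiff_FF.pow 2)

lemma contDiffOn_JJ : ContDiffOn ℝ ∞ JJ {X | 0 < dd X} :=
  contDiff_dd.contDiffOn.sqrt fun _ hX => ne_of_gt hX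

lemma JJ_pos {X : Jet 3} (h : 0 < dd X) : 0 < JJ X := Real.sqrt_pos.2 h

lemma continuous_dd : Continuous dd := contDiff_dd.continuous

/-- The pairs of jets at which the integrands are smooth. -/
def goodPairs (d : ℕ) : Set (Jet 3 × Jet d) := {p | 0 < dd p.1}

lemma isOpen_goodPairs (d : ℕ) : IsOpen (goodPairs d) :=
  isOpen_lt continuous_const (continuous_dd.comp continuous_fst)

section smooth
variable {d : ℕ}

lemma contDiffOn_JJ_fst : ContDiffOn ℝ ∞ (fun p : Jet 3 × Jet d => JJ p.1) (goodPairs d) :=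
  contDiffOn_JJ.comp contDiff_fst.contDiffOn fun _ h => h

lemma contDiff_snd_coord (q : Fin d × Fin 3) : ContDiff ℝ ∞ fun p : Jet 3 × Jet d => p.2 q :=
  (contDiff_coord q).comp contDiff_snd

lemma contDiffOn_mV : ContDiffOn ℝ ∞ (fun p : Jet 3 × Jet d => mV p.1 p.2) (goodPairs d) :=
  contDiff_mkJet (fun _ => contDiffOn_JJ_fst.mul (contDiff_snd_coord _).contDiffOn)
    (fun _ => contDiffOn_const) (fun _ => contDiffOn_const)

lemma contDiffOn_aV : ContDiffOn ℝ ∞ (fun p : Jet 3 × Jet d => aV p.1 p.2) (goodPairs d) := by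
  have hE : ContDiff ℝ ∞ fun p : Jet 3 × Jet d => EE p.1 := contDiff_EE.comp contDiff_fst
  have hF : ContDiff ℝ ∞ fun p : Jet 3 × Jet d => FF p.1 := contDiff_FF.comp contDiff_fst
  have hG : ContDiff ℝ ∞ fun p : Jet 3 × Jet d => GG p.1 := contDiff_GG.comp contDiff_fst
  have hJ : ∀ p ∈ goodPairs d, JJ p.1 ≠ 0 := fun p hp => (JJ_pos hp).ne'
  exact contDiff_mkJet (fun _ => contDiffOn_const)
    (fun _ => ((hG.mul (contDiff_snd_coord _)).sub (hF.mul (contDiff_snd_coord _))).contDiffOn.div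
      contDiffOn_JJ_fst hJ)
    (fun _ => ((hE.mul (contDiff_snd_coord _)).sub (hF.mul (contDiff_snd_coord _))).contDiffOn.div
      contDiffOn_JJ_fst hJ)

lemma contDiff_prodJet : ContDiff ℝ ∞ prodJet := by
  rw [← contDiffOn_univ]
  refine contDiff_mkJet (fun _ => ?_) (fun _ => ?_) (fun _ => ?_)
  · exact ((contDiff_coord _).mul (contDiff_coord _)).contDiffOn
  · exact (((contDiff_coord _).mul (contDiff_coord _)).add
      ((contDiff_coord _).mul (contDiff_coord _))).contDiffOn
  · exact (((contDiff_coord _).mul (contDiff_coord _)).add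
      ((contDiff_coord _).mul (contDiff_coord _))).contDiffOn

lemma contDiffOn_gV : ContDiffOn ℝ ∞ (fun p : Jet 3 × Jet 4 => gV p.1 p.2) (goodPairs 4) := by
  have h : ContDiff ℝ ∞ fun p : Jet 3 × Jet 4 => (p.1, prodJet p.2) :=
    contDiff_fst.prodMk (contDiff_prodJet.comp contDiff_snd)
  exact ((contDiffOn_mV.comp h.contDiffOn fun _ hp => hp).add
    (contDiffOn_aV.comp h.contDiffOn fun _ hp => hp)).neg

lemma contDiffOn_fV : ContDiffOn ℝ ∞ (fun p : Jet 3 × Jet 4 => fV p.1 p.2) (goodPairs 4) := by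
  have hE : ContDiff ℝ ∞ fun p : Jet 3 × Jet 4 => EE p.1 := contDiff_EE.comp contDiff_fst
  have hF : ContDiff ℝ ∞ fun p : Jet 3 × Jet 4 => FF p.1 := contDiff_FF.comp contDiff_fst
  have hG : ContDiff ℝ ∞ fun p : Jet 3 × Jet 4 => GG p.1 := contDiff_GG.comp contDiff_fst
  have hJ : ∀ p ∈ goodPairs 4, JJ p.1 ≠ 0 := fun p hp => (JJ_pos hp).ne'
  refine contDiff_mkJet (fun m => ContDiffOn.mul (ContDiffOn.sum fun ℓ _ => ContDiffOn.div ?_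
    contDiffOn_JJ_fst hJ) (contDiff_snd_coord _).contDiffOn) (fun _ => contDiffOn_const)
    (fun _ => contDiffOn_const)
  exact (((hG.mul ((contDiff_snd_coord _).pow 2)).sub
    (((contDiff_const.mul hF).mul (contDiff_snd_coord _)).mul (contDiff_snd_coord _))).add
    (hE.mul ((contDiff_snd_coord _).pow 2))).contDiffOn

end smooth

/-! ### Pointwise identities for the integrands -/

lemma inner_tgrad_mul_areaElement (Y : Plane → E3) (w z : Plane → ℝ) (ξ : Plane) :
    inner ℝ (tgrad Y w ξ) (tgrad Y z ξ) * areaElement Y ξ =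
    (inner ℝ (patchDeriv Y ξ 1) (patchDeriv Y ξ 1) *
        (fderiv ℝ w ξ (Pi.single 0 1) * fderiv ℝ z ξ (Pi.single 0 1))
      - inner ℝ (patchDeriv Y ξ 0) (patchDeriv Y ξ 1) *
        (fderiv ℝ w ξ (Pi.single 0 1) * fderiv ℝ z ξ (Pi.single 1 1) +
          fderiv ℝ w ξ (Pi.single 1 1) * fderiv ℝ z ξ (Pi.single 0 1))
      + inner ℝ (patchDeriv Y ξ 0) (patchDeriv Y ξ 0) *
        (fderiv ℝ w ξ (Pi.single 1 1) * fderiv ℝ z ξ (Pi.single 1 1))) / areaElement Y ξ := by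
  have hdet : (gram Y ξ).det = inner ℝ (patchDeriv Y ξ 0) (patchDeriv Y ξ 0) *
      inner ℝ (patchDeriv Y ξ 1) (patchDeriv Y ξ 1) -
      inner ℝ (patchDeriv Y ξ 0) (patchDeriv Y ξ 1) * inner ℝ (patchDeriv Y ξ 0) (patchDeriv Y ξ 1) := by
    rw [Matrix.det_fin_two]
    simp only [gram, Matrix.of_apply]
    rw [real_inner_comm (patchDeriv Y ξ 0) (patchDeriv Y ξ 1)]
  have hsym : inner ℝ (patchDeriv Y ξ 1) (patchDeriv Y ξ 0) =
      inner ℝ (patchDeriv Y ξ 0) (patchDeriv Y ξ 1) := real_inner_comm _ _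
  have hdet0 : 0 ≤ (gram Y ξ).det := by
    have := real_inner_mul_inner_self_le (patchDeriv Y ξ 0) (patchDeriv Y ξ 1)
    rw [hdet]; linarith
  have hs : areaElement Y ξ ^ 2 = (gram Y ξ).det := Real.sq_sqrt hdet0
  have hinv : ∀ a b, (gram Y ξ)⁻¹ a b = (gram Y ξ).det⁻¹ * (gram Y ξ).adjugate a b := by
    intro a b
    rw [Matrix.inv_def, Ring.inverse_eq_inv', Matrix.smul_apply, smul_eq_mul]
  rcases eq_or_ne (areaElement Y ξ) 0 with h0 | h0
  · rw [h0]; simp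
  have hd : (gram Y ξ).det ≠ 0 := by rw [← hs]; positivity
  simp only [tgrad, Fin.sum_univ_two, hinv, Matrix.adjugate_fin_two]
  simp only [Matrix.of_apply, Matrix.cons_val', Matrix.cons_val_zero, Matrix.cons_val_one,
    Matrix.cons_val_fin_one, inner_add_left, inner_add_right,
    real_inner_smul_left, real_inner_smul_right, gram]
  rw [show (Matrix.of fun a b => inner ℝ (patchDeriv Y ξ a) (patchDeriv Y ξ b)).det
    = areaElement Y ξ ^ 2 from hs.symm]
  rw [hsym]
  rw [hdet] at hs
  set s := areaElement Y ξ
  set E := inner ℝ (patchDeriv Y ξ 0) (patchDeriv Y ξ 0)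
  set F := inner ℝ (patchDeriv Y ξ 0) (patchDeriv Y ξ 1)
  set G := inner ℝ (patchDeriv Y ξ 1) (patchDeriv Y ξ 1)
  set w0 := fderiv ℝ w ξ (Pi.single 0 1)
  set w1 := fderiv ℝ w ξ (Pi.single 1 1)
  set z0 := fderiv ℝ z ξ (Pi.single 0 1)
  set z1 := fderiv ℝ z ξ (Pi.single 1 1)
  field_simp
  linear_combination (-(G * w0 * z0 - F * (w0 * z1 + w1 * z0) + E * w1 * z1)) * hs

lemma patchDeriv_apply {Y : Plane → E3} {ξ : Plane} (hY : DifferentiableAt ℝ Y ξ) (a : Fin 2)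
    (ℓ : Fin 3) : patchDeriv Y ξ a ℓ = fderiv ℝ (fun ξ => Y ξ ℓ) ξ (Pi.single a 1) := by
  have h := (EuclideanSpace.proj (𝕜 := ℝ) ℓ).hasFDerivAt.comp ξ hY.hasFDerivAt
  have h2 : HasFDerivAt (fun ξ => Y ξ ℓ) ((EuclideanSpace.proj (𝕜 := ℝ) ℓ).comp (fderiv ℝ Y ξ)) ξ := h
  rw [h2.fderiv]; rfl

section localforms

variable {Y : Plane → E3} {ξ : Plane} (hY : DifferentiableAt ℝ Y ξ) {h : ℝ} (hh : 0 < h)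

include hY hh

lemma inner_patchDeriv_eq :
    inner ℝ (patchDeriv Y ξ 0) (patchDeriv Y ξ 0) = h ^ 2 * EE (jetOf h (fun ℓ ξ => Y ξ ℓ) ξ) ∧
    inner ℝ (patchDeriv Y ξ 0) (patchDeriv Y ξ 1) = h ^ 2 * FF (jetOf h (fun ℓ ξ => Y ξ ℓ) ξ) ∧
    inner ℝ (patchDeriv Y ξ 1) (patchDeriv Y ξ 1) = h ^ 2 * GG (jetOf h (fun ℓ ξ => Y ξ ℓ) ξ) := by
  have hh' := hh.ne'
  simp only [PiLp.inner_apply, EE, FF, GG, jetOf, mkJet_one, mkJet_two, Finset.mul_sum,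
    patchDeriv_apply hY]
  refine ⟨Finset.sum_congr rfl fun ℓ _ => ?_, Finset.sum_congr rfl fun ℓ _ => ?_,
    Finset.sum_congr rfl fun ℓ _ => ?_⟩
  all_goals simp only [RCLike.inner_apply, conj_trivial]; field_simp

lemma areaElement_eq : areaElement Y ξ = h ^ 2 * JJ (jetOf h (fun ℓ ξ => Y ξ ℓ) ξ) := by
  obtain ⟨h1, h2, h3⟩ := inner_patchDeriv_eq hY hh
  have hdet : (gram Y ξ).det = (h ^ 2) ^ 2 * dd (jetOf h (fun ℓ ξ => Y ξ ℓ) ξ) := by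
    rw [Matrix.det_fin_two]
    simp only [gram, Matrix.of_apply]
    rw [real_inner_comm (patchDeriv Y ξ 0) (patchDeriv Y ξ 1), h1, h2, h3, dd]; ring
  rw [areaElement, hdet, Real.sqrt_mul (by positivity), Real.sqrt_sq (by positivity), JJ]

lemma mass_integrand_eq {d : ℕ} (w z : Fin d → Plane → ℝ) :
    ∑ ℓ, w ℓ ξ * z ℓ ξ * areaElement Y ξ =
      h ^ 2 * inner ℝ (mV (jetOf h (fun ℓ ξ => Y ξ ℓ) ξ) (jetOf h w ξ)) (jetOf h z ξ) := by
  rw [areaElement_eq hY hh, Jet.inner_eq, Finset.mul_sum]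
  refine Finset.sum_congr rfl fun ℓ _ => ?_
  simp [mV, jetOf]; ring

lemma stiffness_integrand_eq {d : ℕ} (w z : Fin d → Plane → ℝ) :
    ∑ ℓ, inner ℝ (tgrad Y (w ℓ) ξ) (tgrad Y (z ℓ) ξ) * areaElement Y ξ =
      h ^ 2 * inner ℝ (aV (jetOf h (fun ℓ ξ => Y ξ ℓ) ξ) (jetOf h w ξ)) (jetOf h z ξ) := by
  obtain ⟨h1, h2, h3⟩ := inner_patchDeriv_eq hY hh
  rw [Jet.inner_eq, Finset.mul_sum]
  refine Finset.sum_congr rfl fun ℓ _ => ?_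
  rw [inner_tgrad_mul_areaElement, h1, h2, h3, areaElement_eq hY hh]
  set X := jetOf h (fun ℓ ξ => Y ξ ℓ) ξ
  rcases eq_or_ne (JJ X) 0 with h0 | h0
  · simp [aV, h0]
  · simp only [aV, jetOf, mkJet_zero, mkJet_one, mkJet_two]
    have := hh.ne'
    simp only [Pi.zero_apply]
    field_simp
    ring

end localforms

/-! ### Finite element functions through their jets -/

namespace Triangulation

variable {Γ : Set E3} {k : ℕ} (𝒯 : Triangulation Γ k)

/-- The scaled jet of the finite element function with nodal vector `w`. -/
def jet {d : ℕ} (w : Fin d × Fin 𝒯.N → ℝ) (P : Fin 𝒯.n) (ξ : Plane) : Jet d :=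
  jetOf 𝒯.h (fun ℓ => 𝒯.fe (fun j => w (ℓ, j)) P) ξ

lemma fe_eq (w : Fin 𝒯.N → ℝ) (P : Fin 𝒯.n) : 𝒯.fe w P = lag k fun α => w (𝒯.loc P α) := rfl

lemma jet_eq {d : ℕ} (w : Fin d × Fin 𝒯.N → ℝ) (P : Fin 𝒯.n) (ξ : Plane) :
    𝒯.jet w P ξ = mkJet (fun ℓ => lag k (fun α => w (ℓ, 𝒯.loc P α)) ξ)
      (fun ℓ => 𝒯.h⁻¹ * dlag k (fun α => w (ℓ, 𝒯.loc P α)) 0 ξ)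
      (fun ℓ => 𝒯.h⁻¹ * dlag k (fun α => w (ℓ, 𝒯.loc P α)) 1 ξ) := by
  simp only [jet, jetOf, fe_eq, fderiv_lag_single]

/-- The scaled jet as a linear map of the nodal vector. -/
def jetL (d : ℕ) (P : Fin 𝒯.n) (ξ : Plane) : (Fin d × Fin 𝒯.N → ℝ) →L[ℝ] Jet d :=
  LinearMap.toContinuousLinearMap
    { toFun := fun w => 𝒯.jet w P ξ
      map_add' := fun w z => by
        refine Jet.ext' fun ℓ => ?_
        simp only [jet_eq, mkJet_zero, mkJet_one, mkJet_two, PiLp.add_apply, lag, dlag, Pi.add_apply,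
          add_mul, Finset.sum_add_distrib, mul_add, and_self]
      map_smul' := fun s w => by
        refine Jet.ext' fun ℓ => ?_
        simp only [jet_eq, mkJet_zero, mkJet_one, mkJet_two, PiLp.smul_apply, lag, dlag, Pi.smul_apply,
          smul_eq_mul, mul_assoc, ← Finset.mul_sum, RingHom.id_apply]
        refine ⟨trivial, ?_, ?_⟩ <;> ring }

@[simp] lemma jetL_apply {d : ℕ} (w : Fin d × Fin 𝒯.N → ℝ) (P : Fin 𝒯.n) (ξ : Plane) :
    𝒯.jetL d P ξ w = 𝒯.jet w P ξ := rfl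

lemma jet_sub {d : ℕ} (w z : Fin d × Fin 𝒯.N → ℝ) (P : Fin 𝒯.n) (ξ : Plane) :
    𝒯.jet (w - z) P ξ = 𝒯.jet w P ξ - 𝒯.jet z P ξ := map_sub (𝒯.jetL d P ξ) w z

lemma continuous_jet {d : ℕ} (P : Fin 𝒯.n) :
    Continuous fun p : (Fin d × Fin 𝒯.N → ℝ) × Plane => 𝒯.jet p.1 P p.2 := by
  simp only [jet_eq]
  refine (PiLp.continuous_toLp 2 _).comp (continuous_pi ?_)
  rintro ⟨ℓ, i⟩
  have hr : Continuous fun p : (Fin d × Fin 𝒯.N → ℝ) × Plane =>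
      ((fun α => p.1 (ℓ, 𝒯.loc P α) : LagIdx k → ℝ), p.2) :=
    (continuous_pi fun α => (continuous_apply _).comp continuous_fst).prodMk continuous_snd
  fin_cases i
  · exact (continuous_lag_uncurry k).comp hr
  · exact continuous_const.mul ((continuous_dlag_uncurry k 0).comp hr)
  · exact continuous_const.mul ((continuous_dlag_uncurry k 1).comp hr)

lemma continuous_jet_right {d : ℕ} (w : Fin d × Fin 𝒯.N → ℝ) (P : Fin 𝒯.n) :
    Continuous (𝒯.jet w P) := (𝒯.continuous_jet P).comp (Continuous.prodMk_right w)

/-- The scaled integral over all reference patches. -/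
def SI (F : Fin 𝒯.n → Plane → ℝ) : ℝ := 𝒯.h ^ 2 * ∑ P, ∫ ξ in refTriangle, F P ξ

variable {𝒯}

lemma SI_congr {F G : Fin 𝒯.n → Plane → ℝ} (h : ∀ P, ∀ ξ ∈ refTriangle, F P ξ = G P ξ) :
    𝒯.SI F = 𝒯.SI G := by
  unfold SI
  congr 1
  exact Finset.sum_congr rfl fun P _ => setIntegral_congr_fun measurableSet_refTriangle (h P)

lemma SI_mono {F G : Fin 𝒯.n → Plane → ℝ} (hF : ∀ P, ContinuousOn (F P) refTriangle)
    (hG : ∀ P, ContinuousOn (G P) refTriangle) (h : ∀ P, ∀ ξ ∈ refTriangle, F P ξ ≤ G P ξ) :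
    𝒯.SI F ≤ 𝒯.SI G :=
  mul_le_mul_of_nonneg_left (Finset.sum_le_sum fun P _ =>
    setIntegral_refTriangle_mono (hF P) (hG P) (h P)) (sq_nonneg _)

lemma SI_add {F G : Fin 𝒯.n → Plane → ℝ} (hF : ∀ P, ContinuousOn (F P) refTriangle)
    (hG : ∀ P, ContinuousOn (G P) refTriangle) :
    𝒯.SI (fun P ξ => F P ξ + G P ξ) = 𝒯.SI F + 𝒯.SI G := by
  unfold SI
  rw [← mul_add, ← Finset.sum_add_distrib]
  congr 1
  exact Finset.sum_congr rfl fun P _ => integral_add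
    ((hF P).integrableOn_compact isCompact_refTriangle)
    ((hG P).integrableOn_compact isCompact_refTriangle)

lemma SI_const_mul (c : ℝ) (F : Fin 𝒯.n → Plane → ℝ) :
    𝒯.SI (fun P ξ => c * F P ξ) = c * 𝒯.SI F := by
  unfold SI
  simp only [integral_const_mul, ← Finset.mul_sum]; ring

lemma SI_neg (F : Fin 𝒯.n → Plane → ℝ) : 𝒯.SI (fun P ξ => -F P ξ) = -𝒯.SI F := by
  simpa using SI_const_mul (-1) F

lemma SI_sub {F G : Fin 𝒯.n → Plane → ℝ} (hF : ∀ P, ContinuousOn (F P) refTriangle)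
    (hG : ∀ P, ContinuousOn (G P) refTriangle) :
    𝒯.SI (fun P ξ => F P ξ - G P ξ) = 𝒯.SI F - 𝒯.SI G := by
  simp only [sub_eq_add_neg, ← SI_neg]
  exact SI_add hF fun P => (hG P).neg

lemma SI_sum {ι : Type*} (s : Finset ι) {F : ι → Fin 𝒯.n → Plane → ℝ}
    (hF : ∀ i ∈ s, ∀ P, ContinuousOn (F i P) refTriangle) :
    𝒯.SI (fun P ξ => ∑ i ∈ s, F i P ξ) = ∑ i ∈ s, 𝒯.SI (F i) := by
  unfold SI
  rw [← Finset.mul_sum, Finset.sum_comm]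
  congr 1
  exact Finset.sum_congr rfl fun P _ => integral_finsetSum _ fun i hi =>
    (hF i hi P).integrableOn_compact isCompact_refTriangle

lemma SI_nonneg {F : Fin 𝒯.n → Plane → ℝ} (h : ∀ P, ∀ ξ ∈ refTriangle, 0 ≤ F P ξ) : 0 ≤ 𝒯.SI F :=
  mul_nonneg (sq_nonneg _) (Finset.sum_nonneg fun P _ =>
    setIntegral_nonneg measurableSet_refTriangle (h P))

variable (𝒯)

/-- A vector of the finite element space is tested with a nodal vector by testing its
integrand with the jet. -/
lemma dotProduct_eq_SI {d : ℕ} {V : Fin d × Fin 𝒯.N → ℝ} {lam : Fin 𝒯.n → Plane → Jet d}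
    (hV : ∀ q, V q = 𝒯.SI fun P ξ => inner ℝ (lam P ξ) (𝒯.jet (Pi.single q 1) P ξ))
    (hlam : ∀ P, ContinuousOn (lam P) refTriangle) (z : Fin d × Fin 𝒯.N → ℝ) :
    z ⬝ᵥ V = 𝒯.SI fun P ξ => inner ℝ (lam P ξ) (𝒯.jet z P ξ) := by
  have hj : ∀ P ξ, 𝒯.jet z P ξ = ∑ q, z q • 𝒯.jet (Pi.single q 1) P ξ := by
    intro P ξ
    have : z = ∑ q, z q • (Pi.single q 1 : Fin d × Fin 𝒯.N → ℝ) := pi_eq_sum_univ' z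
    conv_lhs => rw [← jetL_apply, this, map_sum]
    simp only [map_smul, jetL_apply]
  simp only [hj, inner_sum, real_inner_smul_right]
  rw [SI_sum]
  · simp only [dotProduct, hV]
    refine Finset.sum_congr rfl fun q _ => ?_
    rw [← SI_const_mul]
  · intro q _ P
    exact continuousOn_const.mul ((hlam P).inner (𝕜 := ℝ) (𝒯.continuous_jet_right _ P).continuousOn)

/-- The jet of a function whose only nonzero component is `ℓ`. -/
lemma jet_single {d : ℕ} (q : Fin d × Fin 𝒯.N) (P : Fin 𝒯.n) (ξ : Plane) :
    𝒯.jet (Pi.single q 1) P ξ =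
      jetOf 𝒯.h (fun ℓ => if ℓ = q.1 then 𝒯.basisFn q.2 P else 0) ξ := by
  unfold jet
  congr 1
  ext ℓ η
  obtain ⟨m, i⟩ := q
  by_cases hℓ : ℓ = m
  · subst hℓ
    simp only [if_true, basisFn, fe]
    refine Finset.sum_congr rfl fun α _ => ?_
    simp [Pi.single_apply, Prod.ext_iff]
  · simp only [hℓ, if_false, fe, Pi.zero_apply]
    refine Finset.sum_eq_zero fun α _ => ?_
    simp [Prod.ext_iff, hℓ]

lemma differentiable_fe (w : Fin 𝒯.N → ℝ) (P : Fin 𝒯.n) (ξ : Plane) :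
    DifferentiableAt ℝ (𝒯.fe w P) ξ := (hasFDerivAt_lag k _ ξ).differentiableAt

lemma differentiable_patch (x : Fin 3 × Fin 𝒯.N → ℝ) (P : Fin 𝒯.n) (ξ : Plane) :
    DifferentiableAt ℝ (𝒯.patch x P) ξ := by
  rw [differentiableAt_euclidean]
  exact fun ℓ => 𝒯.differentiable_fe (fun j => x (ℓ, j)) P ξ

lemma jetOf_patch (x : Fin 3 × Fin 𝒯.N → ℝ) (P : Fin 𝒯.n) (ξ : Plane) :
    jetOf 𝒯.h (fun ℓ ξ => 𝒯.patch x P ξ ℓ) ξ = 𝒯.jet x P ξ := rfl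

lemma surfaceIntegral_eq {Y : Fin 𝒯.n → Plane → E3} {f F : Fin 𝒯.n → Plane → ℝ}
    (h : ∀ P, ∀ ξ ∈ refTriangle, f P ξ * areaElement (Y P) ξ = 𝒯.h ^ 2 * F P ξ) :
    surfaceIntegral Y f = 𝒯.SI F := by
  unfold surfaceIntegral SI
  rw [Finset.mul_sum]
  refine Finset.sum_congr rfl fun P _ => ?_
  rw [← integral_const_mul]
  exact setIntegral_congr_fun measurableSet_refTriangle (h P)

section forms

variable (hh : 0 < 𝒯.h) {Y : Fin 𝒯.n → Plane → E3}

include hh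

/-- The sum over the components of the mass forms of functions on a parametrized surface. -/
lemma massForm_eq (hY : ∀ P, ∀ ξ ∈ refTriangle, DifferentiableAt ℝ (Y P) ξ) {d : ℕ} (q : Fin d)
    (w : Fin d → Fin 𝒯.n → Plane → ℝ) (z : Fin 𝒯.n → Plane → ℝ) :
    massForm Y (w q) z = 𝒯.SI fun P ξ =>
      inner ℝ (mV (jetOf 𝒯.h (fun ℓ ξ => Y P ξ ℓ) ξ) (jetOf 𝒯.h (fun ℓ => w ℓ P) ξ))
        (jetOf 𝒯.h (fun ℓ => if ℓ = q then z P else 0) ξ) := by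
  refine 𝒯.surfaceIntegral_eq fun P ξ hξ => ?_
  rw [← mass_integrand_eq (hY P ξ hξ) hh, Finset.sum_eq_single q]
  · simp
  · intro ℓ _ hℓ; simp [hℓ]
  · simp

lemma stiffnessForm_eq (hY : ∀ P, ∀ ξ ∈ refTriangle, DifferentiableAt ℝ (Y P) ξ) {d : ℕ} (q : Fin d)
    (w : Fin d → Fin 𝒯.n → Plane → ℝ) (z : Fin 𝒯.n → Plane → ℝ) :
    stiffnessForm Y (w q) z = 𝒯.SI fun P ξ =>
      inner ℝ (aV (jetOf 𝒯.h (fun ℓ ξ => Y P ξ ℓ) ξ) (jetOf 𝒯.h (fun ℓ => w ℓ P) ξ))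
        (jetOf 𝒯.h (fun ℓ => if ℓ = q then z P else 0) ξ) := by
  refine 𝒯.surfaceIntegral_eq fun P ξ hξ => ?_
  rw [← stiffness_integrand_eq (hY P ξ hξ) hh, Finset.sum_eq_single q]
  · simp
  · intro ℓ _ hℓ
    have : tgrad (Y P) (0 : Plane → ℝ) ξ = 0 := by
      simp [tgrad, show (0 : Plane → ℝ) = fun _ => 0 from rfl]
    simp [hℓ, this]
  · simp

end forms

end Triangulation

/-! ### The matrices and the nonlinear terms as integrals of jets -/

section jetalgebra

variable {d : ℕ}

lemma inner_mV (X : Jet 3) (W Z : Jet d) :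
    inner ℝ (mV X W) Z = JJ X * ∑ ℓ, W (ℓ, 0) * Z (ℓ, 0) := by
  rw [Jet.inner_eq, Finset.mul_sum]
  exact Finset.sum_congr rfl fun ℓ _ => by simp [mV]; ring

lemma inner_aV (X : Jet 3) (W Z : Jet d) :
    inner ℝ (aV X W) Z = ∑ ℓ, (GG X * (W (ℓ, 1) * Z (ℓ, 1)) -
      FF X * (W (ℓ, 1) * Z (ℓ, 2) + W (ℓ, 2) * Z (ℓ, 1)) + EE X * (W (ℓ, 2) * Z (ℓ, 2))) / JJ X := by
  rw [Jet.inner_eq]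
  exact Finset.sum_congr rfl fun ℓ _ => by simp [aV]; ring

lemma inner_mV_comm (X : Jet 3) (W Z : Jet d) : inner ℝ (mV X W) Z = inner ℝ (mV X Z) W := by
  simp only [inner_mV, mul_comm]

lemma inner_aV_comm (X : Jet 3) (W Z : Jet d) : inner ℝ (aV X W) Z = inner ℝ (aV X Z) W := by
  simp only [inner_aV]
  exact Finset.sum_congr rfl fun ℓ _ => by ring

/-- The integrand of the `H¹` inner product. -/
def kV (X : Jet 3) (W : Jet d) : Jet d := mV X W + aV X W

lemma contDiffOn_kV : ContDiffOn ℝ ∞ (fun p : Jet 3 × Jet d => kV p.1 p.2) (goodPairs d) :=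
  contDiffOn_mV.add contDiffOn_aV

lemma inner_kV_comm (X : Jet 3) (W Z : Jet d) : inner ℝ (kV X W) Z = inner ℝ (kV X Z) W := by
  simp only [kV, inner_add_left, inner_mV_comm X W Z, inner_aV_comm X W Z]

lemma EE_nonneg (X : Jet 3) : 0 ≤ EE X := Finset.sum_nonneg fun _ _ => sq_nonneg _
lemma GG_nonneg (X : Jet 3) : 0 ≤ GG X := Finset.sum_nonneg fun _ _ => sq_nonneg _

lemma EE_add_GG_le (X : Jet 3) : EE X + GG X ≤ ‖X‖ ^ 2 := by
  rw [Jet.norm_sq_eq, EE, GG, ← Finset.sum_add_distrib]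
  exact Finset.sum_le_sum fun ℓ _ => by nlinarith [sq_nonneg (X (ℓ, 0))]

lemma JJ_le (X : Jet 3) : JJ X ≤ ‖X‖ ^ 2 := by
  refine Real.sqrt_le_iff.2 ⟨sq_nonneg _, ?_⟩
  have := EE_add_GG_le X
  have := EE_nonneg X
  have := GG_nonneg X
  unfold dd
  nlinarith [sq_nonneg (FF X), sq_nonneg (EE X - GG X), sq_nonneg (EE X)]

/-- The sum of the squares of the values in a jet. -/
def vsq (W : Jet d) : ℝ := ∑ ℓ, W (ℓ, 0) ^ 2

lemma vsq_nonneg (W : Jet d) : 0 ≤ vsq W := Finset.sum_nonneg fun _ _ => sq_nonneg _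

lemma vsq_le (W : Jet d) : vsq W ≤ ‖W‖ ^ 2 := by
  rw [Jet.norm_sq_eq, vsq]
  exact Finset.sum_le_sum fun ℓ _ => by nlinarith [sq_nonneg (W (ℓ, 1)), sq_nonneg (W (ℓ, 2))]

lemma inner_mV_self (X : Jet 3) (W : Jet d) : inner ℝ (mV X W) W = JJ X * vsq W := by
  rw [inner_mV, vsq]; congr 1; exact Finset.sum_congr rfl fun ℓ _ => by ring

/-- Ellipticity: the smaller eigenvalue of a positive matrix is at least the quotient of determinant
and trace. -/
lemma le_inner_aV_self {X : Jet 3} {L μ : ℝ} (hμ : 0 < μ) (hX : ‖X‖ ≤ L) (hd : μ ≤ dd X) (W : Jet d) :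
    μ / (L ^ 2 * L ^ 2) * (‖W‖ ^ 2 - vsq W) ≤ inner ℝ (aV X W) W := by
  have hd0 : 0 < dd X := hμ.trans_le hd
  have hJ := JJ_pos hd0
  have hLL : ‖X‖ ^ 2 ≤ L ^ 2 := by gcongr
  have hJL : JJ X ≤ L ^ 2 := (JJ_le X).trans hLL
  have hL : 0 < L ^ 2 := hJ.trans_le hJL
  rw [inner_aV, Jet.norm_sq_eq, vsq, ← Finset.sum_sub_distrib, Finset.mul_sum]
  refine Finset.sum_le_sum fun ℓ _ => ?_
  set a := W (ℓ, 1)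
  set b := W (ℓ, 2)
  rw [le_div_iff₀ hJ]
  have h1 : dd X * (a ^ 2 + b ^ 2) ≤ (EE X + GG X) *
      (GG X * (a * a) - FF X * (a * b + b * a) + EE X * (b * b)) := by
    have : (EE X + GG X) * (GG X * (a * a) - FF X * (a * b + b * a) + EE X * (b * b)) -
      dd X * (a ^ 2 + b ^ 2) = (GG X * a - FF X * b) ^ 2 + (EE X * b - FF X * a) ^ 2 := by
      unfold dd; ring
    nlinarith [sq_nonneg (GG X * a - FF X * b), sq_nonneg (EE X * b - FF X * a)]
  have hEG : 0 < EE X + GG X := by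
    have h0 : 0 < EE X * GG X := by unfold dd at hd0; nlinarith [sq_nonneg (FF X)]
    rcases (EE_nonneg X).lt_or_eq with h | h
    · linarith [GG_nonneg X]
    · rw [← h] at h0; simp at h0
  set q := GG X * (a * a) - FF X * (a * b + b * a) + EE X * (b * b)
  have hq : 0 ≤ q := by
    by_contra hq
    push Not at hq
    have : 0 ≤ dd X * (a ^ 2 + b ^ 2) := by positivity
    nlinarith
  have h2 : dd X * (a ^ 2 + b ^ 2) ≤ L ^ 2 * q :=
    h1.trans (mul_le_mul_of_nonneg_right ((EE_add_GG_le X).trans hLL) hq)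
  calc μ / (L ^ 2 * L ^ 2) * (W (ℓ, 0) ^ 2 + a ^ 2 + b ^ 2 - W (ℓ, 0) ^ 2) * JJ X
      = (μ * (a ^ 2 + b ^ 2)) * JJ X / (L ^ 2 * L ^ 2) := by ring
    _ ≤ (dd X * (a ^ 2 + b ^ 2)) * L ^ 2 / (L ^ 2 * L ^ 2) := by gcongr
    _ ≤ (L ^ 2 * q) * L ^ 2 / (L ^ 2 * L ^ 2) := by gcongr
    _ = q := by
        have hL' : L ≠ 0 := by rintro rfl; simp at hL
        field_simp

lemma inner_aV_self_nonneg {X : Jet 3} (hd : 0 < dd X) (W : Jet d) : 0 ≤ inner ℝ (aV X W) W := by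
  refine le_trans ?_ (le_inner_aV_self hd le_rfl le_rfl W)
  have := vsq_le W
  have : 0 ≤ ‖W‖ ^ 2 - vsq W := by linarith
  positivity

/-- The integrand of the `H¹` norm is uniformly positive definite on nondegenerate patches. -/
lemma exists_le_inner_kV_self (L : ℝ) {μ : ℝ} (hμ : 0 < μ) : ∃ c > 0, ∀ {d : ℕ} (X : Jet 3) (W : Jet d),
    ‖X‖ ≤ L → μ ≤ dd X → c * ‖W‖ ^ 2 ≤ inner ℝ (kV X W) W := by
  by_cases hL : L = 0
  · refine ⟨1, one_pos, fun {d} X W hX hd => ?_⟩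
    have hX0 : X = 0 := by rw [hL] at hX; exact norm_le_zero_iff.1 hX
    exfalso
    rw [hX0] at hd
    have h0 : dd (0 : Jet 3) = 0 := by simp [dd, EE, FF, GG]
    linarith
  · refine ⟨min (√μ) (μ / (L ^ 2 * L ^ 2)), by positivity, fun {d} X W hX hd => ?_⟩
    have h1 := le_inner_aV_self hμ hX hd W
    have h2 : √μ ≤ JJ X := Real.sqrt_le_sqrt hd
    have h3 := vsq_nonneg W
    have h4 := vsq_le W
    rw [kV, inner_add_left, inner_mV_self]
    have h5 : min (√μ) (μ / (L ^ 2 * L ^ 2)) * vsq W ≤ JJ X * vsq W :=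
      mul_le_mul_of_nonneg_right ((min_le_left _ _).trans h2) h3
    have h6 : min (√μ) (μ / (L ^ 2 * L ^ 2)) * (‖W‖ ^ 2 - vsq W) ≤
        μ / (L ^ 2 * L ^ 2) * (‖W‖ ^ 2 - vsq W) :=
      mul_le_mul_of_nonneg_right (min_le_right _ _) (by linarith)
    nlinarith

end jetalgebra

namespace Triangulation

variable {Γ : Set E3} {k : ℕ} (𝒯 : Triangulation Γ k)

/-- The discrete surface with nodal vector `x` is nondegenerate. -/
def Good (x : Fin 3 × Fin 𝒯.N → ℝ) : Prop := ∀ P, ∀ ξ ∈ refTriangle, 0 < dd (𝒯.jet x P ξ)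

variable {𝒯}

lemma Good.continuousOn {x : Fin 3 × Fin 𝒯.N → ℝ} (hx : 𝒯.Good x) {d e : ℕ}
    {V : Jet 3 → Jet d → Jet e} (hV : ContDiffOn ℝ ∞ (fun p : Jet 3 × Jet d => V p.1 p.2) (goodPairs d))
    (w : Fin d × Fin 𝒯.N → ℝ) (P : Fin 𝒯.n) :
    ContinuousOn (fun ξ => V (𝒯.jet x P ξ) (𝒯.jet w P ξ)) refTriangle :=
  hV.continuousOn.comp (f := fun ξ => (𝒯.jet x P ξ, 𝒯.jet w P ξ))
    ((𝒯.continuous_jet_right x P).prodMk (𝒯.continuous_jet_right w P)).continuousOn fun ξ hξ => hx P ξ hξ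

lemma Good.continuousOn_inner {x : Fin 3 × Fin 𝒯.N → ℝ} (hx : 𝒯.Good x) {d e : ℕ}
    {V : Jet 3 → Jet d → Jet e} (hV : ContDiffOn ℝ ∞ (fun p : Jet 3 × Jet d => V p.1 p.2) (goodPairs d))
    (w : Fin d × Fin 𝒯.N → ℝ) (z : Fin e × Fin 𝒯.N → ℝ) (P : Fin 𝒯.n) :
    ContinuousOn (fun ξ => inner ℝ (V (𝒯.jet x P ξ) (𝒯.jet w P ξ)) (𝒯.jet z P ξ)) refTriangle :=
  (hx.continuousOn hV w P).inner (𝕜 := ℝ) (𝒯.continuous_jet_right z P).continuousOn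

variable (hh : 0 < 𝒯.h)

include hh

lemma dotProduct_M {x : Fin 3 × Fin 𝒯.N → ℝ} (hx : 𝒯.Good x) {d : ℕ} (z w : Fin d × Fin 𝒯.N → ℝ) :
    z ⬝ᵥ 𝒯.M d x *ᵥ w = 𝒯.SI fun P ξ => inner ℝ (mV (𝒯.jet x P ξ) (𝒯.jet w P ξ)) (𝒯.jet z P ξ) := by
  refine 𝒯.dotProduct_eq_SI (fun q => ?_) (fun P => hx.continuousOn contDiffOn_mV w P) z
  have h1 : (𝒯.M d x *ᵥ w) q = w ⬝ᵥ fun q' => 𝒯.M d x q q' := dotProduct_comm _ _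
  rw [h1, 𝒯.dotProduct_eq_SI (lam := fun P ξ => mV (𝒯.jet x P ξ) (𝒯.jet (Pi.single q 1) P ξ)) _
    (fun P => hx.continuousOn contDiffOn_mV _ P)]
  · exact SI_congr fun P ξ _ => inner_mV_comm _ _ _
  · intro q'
    simp only [jet_single]
    have h2 := 𝒯.massForm_eq hh (Y := 𝒯.patch x) (fun P ξ _ => 𝒯.differentiable_patch x P ξ) q'.1
      (fun ℓ P => if ℓ = q.1 then 𝒯.basisFn q.2 P else 0) (𝒯.basisFn q'.2)
    simp only [jetOf_patch] at h2
    rw [← h2, M, blk, Matrix.kroneckerMap_apply, Matrix.one_apply]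
    by_cases hq : q.1 = q'.1
    · simp [hq, massMatrix]
    · simp [hq, Ne.symm hq, massForm, surfaceIntegral]

lemma dotProduct_A {x : Fin 3 × Fin 𝒯.N → ℝ} (hx : 𝒯.Good x) {d : ℕ} (z w : Fin d × Fin 𝒯.N → ℝ) :
    z ⬝ᵥ 𝒯.A d x *ᵥ w = 𝒯.SI fun P ξ => inner ℝ (aV (𝒯.jet x P ξ) (𝒯.jet w P ξ)) (𝒯.jet z P ξ) := by
  refine 𝒯.dotProduct_eq_SI (fun q => ?_) (fun P => hx.continuousOn contDiffOn_aV w P) z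
  have h1 : (𝒯.A d x *ᵥ w) q = w ⬝ᵥ fun q' => 𝒯.A d x q q' := dotProduct_comm _ _
  rw [h1, 𝒯.dotProduct_eq_SI (lam := fun P ξ => aV (𝒯.jet x P ξ) (𝒯.jet (Pi.single q 1) P ξ)) _
    (fun P => hx.continuousOn contDiffOn_aV _ P)]
  · exact SI_congr fun P ξ _ => inner_aV_comm _ _ _
  · intro q'
    simp only [jet_single]
    have h2 := 𝒯.stiffnessForm_eq hh (Y := 𝒯.patch x) (fun P ξ _ => 𝒯.differentiable_patch x P ξ) q'.1
      (fun ℓ P => if ℓ = q.1 then 𝒯.basisFn q.2 P else 0) (𝒯.basisFn q'.2)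
    simp only [jetOf_patch] at h2
    rw [← h2, A, blk, Matrix.kroneckerMap_apply, Matrix.one_apply]
    by_cases hq : q.1 = q'.1
    · simp [hq, stiffnessMatrix]
    · have h0 : ∀ (Y : Plane → E3) ξ, tgrad Y (0 : Plane → ℝ) ξ = 0 := fun Y ξ => by
        simp [tgrad, show (0 : Plane → ℝ) = fun _ => 0 from rfl]
      simp [hq, Ne.symm hq, stiffnessForm, surfaceIntegral, h0]

omit hh in
lemma K_eq (d : ℕ) (x : Fin 3 × Fin 𝒯.N → ℝ) : 𝒯.K d x = 𝒯.M d x + 𝒯.A d x := by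
  simp only [K, M, A, blk, Matrix.kronecker_add]

lemma dotProduct_K {x : Fin 3 × Fin 𝒯.N → ℝ} (hx : 𝒯.Good x) {d : ℕ} (z w : Fin d × Fin 𝒯.N → ℝ) :
    z ⬝ᵥ 𝒯.K d x *ᵥ w = 𝒯.SI fun P ξ => inner ℝ (kV (𝒯.jet x P ξ) (𝒯.jet w P ξ)) (𝒯.jet z P ξ) := by
  rw [K_eq, Matrix.add_mulVec, dotProduct_add, dotProduct_M hh hx, dotProduct_A hh hx, ← SI_add]
  · simp only [kV, inner_add_left]
  · exact fun P => hx.continuousOn_inner contDiffOn_mV w z P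
  · exact fun P => hx.continuousOn_inner contDiffOn_aV w z P

omit hh in
lemma jetOf_product (u : Fin 4 × Fin 𝒯.N → ℝ) (P : Fin 𝒯.n) (ξ : Plane) :
    jetOf 𝒯.h (fun (ℓ : Fin 3) ξ => 𝒯.comp u 3 P ξ * 𝒯.comp u ℓ.castSucc P ξ) ξ =
      prodJet (𝒯.jet u P ξ) := by
  have hd : ∀ m, HasFDerivAt (𝒯.comp u m P) (fderiv ℝ (𝒯.comp u m P) ξ) ξ :=
    fun m => (𝒯.differentiable_fe _ P ξ).hasFDerivAt
  have h1 : ∀ (ℓ : Fin 3), fderiv ℝ (fun ξ => 𝒯.comp u 3 P ξ * 𝒯.comp u ℓ.castSucc P ξ) ξ =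
      𝒯.comp u 3 P ξ • fderiv ℝ (𝒯.comp u ℓ.castSucc P) ξ +
        𝒯.comp u ℓ.castSucc P ξ • fderiv ℝ (𝒯.comp u 3 P) ξ := fun ℓ =>
    ((hd 3).mul (hd ℓ.castSucc)).fderiv
  refine Jet.ext' fun ℓ => ?_
  simp only [prodJet, jetOf, jet, mkJet_zero, mkJet_one, mkJet_two, h1]
  simp only [add_apply, smul_apply, smul_eq_mul, comp]
  refine ⟨trivial, ?_, ?_⟩ <;> ring

omit hh in
lemma contDiff_fst_prodJet : ContDiff ℝ ∞ fun p : Jet 3 × Jet 4 => (p.1, prodJet p.2) :=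
  contDiff_fst.prodMk (contDiff_prodJet.comp contDiff_snd)

omit hh in
lemma contDiffOn_mV_prodJet :
    ContDiffOn ℝ ∞ (fun p : Jet 3 × Jet 4 => mV p.1 (prodJet p.2)) (goodPairs 4) := by
  have h := (contDiffOn_mV (d := 3)).comp (contDiff_fst_prodJet.contDiffOn (s := goodPairs 4))
    (fun p hp => show (p.1, prodJet p.2) ∈ goodPairs 3 from hp)
  simpa only [Function.comp_def] using h

omit hh in
lemma contDiffOn_aV_prodJet :
    ContDiffOn ℝ ∞ (fun p : Jet 3 × Jet 4 => aV p.1 (prodJet p.2)) (goodPairs 4) := by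
  have h := (contDiffOn_aV (d := 3)).comp (contDiff_fst_prodJet.contDiffOn (s := goodPairs 4))
    (fun p hp => show (p.1, prodJet p.2) ∈ goodPairs 3 from hp)
  simpa only [Function.comp_def] using h

lemma g_apply {x : Fin 3 × Fin 𝒯.N → ℝ} (hx : 𝒯.Good x)
    (u : Fin 4 × Fin 𝒯.N → ℝ) (q : Fin 3 × Fin 𝒯.N) :
    𝒯.g x u q = 𝒯.SI fun P ξ =>
      inner ℝ (gV (𝒯.jet x P ξ) (𝒯.jet u P ξ)) (𝒯.jet (Pi.single q 1) P ξ) := by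
  have c1 := fun P => hx.continuousOn_inner (V := fun X U => mV X (prodJet U))
    contDiffOn_mV_prodJet u (Pi.single q 1) P
  have c2 := fun P => hx.continuousOn_inner (V := fun X U => aV X (prodJet U))
    contDiffOn_aV_prodJet u (Pi.single q 1) P
  have h1 := 𝒯.massForm_eq hh (Y := 𝒯.patch x) (fun P ξ _ => 𝒯.differentiable_patch x P ξ) q.1
    (fun ℓ P ξ => 𝒯.comp u 3 P ξ * 𝒯.comp u ℓ.castSucc P ξ) (𝒯.basisFn q.2)
  have h2 := 𝒯.stiffnessForm_eq hh (Y := 𝒯.patch x) (fun P ξ _ => 𝒯.differentiable_patch x P ξ) q.1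
    (fun ℓ P ξ => 𝒯.comp u 3 P ξ * 𝒯.comp u ℓ.castSucc P ξ) (𝒯.basisFn q.2)
  simp only [jetOf_patch, jetOf_product, ← jet_single] at h1 h2
  unfold g
  rw [h1, h2]
  simp only [gV, inner_neg_left, inner_add_left, SI_neg]
  rw [SI_add c1 c2, neg_add']

lemma dotProduct_g {x : Fin 3 × Fin 𝒯.N → ℝ} (hx : 𝒯.Good x) (z : Fin 3 × Fin 𝒯.N → ℝ)
    (u : Fin 4 × Fin 𝒯.N → ℝ) :
    z ⬝ᵥ 𝒯.g x u = 𝒯.SI fun P ξ => inner ℝ (gV (𝒯.jet x P ξ) (𝒯.jet u P ξ)) (𝒯.jet z P ξ) :=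
  𝒯.dotProduct_eq_SI (fun q => g_apply hh hx u q) (fun P => hx.continuousOn contDiffOn_gV u P) z

omit hh in
lemma inner_aV_eq_alphaV (X : Jet 3) (U : Jet 4) (W : Jet 3)
    (hW : ∀ ℓ : Fin 3, W (ℓ, 1) = U (ℓ.castSucc, 1) ∧ W (ℓ, 2) = U (ℓ.castSucc, 2)) :
    inner ℝ (aV X W) W = alphaV X U := by
  rw [inner_aV, alphaV]
  refine Finset.sum_congr rfl fun ℓ _ => ?_
  rw [(hW ℓ).1, (hW ℓ).2]; ring

lemma dotProduct_f {x : Fin 3 × Fin 𝒯.N → ℝ} (hx : 𝒯.Good x) (z u : Fin 4 × Fin 𝒯.N → ℝ) :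
    z ⬝ᵥ 𝒯.f x u = 𝒯.SI fun P ξ => inner ℝ (fV (𝒯.jet x P ξ) (𝒯.jet u P ξ)) (𝒯.jet z P ξ) := by
  refine 𝒯.dotProduct_eq_SI (fun q => ?_) (fun P => hx.continuousOn contDiffOn_fV u P) z
  refine 𝒯.surfaceIntegral_eq fun P ξ hξ => ?_
  have h1 := stiffness_integrand_eq (𝒯.differentiable_patch x P ξ) hh
    (fun ℓ : Fin 3 => 𝒯.comp u ℓ.castSucc P) (fun ℓ : Fin 3 => 𝒯.comp u ℓ.castSucc P)
  rw [jetOf_patch, inner_aV_eq_alphaV _ (𝒯.jet u P ξ) _ fun ℓ => ⟨rfl, rfl⟩] at h1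
  have h2 : 𝒯.alphaSq x u P ξ * areaElement (𝒯.patch x P) ξ =
      𝒯.h ^ 2 * alphaV (𝒯.jet x P ξ) (𝒯.jet u P ξ) := by
    rw [← h1, alphaSq, Finset.sum_mul]
    simp only [real_inner_self_eq_norm_sq]
  have h3 : inner ℝ (fV (𝒯.jet x P ξ) (𝒯.jet u P ξ)) (𝒯.jet (Pi.single q 1) P ξ) =
      alphaV (𝒯.jet x P ξ) (𝒯.jet u P ξ) * 𝒯.comp u q.1 P ξ * 𝒯.basisFn q.2 P ξ := by
    rw [Jet.inner_eq, Finset.sum_eq_single q.1]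
    · rw [jet_single]
      simp only [fV, jetOf, mkJet_zero, mkJet_one, mkJet_two, Pi.zero_apply, zero_mul, add_zero, if_true]
      rfl
    · intro ℓ _ hℓ
      simp [fV, jet_single, jetOf, hℓ]
    · simp
  rw [h3]
  linear_combination (𝒯.comp u q.1 P ξ * 𝒯.basisFn q.2 P ξ) * h2

end Triangulation

/-! ### Smooth functions on compact sets and parametric integrals -/

/-- A function of class `C¹` on a relatively open subset of a convex set is bounded and Lipschitz on
compact subsets (which need not be convex). -/
lemma exists_bound_lipschitz {E F : Type*} [NormedAddCommGroup E] [NormedSpace ℝ E]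
    [NormedAddCommGroup F] [NormedSpace ℝ F] {f : E → F} {U D K : Set E} (hU : IsOpen U)
    (hD : Convex ℝ D) (hf : ContDiffOn ℝ 1 f (U ∩ D)) (hK : IsCompact K) (hKU : K ⊆ U ∩ D) :
    ∃ C, 0 ≤ C ∧ (∀ x ∈ K, ‖f x‖ ≤ C) ∧ ∀ x ∈ K, ∀ y ∈ K, ‖f x - f y‖ ≤ C * ‖x - y‖ := by
  have hl : LocallyLipschitzOn K f := by
    intro x hx
    have h1 : ContDiffWithinAt ℝ 1 f D x :=
      (hf x (hKU hx)).mono_of_mem_nhdsWithin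
        (by rw [inter_comm]; exact inter_mem_nhdsWithin D (hU.mem_nhds (hKU hx).1))
    obtain ⟨C, t, ht, hC⟩ := h1.exists_lipschitzOnWith hD
    exact ⟨C, t, nhdsWithin_mono x (fun y hy => (hKU hy).2) ht, hC⟩
  obtain ⟨C1, hC1⟩ := hl.exists_lipschitzOnWith_of_compact hK
  obtain ⟨C2, hC2⟩ := hK.exists_bound_of_continuousOn (hf.continuousOn.mono hKU)
  refine ⟨max C1 C2, le_max_of_le_left C1.2, fun x hx => (hC2 x hx).trans (le_max_right _ _),
    fun x hx y hy => ?_⟩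
  have := hC1.dist_le_mul x hx y hy
  rw [dist_eq_norm, dist_eq_norm] at this
  exact this.trans (mul_le_mul_of_nonneg_right (le_max_left _ _) (norm_nonneg _))

lemma exists_bound_lipschitz_of_isOpen {E F : Type*} [NormedAddCommGroup E] [NormedSpace ℝ E]
    [NormedAddCommGroup F] [NormedSpace ℝ F] {f : E → F} {U K : Set E} (hU : IsOpen U)
    (hf : ContDiffOn ℝ 1 f U) (hK : IsCompact K) (hKU : K ⊆ U) :
    ∃ C, 0 ≤ C ∧ (∀ x ∈ K, ‖f x‖ ≤ C) ∧ ∀ x ∈ K, ∀ y ∈ K, ‖f x - f y‖ ≤ C * ‖x - y‖ :=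
  exists_bound_lipschitz hU convex_univ (by rwa [inter_univ]) hK (by rwa [inter_univ])

/-- Differentiation under the integral over the reference triangle, along a curve of parameters that
is only differentiable at one point. -/
lemma hasDerivAt_setIntegral_refTriangle {Z J : Type*} [NormedAddCommGroup Z] [NormedSpace ℝ Z]
    [FiniteDimensional ℝ Z] [NormedAddCommGroup J] [NormedSpace ℝ J]
    {Lam : Plane → Z →L[ℝ] J} (hLam : Continuous Lam) {O : Set J} (hO : IsOpen O) {G : J → ℝ}
    (hG : ContDiffOn ℝ 1 G O) {z : ℝ → Z} {z' : Z} {t : ℝ} (hz : HasDerivAt z z' t)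
    (h : ∀ ξ ∈ refTriangle, Lam ξ (z t) ∈ O) {g' : Plane → ℝ}
    (hg' : ∀ ξ ∈ refTriangle, HasDerivAt (fun s => G (Lam ξ (z s))) (g' ξ) t) :
    HasDerivAt (fun s => ∫ ξ in refTriangle, G (Lam ξ (z s))) (∫ ξ in refTriangle, g' ξ) t ∧
      ContinuousOn g' refTriangle := by
  have : ProperSpace Z := FiniteDimensional.proper ℝ Z
  have hcont : Continuous fun p : Z × Plane => Lam p.2 p.1 :=
    (hLam.comp continuous_snd).clm_apply continuous_fst
  have hopen : IsOpen {p : Z × Plane | Lam p.2 p.1 ∈ O} := hO.preimage hcont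
  obtain ⟨u, v, hu, -, hzu, hrv, huv⟩ := generalized_tube_lemma (isCompact_singleton (x := z t))
    isCompact_refTriangle hopen (by rintro ⟨a, ξ⟩ ⟨ha, hξ⟩; obtain rfl : a = z t := ha; exact h ξ hξ)
  obtain ⟨r, hr, hru⟩ := Metric.nhds_basis_closedBall.mem_iff.1 (hu.mem_nhds (hzu rfl))
  have hmem : ∀ a ∈ Metric.closedBall (z t) r, ∀ ξ ∈ refTriangle, Lam ξ a ∈ O :=
    fun a ha ξ hξ => @huv (a, ξ) ⟨hru ha, hrv hξ⟩
  have hfd : ContinuousOn (fderiv ℝ G) O := hG.continuousOn_fderiv_of_isOpen hO le_rfl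
  have hcd : ContinuousOn (fun p : Z × Plane => (fderiv ℝ G (Lam p.2 p.1)).comp (Lam p.2))
      (Metric.closedBall (z t) r ×ˢ refTriangle) :=
    (hfd.comp hcont.continuousOn fun p hp => hmem _ hp.1 _ hp.2).clm_comp
      (hLam.comp continuous_snd).continuousOn
  obtain ⟨C, hC⟩ := ((isCompact_closedBall (z t) r).prod isCompact_refTriangle).exists_bound_of_continuousOn
    hcd
  have hGc : ∀ a ∈ Metric.closedBall (z t) r, ContinuousOn (fun ξ => G (Lam ξ a)) refTriangle :=
    fun a ha => hG.continuousOn.comp (hLam.clm_apply continuous_const).continuousOn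
      fun ξ hξ => hmem a ha ξ hξ
  have hz0 : z t ∈ Metric.closedBall (z t) r := Metric.mem_closedBall_self hr.le
  have hF'c : ContinuousOn (fun ξ => (fderiv ℝ G (Lam ξ (z t))).comp (Lam ξ)) refTriangle :=
    hcd.comp (Continuous.prodMk_right (z t)).continuousOn fun ξ hξ => ⟨hz0, hξ⟩
  have hGd : ∀ a ∈ Metric.closedBall (z t) r, ∀ ξ ∈ refTriangle,
      HasFDerivAt (fun a => G (Lam ξ a)) ((fderiv ℝ G (Lam ξ a)).comp (Lam ξ)) a := fun a ha ξ hξ =>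
    ((hG.contDiffAt (hO.mem_nhds (hmem a ha ξ hξ))).differentiableAt one_ne_zero).hasFDerivAt.comp a
      (Lam ξ).hasFDerivAt
  have key := hasFDerivAt_integral_of_dominated_of_fderiv_le (μ := volume.restrict refTriangle)
    (F := fun a ξ => G (Lam ξ a)) (F' := fun a ξ => (fderiv ℝ G (Lam ξ a)).comp (Lam ξ))
    (x₀ := z t) (bound := fun _ => C) (Metric.closedBall_mem_nhds (z t) hr)
    (by filter_upwards [Metric.closedBall_mem_nhds (z t) hr] with a ha
        exact (hGc a ha).aestronglyMeasurable_of_isCompact isCompact_refTriangle measurableSet_refTriangle)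
    ((hGc _ hz0).integrableOn_compact isCompact_refTriangle)
    (hF'c.aestronglyMeasurable_of_isCompact isCompact_refTriangle measurableSet_refTriangle)
    (by filter_upwards [ae_restrict_mem measurableSet_refTriangle] with ξ hξ a ha
        exact hC (a, ξ) ⟨ha, hξ⟩)
    (integrable_const C)
    (by filter_upwards [ae_restrict_mem measurableSet_refTriangle] with ξ hξ a ha
        exact hGd a ha ξ hξ)
  have hpt : ∀ ξ ∈ refTriangle, ((fderiv ℝ G (Lam ξ (z t))).comp (Lam ξ)) z' = g' ξ := fun ξ hξ =>
    ((hGd _ hz0 ξ hξ).comp_hasDerivAt t hz).unique (hg' ξ hξ)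
  have hint : Integrable (fun ξ => (fderiv ℝ G (Lam ξ (z t))).comp (Lam ξ))
      (volume.restrict refTriangle) := hF'c.integrableOn_compact isCompact_refTriangle
  have h2 := key.comp_hasDerivAt t hz
  rw [ContinuousLinearMap.integral_apply hint] at h2
  rw [setIntegral_congr_fun measurableSet_refTriangle hpt] at h2
  exact ⟨h2, (hF'c.clm_apply continuousOn_const).congr fun ξ hξ => (hpt ξ hξ).symm⟩

namespace Triangulation

variable {Γ : Set E3} {k : ℕ} {𝒯 : Triangulation Γ k}

lemma hasDerivAt_SI {Z J : Type*} [NormedAddCommGroup Z] [NormedSpace ℝ Z]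
    [FiniteDimensional ℝ Z] [NormedAddCommGroup J] [NormedSpace ℝ J]
    {Lam : Fin 𝒯.n → Plane → Z →L[ℝ] J} (hLam : ∀ P, Continuous (Lam P)) {O : Set J} (hO : IsOpen O)
    {G : J → ℝ} (hG : ContDiffOn ℝ 1 G O) {z : ℝ → Z} {z' : Z} {t : ℝ} (hz : HasDerivAt z z' t)
    (h : ∀ P, ∀ ξ ∈ refTriangle, Lam P ξ (z t) ∈ O) {g' : Fin 𝒯.n → Plane → ℝ}
    (hg' : ∀ P, ∀ ξ ∈ refTriangle, HasDerivAt (fun s => G (Lam P ξ (z s))) (g' P ξ) t) :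
    HasDerivAt (fun s => 𝒯.SI fun P ξ => G (Lam P ξ (z s))) (𝒯.SI g') t ∧
      ∀ P, ContinuousOn (g' P) refTriangle := by
  have h1 := fun P => hasDerivAt_setIntegral_refTriangle (hLam P) hO hG hz (h P) (hg' P)
  exact ⟨(HasDerivAt.fun_sum fun P _ => (h1 P).1).const_mul _, fun P => (h1 P).2⟩

/-! ### Norms of finite element functions -/

/-- The square of the `H¹` norm of a finite element function, computed on the reference triangles. -/
def NH (𝒯 : Triangulation Γ k) {d : ℕ} (w : Fin d × Fin 𝒯.N → ℝ) : ℝ := 𝒯.SI fun P ξ => ‖𝒯.jet w P ξ‖ ^ 2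

/-- The square of the `L²` norm of a finite element function, computed on the reference triangles. -/
def N0 (𝒯 : Triangulation Γ k) {d : ℕ} (w : Fin d × Fin 𝒯.N → ℝ) : ℝ := 𝒯.SI fun P ξ => vsq (𝒯.jet w P ξ)

lemma continuous_normSq_jet {d : ℕ} (w : Fin d × Fin 𝒯.N → ℝ) (P : Fin 𝒯.n) :
    Continuous fun ξ => ‖𝒯.jet w P ξ‖ ^ 2 := (𝒯.continuous_jet_right w P).norm.pow 2

lemma continuous_vsq {d : ℕ} : Continuous (vsq : Jet d → ℝ) :=
  continuous_finsetSum _ fun _ _ => (contDiff_coord _).continuous.pow 2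

lemma continuous_vsq_jet {d : ℕ} (w : Fin d × Fin 𝒯.N → ℝ) (P : Fin 𝒯.n) :
    Continuous fun ξ => vsq (𝒯.jet w P ξ) := continuous_vsq.comp (𝒯.continuous_jet_right w P)

lemma NH_nonneg {d : ℕ} (w : Fin d × Fin 𝒯.N → ℝ) : 0 ≤ 𝒯.NH w := SI_nonneg fun _ _ _ => sq_nonneg _

lemma N0_nonneg {d : ℕ} (w : Fin d × Fin 𝒯.N → ℝ) : 0 ≤ 𝒯.N0 w := SI_nonneg fun _ _ _ => vsq_nonneg _

/-- Inverse estimate: the maximum norm of a jet is bounded by `h⁻¹` times the `H¹` norm. -/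
lemma exists_inverse_estimate_jet {k : ℕ} (hk : 1 ≤ k) (d : ℕ) : ∃ C > 0, ∀ {Γ : Set E3}
    (𝒯 : Triangulation Γ k), 0 < 𝒯.h → ∀ (w : Fin d × Fin 𝒯.N → ℝ) (P : Fin 𝒯.n), ∀ ξ ∈ refTriangle,
      𝒯.h ^ 2 * ‖𝒯.jet w P ξ‖ ^ 2 ≤ C * 𝒯.NH w := by
  obtain ⟨C, hC, hinv⟩ := exists_inverse_estimate hk
  refine ⟨3 * C, by positivity, fun {Γ} 𝒯 hh w P ξ hξ => ?_⟩
  have hP : 𝒯.h ^ 2 * ∫ η in refTriangle, ‖𝒯.jet w P η‖ ^ 2 ≤ 𝒯.NH w := by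
    unfold NH SI
    gcongr
    exact Finset.single_le_sum (f := fun P => ∫ η in refTriangle, ‖𝒯.jet w P η‖ ^ 2)
      (fun P _ => integral_nonneg fun η => sq_nonneg _) (Finset.mem_univ P)
  have hcl : ∀ W : LagIdx k → ℝ, Continuous (lag k W) := fun W =>
    (continuous_lag_uncurry k).comp (Continuous.prodMk_right W)
  have hcd : ∀ (W : LagIdx k → ℝ) a, Continuous (dlag k W a) := fun W a =>
    (continuous_dlag_uncurry k a).comp (Continuous.prodMk_right W)
  have hloc : ‖𝒯.jet w P ξ‖ ^ 2 ≤ 3 * C * ∫ η in refTriangle, ‖𝒯.jet w P η‖ ^ 2 := by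
    have e : ∀ η, ‖𝒯.jet w P η‖ ^ 2 = ∑ ℓ, (lag k (fun α => w (ℓ, 𝒯.loc P α)) η ^ 2 +
        𝒯.h⁻¹ ^ 2 * (dlag k (fun α => w (ℓ, 𝒯.loc P α)) 0 η ^ 2 +
          dlag k (fun α => w (ℓ, 𝒯.loc P α)) 1 η ^ 2)) := by
      intro η
      rw [Jet.norm_sq_eq, jet_eq]
      refine Finset.sum_congr rfl fun ℓ _ => ?_
      simp only [mkJet_zero, mkJet_one, mkJet_two]; ring
    have i1 : ∀ W : LagIdx k → ℝ, IntegrableOn (fun η => lag k W η ^ 2) refTriangle := fun W =>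
      ((hcl W).pow 2).continuousOn.integrableOn_compact isCompact_refTriangle
    have i2 : ∀ W : LagIdx k → ℝ, IntegrableOn (fun η => dlag k W 0 η ^ 2 + dlag k W 1 η ^ 2)
        refTriangle := fun W =>
      (((hcd W 0).pow 2).add ((hcd W 1).pow 2)).continuousOn.integrableOn_compact isCompact_refTriangle
    simp only [e]
    have e2 := integral_finsetSum (μ := volume.restrict refTriangle) Finset.univ
      (f := fun (ℓ : Fin d) η => lag k (fun α => w (ℓ, 𝒯.loc P α)) η ^ 2 +
        𝒯.h⁻¹ ^ 2 * (dlag k (fun α => w (ℓ, 𝒯.loc P α)) 0 η ^ 2 +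
          dlag k (fun α => w (ℓ, 𝒯.loc P α)) 1 η ^ 2))
      fun ℓ _ => Integrable.add (i1 fun α => w (ℓ, 𝒯.loc P α))
        (Integrable.const_mul (i2 fun α => w (ℓ, 𝒯.loc P α)) (𝒯.h⁻¹ ^ 2))
    rw [e2, Finset.mul_sum]
    refine Finset.sum_le_sum fun ℓ _ => ?_
    set W : LagIdx k → ℝ := fun α => w (ℓ, 𝒯.loc P α)
    rw [integral_add (i1 W) ((i2 W).const_mul _), integral_const_mul]
    have h1 := (hinv W ξ hξ).1
    have h2 := (hinv W ξ hξ).2 0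
    have h3 := (hinv W ξ hξ).2 1
    have h4 : 0 ≤ ∫ η in refTriangle, lag k W η ^ 2 := integral_nonneg fun _ => sq_nonneg _
    have h5 : 0 ≤ ∫ η in refTriangle, (dlag k W 0 η ^ 2 + dlag k W 1 η ^ 2) :=
      integral_nonneg fun _ => by positivity
    have h6 : 𝒯.h⁻¹ ^ 2 * (dlag k W 0 ξ ^ 2 + dlag k W 1 ξ ^ 2) ≤ 𝒯.h⁻¹ ^ 2 *
        (2 * (C * ∫ η in refTriangle, (dlag k W 0 η ^ 2 + dlag k W 1 η ^ 2))) := by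
      gcongr; linarith
    have h7 : 0 ≤ 𝒯.h⁻¹ ^ 2 * (C * ∫ η in refTriangle, (dlag k W 0 η ^ 2 + dlag k W 1 η ^ 2)) := by
      positivity
    have h8 : 0 ≤ C * ∫ η in refTriangle, lag k W η ^ 2 := by positivity
    nlinarith
  calc 𝒯.h ^ 2 * ‖𝒯.jet w P ξ‖ ^ 2 ≤ 𝒯.h ^ 2 * (3 * C * ∫ η in refTriangle, ‖𝒯.jet w P η‖ ^ 2) := by
        gcongr
    _ = 3 * C * (𝒯.h ^ 2 * ∫ η in refTriangle, ‖𝒯.jet w P η‖ ^ 2) := by ring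
    _ ≤ _ := by gcongr

lemma eq_zero_of_NH_eq_zero (hk : 1 ≤ k) (hh : 0 < 𝒯.h) {d : ℕ} {w : Fin d × Fin 𝒯.N → ℝ}
    (h : 𝒯.NH w ≤ 0) : w = 0 := by
  obtain ⟨C, hC, hinv⟩ := exists_inverse_estimate_jet hk d
  ext ⟨ℓ, j⟩
  obtain ⟨P, α, rfl⟩ := 𝒯.loc_surjective j
  have h1 := hinv 𝒯 hh w P (refNode k α) (refNode_mem hk α)
  have h2 : C * 𝒯.NH w ≤ 0 := mul_nonpos_of_nonneg_of_nonpos hC.le h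
  have h3 : 0 < 𝒯.h ^ 2 := by positivity
  have h4 : ‖𝒯.jet w P (refNode k α)‖ ^ 2 ≤ 0 := by
    by_contra hc
    push Not at hc
    have := mul_pos h3 hc
    linarith
  have h5 : 𝒯.jet w P (refNode k α) = 0 := by
    rw [← norm_eq_zero]
    exact pow_eq_zero_iff (two_ne_zero) |>.1 (le_antisymm h4 (sq_nonneg _))
  have h6 : 𝒯.jet w P (refNode k α) (ℓ, 0) = w (ℓ, 𝒯.loc P α) := by
    rw [jet_eq, mkJet_zero, lag_refNode hk]
  rw [← h6, h5]; rfl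

variable (hh : 0 < 𝒯.h)
include hh

lemma dotProduct_M_comm {x : Fin 3 × Fin 𝒯.N → ℝ} (hx : 𝒯.Good x) {d : ℕ} (z w : Fin d × Fin 𝒯.N → ℝ) :
    z ⬝ᵥ 𝒯.M d x *ᵥ w = w ⬝ᵥ 𝒯.M d x *ᵥ z := by
  rw [dotProduct_M hh hx, dotProduct_M hh hx]
  exact SI_congr fun P ξ _ => inner_mV_comm _ _ _

lemma dotProduct_K_comm {x : Fin 3 × Fin 𝒯.N → ℝ} (hx : 𝒯.Good x) {d : ℕ} (z w : Fin d × Fin 𝒯.N → ℝ) :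
    z ⬝ᵥ 𝒯.K d x *ᵥ w = w ⬝ᵥ 𝒯.K d x *ᵥ z := by
  rw [dotProduct_K hh hx, dotProduct_K hh hx]
  exact SI_congr fun P ξ _ => inner_kV_comm _ _ _

lemma dotProduct_M_self_nonneg {x : Fin 3 × Fin 𝒯.N → ℝ} (hx : 𝒯.Good x) {d : ℕ}
    (w : Fin d × Fin 𝒯.N → ℝ) : 0 ≤ w ⬝ᵥ 𝒯.M d x *ᵥ w := by
  rw [dotProduct_M hh hx]
  refine SI_nonneg fun P ξ hξ => ?_
  rw [inner_mV_self]
  exact mul_nonneg (Real.sqrt_nonneg _) (vsq_nonneg _)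

lemma dotProduct_K_self_nonneg {x : Fin 3 × Fin 𝒯.N → ℝ} (hx : 𝒯.Good x) {d : ℕ}
    (w : Fin d × Fin 𝒯.N → ℝ) : 0 ≤ w ⬝ᵥ 𝒯.K d x *ᵥ w := by
  rw [dotProduct_K hh hx]
  refine SI_nonneg fun P ξ hξ => ?_
  rw [kV, inner_add_left, inner_mV_self]
  exact add_nonneg (mul_nonneg (Real.sqrt_nonneg _) (vsq_nonneg _)) (inner_aV_self_nonneg (hx P ξ hξ) _)

lemma le_dotProduct_K_self {x : Fin 3 × Fin 𝒯.N → ℝ} (hx : 𝒯.Good x) {d : ℕ} {c : ℝ}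
    {w : Fin d × Fin 𝒯.N → ℝ} (hc : ∀ P, ∀ ξ ∈ refTriangle,
      c * ‖𝒯.jet w P ξ‖ ^ 2 ≤ inner ℝ (kV (𝒯.jet x P ξ) (𝒯.jet w P ξ)) (𝒯.jet w P ξ)) :
    c * 𝒯.NH w ≤ w ⬝ᵥ 𝒯.K d x *ᵥ w := by
  rw [dotProduct_K hh hx, NH, ← SI_const_mul]
  exact SI_mono (fun P => (continuous_const.mul (continuous_normSq_jet w P)).continuousOn)
    (fun P => hx.continuousOn_inner contDiffOn_kV w w P) hc

/-- The discrete dual norm bounds the functional `w ↦ wᵀ M d` on the energy space. -/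
lemma two_mul_dotProduct_M_le {x : Fin 3 × Fin 𝒯.N → ℝ} (hx : 𝒯.Good x) {d : ℕ}
    (hK : IsUnit (𝒯.K d x).det) (w y : Fin d × Fin 𝒯.N → ℝ) {ε : ℝ} (hε : 0 < ε) :
    2 * (w ⬝ᵥ 𝒯.M d x *ᵥ y) ≤ ε * (w ⬝ᵥ 𝒯.K d x *ᵥ w) +
      ε⁻¹ * (y ⬝ᵥ (𝒯.M d x * (𝒯.K d x)⁻¹ * 𝒯.M d x) *ᵥ y) := by
  set r := (𝒯.K d x)⁻¹ *ᵥ (𝒯.M d x *ᵥ y)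
  have h1 : 𝒯.K d x *ᵥ r = 𝒯.M d x *ᵥ y := by
    rw [Matrix.mulVec_mulVec, Matrix.mul_nonsing_inv _ hK, Matrix.one_mulVec]
  have h2 : y ⬝ᵥ (𝒯.M d x * (𝒯.K d x)⁻¹ * 𝒯.M d x) *ᵥ y = r ⬝ᵥ 𝒯.K d x *ᵥ r := by
    rw [h1, ← Matrix.mulVec_mulVec, ← Matrix.mulVec_mulVec, dotProduct_M_comm hh hx r y]
  have h3 := dotProduct_K_self_nonneg hh hx (ε • w - r)
  rw [Matrix.mulVec_sub, Matrix.mulVec_smul, dotProduct_sub, sub_dotProduct, sub_dotProduct,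
    dotProduct_smul, smul_dotProduct, smul_dotProduct, dotProduct_smul,
    dotProduct_K_comm hh hx r w, smul_eq_mul, smul_eq_mul, smul_eq_mul] at h3
  rw [h2, ← h1]
  have h4 : 0 ≤ ε⁻¹ * (ε * (ε * (w ⬝ᵥ 𝒯.K d x *ᵥ w)) - ε * (w ⬝ᵥ 𝒯.K d x *ᵥ r) -
      (ε * (w ⬝ᵥ 𝒯.K d x *ᵥ r) - r ⬝ᵥ 𝒯.K d x *ᵥ r)) :=
    mul_nonneg (inv_pos.2 hε).le (by linarith)
  have h5 : ε⁻¹ * (ε * (ε * (w ⬝ᵥ 𝒯.K d x *ᵥ w)) - ε * (w ⬝ᵥ 𝒯.K d x *ᵥ r) -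
      (ε * (w ⬝ᵥ 𝒯.K d x *ᵥ r) - r ⬝ᵥ 𝒯.K d x *ᵥ r)) =
      ε * (w ⬝ᵥ 𝒯.K d x *ᵥ w) + ε⁻¹ * (r ⬝ᵥ 𝒯.K d x *ᵥ r) - 2 * (w ⬝ᵥ 𝒯.K d x *ᵥ r) := by
    field_simp; ring
  linarith

lemma two_mul_dotProduct_M_le' {x : Fin 3 × Fin 𝒯.N → ℝ} (hx : 𝒯.Good x) {d : ℕ}
    (w y : Fin d × Fin 𝒯.N → ℝ) {ε : ℝ} (hε : 0 < ε) :
    2 * (w ⬝ᵥ 𝒯.M d x *ᵥ y) ≤ ε * (w ⬝ᵥ 𝒯.M d x *ᵥ w) + ε⁻¹ * (y ⬝ᵥ 𝒯.M d x *ᵥ y) := by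
  have h3 := dotProduct_M_self_nonneg hh hx (ε • w - y)
  rw [Matrix.mulVec_sub, Matrix.mulVec_smul, dotProduct_sub, sub_dotProduct, sub_dotProduct,
    dotProduct_smul, smul_dotProduct, smul_dotProduct, dotProduct_smul,
    dotProduct_M_comm hh hx y w, smul_eq_mul, smul_eq_mul, smul_eq_mul] at h3
  have h4 : 0 ≤ ε⁻¹ * (ε * (ε * (w ⬝ᵥ 𝒯.M d x *ᵥ w)) - ε * (w ⬝ᵥ 𝒯.M d x *ᵥ y) -
      (ε * (w ⬝ᵥ 𝒯.M d x *ᵥ y) - y ⬝ᵥ 𝒯.M d x *ᵥ y)) :=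
    mul_nonneg (inv_pos.2 hε).le (by linarith)
  have h5 : ε⁻¹ * (ε * (ε * (w ⬝ᵥ 𝒯.M d x *ᵥ w)) - ε * (w ⬝ᵥ 𝒯.M d x *ᵥ y) -
      (ε * (w ⬝ᵥ 𝒯.M d x *ᵥ y) - y ⬝ᵥ 𝒯.M d x *ᵥ y)) =
      ε * (w ⬝ᵥ 𝒯.M d x *ᵥ w) + ε⁻¹ * (y ⬝ᵥ 𝒯.M d x *ᵥ y) - 2 * (w ⬝ᵥ 𝒯.M d x *ᵥ y) := by
    field_simp; ring
  linarith

lemma isUnit_det_K (hk : 1 ≤ k) {x : Fin 3 × Fin 𝒯.N → ℝ} (hx : 𝒯.Good x) {d : ℕ} {L μ : ℝ} (hμ : 0 < μ)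
    (hL : ∀ P, ∀ ξ ∈ refTriangle, ‖𝒯.jet x P ξ‖ ≤ L) (hμx : ∀ P, ∀ ξ ∈ refTriangle, μ ≤ dd (𝒯.jet x P ξ)) :
    IsUnit (𝒯.K d x).det := by
  obtain ⟨c, hc, hcoer⟩ := exists_le_inner_kV_self L hμ
  by_contra hdet
  rw [isUnit_iff_ne_zero, not_not] at hdet
  obtain ⟨v, hv, hv0⟩ := Matrix.exists_mulVec_eq_zero_iff.2 hdet
  have h1 := le_dotProduct_K_self hh hx (w := v) fun P ξ hξ => hcoer _ _ (hL P ξ hξ) (hμx P ξ hξ)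
  rw [hv0, dotProduct_zero] at h1
  refine hv (eq_zero_of_NH_eq_zero hk hh ?_)
  by_contra hc2
  push Not at hc2
  nlinarith

end Triangulation

/-! ### The coefficients of the stiffness form -/

/-- The coefficients of the stiffness integrand. -/
def coef (X : Jet 3) : Fin 3 → ℝ := ![GG X / JJ X, FF X / JJ X, EE X / JJ X]

/-- The stiffness integrand as a trilinear function of its coefficients and two jets. -/
def aB {d : ℕ} (c : Fin 3 → ℝ) (W Z : Jet d) : ℝ :=
  ∑ ℓ, (c 0 * W (ℓ, 1) * Z (ℓ, 1) - c 1 * (W (ℓ, 1) * Z (ℓ, 2) + W (ℓ, 2) * Z (ℓ, 1)) +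
    c 2 * W (ℓ, 2) * Z (ℓ, 2))

lemma inner_aV_eq_aB {d : ℕ} (X : Jet 3) (W Z : Jet d) : inner ℝ (aV X W) Z = aB (coef X) W Z := by
  rw [inner_aV, aB]
  refine Finset.sum_congr rfl fun ℓ _ => ?_
  simp [coef]; ring

lemma aB_sub {d : ℕ} (c c' : Fin 3 → ℝ) (W Z : Jet d) : aB (c - c') W Z = aB c W Z - aB c' W Z := by
  simp only [aB, ← Finset.sum_sub_distrib, Pi.sub_apply]
  exact Finset.sum_congr rfl fun ℓ _ => by ring

lemma aB_comm {d : ℕ} (c : Fin 3 → ℝ) (W Z : Jet d) : aB c W Z = aB c Z W := by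
  simp only [aB]
  exact Finset.sum_congr rfl fun ℓ _ => by ring

lemma abs_aB_le {d : ℕ} (c : Fin 3 → ℝ) (W Z : Jet d) : |aB c W Z| ≤ 2 * ‖c‖ * (‖W‖ * ‖Z‖) := by
  -- the estimate with squares, rescaled
  have key : ∀ W Z : Jet d, |aB c W Z| ≤ ‖c‖ * (‖W‖ ^ 2 + ‖Z‖ ^ 2) := by
    intro W Z
    rw [Jet.norm_sq_eq, Jet.norm_sq_eq, ← Finset.sum_add_distrib, Finset.mul_sum, aB]
    refine (Finset.abs_sum_le_sum_abs _ _).trans (Finset.sum_le_sum fun ℓ _ => ?_)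
    have hc : ∀ i, |c i| ≤ ‖c‖ := fun i => norm_le_pi_norm c i
    have hp : ∀ i (a b : ℝ), |c i * (a * b)| ≤ ‖c‖ * ((a ^ 2 + b ^ 2) / 2) := by
      intro i a b
      rw [abs_mul]
      refine mul_le_mul (hc i) ?_ (abs_nonneg _) (norm_nonneg _)
      rw [abs_le]; constructor <;> nlinarith [sq_nonneg (a + b), sq_nonneg (a - b)]
    have h0 := hp 0 (W (ℓ, 1)) (Z (ℓ, 1))
    have h1 := hp 1 (W (ℓ, 1)) (Z (ℓ, 2))
    have h2 := hp 1 (W (ℓ, 2)) (Z (ℓ, 1))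
    have h3 := hp 2 (W (ℓ, 2)) (Z (ℓ, 2))
    have hn : 0 ≤ ‖c‖ * (W (ℓ, 0) ^ 2 + Z (ℓ, 0) ^ 2) := by positivity
    rw [abs_le] at *
    constructor <;> linarith [h0.1, h0.2, h1.1, h1.2, h2.1, h2.2, h3.1, h3.2]
  have hsm : ∀ (s r : ℝ), aB c (s • W) (r • Z) = s * r * aB c W Z := by
    intro s r
    simp only [aB, Finset.mul_sum, PiLp.smul_apply, smul_eq_mul]
    exact Finset.sum_congr rfl fun ℓ _ => by ring
  rcases eq_or_ne ‖W‖ 0 with hW | hW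
  · have : W = 0 := norm_eq_zero.1 hW
    subst this; simp [aB]
  rcases eq_or_ne ‖Z‖ 0 with hZ | hZ
  · have : Z = 0 := norm_eq_zero.1 hZ
    subst this; simp [aB]
  have h := key (‖W‖⁻¹ • W) (‖Z‖⁻¹ • Z)
  rw [hsm, norm_smul, norm_smul, norm_inv, norm_inv, norm_norm, norm_norm, inv_mul_cancel₀ hW,
    inv_mul_cancel₀ hZ, abs_mul, abs_of_nonneg (by positivity)] at h
  have hWp : 0 < ‖W‖ := lt_of_le_of_ne (norm_nonneg _) hW.symm
  have hZp : 0 < ‖Z‖ := lt_of_le_of_ne (norm_nonneg _) hZ.symm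
  calc |aB c W Z| = (‖W‖ * ‖Z‖) * (‖W‖⁻¹ * ‖Z‖⁻¹ * |aB c W Z|) := by field_simp
    _ ≤ (‖W‖ * ‖Z‖) * (‖c‖ * (1 ^ 2 + 1 ^ 2)) := by gcongr
    _ = _ := by ring

lemma hasDerivAt_aB {d : ℕ} {c : ℝ → Fin 3 → ℝ} {W Z : ℝ → Jet d} {c' : Fin 3 → ℝ} {W' Z' : Jet d} {t : ℝ}
    (hc : HasDerivAt c c' t) (hW : HasDerivAt W W' t) (hZ : HasDerivAt Z Z' t) :
    HasDerivAt (fun s => aB (c s) (W s) (Z s)) (aB c' (W t) (Z t) + aB (c t) W' (Z t) + aB (c t) (W t) Z') t := by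
  have hci : ∀ i, HasDerivAt (fun s => c s i) (c' i) t := fun i => hasDerivAt_pi.1 hc i
  have hWi : ∀ q, HasDerivAt (fun s => W s q) (W' q) t := fun q =>
    (EuclideanSpace.proj (𝕜 := ℝ) q).hasFDerivAt.comp_hasDerivAt t hW
  have hZi : ∀ q, HasDerivAt (fun s => Z s q) (Z' q) t := fun q =>
    (EuclideanSpace.proj (𝕜 := ℝ) q).hasFDerivAt.comp_hasDerivAt t hZ
  have h : HasDerivAt (fun s => aB (c s) (W s) (Z s)) _ t := HasDerivAt.fun_sum fun ℓ _ =>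
    ((((hci 0).mul (hWi (ℓ, 1))).mul (hZi (ℓ, 1))).sub
      ((hci 1).mul (((hWi (ℓ, 1)).mul (hZi (ℓ, 2))).add ((hWi (ℓ, 2)).mul (hZi (ℓ, 1)))))).add
        (((hci 2).mul (hWi (ℓ, 2))).mul (hZi (ℓ, 2)))
  convert h using 1
  simp only [aB, ← Finset.sum_add_distrib]
  exact Finset.sum_congr rfl fun ℓ _ => by simp; ring

lemma contDiffOn_coef : ContDiffOn ℝ ∞ coef {X | 0 < dd X} := by
  refine contDiffOn_pi.2 fun i => ?_
  fin_cases i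
  · exact contDiff_GG.contDiffOn.div contDiffOn_JJ fun X hX => (JJ_pos hX).ne'
  · exact contDiff_FF.contDiffOn.div contDiffOn_JJ fun X hX => (JJ_pos hX).ne'
  · exact contDiff_EE.contDiffOn.div contDiffOn_JJ fun X hX => (JJ_pos hX).ne'

lemma isOpen_dd_pos : IsOpen {X : Jet 3 | 0 < dd X} := isOpen_lt continuous_const continuous_dd

/-- The jets of uniformly nondegenerate patches. -/
def goodJets (L μ : ℝ) : Set (Jet 3) := {X | ‖X‖ ≤ L ∧ μ ≤ dd X}

lemma isCompact_goodJets (L μ : ℝ) : IsCompact (goodJets L μ) := by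
  have : goodJets L μ = Metric.closedBall 0 L ∩ {X | μ ≤ dd X} := by
    ext X; simp [goodJets]
  rw [this]
  exact (isCompact_closedBall 0 L).inter_right (isClosed_le continuous_const continuous_dd)

lemma goodJets_subset {L μ : ℝ} (hμ : 0 < μ) : goodJets L μ ⊆ {X | 0 < dd X} := fun _ hX => hμ.trans_le hX.2

/-- Nearby patches of a uniformly nondegenerate patch are uniformly nondegenerate. -/
lemma exists_goodJets_perturbation (L : ℝ) {μ : ℝ} (hμ : 0 < μ) : ∃ δ > 0, δ ≤ 1 ∧ ∀ X Xs : Jet 3,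
    Xs ∈ goodJets L μ → ‖X - Xs‖ ≤ δ → X ∈ goodJets (L + 1) (μ / 2) := by
  obtain ⟨C, hC, -, hlip⟩ := exists_bound_lipschitz_of_isOpen isOpen_univ
    ((contDiff_dd.of_le (by simp)).contDiffOn) (isCompact_closedBall (0 : Jet 3) (L + 1)) (subset_univ _)
  refine ⟨min 1 (μ / (2 * (C + 1))), by positivity, min_le_left _ _, fun X Xs hXs h => ?_⟩
  have h1 : ‖X‖ ≤ L + 1 := by
    have := norm_le_norm_add_norm_sub Xs X
    rw [norm_sub_rev] at this
    linarith [hXs.1, h.trans (min_le_left _ _)]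
  refine ⟨h1, ?_⟩
  have h2 := hlip X (by simpa using h1) Xs (by simp; linarith [hXs.1])
  have h3 : C * ‖X - Xs‖ ≤ μ / 2 := by
    calc C * ‖X - Xs‖ ≤ (C + 1) * (μ / (2 * (C + 1))) := by
          gcongr
          · linarith
          · exact h.trans (min_le_right _ _)
      _ = μ / 2 := by field_simp
  have h4 := (abs_le.1 ((Real.norm_eq_abs _) ▸ h2)).1
  linarith [hXs.2]

/-- Uniform bounds and Lipschitz estimates for a smooth integrand. -/
lemma exists_lipschitz_integrand {d e : ℕ} {V : Jet 3 → Jet d → Jet e}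
    (hV : ContDiffOn ℝ ∞ (fun p : Jet 3 × Jet d => V p.1 p.2) (goodPairs d)) (L : ℝ) {μ : ℝ} (hμ : 0 < μ) :
    ∃ C, 0 ≤ C ∧ ∀ X ∈ goodJets L μ, ∀ Y ∈ goodJets L μ, ∀ W Z : Jet d, ‖W‖ ≤ L → ‖Z‖ ≤ L →
      ‖V X W‖ ≤ C ∧ ‖V X W - V Y Z‖ ≤ C * (‖X - Y‖ + ‖W - Z‖) := by
  obtain ⟨C, hC, hb, hl⟩ := exists_bound_lipschitz_of_isOpen (isOpen_goodPairs d) (hV.of_le (by simp))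
    ((isCompact_goodJets L μ).prod (isCompact_closedBall (0 : Jet d) L))
    (fun p hp => goodJets_subset hμ hp.1)
  refine ⟨C, hC, fun X hX Y hY W Z hW hZ => ⟨hb (X, W) ⟨hX, by simpa using hW⟩, ?_⟩⟩
  refine (hl (X, W) ⟨hX, by simpa using hW⟩ (Y, Z) ⟨hY, by simpa using hZ⟩).trans ?_
  gcongr
  rw [Prod.mk_sub_mk, Prod.norm_mk]
  exact max_le_add_of_nonneg (norm_nonneg _) (norm_nonneg _)

lemma exists_lipschitz_coef (L : ℝ) {μ : ℝ} (hμ : 0 < μ) :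
    ∃ C, 0 ≤ C ∧ ∀ X ∈ goodJets L μ, ∀ Y ∈ goodJets L μ,
      ‖coef X‖ ≤ C ∧ ‖coef X - coef Y‖ ≤ C * ‖X - Y‖ ∧
      ‖fderiv ℝ coef X‖ ≤ C ∧ ‖fderiv ℝ coef X - fderiv ℝ coef Y‖ ≤ C * ‖X - Y‖ := by
  obtain ⟨C, hC, hb, hl⟩ := exists_bound_lipschitz_of_isOpen isOpen_dd_pos (contDiffOn_coef.of_le (by simp))
    (isCompact_goodJets L μ) (goodJets_subset hμ)
  obtain ⟨C', hC', hb', hl'⟩ := exists_bound_lipschitz_of_isOpen isOpen_dd_pos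
    ((contDiffOn_coef.of_le (n := ∞) (m := 2) (by norm_cast)).fderiv_of_isOpen (m := 1) isOpen_dd_pos
      (by norm_num [one_add_one_eq_two]))
    (isCompact_goodJets L μ) (goodJets_subset hμ)
  refine ⟨max C C', le_max_of_le_left hC, fun X hX Y hY => ⟨(hb X hX).trans (le_max_left _ _), ?_,
    (hb' X hX).trans (le_max_right _ _), ?_⟩⟩
  · exact (hl X hX Y hY).trans (mul_le_mul_of_nonneg_right (le_max_left _ _) (norm_nonneg _))
  · exact (hl' X hX Y hY).trans (mul_le_mul_of_nonneg_right (le_max_right _ _) (norm_nonneg _))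

/-! ### Pointwise estimates for the velocity and energy integrands -/

lemma goodJets_mono {L L' μ μ' : ℝ} (hL : L ≤ L') (hμ : μ' ≤ μ) : goodJets L μ ⊆ goodJets L' μ' :=
  fun _ hX => ⟨hX.1.trans hL, hμ.trans hX.2⟩

/-- A jet without derivative entries only sees the values of another jet. -/
lemma abs_inner_le_of_values {d : ℕ} (Y W : Jet d) (hY : ∀ ℓ, Y (ℓ, 1) = 0 ∧ Y (ℓ, 2) = 0) :
    |inner ℝ Y W| ≤ ‖Y‖ * √(vsq W) := by
  have h1 : inner ℝ Y W = ∑ ℓ, Y (ℓ, 0) * W (ℓ, 0) := by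
    rw [Jet.inner_eq]
    exact Finset.sum_congr rfl fun ℓ _ => by rw [(hY ℓ).1, (hY ℓ).2]; ring
  have h2 : ‖Y‖ ^ 2 = ∑ ℓ, Y (ℓ, 0) ^ 2 := by
    rw [Jet.norm_sq_eq]
    exact Finset.sum_congr rfl fun ℓ _ => by rw [(hY ℓ).1, (hY ℓ).2]; ring
  refine abs_le_of_sq_le_sq ?_ (by positivity)
  rw [mul_pow, Real.sq_sqrt (vsq_nonneg W), h1, h2, vsq]
  exact Finset.sum_mul_sq_le_sq_mul_sq _ _ _

lemma abs_sum_value_mul_le {d : ℕ} (W Z : Jet d) : |∑ ℓ, W (ℓ, 0) * Z (ℓ, 0)| ≤ ‖W‖ * √(vsq Z) := by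
  refine abs_le_of_sq_le_sq ?_ (by positivity)
  rw [mul_pow, Real.sq_sqrt (vsq_nonneg Z)]
  refine (Finset.sum_mul_sq_le_sq_mul_sq _ _ _).trans ?_
  exact mul_le_mul_of_nonneg_right (vsq_le W) (vsq_nonneg Z)

/-- The velocity integrands: coercivity of `K` absorbs the perturbation of `K` and of `g`. -/
lemma exists_velocity_estimate (L : ℝ) {μ : ℝ} (hμ : 0 < μ) : ∃ c > 0, ∃ C, 0 ≤ C ∧
    ∀ X ∈ goodJets L μ, ∀ Y ∈ goodJets L μ, ∀ (V Z : Jet 3) (U W : Jet 4), ‖V‖ ≤ L → ‖U‖ ≤ L → ‖W‖ ≤ L →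
      c * ‖Z‖ ^ 2 + (2 * inner ℝ (gV X U) Z - 2 * inner ℝ (gV Y W) Z
        - (2 * inner ℝ (kV X V) Z - 2 * inner ℝ (kV Y V) Z)) ≤
      2 * inner ℝ (kV X Z) Z + C * (‖X - Y‖ ^ 2 + ‖U - W‖ ^ 2) := by
  obtain ⟨c, hc, hcoer⟩ := exists_le_inner_kV_self L hμ
  obtain ⟨C₁, hC₁, h₁⟩ := exists_lipschitz_integrand (contDiffOn_gV) L hμ
  obtain ⟨C₂, hC₂, h₂⟩ := exists_lipschitz_integrand (contDiffOn_kV (d := 3)) L hμ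
  refine ⟨c, hc, 2 * (2 * (C₁ + C₂)) ^ 2 / c, by positivity, fun X hX Y hY V Z U W hV hU hW => ?_⟩
  have e1 := (h₁ X hX Y hY U W hU hW).2
  have e2 := (h₂ X hX Y hY V V hV hV).2
  rw [sub_self, norm_zero, add_zero] at e2
  have i1 : |inner ℝ (gV X U - gV Y W) Z| ≤ C₁ * (‖X - Y‖ + ‖U - W‖) * ‖Z‖ :=
    (abs_real_inner_le_norm _ _).trans (mul_le_mul_of_nonneg_right e1 (norm_nonneg _))
  have i2 : |inner ℝ (kV X V - kV Y V) Z| ≤ C₂ * ‖X - Y‖ * ‖Z‖ :=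
    (abs_real_inner_le_norm _ _).trans (mul_le_mul_of_nonneg_right e2 (norm_nonneg _))
  rw [inner_sub_left] at i1 i2
  have i3 := hcoer X Z hX.1 hX.2
  have j1 := (abs_le.1 i1).2
  have j2 := (abs_le.1 i2).1
  have hX0 := norm_nonneg (X - Y)
  have hU0 := norm_nonneg (U - W)
  set a := ‖X - Y‖
  set b := ‖U - W‖
  set z := ‖Z‖
  have hz0 : 0 ≤ z := norm_nonneg _
  have hb1 : 2 * (C₁ * (a + b) * z) + 2 * (C₂ * a * z) ≤ 2 * (C₁ + C₂) * (a + b) * z := by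
    have : 0 ≤ C₂ * b * z := by positivity
    nlinarith
  have hy : 2 * (C₁ + C₂) * (a + b) * z ≤ c * z ^ 2 + 2 * (2 * (C₁ + C₂)) ^ 2 / c * (a ^ 2 + b ^ 2) := by
    have k1 : 2 * (C₁ + C₂) * (a + b) * z ≤ c * z ^ 2 + (2 * (C₁ + C₂) * (a + b)) ^ 2 / (4 * c) := by
      have := sq_nonneg (2 * c * z - 2 * (C₁ + C₂) * (a + b))
      have k0 : c * z ^ 2 + (2 * (C₁ + C₂) * (a + b)) ^ 2 / (4 * c) - 2 * (C₁ + C₂) * (a + b) * z =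
        (2 * c * z - 2 * (C₁ + C₂) * (a + b)) ^ 2 / (4 * c) := by field_simp; ring
      have : 0 ≤ (2 * c * z - 2 * (C₁ + C₂) * (a + b)) ^ 2 / (4 * c) := by positivity
      linarith
    have k2 : (2 * (C₁ + C₂) * (a + b)) ^ 2 / (4 * c) ≤ 2 * (2 * (C₁ + C₂)) ^ 2 / c * (a ^ 2 + b ^ 2) := by
      have k3 : (a + b) ^ 2 ≤ 2 * (a ^ 2 + b ^ 2) := by nlinarith [sq_nonneg (a - b)]
      calc (2 * (C₁ + C₂) * (a + b)) ^ 2 / (4 * c) = (2 * (C₁ + C₂)) ^ 2 / c / 4 * (a + b) ^ 2 := by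
            field_simp
        _ ≤ (2 * (C₁ + C₂)) ^ 2 / c / 4 * (2 * (a ^ 2 + b ^ 2)) := by gcongr
        _ ≤ 2 * (2 * (C₁ + C₂)) ^ 2 / c * (a ^ 2 + b ^ 2) := by
            have : 0 ≤ (2 * (C₁ + C₂)) ^ 2 / c * (a ^ 2 + b ^ 2) := by positivity
            have e : 2 * (2 * (C₁ + C₂)) ^ 2 / c = 2 * ((2 * (C₁ + C₂)) ^ 2 / c) := by ring
            rw [e]; linarith
    linarith
  linarith

/-- An upper bound of the `H¹` integrand. -/
lemma exists_inner_kV_self_le (L : ℝ) {μ : ℝ} (hμ : 0 < μ) : ∃ C, 0 < C ∧ ∀ X ∈ goodJets L μ,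
    ∀ {d : ℕ} (Z : Jet d), inner ℝ (kV X Z) Z ≤ C * ‖Z‖ ^ 2 := by
  obtain ⟨C, hC, h⟩ := exists_lipschitz_coef L hμ
  refine ⟨L ^ 2 + 2 * C + 1, by positivity, fun X hX d Z => ?_⟩
  rw [kV, inner_add_left, inner_mV_self, inner_aV_eq_aB]
  have h1 := (le_abs_self _).trans (abs_aB_le (coef X) Z Z)
  have h2 := (h X hX X hX).1
  have h3 : JJ X ≤ L ^ 2 := (JJ_le X).trans (by have := hX.1; gcongr)
  have h4 : JJ X * vsq Z ≤ L ^ 2 * ‖Z‖ ^ 2 :=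
    mul_le_mul h3 (vsq_le Z) (vsq_nonneg Z) (sq_nonneg _)
  have h5 : 2 * ‖coef X‖ * (‖Z‖ * ‖Z‖) ≤ 2 * C * ‖Z‖ ^ 2 := by
    rw [← sq]; gcongr
  nlinarith [sq_nonneg ‖Z‖]

/-- The density of the energy: the stiffness form of the error in `u`, corrected by the stiffness form of
the reference solution on the perturbed surface so that its derivative is the tested equation, and
made coercive by lower order terms. -/
def energyDensity (Λ₁ Λ₂ : ℝ) (X Y : Jet 3) (U E : Jet 4) : ℝ :=
  aB (coef X) E E + 2 * aB (coef X - coef Y) U E + Λ₁ * vsq E + Λ₂ * ‖X - Y‖ ^ 2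

/-- The part of the rate of change of the energy density which is not covered by the tested equation. -/
def energyRate (Λ₁ Λ₂ : ℝ) (X Y X' Y' : Jet 3) (U E U' E' : Jet 4) : ℝ :=
  aB (fderiv ℝ coef X X') E E + 2 * aB (fderiv ℝ coef X X' - fderiv ℝ coef Y Y') U E +
    2 * aB (coef X - coef Y) U' E + Λ₁ * (2 * ∑ ℓ, E (ℓ, 0) * E' (ℓ, 0)) +
    Λ₂ * (2 * inner ℝ (X - Y) (X' - Y'))

lemma hasDerivAt_vsq {d : ℕ} {W : ℝ → Jet d} {W' : Jet d} {t : ℝ} (hW : HasDerivAt W W' t) :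
    HasDerivAt (fun s => vsq (W s)) (2 * ∑ ℓ, W t (ℓ, 0) * W' (ℓ, 0)) t := by
  have h : ∀ q, HasDerivAt (fun s => W s q) (W' q) t := fun q =>
    (EuclideanSpace.proj (𝕜 := ℝ) q).hasFDerivAt.comp_hasDerivAt t hW
  refine (HasDerivAt.fun_sum fun ℓ _ => (h (ℓ, 0)).fun_pow 2).congr_deriv ?_
  rw [Finset.mul_sum]
  exact Finset.sum_congr rfl fun ℓ _ => by norm_num; ring

lemma hasDerivAt_energyDensity (Λ₁ Λ₂ : ℝ) {X Y : ℝ → Jet 3} {U E : ℝ → Jet 4} {X' Y' : Jet 3} {U' E' : Jet 4}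
    {t : ℝ} (hX : HasDerivAt X X' t) (hY : HasDerivAt Y Y' t) (hU : HasDerivAt U U' t)
    (hE : HasDerivAt E E' t) (hX0 : 0 < dd (X t)) (hY0 : 0 < dd (Y t)) :
    HasDerivAt (fun s => energyDensity Λ₁ Λ₂ (X s) (Y s) (U s) (E s))
      (energyRate Λ₁ Λ₂ (X t) (Y t) X' Y' (U t) (E t) U' E' +
        (2 * aB (coef (X t)) (E t) E' + 2 * aB (coef (X t) - coef (Y t)) (U t) E')) t := by
  have hc : ∀ {X : ℝ → Jet 3} {X' : Jet 3}, HasDerivAt X X' t → 0 < dd (X t) →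
      HasDerivAt (fun s => coef (X s)) (fderiv ℝ coef (X t) X') t := fun {X X'} hX h0 =>
    HasFDerivAt.comp_hasDerivAt t (((contDiffOn_coef.contDiffAt (isOpen_dd_pos.mem_nhds h0)).differentiableAt
      (by simp)).hasFDerivAt) hX
  have h1 := hasDerivAt_aB (hc hX hX0) hE hE
  have h2 := hasDerivAt_aB ((hc hX hX0).fun_sub (hc hY hY0)) hU hE
  have h3 := hasDerivAt_vsq hE
  have h4 := (hX.fun_sub hY).norm_sq
  refine (((h1.fun_add (h2.const_mul 2)).fun_add (h3.const_mul Λ₁)).fun_add (h4.const_mul Λ₂)).congr_deriv ?_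
  rw [energyRate, aB_comm _ E' (E t)]
  ring

lemma contDiffOn_energyDensity (Λ₁ Λ₂ : ℝ) :
    ContDiffOn ℝ 1 (fun p : (Jet 3 × Jet 3) × (Jet 4 × Jet 4) =>
      energyDensity Λ₁ Λ₂ p.1.1 p.1.2 p.2.1 p.2.2) {p | 0 < dd p.1.1 ∧ 0 < dd p.1.2} := by
  have hcX : ContDiffOn ℝ 1 (fun p : (Jet 3 × Jet 3) × (Jet 4 × Jet 4) => coef p.1.1)
      {p | 0 < dd p.1.1 ∧ 0 < dd p.1.2} := by
    have h := (contDiffOn_coef.of_le (m := 1) (by simp)).comp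
      (contDiff_fst.fst.contDiffOn (𝕜 := ℝ) (n := 1)
      (s := {p : (Jet 3 × Jet 3) × (Jet 4 × Jet 4) | 0 < dd p.1.1 ∧ 0 < dd p.1.2})) (fun p hp => hp.1)
    simpa only [Function.comp_def] using h
  have hcY : ContDiffOn ℝ 1 (fun p : (Jet 3 × Jet 3) × (Jet 4 × Jet 4) => coef p.1.2)
      {p | 0 < dd p.1.1 ∧ 0 < dd p.1.2} := by
    have h := (contDiffOn_coef.of_le (m := 1) (by simp)).comp
      (contDiff_fst.snd.contDiffOn (𝕜 := ℝ) (n := 1)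
      (s := {p : (Jet 3 × Jet 3) × (Jet 4 × Jet 4) | 0 < dd p.1.1 ∧ 0 < dd p.1.2})) (fun p hp => hp.2)
    simpa only [Function.comp_def] using h
  have cX := contDiffOn_pi.1 hcX
  have cY := contDiffOn_pi.1 hcY
  have hU : ∀ q, ContDiffOn ℝ 1 (fun p : (Jet 3 × Jet 3) × (Jet 4 × Jet 4) => p.2.1 q)
      {p | 0 < dd p.1.1 ∧ 0 < dd p.1.2} := fun q =>
    ((contDiff_coord q).of_le (by simp)).comp_contDiffOn contDiff_snd.fst.contDiffOn
  have hE : ∀ q, ContDiffOn ℝ 1 (fun p : (Jet 3 × Jet 3) × (Jet 4 × Jet 4) => p.2.2 q)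
      {p | 0 < dd p.1.1 ∧ 0 < dd p.1.2} := fun q =>
    ((contDiff_coord q).of_le (by simp)).comp_contDiffOn contDiff_snd.snd.contDiffOn
  unfold energyDensity aB vsq
  refine ((ContDiffOn.add ?_ (contDiffOn_const.mul ?_)).add (contDiffOn_const.mul ?_)).add
    (contDiffOn_const.mul ?_)
  · exact ContDiffOn.sum fun ℓ _ => ((((cX 0).mul (hE _)).mul (hE _)).sub ((cX 1).mul
      (((hE _).mul (hE _)).add ((hE _).mul (hE _))))).add (((cX 2).mul (hE _)).mul (hE _))
  · exact ContDiffOn.sum fun ℓ _ => (((((cX 0).sub (cY 0)).mul (hU _)).mul (hE _)).sub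
      (((cX 1).sub (cY 1)).mul (((hU _).mul (hE _)).add ((hU _).mul (hE _))))).add
      ((((cX 2).sub (cY 2)).mul (hU _)).mul (hE _))
  · exact ContDiffOn.sum fun ℓ _ => (hE _).pow 2
  · exact (contDiff_fst.fst.sub contDiff_fst.snd).contDiffOn.norm_sq ℝ

/-- The energy density is equivalent to the sum of the squares of the errors. -/
lemma exists_energyDensity_equiv (L : ℝ) {μ : ℝ} (hμ : 0 < μ) : ∃ Λ₁ Λ₂, 0 ≤ Λ₁ ∧ 0 ≤ Λ₂ ∧ ∃ c > 0, ∃ C > 0,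
    ∀ X ∈ goodJets L μ, ∀ Y ∈ goodJets L μ, ∀ U E : Jet 4, ‖U‖ ≤ L →
      c * (‖X - Y‖ ^ 2 + ‖E‖ ^ 2) ≤ energyDensity Λ₁ Λ₂ X Y U E ∧
      energyDensity Λ₁ Λ₂ X Y U E ≤ C * (‖X - Y‖ ^ 2 + ‖E‖ ^ 2) := by
  obtain ⟨C, hC, h⟩ := exists_lipschitz_coef L hμ
  -- enlarge `L` to have a positive ellipticity constant
  set L' := |L| + 1
  have hL' : L ≤ L' := (le_abs_self L).trans (by simp [L'])
  have hL0 : 0 < L' := by positivity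
  set c := μ / (L' ^ 2 * L' ^ 2)
  have hc : 0 < c := by positivity
  set D := 4 * C * L'
  have hD : 0 ≤ D := by positivity
  refine ⟨c, D ^ 2 / c + c / 2, hc.le, by positivity, c / 2, by positivity,
    2 * C + D + c + (D ^ 2 / c + c / 2), by positivity, fun X hX Y hY U E hU => ?_⟩
  have h1 := (h X hX Y hY).1
  have h2 := (h X hX Y hY).2.1
  have e1 := le_inner_aV_self hμ (hX.1.trans hL') hX.2 E
  rw [inner_aV_eq_aB] at e1
  have e2 : |aB (coef X) E E| ≤ 2 * C * ‖E‖ ^ 2 := by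
    refine (abs_aB_le _ _ _).trans ?_
    rw [← sq]; gcongr
  have e3 : |2 * aB (coef X - coef Y) U E| ≤ D * ‖X - Y‖ * ‖E‖ := by
    rw [abs_mul, abs_two]
    have := abs_aB_le (coef X - coef Y) U E
    have : 2 * ‖coef X - coef Y‖ * (‖U‖ * ‖E‖) ≤ 2 * (C * ‖X - Y‖) * (L' * ‖E‖) := by
      have := hU.trans hL'
      gcongr
    calc _ ≤ 2 * (2 * (C * ‖X - Y‖) * (L' * ‖E‖)) := by linarith
      _ = _ := by simp only [D]; ring
  have e4 := vsq_le E
  have e5 := vsq_nonneg E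
  rw [energyDensity]
  have hX0 := norm_nonneg (X - Y)
  have hE0 := norm_nonneg E
  set a := ‖X - Y‖
  set e := ‖E‖
  have f1 : D * a * e ≤ c / 2 * e ^ 2 + D ^ 2 / c * a ^ 2 := by
    have k0 : c / 2 * e ^ 2 + D ^ 2 / c * a ^ 2 - D * a * e =
      ((c * e - D * a) ^ 2 + (D * a) ^ 2) / (2 * c) := by field_simp; ring
    have : 0 ≤ ((c * e - D * a) ^ 2 + (D * a) ^ 2) / (2 * c) := by positivity
    linarith
  have f2 : D * a * e ≤ D * (a ^ 2 + e ^ 2) := by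
    have : a * e ≤ a ^ 2 + e ^ 2 := by nlinarith [sq_nonneg (a - e)]
    calc D * a * e = D * (a * e) := by ring
      _ ≤ _ := by gcongr
  constructor
  · have := (abs_le.1 e3).1
    nlinarith
  · have g1 := (abs_le.1 e3).2
    have g2 := (abs_le.1 e2).2
    have g3 : c * vsq E ≤ c * e ^ 2 := by gcongr
    have g4 : 0 ≤ C * a ^ 2 := by positivity
    have g5 : 0 ≤ c * a ^ 2 := by positivity
    have g6 : 0 ≤ (D ^ 2 / c + c / 2) * e ^ 2 := by positivity
    nlinarith

/-! ### The rate of change of the energy density -/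

lemma energyRate_aux {C L Λ a b e : ℝ} (hC : 0 ≤ C) (hL : 0 ≤ L) (hΛ : 0 ≤ Λ) (hb : 0 ≤ b)
    (he : 0 ≤ e) (he1 : e ≤ 1) :
    2 * (C * (b + L)) * (e * e) + 2 * (2 * (C * b + C * a * L) * (L * e)) +
      2 * (2 * (C * a) * (L * e)) + Λ * (2 * (a * b)) ≤
    (2 * C * L + 2 * C + 4 * L * C + 4 * L ^ 2 * C + 4 * C * L + 2 * Λ) * (a ^ 2 + e ^ 2 + b ^ 2) := by
  set s := a ^ 2 + e ^ 2 + b ^ 2 with hs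
  have s1 : e * e ≤ s := by nlinarith
  have s2 : b * e ≤ s := by nlinarith [sq_nonneg (b - e)]
  have s3 : a * e ≤ s := by nlinarith [sq_nonneg (a - e)]
  have s4 : a * b ≤ s := by nlinarith [sq_nonneg (a - b)]
  have s5 : b * (e * e) ≤ s := by
    have : b * (e * e) ≤ b * (e * 1) := by gcongr
    linarith
  have r1 := mul_le_mul_of_nonneg_left s1 (mul_nonneg hC hL)
  have r2 := mul_le_mul_of_nonneg_left s5 hC
  have r3 := mul_le_mul_of_nonneg_left s2 (mul_nonneg hL hC)
  have r4 := mul_le_mul_of_nonneg_left s3 (mul_nonneg (sq_nonneg L) hC)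
  have r5 := mul_le_mul_of_nonneg_left s3 (mul_nonneg hC hL)
  have r6 := mul_le_mul_of_nonneg_left s4 hΛ
  linarith

/-- The rate of change of the energy density together with the integrands of the tested equation is
bounded by the squares of the errors: the mass term of the time derivative absorbs all terms with
this derivative, since they only contain its values. -/
lemma exists_energyRate_le (L : ℝ) {μ Λ₁ Λ₂ : ℝ} (hμ : 0 < μ) (hΛ₁ : 0 ≤ Λ₁) (hΛ₂ : 0 ≤ Λ₂) :
    ∃ ε > 0, ∃ C, 0 ≤ C ∧ ∀ X ∈ goodJets L μ, ∀ Y ∈ goodJets L μ, ∀ (X' Y' : Jet 3) (U W W' E' : Jet 4),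
      ‖Y'‖ ≤ L → ‖U‖ ≤ L → ‖W‖ ≤ L → ‖W'‖ ≤ L → ‖U - W‖ ≤ 1 →
      energyRate Λ₁ Λ₂ X Y X' Y' W (U - W) W' E' - 2 * inner ℝ (mV X E') E' +
        2 * (inner ℝ (fV X U) E' - inner ℝ (fV Y W) E') -
        2 * (inner ℝ (mV X W') E' - inner ℝ (mV Y W') E') + ε * inner ℝ (mV Y E') E' ≤
      C * (‖X - Y‖ ^ 2 + ‖U - W‖ ^ 2 + ‖X' - Y'‖ ^ 2) := by
  obtain ⟨C, hC, h⟩ := exists_lipschitz_coef L hμ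
  obtain ⟨C₁, hC₁, h₁⟩ := exists_lipschitz_integrand contDiffOn_fV L hμ
  obtain ⟨C₂, hC₂, h₂⟩ := exists_lipschitz_integrand (contDiffOn_mV (d := 4)) L hμ
  set j := √μ
  have hj : 0 < j := Real.sqrt_pos.2 hμ
  set B := 2 * C₁ + 2 * C₂ + 2 * Λ₁
  have hB : 0 ≤ B := by positivity
  obtain ⟨D, hD'⟩ : ∃ D, D = 2 * C * |L| + 2 * C + 4 * |L| * C + 4 * |L| ^ 2 * C + 4 * C * |L| + 2 * Λ₂ := ⟨_, rfl⟩
  have hD : 0 ≤ D := by rw [hD']; positivity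
  refine ⟨j / (L ^ 2 + 1), by positivity, D + B ^ 2 / (2 * j), by positivity, ?_⟩
  intro X hX Y hY X' Y' U W W' E' hY' hU hW hW' hE
  have hL : 0 ≤ L := (norm_nonneg _).trans hU
  set E := U - W
  have hr0 := Real.sqrt_nonneg (vsq E')
  have hr2 := Real.sq_sqrt (vsq_nonneg E')
  obtain ⟨n1, n2, n3, n4⟩ := h X hX Y hY
  have a0 := norm_nonneg (X - Y)
  have b0 := norm_nonneg (X' - Y')
  have e0 := norm_nonneg E
  have hX' : ‖X'‖ ≤ ‖X' - Y'‖ + L := by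
    have := norm_le_norm_add_norm_sub Y' X'
    rw [norm_sub_rev] at this; linarith
  have t1 : aB (fderiv ℝ coef X X') E E ≤ 2 * (C * (‖X' - Y'‖ + L)) * (‖E‖ * ‖E‖) := by
    refine ((le_abs_self _).trans (abs_aB_le _ _ _)).trans ?_
    have := (ContinuousLinearMap.le_opNorm (fderiv ℝ coef X) X').trans
      (mul_le_mul n3 hX' (norm_nonneg _) hC)
    gcongr
  have t2 : aB (fderiv ℝ coef X X' - fderiv ℝ coef Y Y') W E ≤
      2 * (C * ‖X' - Y'‖ + C * ‖X - Y‖ * L) * (L * ‖E‖) := by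
    refine ((le_abs_self _).trans (abs_aB_le _ _ _)).trans ?_
    have e1 : fderiv ℝ coef X X' - fderiv ℝ coef Y Y' =
        fderiv ℝ coef X (X' - Y') + (fderiv ℝ coef X - fderiv ℝ coef Y) Y' := by
      rw [map_sub, sub_apply]; abel
    have e2 : ‖fderiv ℝ coef X X' - fderiv ℝ coef Y Y'‖ ≤ C * ‖X' - Y'‖ + C * ‖X - Y‖ * L := by
      rw [e1]
      refine (norm_add_le _ _).trans (add_le_add ?_ ?_)
      · exact (ContinuousLinearMap.le_opNorm _ _).trans (mul_le_mul_of_nonneg_right n3 b0)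
      · exact (ContinuousLinearMap.le_opNorm _ _).trans (mul_le_mul n4 hY' (norm_nonneg _) (by positivity))
    gcongr
  have t3 : aB (coef X - coef Y) W' E ≤ 2 * (C * ‖X - Y‖) * (L * ‖E‖) := by
    refine ((le_abs_self _).trans (abs_aB_le _ _ _)).trans ?_
    gcongr
  have t4 : ∑ ℓ, E (ℓ, 0) * E' (ℓ, 0) ≤ ‖E‖ * √(vsq E') := (le_abs_self _).trans (abs_sum_value_mul_le _ _)
  have t5 : inner ℝ (X - Y) (X' - Y') ≤ ‖X - Y‖ * ‖X' - Y'‖ := real_inner_le_norm _ _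
  have t6 : j * vsq E' ≤ inner ℝ (mV X E') E' := by
    rw [inner_mV_self]
    exact mul_le_mul_of_nonneg_right (Real.sqrt_le_sqrt hX.2) (vsq_nonneg _)
  have t7 : inner ℝ (fV X U) E' - inner ℝ (fV Y W) E' ≤ C₁ * (‖X - Y‖ + ‖E‖) * √(vsq E') := by
    rw [← inner_sub_left]
    refine ((le_abs_self _).trans (abs_inner_le_of_values _ _ fun ℓ => by simp [fV])).trans ?_
    exact mul_le_mul_of_nonneg_right (h₁ X hX Y hY U W hU hW).2 hr0
  have t8 : -(inner ℝ (mV X W') E' - inner ℝ (mV Y W') E') ≤ C₂ * ‖X - Y‖ * √(vsq E') := by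
    rw [← inner_sub_left]
    refine ((neg_le_abs _).trans (abs_inner_le_of_values _ _ fun ℓ => by simp [mV])).trans ?_
    refine mul_le_mul_of_nonneg_right ?_ hr0
    simpa using (h₂ X hX Y hY W' W' hW' hW').2
  have t9 : j / (L ^ 2 + 1) * inner ℝ (mV Y E') E' ≤ j * vsq E' := by
    rw [inner_mV_self]
    have h3 : JJ Y ≤ L ^ 2 + 1 := (JJ_le Y).trans (by
      have : ‖Y‖ ^ 2 ≤ L ^ 2 := by have := hY.1; gcongr
      linarith)
    calc j / (L ^ 2 + 1) * (JJ Y * vsq E') ≤ j / (L ^ 2 + 1) * ((L ^ 2 + 1) * vsq E') := by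
          have := vsq_nonneg E'
          gcongr
      _ = _ := by field_simp
  rw [energyRate]
  rw [← hr2] at t6 t9
  set a := ‖X - Y‖
  set b := ‖X' - Y'‖
  set e := ‖E‖
  set r := √(vsq E')
  have hDe : D = 2 * C * L + 2 * C + 4 * L * C + 4 * L ^ 2 * C + 4 * C * L + 2 * Λ₂ := by
    rw [hD', abs_of_nonneg hL]
  have q1 : B * (a + e) * r ≤ j * r ^ 2 + B ^ 2 / (2 * j) * (a ^ 2 + e ^ 2) := by
    have k0 : j * r ^ 2 + B ^ 2 / (2 * j) * (a ^ 2 + e ^ 2) - B * (a + e) * r =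
        ((2 * j * r - B * (a + e)) ^ 2 + B ^ 2 * (a - e) ^ 2) / (4 * j) := by field_simp; ring
    have : 0 ≤ ((2 * j * r - B * (a + e)) ^ 2 + B ^ 2 * (a - e) ^ 2) / (4 * j) := by positivity
    linarith
  have q2 : 2 * (C₁ * (a + e) * r) + 2 * (C₂ * a * r) + Λ₁ * (2 * (e * r)) ≤ B * (a + e) * r := by
    have : B * (a + e) * r - (2 * (C₁ * (a + e) * r) + 2 * (C₂ * a * r) + Λ₁ * (2 * (e * r))) =
      2 * C₂ * e * r + 2 * Λ₁ * a * r := by simp only [B]; ring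
    have : 0 ≤ 2 * C₂ * e * r + 2 * Λ₁ * a * r := by positivity
    linarith
  have q3 := energyRate_aux (a := a) hC hL hΛ₂ b0 e0 hE
  rw [← hDe] at q3
  have q4 : B ^ 2 / (2 * j) * (a ^ 2 + e ^ 2) ≤ B ^ 2 / (2 * j) * (a ^ 2 + e ^ 2 + b ^ 2) :=
    mul_le_mul_of_nonneg_left (le_add_of_nonneg_right (sq_nonneg b)) (by positivity)
  have q5 := mul_le_mul_of_nonneg_left t4 hΛ₁
  have q6 := mul_le_mul_of_nonneg_left t5 hΛ₂
  linarith

/-! ### The error equations -/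

lemma continuousOn_setIntegral_refTriangle {K : Set ℝ} (hK : IsCompact K) {F : ℝ → Plane → ℝ}
    (hF : ContinuousOn (fun p : ℝ × Plane => F p.1 p.2) (K ×ˢ refTriangle)) :
    ContinuousOn (fun s => ∫ ξ in refTriangle, F s ξ) K := by
  obtain ⟨C, hC⟩ := (hK.prod isCompact_refTriangle).exists_bound_of_continuousOn hF
  have h1 : ∀ s ∈ K, ContinuousOn (F s) refTriangle := fun s hs =>
    hF.comp (Continuous.prodMk_right s).continuousOn fun ξ hξ => ⟨hs, hξ⟩
  refine continuousOn_of_dominated (bound := fun _ => C)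
    (fun s hs => (h1 s hs).aestronglyMeasurable measurableSet_refTriangle) (fun s hs => ?_)
    (integrable_const C) ?_
  · filter_upwards [ae_restrict_mem measurableSet_refTriangle] with ξ hξ using hC (s, ξ) ⟨hs, hξ⟩
  · filter_upwards [ae_restrict_mem measurableSet_refTriangle] with ξ hξ
    exact hF.comp (Continuous.prodMk_left ξ).continuousOn fun s hs => ⟨hs, hξ⟩

namespace Triangulation

variable {Γ : Set E3} {k : ℕ} {𝒯 : Triangulation Γ k}

lemma continuousOn_SI {K : Set ℝ} (hK : IsCompact K) {F : ℝ → Fin 𝒯.n → Plane → ℝ}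
    (hF : ∀ P, ContinuousOn (fun p : ℝ × Plane => F p.1 P p.2) (K ×ˢ refTriangle)) :
    ContinuousOn (fun s => 𝒯.SI (F s)) K :=
  continuousOn_const.mul (continuousOn_finsetSum _ fun P _ => continuousOn_setIntegral_refTriangle hK (hF P))

/-- Linear inequalities between integrands can be integrated. -/
lemma sum_SI_nonpos (l : List (ℝ × (Fin 𝒯.n → Plane → ℝ))) (hl : ∀ p ∈ l, ∀ P, ContinuousOn (p.2 P) refTriangle)
    (h : ∀ P, ∀ ξ ∈ refTriangle, (l.map fun p => p.1 * p.2 P ξ).sum ≤ 0) :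
    (l.map fun p => p.1 * 𝒯.SI p.2).sum ≤ 0 := by
  have key : ∀ l : List (ℝ × (Fin 𝒯.n → Plane → ℝ)), (∀ p ∈ l, ∀ P, ContinuousOn (p.2 P) refTriangle) →
      (∀ P, ContinuousOn (fun ξ => (l.map fun p => p.1 * p.2 P ξ).sum) refTriangle) ∧
      𝒯.SI (fun P ξ => (l.map fun p => p.1 * p.2 P ξ).sum) = (l.map fun p => p.1 * 𝒯.SI p.2).sum := by
    intro l hl
    induction l with
    | nil => exact ⟨fun P => by simpa using continuousOn_const, by simp [SI]⟩
    | cons p l ih =>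
      rw [List.forall_mem_cons] at hl
      obtain ⟨i1, i2⟩ := ih hl.2
      have h1 : ∀ P, ContinuousOn (fun ξ => p.1 * p.2 P ξ) refTriangle := fun P => continuousOn_const.mul (hl.1 P)
      simp only [List.map_cons, List.sum_cons]
      exact ⟨fun P => (h1 P).add (i1 P), by rw [SI_add h1 i1, SI_const_mul, i2]⟩
  rw [← (key l hl).2, ← neg_nonneg, ← SI_neg]
  exact SI_nonneg fun P ξ hξ => neg_nonneg.2 (h P ξ hξ)

lemma continuousOn_jet {K : Set ℝ} {d : ℕ} {w : ℝ → Fin d × Fin 𝒯.N → ℝ} (hw : ContinuousOn w K) (P : Fin 𝒯.n) :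
    ContinuousOn (fun p : ℝ × Plane => 𝒯.jet (w p.1) P p.2) (K ×ˢ refTriangle) :=
  ((𝒯.continuous_jet P).continuousOn (s := univ)).comp (f := fun p : ℝ × Plane => (w p.1, p.2))
    ((hw.comp (f := Prod.fst) continuousOn_fst fun _ hp => hp.1).prodMk continuousOn_snd) fun _ _ => mem_univ _

lemma continuousOn_NH {K : Set ℝ} (hK : IsCompact K) {d : ℕ} {w : ℝ → Fin d × Fin 𝒯.N → ℝ}
    (hw : ContinuousOn w K) : ContinuousOn (fun s => 𝒯.NH (w s)) K :=
  continuousOn_SI hK fun P => (continuousOn_jet hw P).norm.pow 2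

lemma hasDerivAt_jet {d : ℕ} {w : ℝ → Fin d × Fin 𝒯.N → ℝ} {w' : Fin d × Fin 𝒯.N → ℝ} {t : ℝ}
    (hw : HasDerivAt w w' t) (P : Fin 𝒯.n) (ξ : Plane) :
    HasDerivAt (fun s => 𝒯.jet (w s) P ξ) (𝒯.jet w' P ξ) t :=
  (𝒯.jetL d P ξ).hasFDerivAt.comp_hasDerivAt t hw

/-- The errors of the velocity are bounded by the errors of position and geometry, and the defect. -/
lemma exists_NH_velocity_le (L : ℝ) {μ : ℝ} (hμ : 0 < μ) : ∃ C, 0 < C ∧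
    ∀ {Γ : Set E3} {k : ℕ} (𝒯 : Triangulation Γ k), 1 ≤ k → 0 < 𝒯.h →
    ∀ (x v xs vs dv : Fin 3 × Fin 𝒯.N → ℝ) (u us : Fin 4 × Fin 𝒯.N → ℝ),
      (∀ P, ∀ ξ ∈ refTriangle, 𝒯.jet x P ξ ∈ goodJets L μ) →
      (∀ P, ∀ ξ ∈ refTriangle, 𝒯.jet xs P ξ ∈ goodJets L μ) →
      (∀ P, ∀ ξ ∈ refTriangle, ‖𝒯.jet vs P ξ‖ ≤ L) → (∀ P, ∀ ξ ∈ refTriangle, ‖𝒯.jet us P ξ‖ ≤ L) →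
      (∀ P, ∀ ξ ∈ refTriangle, ‖𝒯.jet u P ξ‖ ≤ L) →
      𝒯.K 3 x *ᵥ v = 𝒯.g x u → 𝒯.K 3 xs *ᵥ vs = 𝒯.g xs us + 𝒯.M 3 xs *ᵥ dv →
      𝒯.NH (v - vs) ≤ C * (𝒯.NH (x - xs) + 𝒯.NH (u - us) +
        dv ⬝ᵥ (𝒯.M 3 xs * (𝒯.K 3 xs)⁻¹ * 𝒯.M 3 xs) *ᵥ dv) := by
  obtain ⟨c, hc, C, hC, hest⟩ := exists_velocity_estimate L hμ
  obtain ⟨CK, hCK, hKle⟩ := exists_inner_kV_self_le L hμ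
  set ε := c / (2 * CK)
  have hε : 0 < ε := by positivity
  refine ⟨(C + ε⁻¹) * (2 / c), by positivity, fun {Γ k} 𝒯 hk hh x v xs vs dv u us hx hxs hvs hus hu hv hvss => ?_⟩
  have gx : 𝒯.Good x := fun P ξ hξ => goodJets_subset hμ (hx P ξ hξ)
  have gxs : 𝒯.Good xs := fun P ξ hξ => goodJets_subset hμ (hxs P ξ hξ)
  set z := v - vs
  have hK := isUnit_det_K (d := 3) hh hk gxs hμ (fun P ξ hξ => (hxs P ξ hξ).1) (fun P ξ hξ => (hxs P ξ hξ).2)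
  have h1 := two_mul_dotProduct_M_le hh gxs hK (-z) dv hε
  have h2 : (-z) ⬝ᵥ 𝒯.K 3 xs *ᵥ (-z) ≤ CK * 𝒯.NH z := by
    rw [Matrix.mulVec_neg, neg_dotProduct_neg, dotProduct_K hh gxs, NH, ← SI_const_mul]
    exact SI_mono (fun P => gxs.continuousOn_inner contDiffOn_kV z z P)
      (fun P => (continuous_const.mul (continuous_normSq_jet z P)).continuousOn)
      fun P ξ hξ => hKle _ (hxs P ξ hξ) _
  -- the tested difference of the two velocity equations
  have h3 : z ⬝ᵥ 𝒯.K 3 x *ᵥ z = z ⬝ᵥ 𝒯.g x u - z ⬝ᵥ 𝒯.g xs us - z ⬝ᵥ 𝒯.M 3 xs *ᵥ dv -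
      (z ⬝ᵥ 𝒯.K 3 x *ᵥ vs - z ⬝ᵥ 𝒯.K 3 xs *ᵥ vs) := by
    have : 𝒯.K 3 x *ᵥ z = 𝒯.g x u - 𝒯.K 3 x *ᵥ vs := by rw [Matrix.mulVec_sub, hv]
    rw [this, hvss, dotProduct_sub, dotProduct_add]; ring
  rw [dotProduct_K hh gx, dotProduct_K hh gx, dotProduct_K hh gxs, dotProduct_g hh gx, dotProduct_g hh gxs] at h3
  have k1 := fun P => gx.continuousOn_inner contDiffOn_kV z z P
  have k2 := fun P => gx.continuousOn_inner contDiffOn_gV u z P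
  have k3 := fun P => gxs.continuousOn_inner contDiffOn_gV us z P
  have k4 := fun P => gx.continuousOn_inner contDiffOn_kV vs z P
  have k5 := fun P => gxs.continuousOn_inner contDiffOn_kV vs z P
  have h4 := sum_SI_nonpos (𝒯 := 𝒯)
    [(c, fun P ξ => ‖𝒯.jet z P ξ‖ ^ 2),
     (2, fun P ξ => inner ℝ (gV (𝒯.jet x P ξ) (𝒯.jet u P ξ)) (𝒯.jet z P ξ)),
     (-2, fun P ξ => inner ℝ (gV (𝒯.jet xs P ξ) (𝒯.jet us P ξ)) (𝒯.jet z P ξ)),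
     (-2, fun P ξ => inner ℝ (kV (𝒯.jet x P ξ) (𝒯.jet vs P ξ)) (𝒯.jet z P ξ)),
     (2, fun P ξ => inner ℝ (kV (𝒯.jet xs P ξ) (𝒯.jet vs P ξ)) (𝒯.jet z P ξ)),
     (-2, fun P ξ => inner ℝ (kV (𝒯.jet x P ξ) (𝒯.jet z P ξ)) (𝒯.jet z P ξ)),
     (-C, fun P ξ => ‖𝒯.jet (x - xs) P ξ‖ ^ 2),
     (-C, fun P ξ => ‖𝒯.jet (u - us) P ξ‖ ^ 2)]
    (by
      simp only [List.forall_mem_cons, List.not_mem_nil, false_imp_iff, implies_true, and_true]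
      exact ⟨fun P => (continuous_normSq_jet z P).continuousOn, k2, k3, k4, k5, k1,
        fun P => (continuous_normSq_jet _ P).continuousOn, fun P => (continuous_normSq_jet _ P).continuousOn⟩)
    (fun P ξ hξ => by
      simp only [List.map_cons, List.map_nil, List.sum_cons, List.sum_nil]
      have := hest _ (hx P ξ hξ) _ (hxs P ξ hξ) _ (𝒯.jet z P ξ) _ _ (hvs P ξ hξ) (hu P ξ hξ) (hus P ξ hξ)
      rw [← jet_sub, ← jet_sub] at this
      linarith)
  simp only [List.map_cons, List.map_nil, List.sum_cons, List.sum_nil] at h4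
  change c * 𝒯.NH z + (_ + (_ + (_ + (_ + (_ + (-C * 𝒯.NH (x - xs) + (-C * 𝒯.NH (u - us) + 0))))))) ≤ 0 at h4
  rw [neg_dotProduct] at h1
  set Dv := dv ⬝ᵥ (𝒯.M 3 xs * (𝒯.K 3 xs)⁻¹ * 𝒯.M 3 xs) *ᵥ dv
  have hDv : 0 ≤ Dv := by
    have h0 := two_mul_dotProduct_M_le hh gxs hK 0 dv one_pos
    simp only [zero_dotProduct, mul_zero, inv_one, one_mul, zero_add] at h0
    exact h0
  have h5 : c * 𝒯.NH z ≤ C * (𝒯.NH (x - xs) + 𝒯.NH (u - us)) + ε * (CK * 𝒯.NH z) + ε⁻¹ * Dv := by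
    have := mul_le_mul_of_nonneg_left h2 hε.le
    linarith
  have h6 : ε * (CK * 𝒯.NH z) = c / 2 * 𝒯.NH z := by simp only [ε]; field_simp
  have n1 := NH_nonneg (𝒯 := 𝒯) (x - xs)
  have n2 := NH_nonneg (𝒯 := 𝒯) (u - us)
  have h7 : c / 2 * 𝒯.NH z ≤ (C + ε⁻¹) * (𝒯.NH (x - xs) + 𝒯.NH (u - us) + Dv) := by
    have : 0 ≤ ε⁻¹ * (𝒯.NH (x - xs) + 𝒯.NH (u - us)) := by positivity
    have : 0 ≤ C * Dv := by positivity
    linarith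
  calc 𝒯.NH z = 2 / c * (c / 2 * 𝒯.NH z) := by field_simp
    _ ≤ 2 / c * ((C + ε⁻¹) * (𝒯.NH (x - xs) + 𝒯.NH (u - us) + Dv)) := by gcongr
    _ = _ := by ring

end Triangulation

/-! ### The energy estimate -/

/-- Gronwall's inequality, with a derivative on the open interval only and an integrable right-hand
side. -/
lemma gronwall_integral {Ψ Ψ' φ : ℝ → ℝ} {C D τ : ℝ} (hτ : 0 ≤ τ) (hC : 0 ≤ C) (hD : 0 ≤ D)
    (hcont : ContinuousOn Ψ (Icc 0 τ)) (hder : ∀ t ∈ Ioo 0 τ, HasDerivAt Ψ (Ψ' t) t)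
    (hle : ∀ t ∈ Ioo 0 τ, Ψ' t ≤ C * (Ψ t + D + φ t)) (hφ : IntegrableOn φ (Icc 0 τ))
    (hφ0 : ∀ t ∈ Ioo 0 τ, 0 ≤ φ t) :
    Ψ τ ≤ Real.exp (C * τ) * (Ψ 0 + C * (τ * D + ∫ s in (0 : ℝ)..τ, φ s)) := by
  have hexp : ∀ t, HasDerivAt (fun s => Real.exp (-(C * s))) (Real.exp (-(C * t)) * -C) t := fun t => by
    simpa using ((hasDerivAt_id t).const_mul C).neg.exp
  have h1 := intervalIntegral.sub_le_integral_of_hasDeriv_right_of_le (a := 0) (b := τ)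
    (g := fun t => Real.exp (-(C * t)) * Ψ t)
    (g' := fun t => Real.exp (-(C * t)) * -C * Ψ t + Real.exp (-(C * t)) * Ψ' t)
    (φ := fun t => C * (D + φ t)) hτ
    (ContinuousOn.mul (by fun_prop) hcont)
    (fun t ht => ((hexp t).mul (hder t ht)).hasDerivWithinAt)
    ((((integrableOn_const (by simp)).add hφ).const_mul C))
    (fun t ht => by
      have e0 := Real.exp_pos (-(C * t))
      have e1 : Real.exp (-(C * t)) ≤ 1 := Real.exp_le_one_iff.2 (by
        have := ht.1.le
        have : 0 ≤ C * t := by positivity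
        linarith)
      have e2 := mul_le_mul_of_nonneg_left (hle t ht) e0.le
      have e3 : 0 ≤ C * (D + φ t) := by have := hφ0 t ht; positivity
      have e4 := mul_le_mul_of_nonneg_right e1 e3
      linarith)
  have hφi : IntervalIntegrable φ volume 0 τ := (intervalIntegrable_iff_integrableOn_Icc_of_le hτ).2 hφ
  rw [intervalIntegral.integral_const_mul, intervalIntegral.integral_add (by simp) hφi,
    intervalIntegral.integral_const] at h1
  simp only [mul_zero, neg_zero, Real.exp_zero, one_mul, sub_zero, smul_eq_mul] at h1
  have h2 : Ψ τ = Real.exp (C * τ) * (Real.exp (-(C * τ)) * Ψ τ) := by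
    rw [← mul_assoc, ← Real.exp_add]; simp
  rw [h2]
  exact mul_le_mul_of_nonneg_left (by linarith) (Real.exp_pos _).le

namespace Triangulation

/-- The energy of the errors. -/
def energy {Γ : Set E3} {k : ℕ} (𝒯 : Triangulation Γ k) (Λ₁ Λ₂ : ℝ) (x xs : Fin 3 × Fin 𝒯.N → ℝ)
    (u us : Fin 4 × Fin 𝒯.N → ℝ) : ℝ :=
  𝒯.SI fun P ξ => energyDensity Λ₁ Λ₂ (𝒯.jet x P ξ) (𝒯.jet xs P ξ) (𝒯.jet us P ξ) (𝒯.jet (u - us) P ξ)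

set_option maxHeartbeats 1000000 in
/-- The derivative of the energy is bounded by the errors and the defects. -/
lemma exists_energy_deriv_le (L : ℝ) {μ Λ₁ Λ₂ : ℝ} (hμ : 0 < μ) (hΛ₁ : 0 ≤ Λ₁) (hΛ₂ : 0 ≤ Λ₂) : ∃ C, 0 < C ∧
    ∀ {Γ : Set E3} {k : ℕ} (𝒯 : Triangulation Γ k), 0 < 𝒯.h →
    ∀ (x xs : ℝ → Fin 3 × Fin 𝒯.N → ℝ) (u us : ℝ → Fin 4 × Fin 𝒯.N → ℝ) (v vs : Fin 3 × Fin 𝒯.N → ℝ)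
      (u' us' du : Fin 4 × Fin 𝒯.N → ℝ) (t : ℝ),
      HasDerivAt x v t → HasDerivAt xs vs t → HasDerivAt u u' t → HasDerivAt us us' t →
      (∀ P, ∀ ξ ∈ refTriangle, 𝒯.jet (x t) P ξ ∈ goodJets L μ) →
      (∀ P, ∀ ξ ∈ refTriangle, 𝒯.jet (xs t) P ξ ∈ goodJets L μ) →
      (∀ P, ∀ ξ ∈ refTriangle, ‖𝒯.jet vs P ξ‖ ≤ L) → (∀ P, ∀ ξ ∈ refTriangle, ‖𝒯.jet (us t) P ξ‖ ≤ L) →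
      (∀ P, ∀ ξ ∈ refTriangle, ‖𝒯.jet (u t) P ξ‖ ≤ L) → (∀ P, ∀ ξ ∈ refTriangle, ‖𝒯.jet us' P ξ‖ ≤ L) →
      (∀ P, ∀ ξ ∈ refTriangle, ‖𝒯.jet (u t - us t) P ξ‖ ≤ 1) →
      𝒯.M 4 (x t) *ᵥ u' + 𝒯.A 4 (x t) *ᵥ u t = 𝒯.f (x t) (u t) →
      𝒯.M 4 (xs t) *ᵥ us' + 𝒯.A 4 (xs t) *ᵥ us t = 𝒯.f (xs t) (us t) + 𝒯.M 4 (xs t) *ᵥ du →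
      ∃ Ψ', HasDerivAt (fun s => 𝒯.energy Λ₁ Λ₂ (x s) (xs s) (u s) (us s)) Ψ' t ∧
        Ψ' ≤ C * (𝒯.NH (x t - xs t) + 𝒯.NH (u t - us t) + 𝒯.NH (v - vs) + du ⬝ᵥ 𝒯.M 4 (xs t) *ᵥ du) := by
  obtain ⟨ε, hε, C, hC, hrate⟩ := exists_energyRate_le L hμ hΛ₁ hΛ₂
  refine ⟨C + ε⁻¹, by positivity, fun {Γ k} 𝒯 hh x xs u us v vs u' us' du t dx dxs du' dus hx hxs hvs hus hu
    hus' he hgeo hgeos => ?_⟩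
  have gx : 𝒯.Good (x t) := fun P ξ hξ => goodJets_subset hμ (hx P ξ hξ)
  have gxs : 𝒯.Good (xs t) := fun P ξ hξ => goodJets_subset hμ (hxs P ξ hξ)
  set z := u' - us' with hz
  have hO : IsOpen {p : (Jet 3 × Jet 3) × (Jet 4 × Jet 4) | 0 < dd p.1.1 ∧ 0 < dd p.1.2} :=
    (isOpen_dd_pos.preimage continuous_fst.fst).inter (isOpen_dd_pos.preimage continuous_fst.snd)
  obtain ⟨hder, hcont⟩ := hasDerivAt_SI (𝒯 := 𝒯)
    (Lam := fun P ξ => ((𝒯.jetL 3 P ξ).prodMap (𝒯.jetL 3 P ξ)).prodMap ((𝒯.jetL 4 P ξ).prodMap (𝒯.jetL 4 P ξ)))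
    (fun P => by
      refine continuous_clm_apply.2 fun w => ?_
      exact ((𝒯.continuous_jet_right _ P).prodMk (𝒯.continuous_jet_right _ P)).prodMk
        ((𝒯.continuous_jet_right _ P).prodMk (𝒯.continuous_jet_right _ P)))
    hO (contDiffOn_energyDensity Λ₁ Λ₂)
    (z := fun s => ((x s, xs s), (us s, u s - us s))) ((dx.prodMk dxs).prodMk (dus.prodMk (du'.sub dus)))
    (fun P ξ hξ => ⟨gx P ξ hξ, gxs P ξ hξ⟩)
    (g' := fun P ξ => energyRate Λ₁ Λ₂ (𝒯.jet (x t) P ξ) (𝒯.jet (xs t) P ξ) (𝒯.jet v P ξ) (𝒯.jet vs P ξ)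
      (𝒯.jet (us t) P ξ) (𝒯.jet (u t - us t) P ξ) (𝒯.jet us' P ξ) (𝒯.jet z P ξ) +
      (2 * aB (coef (𝒯.jet (x t) P ξ)) (𝒯.jet (u t - us t) P ξ) (𝒯.jet z P ξ) +
        2 * aB (coef (𝒯.jet (x t) P ξ) - coef (𝒯.jet (xs t) P ξ)) (𝒯.jet (us t) P ξ) (𝒯.jet z P ξ)))
    (fun P ξ hξ => hasDerivAt_energyDensity Λ₁ Λ₂ (hasDerivAt_jet dx P ξ) (hasDerivAt_jet dxs P ξ)
      (hasDerivAt_jet dus P ξ) (hasDerivAt_jet (du'.sub dus) P ξ) (gx P ξ hξ) (gxs P ξ hξ))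
  refine ⟨_, hder, ?_⟩
  -- the tested difference of the two equations
  have h3 : z ⬝ᵥ 𝒯.M 4 (x t) *ᵥ z + z ⬝ᵥ 𝒯.A 4 (x t) *ᵥ (u t - us t) + z ⬝ᵥ 𝒯.A 4 (x t) *ᵥ us t
      - z ⬝ᵥ 𝒯.A 4 (xs t) *ᵥ us t = z ⬝ᵥ 𝒯.f (x t) (u t) - z ⬝ᵥ 𝒯.f (xs t) (us t) - z ⬝ᵥ 𝒯.M 4 (x t) *ᵥ us'
      + z ⬝ᵥ 𝒯.M 4 (xs t) *ᵥ us' - z ⬝ᵥ 𝒯.M 4 (xs t) *ᵥ du := by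
    have e1 := congrArg (z ⬝ᵥ ·) hgeo
    have e2 := congrArg (z ⬝ᵥ ·) hgeos
    simp only [dotProduct_add] at e1 e2
    have e3 : z ⬝ᵥ 𝒯.M 4 (x t) *ᵥ z = z ⬝ᵥ 𝒯.M 4 (x t) *ᵥ u' - z ⬝ᵥ 𝒯.M 4 (x t) *ᵥ us' := by
      conv_lhs => rw [hz]
      rw [← hz, Matrix.mulVec_sub, dotProduct_sub]
    rw [e3, Matrix.mulVec_sub, dotProduct_sub]
    linarith
  have h1 := two_mul_dotProduct_M_le' hh gxs (-z) du hε
  rw [Matrix.mulVec_neg, neg_dotProduct_neg, neg_dotProduct, dotProduct_M hh gxs z z] at h1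
  rw [dotProduct_M hh gx, dotProduct_M hh gx, dotProduct_M hh gxs z us', dotProduct_A hh gx, dotProduct_A hh gx,
    dotProduct_A hh gxs, dotProduct_f hh gx, dotProduct_f hh gxs] at h3
  have h4 := sum_SI_nonpos (𝒯 := 𝒯)
    [(1, _),
     (-2, fun P ξ => inner ℝ (aV (𝒯.jet (x t) P ξ) (𝒯.jet (u t - us t) P ξ)) (𝒯.jet z P ξ)),
     (-2, fun P ξ => inner ℝ (aV (𝒯.jet (x t) P ξ) (𝒯.jet (us t) P ξ)) (𝒯.jet z P ξ)),
     (2, fun P ξ => inner ℝ (aV (𝒯.jet (xs t) P ξ) (𝒯.jet (us t) P ξ)) (𝒯.jet z P ξ)),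
     (-2, fun P ξ => inner ℝ (mV (𝒯.jet (x t) P ξ) (𝒯.jet z P ξ)) (𝒯.jet z P ξ)),
     (2, fun P ξ => inner ℝ (fV (𝒯.jet (x t) P ξ) (𝒯.jet (u t) P ξ)) (𝒯.jet z P ξ)),
     (-2, fun P ξ => inner ℝ (fV (𝒯.jet (xs t) P ξ) (𝒯.jet (us t) P ξ)) (𝒯.jet z P ξ)),
     (-2, fun P ξ => inner ℝ (mV (𝒯.jet (x t) P ξ) (𝒯.jet us' P ξ)) (𝒯.jet z P ξ)),
     (2, fun P ξ => inner ℝ (mV (𝒯.jet (xs t) P ξ) (𝒯.jet us' P ξ)) (𝒯.jet z P ξ)),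
     (ε, fun P ξ => inner ℝ (mV (𝒯.jet (xs t) P ξ) (𝒯.jet z P ξ)) (𝒯.jet z P ξ)),
     (-C, fun P ξ => ‖𝒯.jet (x t - xs t) P ξ‖ ^ 2),
     (-C, fun P ξ => ‖𝒯.jet (u t - us t) P ξ‖ ^ 2),
     (-C, fun P ξ => ‖𝒯.jet (v - vs) P ξ‖ ^ 2)]
    (by
      simp only [List.forall_mem_cons, List.not_mem_nil, false_imp_iff, implies_true, and_true]
      exact ⟨hcont, gx.continuousOn_inner contDiffOn_aV _ _, gx.continuousOn_inner contDiffOn_aV _ _,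
        gxs.continuousOn_inner contDiffOn_aV _ _, gx.continuousOn_inner contDiffOn_mV _ _,
        gx.continuousOn_inner contDiffOn_fV _ _, gxs.continuousOn_inner contDiffOn_fV _ _,
        gx.continuousOn_inner contDiffOn_mV _ _, gxs.continuousOn_inner contDiffOn_mV _ _,
        gxs.continuousOn_inner contDiffOn_mV _ _,
        fun P => (continuous_normSq_jet _ P).continuousOn, fun P => (continuous_normSq_jet _ P).continuousOn,
        fun P => (continuous_normSq_jet _ P).continuousOn⟩)
    (fun P ξ hξ => by
      simp only [List.map_cons, List.map_nil, List.sum_cons, List.sum_nil]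
      have := hrate _ (hx P ξ hξ) _ (hxs P ξ hξ) (𝒯.jet v P ξ) _ _ _ _ (𝒯.jet z P ξ) (hvs P ξ hξ) (hu P ξ hξ)
        (hus P ξ hξ) (hus' P ξ hξ) (by rw [← jet_sub]; exact he P ξ hξ)
      rw [← jet_sub, ← jet_sub, ← jet_sub] at this
      rw [aB_sub, ← inner_aV_eq_aB, ← inner_aV_eq_aB, ← inner_aV_eq_aB]
      linarith)
  simp only [List.map_cons, List.map_nil, List.sum_cons, List.sum_nil] at h4
  change 1 * _ + (_ + (_ + (_ + (_ + (_ + (_ + (_ + (_ + (_ + (-C * 𝒯.NH (x t - xs t) +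
    (-C * 𝒯.NH (u t - us t) + (-C * 𝒯.NH (v - vs) + 0)))))))))))) ≤ 0 at h4
  have n1 := NH_nonneg (𝒯 := 𝒯) (x t - xs t)
  have n2 := NH_nonneg (𝒯 := 𝒯) (u t - us t)
  have n3 := NH_nonneg (𝒯 := 𝒯) (v - vs)
  have n4 := dotProduct_M_self_nonneg hh gxs du
  have n5 : 0 ≤ ε⁻¹ * (𝒯.NH (x t - xs t) + 𝒯.NH (u t - us t) + 𝒯.NH (v - vs)) := by positivity
  have n6 : 0 ≤ C * (du ⬝ᵥ 𝒯.M 4 (xs t) *ᵥ du) := by positivity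
  linarith

end Triangulation

/-! ### Stability -/

/-- A continuity argument: a continuous function which is below `η` as long as it is at most `η` stays
below `η`. -/
lemma lt_of_bootstrap {q : ℝ → ℝ} {S η : ℝ} (hq : ContinuousOn q (Icc 0 S)) (h0 : q 0 < η)
    (h : ∀ t ∈ Icc 0 S, (∀ s ∈ Icc 0 t, q s ≤ η) → q t < η) : ∀ t ∈ Icc 0 S, q t < η := by
  by_contra! hcon
  obtain ⟨t₁, ht₁, hqt₁⟩ := hcon
  have hB : IsCompact (Icc 0 S ∩ q ⁻¹' Ici η) :=
    isCompact_Icc.of_isClosed_subset (hq.preimage_isClosed_of_isClosed isClosed_Icc isClosed_Ici)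
      inter_subset_left
  obtain ⟨τ, ⟨hτ, hqτ⟩, hmin⟩ := hB.exists_isLeast ⟨t₁, ht₁, hqt₁⟩
  have hsub : Icc 0 τ ⊆ Icc 0 S := Icc_subset_Icc_right hτ.2
  obtain ⟨s, hs, hqs⟩ := intermediate_value_Icc hτ.1 (hq.mono hsub) ⟨h0.le, hqτ⟩
  have hsτ : s = τ := le_antisymm hs.2 (hmin ⟨hsub hs, hqs.ge⟩)
  refine (h τ hτ fun s' hs' => ?_).not_ge hqτ
  by_contra! hlt
  have := hmin ⟨hsub hs', hlt.le⟩
  have h1 : s' = τ := le_antisymm hs'.2 this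
  rw [h1, ← hsτ, hqs] at hlt
  exact lt_irrefl _ hlt

namespace Triangulation

variable {Γ : Set E3} {k : ℕ} {𝒯 : Triangulation Γ k}

lemma isUnit_det_M (hh : 0 < 𝒯.h) (hk : 1 ≤ k) {x : Fin 3 × Fin 𝒯.N → ℝ} (hx : 𝒯.Good x) {d : ℕ} {μ : ℝ}
    (hμ : 0 < μ) (hμx : ∀ P, ∀ ξ ∈ refTriangle, μ ≤ dd (𝒯.jet x P ξ)) : IsUnit (𝒯.M d x).det := by
  by_contra hdet
  rw [isUnit_iff_ne_zero, not_not] at hdet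
  obtain ⟨v, hv, hv0⟩ := Matrix.exists_mulVec_eq_zero_iff.2 hdet
  refine hv ?_
  have h1 : √μ * 𝒯.N0 v ≤ 0 := by
    have h0 : v ⬝ᵥ 𝒯.M d x *ᵥ v = 0 := by rw [hv0, dotProduct_zero]
    rw [dotProduct_M hh hx] at h0
    rw [N0, ← SI_const_mul, ← h0]
    refine SI_mono (fun P => (continuous_const.mul (continuous_vsq_jet v P)).continuousOn)
      (fun P => hx.continuousOn_inner (contDiffOn_mV (d := d)) v v P) fun P ξ hξ => ?_
    rw [inner_mV_self]
    exact mul_le_mul_of_nonneg_right (Real.sqrt_le_sqrt (hμx P ξ hξ)) (vsq_nonneg _)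
  have h2 : 𝒯.N0 v = 0 := by
    have := N0_nonneg (𝒯 := 𝒯) v
    have := Real.sqrt_pos.2 hμ
    nlinarith
  rw [N0, SI, mul_eq_zero, or_iff_right (by positivity),
    Finset.sum_eq_zero_iff_of_nonneg fun P _ =>
      setIntegral_nonneg measurableSet_refTriangle fun _ _ => vsq_nonneg _] at h2
  ext ⟨ℓ, j⟩
  obtain ⟨P, α, rfl⟩ := 𝒯.loc_surjective j
  have h3 := eq_zero_of_setIntegral_refTriangle_eq_zero (continuous_vsq_jet v P) (fun _ => vsq_nonneg _)
    (h2 P (Finset.mem_univ _)) _ (refNode_mem hk α)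
  rw [vsq, Finset.sum_eq_zero_iff_of_nonneg fun _ _ => sq_nonneg _] at h3
  have h4 := pow_eq_zero_iff (two_ne_zero) |>.1 (h3 ℓ (Finset.mem_univ _))
  rwa [jet_eq, mkJet_zero, lag_refNode hk] at h4

lemma continuousOn_SI_inner {K : Set ℝ} (hK : IsCompact K) {d e : ℕ} {V : Jet 3 → Jet d → Jet e}
    (hV : ContDiffOn ℝ ∞ (fun p : Jet 3 × Jet d => V p.1 p.2) (goodPairs d))
    {x : ℝ → Fin 3 × Fin 𝒯.N → ℝ} {w : ℝ → Fin d × Fin 𝒯.N → ℝ} (hx : ContinuousOn x K) (hw : ContinuousOn w K)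
    (hgood : ∀ t ∈ K, 𝒯.Good (x t)) (z : Fin e × Fin 𝒯.N → ℝ) :
    ContinuousOn (fun s => 𝒯.SI fun P ξ => inner ℝ (V (𝒯.jet (x s) P ξ) (𝒯.jet (w s) P ξ)) (𝒯.jet z P ξ)) K := by
  refine continuousOn_SI hK fun P => ContinuousOn.inner (𝕜 := ℝ) ?_ ?_
  · exact hV.continuousOn.comp (f := fun p : ℝ × Plane => (𝒯.jet (x p.1) P p.2, 𝒯.jet (w p.1) P p.2))
      ((continuousOn_jet hx P).prodMk (continuousOn_jet hw P)) fun p hp => hgood p.1 hp.1 P p.2 hp.2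
  · exact ((𝒯.continuous_jet_right z P).comp continuous_snd).continuousOn

/-- Reference data for the stability estimate: nodal vectors of positions, velocities and geometry with
bounded jets, which satisfy the semi-discrete equations up to defects. -/
structure IsReference (𝒯 : Triangulation Γ k) (L μ T : ℝ) (xs vs : ℝ → Fin 3 × Fin 𝒯.N → ℝ)
    (us us' : ℝ → Fin 4 × Fin 𝒯.N → ℝ) (dv : ℝ → Fin 3 × Fin 𝒯.N → ℝ) (du : ℝ → Fin 4 × Fin 𝒯.N → ℝ) :
    Prop where
  jet_xs : ∀ t ∈ Icc 0 T, ∀ P, ∀ ξ ∈ refTriangle, 𝒯.jet (xs t) P ξ ∈ goodJets L μ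
  jet_vs : ∀ t ∈ Icc 0 T, ∀ P, ∀ ξ ∈ refTriangle, ‖𝒯.jet (vs t) P ξ‖ ≤ L
  jet_us : ∀ t ∈ Icc 0 T, ∀ P, ∀ ξ ∈ refTriangle, ‖𝒯.jet (us t) P ξ‖ ≤ L
  jet_us' : ∀ t ∈ Ioo 0 T, ∀ P, ∀ ξ ∈ refTriangle, ‖𝒯.jet (us' t) P ξ‖ ≤ L
  continuousOn_xs : ContinuousOn xs (Icc 0 T)
  continuousOn_us : ContinuousOn us (Icc 0 T)
  hasDerivAt_xs : ∀ t ∈ Ioo 0 T, HasDerivAt xs (vs t) t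
  hasDerivAt_us : ∀ t ∈ Ioo 0 T, HasDerivAt us (us' t) t
  velocity : ∀ t ∈ Icc 0 T, 𝒯.K 3 (xs t) *ᵥ vs t = 𝒯.g (xs t) (us t) + 𝒯.M 3 (xs t) *ᵥ dv t
  geometry : ∀ t ∈ Ioo 0 T, 𝒯.M 4 (xs t) *ᵥ us' t + 𝒯.A 4 (xs t) *ᵥ us t =
    𝒯.f (xs t) (us t) + 𝒯.M 4 (xs t) *ᵥ du t

variable {L μ T : ℝ} {xs vs : ℝ → Fin 3 × Fin 𝒯.N → ℝ} {us us' : ℝ → Fin 4 × Fin 𝒯.N → ℝ}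
  {dv : ℝ → Fin 3 × Fin 𝒯.N → ℝ} {du : ℝ → Fin 4 × Fin 𝒯.N → ℝ}

/-- The defect is determined by the reference data, so that its norm is measurable; hence it is
integrable if it is bounded. -/
lemma IsReference.integrableOn_defect (hh : 0 < 𝒯.h) (hk : 1 ≤ k) (hμ : 0 < μ)
    (H : 𝒯.IsReference L μ T xs vs us us' dv du) {B : ℝ}
    (hB : ∀ t ∈ Icc 0 T, du t ⬝ᵥ 𝒯.M 4 (xs t) *ᵥ du t ≤ B) :
    IntegrableOn (fun t => du t ⬝ᵥ 𝒯.M 4 (xs t) *ᵥ du t) (Icc 0 T) := by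
  have hgood : ∀ t ∈ Icc 0 T, 𝒯.Good (xs t) := fun t ht P ξ hξ => goodJets_subset hμ (H.jet_xs t ht P ξ hξ)
  have hsub : Ioo 0 T ⊆ Icc 0 T := Ioo_subset_Icc_self
  have hunit : ∀ t ∈ Icc 0 T, IsUnit (𝒯.M 4 (xs t)).det := fun t ht =>
    isUnit_det_M hh hk (hgood t ht) hμ fun P ξ hξ => (H.jet_xs t ht P ξ hξ).2
  -- the entries of a vector are its products with unit vectors
  have hent : ∀ (d : ℕ) (V : Fin d × Fin 𝒯.N → ℝ) q, V q = Pi.single q 1 ⬝ᵥ V := by simp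
  have hM : ContinuousOn (fun t => 𝒯.M 4 (xs t)) (Icc 0 T) := by
    refine continuousOn_pi.2 fun q => continuousOn_pi.2 fun q' => ?_
    refine (continuousOn_SI_inner isCompact_Icc (contDiffOn_mV (d := 4)) H.continuousOn_xs
      (continuousOn_const (c := Pi.single q' 1)) hgood (Pi.single q 1)).congr fun t ht => ?_
    beta_reduce
    rw [← dotProduct_M hh (hgood t ht)]
    simp
  have hMi : ContinuousOn (fun t => (𝒯.M 4 (xs t))⁻¹) (Icc 0 T) := by
    simp only [Matrix.inv_def, Ring.inverse_eq_inv']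
    refine ContinuousOn.smul (f := fun t => (𝒯.M 4 (xs t)).det⁻¹) (g := fun t => (𝒯.M 4 (xs t)).adjugate)
      (ContinuousOn.inv₀ ?_ fun t ht => ?_) ?_
    · exact (Continuous.matrix_det continuous_id).comp_continuousOn hM
    · exact (hunit t ht).ne_zero
    · exact (Continuous.matrix_adjugate continuous_id).comp_continuousOn hM
  set ν := volume.restrict (Ioo 0 T)
  have hcont : ∀ {g : ℝ → ℝ}, ContinuousOn g (Icc 0 T) → AEMeasurable g ν := fun {g} hg =>
    (hg.mono hsub).aemeasurable measurableSet_Ioo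
  have hus' : ∀ q, AEMeasurable (fun t => us' t q) ν := fun q => by
    refine ((measurable_pi_apply q).comp (measurable_deriv us)).aemeasurable.congr ?_
    filter_upwards [ae_restrict_mem measurableSet_Ioo] with t ht
    rw [Function.comp_apply, (H.hasDerivAt_us t ht).deriv]
  set r : ℝ → Fin 4 × Fin 𝒯.N → ℝ := fun t =>
    𝒯.M 4 (xs t) *ᵥ us' t + 𝒯.A 4 (xs t) *ᵥ us t - 𝒯.f (xs t) (us t)
  have hr : ∀ q, AEMeasurable (fun t => r t q) ν := fun q => by
    refine (AEMeasurable.add ?_ (hcont ?_)).sub (hcont ?_)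
    · exact Finset.aemeasurable_fun_sum Finset.univ (f := fun q' t => 𝒯.M 4 (xs t) q q' * us' t q') fun q' _ =>
        (hcont (continuousOn_pi.1 (continuousOn_pi.1 hM q) q')).mul (hus' q')
    · refine (continuousOn_SI_inner isCompact_Icc (contDiffOn_aV (d := 4)) H.continuousOn_xs H.continuousOn_us
        hgood (Pi.single q 1)).congr fun t ht => ?_
      beta_reduce
      rw [← dotProduct_A hh (hgood t ht), ← hent]
    · refine (continuousOn_SI_inner isCompact_Icc contDiffOn_fV H.continuousOn_xs H.continuousOn_us
        hgood (Pi.single q 1)).congr fun t ht => ?_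
      beta_reduce
      rw [← dotProduct_f hh (hgood t ht), ← hent]
  have hq : AEMeasurable (fun t => du t ⬝ᵥ 𝒯.M 4 (xs t) *ᵥ du t) ν := by
    have h1 : AEMeasurable (fun t => ((𝒯.M 4 (xs t))⁻¹ *ᵥ r t) ⬝ᵥ r t) ν :=
      Finset.aemeasurable_fun_sum Finset.univ (f := fun q t => ((𝒯.M 4 (xs t))⁻¹ *ᵥ r t) q * r t q)
        fun q _ => AEMeasurable.mul
        (Finset.aemeasurable_fun_sum Finset.univ (f := fun q' t => (𝒯.M 4 (xs t))⁻¹ q q' * r t q') fun q' _ =>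
          (hcont (continuousOn_pi.1 (continuousOn_pi.1 hMi q) q')).mul (hr q')) (hr q)
    refine h1.congr ?_
    filter_upwards [ae_restrict_mem measurableSet_Ioo] with t ht
    have h2 : r t = 𝒯.M 4 (xs t) *ᵥ du t := by
      simp only [r, H.geometry t ht]; abel
    rw [h2, Matrix.mulVec_mulVec, Matrix.nonsing_inv_mul _ (hunit t (hsub ht)),
      Matrix.one_mulVec]
  rw [integrableOn_Icc_iff_integrableOn_Ioo]
  refine Integrable.of_bound (μ := ν) hq.aestronglyMeasurable B ?_
  filter_upwards [ae_restrict_mem measurableSet_Ioo] with t ht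
  rw [Real.norm_of_nonneg (dotProduct_M_self_nonneg hh (hgood t (hsub ht)) _)]
  exact hB t (hsub ht)

end Triangulation

/-! ### Norms of errors and continuation in time -/

namespace Triangulation

lemma exists_inner_kV_bounds (L : ℝ) {μ : ℝ} (hμ : 0 < μ) : ∃ c > 0, ∃ C > 0, ∀ {Γ : Set E3} {k : ℕ}
    (𝒯 : Triangulation Γ k), 0 < 𝒯.h → ∀ x : Fin 3 × Fin 𝒯.N → ℝ,
    (∀ P, ∀ ξ ∈ refTriangle, 𝒯.jet x P ξ ∈ goodJets L μ) → ∀ {d : ℕ} (w : Fin d × Fin 𝒯.N → ℝ),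
      c * 𝒯.NH w ≤ w ⬝ᵥ 𝒯.K d x *ᵥ w ∧ w ⬝ᵥ 𝒯.K d x *ᵥ w ≤ C * 𝒯.NH w := by
  obtain ⟨c, hc, hcoer⟩ := exists_le_inner_kV_self L hμ
  obtain ⟨C, hC, hle⟩ := exists_inner_kV_self_le L hμ
  refine ⟨c, hc, C, hC, fun {Γ k} 𝒯 hh x hx d w => ?_⟩
  have gx : 𝒯.Good x := fun P ξ hξ => goodJets_subset hμ (hx P ξ hξ)
  refine ⟨le_dotProduct_K_self hh gx fun P ξ hξ => hcoer _ _ (hx P ξ hξ).1 (hx P ξ hξ).2, ?_⟩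
  rw [dotProduct_K hh gx, NH, ← SI_const_mul]
  exact SI_mono (fun P => gx.continuousOn_inner contDiffOn_kV w w P)
    (fun P => (continuous_const.mul (continuous_normSq_jet w P)).continuousOn)
    fun P ξ hξ => hle _ (hx P ξ hξ) _

lemma exists_energy_equiv (L : ℝ) {μ : ℝ} (hμ : 0 < μ) : ∃ Λ₁ Λ₂, 0 ≤ Λ₁ ∧ 0 ≤ Λ₂ ∧ ∃ c > 0, ∃ C > 0,
    ∀ {Γ : Set E3} {k : ℕ} (𝒯 : Triangulation Γ k) (x xs : Fin 3 × Fin 𝒯.N → ℝ) (u us : Fin 4 × Fin 𝒯.N → ℝ),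
      (∀ P, ∀ ξ ∈ refTriangle, 𝒯.jet x P ξ ∈ goodJets L μ) →
      (∀ P, ∀ ξ ∈ refTriangle, 𝒯.jet xs P ξ ∈ goodJets L μ) →
      (∀ P, ∀ ξ ∈ refTriangle, ‖𝒯.jet us P ξ‖ ≤ L) →
      c * (𝒯.NH (x - xs) + 𝒯.NH (u - us)) ≤ 𝒯.energy Λ₁ Λ₂ x xs u us ∧
      𝒯.energy Λ₁ Λ₂ x xs u us ≤ C * (𝒯.NH (x - xs) + 𝒯.NH (u - us)) := by
  obtain ⟨Λ₁, Λ₂, h1, h2, c, hc, C, hC, h⟩ := exists_energyDensity_equiv L hμ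
  refine ⟨Λ₁, Λ₂, h1, h2, c, hc, C, hC, fun {Γ k} 𝒯 x xs u us hx hxs hus => ?_⟩
  have hcont : ∀ P, ContinuousOn (fun ξ => energyDensity Λ₁ Λ₂ (𝒯.jet x P ξ) (𝒯.jet xs P ξ) (𝒯.jet us P ξ)
      (𝒯.jet (u - us) P ξ)) refTriangle := fun P =>
    (contDiffOn_energyDensity Λ₁ Λ₂).continuousOn.comp
      (f := fun ξ => ((𝒯.jet x P ξ, 𝒯.jet xs P ξ), (𝒯.jet us P ξ, 𝒯.jet (u - us) P ξ)))
      (((𝒯.continuous_jet_right _ P).prodMk (𝒯.continuous_jet_right _ P)).prodMk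
        ((𝒯.continuous_jet_right _ P).prodMk (𝒯.continuous_jet_right _ P))).continuousOn
      fun ξ hξ => ⟨goodJets_subset hμ (hx P ξ hξ), goodJets_subset hμ (hxs P ξ hξ)⟩
  have hc0 : ∀ a P, ContinuousOn (fun ξ => a * (‖𝒯.jet (x - xs) P ξ‖ ^ 2 + ‖𝒯.jet (u - us) P ξ‖ ^ 2)) refTriangle :=
    fun a P => (continuous_const.mul ((continuous_normSq_jet _ P).add (continuous_normSq_jet _ P))).continuousOn
  have he : ∀ a, a * (𝒯.NH (x - xs) + 𝒯.NH (u - us)) =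
      𝒯.SI fun P ξ => a * (‖𝒯.jet (x - xs) P ξ‖ ^ 2 + ‖𝒯.jet (u - us) P ξ‖ ^ 2) := fun a => by
    rw [SI_const_mul, SI_add (fun P => (continuous_normSq_jet _ P).continuousOn)
      (fun P => (continuous_normSq_jet _ P).continuousOn)]; rfl
  rw [he, he]
  refine ⟨SI_mono (hc0 c) hcont fun P ξ hξ => ?_, SI_mono hcont (hc0 C) fun P ξ hξ => ?_⟩
  · rw [jet_sub 𝒯 x]; exact (h _ (hx P ξ hξ) _ (hxs P ξ hξ) _ _ (hus P ξ hξ)).1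
  · rw [jet_sub 𝒯 x]; exact (h _ (hx P ξ hξ) _ (hxs P ξ hξ) _ _ (hus P ξ hξ)).2

/-- The energy estimate, as long as the errors are small in the maximum norm. -/
lemma exists_error_bound (k : ℕ) (hk : 1 ≤ k) (L : ℝ) {μ T : ℝ} (hμ : 0 < μ) (hT : 0 < T) : ∃ δ > 0, δ ≤ 1 ∧ ∃ C > 0,
    ∀ {Γ : Set E3} (𝒯 : Triangulation Γ k), 0 < 𝒯.h →
    ∀ (xs vs dv : ℝ → Fin 3 × Fin 𝒯.N → ℝ) (us us' du : ℝ → Fin 4 × Fin 𝒯.N → ℝ),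
      𝒯.IsReference L μ T xs vs us us' dv du →
    ∀ (S : ℝ) (x v : ℝ → Fin 3 × Fin 𝒯.N → ℝ) (u : ℝ → Fin 4 × Fin 𝒯.N → ℝ), S ≤ T →
      𝒯.IsSemidiscreteSolution S x v u → x 0 = xs 0 →
      IntegrableOn (fun t => du t ⬝ᵥ 𝒯.M 4 (xs t) *ᵥ du t) (Icc 0 T) →
    ∀ t ∈ Icc 0 S,
      (∀ s ∈ Icc 0 t, ∀ P, ∀ ξ ∈ refTriangle, ‖𝒯.jet (x s - xs s) P ξ‖ ≤ δ ∧ ‖𝒯.jet (u s - us s) P ξ‖ ≤ δ) →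
    ∀ D, (∀ s ∈ Icc 0 t, dv s ⬝ᵥ (𝒯.M 3 (xs s) * (𝒯.K 3 (xs s))⁻¹ * 𝒯.M 3 (xs s)) *ᵥ dv s ≤ D) →
      𝒯.NH (x t - xs t) + 𝒯.NH (u t - us t) + 𝒯.NH (v t - vs t) ≤
        C * (𝒯.NH (u 0 - us 0) + D + ∫ s in (0 : ℝ)..t, du s ⬝ᵥ 𝒯.M 4 (xs s) *ᵥ du s) := by
  obtain ⟨δ, hδ, hδ1, hpert⟩ := exists_goodJets_perturbation L hμ
  have hμ2 : 0 < μ / 2 := by positivity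
  obtain ⟨Λ₁, Λ₂, hΛ₁, hΛ₂, c, hc, Cd, hCd, hequiv⟩ := exists_energy_equiv (L + 1) hμ2
  obtain ⟨CV, hCV, hvel⟩ := exists_NH_velocity_le (L + 1) hμ2
  obtain ⟨CE, hCE, hen⟩ := exists_energy_deriv_le (L + 1) hμ2 hΛ₁ hΛ₂
  set CG := CE * (1 + CV) * (1 / c + 1)
  have hCG : 0 < CG := by positivity
  set C₁ := Real.exp (CG * T) * (Cd + CG * T + CG) / c
  have hC₁ : 0 < C₁ := by positivity
  refine ⟨δ, hδ, hδ1, (1 + CV) * C₁ + CV, by positivity, ?_⟩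
  intro Γ 𝒯 hh xs vs dv us us' du H S x v u hST hsol h0 hint t ht hsmall D hD
  have hgs : goodJets L μ ⊆ goodJets (L + 1) (μ / 2) := goodJets_mono (by linarith) (by linarith)
  have htT : t ≤ T := ht.2.trans hST
  have hsubT : Icc 0 t ⊆ Icc 0 T := Icc_subset_Icc_right htT
  have hsubS : Icc 0 t ⊆ Icc 0 S := Icc_subset_Icc_right ht.2
  have hxs : ∀ s ∈ Icc 0 t, ∀ P, ∀ ξ ∈ refTriangle, 𝒯.jet (xs s) P ξ ∈ goodJets (L + 1) (μ / 2) :=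
    fun s hs P ξ hξ => hgs (H.jet_xs s (hsubT hs) P ξ hξ)
  have hx : ∀ s ∈ Icc 0 t, ∀ P, ∀ ξ ∈ refTriangle, 𝒯.jet (x s) P ξ ∈ goodJets (L + 1) (μ / 2) :=
    fun s hs P ξ hξ => hpert _ _ (H.jet_xs s (hsubT hs) P ξ hξ) (by
      rw [← jet_sub]; exact (hsmall s hs P ξ hξ).1)
  have hvs : ∀ s ∈ Icc 0 t, ∀ P, ∀ ξ ∈ refTriangle, ‖𝒯.jet (vs s) P ξ‖ ≤ L + 1 :=
    fun s hs P ξ hξ => (H.jet_vs s (hsubT hs) P ξ hξ).trans (by linarith)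
  have hus : ∀ s ∈ Icc 0 t, ∀ P, ∀ ξ ∈ refTriangle, ‖𝒯.jet (us s) P ξ‖ ≤ L + 1 :=
    fun s hs P ξ hξ => (H.jet_us s (hsubT hs) P ξ hξ).trans (by linarith)
  have he1 : ∀ s ∈ Icc 0 t, ∀ P, ∀ ξ ∈ refTriangle, ‖𝒯.jet (u s - us s) P ξ‖ ≤ 1 :=
    fun s hs P ξ hξ => (hsmall s hs P ξ hξ).2.trans hδ1
  have hu : ∀ s ∈ Icc 0 t, ∀ P, ∀ ξ ∈ refTriangle, ‖𝒯.jet (u s) P ξ‖ ≤ L + 1 := fun s hs P ξ hξ => by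
    have h1 := norm_le_norm_add_norm_sub (𝒯.jet (us s) P ξ) (𝒯.jet (u s) P ξ)
    rw [norm_sub_rev, ← jet_sub] at h1
    linarith [H.jet_us s (hsubT hs) P ξ hξ, he1 s hs P ξ hξ]
  have hcx : ContinuousOn x (Icc 0 S) := fun s hs => (hsol.position s hs).continuousWithinAt
  have hcu : ContinuousOn u (Icc 0 S) := fun s hs => by
    obtain ⟨u', hu', -⟩ := hsol.geometry s hs
    exact hu'.continuousWithinAt
  -- the velocity error
  have hve : ∀ s ∈ Icc 0 t, 𝒯.NH (v s - vs s) ≤ CV * (𝒯.NH (x s - xs s) + 𝒯.NH (u s - us s) + D) := by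
    intro s hs
    refine (hvel 𝒯 hk hh (x s) (v s) (xs s) (vs s) (dv s) (u s) (us s) (hx s hs) (hxs s hs) (hvs s hs) (hus s hs)
      (hu s hs) (hsol.velocity s (hsubS hs)) (H.velocity s (hsubT hs))).trans ?_
    have := hD s hs
    gcongr
  have hD0 : 0 ≤ D := by
    have hz : (0 : ℝ) ∈ Icc 0 t := ⟨le_rfl, ht.1⟩
    have gxs : 𝒯.Good (xs 0) := fun P ξ hξ => goodJets_subset hμ2 (hxs 0 hz P ξ hξ)
    have h1 := two_mul_dotProduct_M_le hh gxs (isUnit_det_K (d := 3) hh hk gxs hμ2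
      (fun P ξ hξ => (hxs 0 hz P ξ hξ).1) (fun P ξ hξ => (hxs 0 hz P ξ hξ).2)) 0 (dv 0) one_pos
    simp only [zero_dotProduct, mul_zero, inv_one, one_mul, zero_add] at h1
    exact h1.trans (hD 0 hz)
  have hφ0 : ∀ s ∈ Icc 0 t, 0 ≤ du s ⬝ᵥ 𝒯.M 4 (xs s) *ᵥ du s := fun s hs =>
    dotProduct_M_self_nonneg hh (fun P ξ hξ => goodJets_subset hμ2 (hxs s hs P ξ hξ)) _
  -- the derivative of the energy
  have hder : ∀ s ∈ Ioo 0 t, ∃ Ψ', HasDerivAt (fun s => 𝒯.energy Λ₁ Λ₂ (x s) (xs s) (u s) (us s)) Ψ' s ∧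
      Ψ' ≤ CG * (𝒯.energy Λ₁ Λ₂ (x s) (xs s) (u s) (us s) + D + du s ⬝ᵥ 𝒯.M 4 (xs s) *ᵥ du s) := by
    intro s hs
    have hs' : s ∈ Icc 0 t := Ioo_subset_Icc_self hs
    have hsT : s ∈ Ioo 0 T := ⟨hs.1, hs.2.trans_le htT⟩
    have hnhds : Icc 0 S ∈ 𝓝 s := Icc_mem_nhds hs.1 (hs.2.trans_le ht.2)
    obtain ⟨u', hu', hgeo⟩ := hsol.geometry s (hsubS hs')
    obtain ⟨Ψ', h1, h2⟩ := hen 𝒯 hh x xs u us (v s) (vs s) u' (us' s) (du s) s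
      ((hsol.position s (hsubS hs')).hasDerivAt hnhds) (H.hasDerivAt_xs s hsT) (hu'.hasDerivAt hnhds)
      (H.hasDerivAt_us s hsT) (hx s hs') (hxs s hs') (hvs s hs') (hus s hs') (hu s hs')
      (fun P ξ hξ => (H.jet_us' s hsT P ξ hξ).trans (by linarith)) (he1 s hs') hgeo (H.geometry s hsT)
    refine ⟨Ψ', h1, h2.trans ?_⟩
    have h3 := (hequiv 𝒯 (x s) (xs s) (u s) (us s) (hx s hs') (hxs s hs') (hus s hs')).1
    have h4 := hve s hs'
    have h5 := hφ0 s hs'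
    have n1 := NH_nonneg (𝒯 := 𝒯) (x s - xs s)
    have n2 := NH_nonneg (𝒯 := 𝒯) (u s - us s)
    set q := 𝒯.NH (x s - xs s) + 𝒯.NH (u s - us s)
    set Ψ := 𝒯.energy Λ₁ Λ₂ (x s) (xs s) (u s) (us s)
    set φ := du s ⬝ᵥ 𝒯.M 4 (xs s) *ᵥ du s
    have hq0 : 0 ≤ q := add_nonneg n1 n2
    have hΨ0 : 0 ≤ Ψ := le_trans (by positivity) h3
    have h6 : q ≤ 1 / c * Ψ := by
      rw [one_div_mul_eq_div, le_div_iff₀ hc]; linarith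
    calc CE * (q + 𝒯.NH (v s - vs s) + φ) ≤ CE * (q + CV * (q + D) + φ) := by gcongr
      _ ≤ CE * ((1 + CV) * (q + D + φ)) := by
          have : 0 ≤ D + CV * φ := by positivity
          gcongr
          linarith
      _ ≤ CE * ((1 + CV) * ((1 / c + 1) * (Ψ + D + φ))) := by
          have : 0 ≤ 1 / c * (D + φ) := by positivity
          gcongr
          linarith
      _ = CG * (Ψ + D + φ) := by simp only [CG]; ring
  have hcont : ContinuousOn (fun s => 𝒯.energy Λ₁ Λ₂ (x s) (xs s) (u s) (us s)) (Icc 0 t) := by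
    refine continuousOn_SI isCompact_Icc fun P => ?_
    have c1 := continuousOn_jet (hcx.mono hsubS) P
    have c2 := continuousOn_jet (H.continuousOn_xs.mono hsubT) P
    have c3 := continuousOn_jet (H.continuousOn_us.mono hsubT) P
    have c4 := continuousOn_jet ((hcu.mono hsubS).sub (H.continuousOn_us.mono hsubT)) P
    exact (contDiffOn_energyDensity Λ₁ Λ₂).continuousOn.comp
      (f := fun p : ℝ × Plane => ((𝒯.jet (x p.1) P p.2, 𝒯.jet (xs p.1) P p.2),
        (𝒯.jet (us p.1) P p.2, 𝒯.jet (u p.1 - us p.1) P p.2)))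
      ((c1.prodMk c2).prodMk (c3.prodMk c4))
      fun p hp => ⟨goodJets_subset hμ2 (hx _ hp.1 P _ hp.2), goodJets_subset hμ2 (hxs _ hp.1 P _ hp.2)⟩
  choose! Ψ' hΨ1 hΨ2 using hder
  have hg := gronwall_integral ht.1 hCG.le hD0 hcont hΨ1 hΨ2 (hint.mono_set hsubT)
    fun s hs => hφ0 s (Ioo_subset_Icc_self hs)
  have hz : (0 : ℝ) ∈ Icc 0 t := ⟨le_rfl, ht.1⟩
  have htt : t ∈ Icc 0 t := ⟨ht.1, le_rfl⟩
  have e0 := (hequiv 𝒯 (x 0) (xs 0) (u 0) (us 0) (hx 0 hz) (hxs 0 hz) (hus 0 hz)).2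
  have et := (hequiv 𝒯 (x t) (xs t) (u t) (us t) (hx t htt) (hxs t htt) (hus t htt)).1
  have hNH0 : 𝒯.NH (x 0 - xs 0) = 0 := by
    rw [h0, sub_self, NH]
    have : ∀ P ξ, 𝒯.jet (0 : Fin 3 × Fin 𝒯.N → ℝ) P ξ = 0 := fun P ξ => map_zero (𝒯.jetL 3 P ξ)
    simp [this, SI]
  rw [hNH0, zero_add] at e0
  have hI0 : 0 ≤ ∫ s in (0 : ℝ)..t, du s ⬝ᵥ 𝒯.M 4 (xs s) *ᵥ du s :=
    intervalIntegral.integral_nonneg ht.1 hφ0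
  have n0 := NH_nonneg (𝒯 := 𝒯) (u 0 - us 0)
  have hv := hve t htt
  set I := ∫ s in (0 : ℝ)..t, du s ⬝ᵥ 𝒯.M 4 (xs s) *ᵥ du s
  set q := 𝒯.NH (x t - xs t) + 𝒯.NH (u t - us t)
  set q0 := 𝒯.NH (u 0 - us 0)
  have hmain : c * q ≤ Real.exp (CG * T) * ((Cd + CG * T + CG) * (q0 + D + I)) := by
    refine (et.trans hg).trans ?_
    have ht0 := ht.1
    have hrest : 0 ≤ 𝒯.energy Λ₁ Λ₂ (x 0) (xs 0) (u 0) (us 0) + CG * (t * D + I) := by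
      have := (hequiv 𝒯 (x 0) (xs 0) (u 0) (us 0) (hx 0 hz) (hxs 0 hz) (hus 0 hz)).1
      rw [hNH0, zero_add] at this
      have : 0 ≤ c * q0 := by positivity
      have : 0 ≤ CG * (t * D + I) := by positivity
      linarith
    refine mul_le_mul (Real.exp_le_exp.2 (by gcongr)) ?_ hrest (Real.exp_pos _).le
    have k1 : CG * (t * D) ≤ CG * (T * D) := by gcongr
    have k2 : 0 ≤ (CG * T + CG) * q0 := by positivity
    have k3 : 0 ≤ (Cd + CG) * D := by positivity
    have k4 : 0 ≤ (Cd + CG * T) * I := by positivity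
    linarith
  have hq : q ≤ C₁ * (q0 + D + I) := by
    have : C₁ * (q0 + D + I) = (Real.exp (CG * T) * ((Cd + CG * T + CG) * (q0 + D + I))) / c := by
      simp only [C₁]; ring
    rw [this, le_div_iff₀ hc]; linarith
  have k5 : CV * D ≤ CV * (q0 + D + I) := by gcongr; linarith
  have k6 := mul_le_mul_of_nonneg_left hq (by positivity : 0 ≤ 1 + CV)
  linarith

/-- Stability: if the initial error and the defects are small compared with the square of the mesh size,
then the errors are bounded by the initial error and the defects. -/
theorem exists_stability_bound (k : ℕ) (hk : 1 ≤ k) (L : ℝ) {μ T : ℝ} (hμ : 0 < μ) (hT : 0 < T) : ∃ C > 0, ∃ b > 0,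
    ∀ {Γ : Set E3} (𝒯 : Triangulation Γ k), 0 < 𝒯.h →
    ∀ (xs vs dv : ℝ → Fin 3 × Fin 𝒯.N → ℝ) (us us' du : ℝ → Fin 4 × Fin 𝒯.N → ℝ),
      𝒯.IsReference L μ T xs vs us us' dv du →
    ∀ G, G ≤ b * 𝒯.h ^ 2 →
      (∀ t ∈ Icc 0 T, dv t ⬝ᵥ (𝒯.M 3 (xs t) * (𝒯.K 3 (xs t))⁻¹ * 𝒯.M 3 (xs t)) *ᵥ dv t ≤ G) →
      (∀ t ∈ Icc 0 T, du t ⬝ᵥ 𝒯.M 4 (xs t) *ᵥ du t ≤ G) →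
    ∀ (S : ℝ) (x v : ℝ → Fin 3 × Fin 𝒯.N → ℝ) (u : ℝ → Fin 4 × Fin 𝒯.N → ℝ), S ≤ T →
      𝒯.IsSemidiscreteSolution S x v u → x 0 = xs 0 →
      (u 0 - us 0) ⬝ᵥ 𝒯.K 4 (xs 0) *ᵥ (u 0 - us 0) ≤ G →
    ∀ t ∈ Icc 0 S, ∀ D,
      (∀ s ∈ Icc 0 t, dv s ⬝ᵥ (𝒯.M 3 (xs s) * (𝒯.K 3 (xs s))⁻¹ * 𝒯.M 3 (xs s)) *ᵥ dv s ≤ D) →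
      (x t - xs t) ⬝ᵥ 𝒯.K 3 (xs t) *ᵥ (x t - xs t) + (v t - vs t) ⬝ᵥ 𝒯.K 3 (xs t) *ᵥ (v t - vs t) +
        (u t - us t) ⬝ᵥ 𝒯.K 4 (xs t) *ᵥ (u t - us t) ≤
      C * ((u 0 - us 0) ⬝ᵥ 𝒯.K 4 (xs 0) *ᵥ (u 0 - us 0) + D +
        ∫ s in (0 : ℝ)..t, du s ⬝ᵥ 𝒯.M 4 (xs s) *ᵥ du s) := by
  obtain ⟨δ, hδ, hδ1, C₁, hC₁, herr⟩ := exists_error_bound k hk L hμ hT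
  obtain ⟨c, hc, CK, hCK, hK⟩ := exists_inner_kV_bounds L hμ
  obtain ⟨I₃, hI₃, hinv₃⟩ := exists_inverse_estimate_jet hk 3
  obtain ⟨I₄, hI₄, hinv₄⟩ := exists_inverse_estimate_jet hk 4
  set B := (C₁ + 1) * (1 / c + 1 + T)
  have hB : 0 < B := by positivity
  refine ⟨CK * (C₁ * (1 / c + 1)), by positivity, δ ^ 2 / (2 * (I₃ + I₄) * B), by positivity, ?_⟩
  intro Γ 𝒯 hh xs vs dv us us' du H G hG hdv hdu S x v u hST hsol h0 hu0 t ht D hD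
  have hint := H.integrableOn_defect hh hk hμ hdu
  set η := δ ^ 2 * 𝒯.h ^ 2 / (I₃ + I₄)
  have hη : 0 < η := by positivity
  have hS0 : (0 : ℝ) ≤ S := ht.1.trans ht.2
  have h0T : (0 : ℝ) ∈ Icc 0 T := ⟨le_rfl, hT.le⟩
  have hBG : B * G ≤ η / 2 := by
    calc B * G ≤ B * (δ ^ 2 / (2 * (I₃ + I₄) * B) * 𝒯.h ^ 2) := by gcongr
      _ = η / 2 := by simp only [η]; field_simp
  have hcx : ContinuousOn x (Icc 0 S) := fun s hs => (hsol.position s hs).continuousWithinAt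
  have hcu : ContinuousOn u (Icc 0 S) := fun s hs => by
    obtain ⟨u', hu', -⟩ := hsol.geometry s hs
    exact hu'.continuousWithinAt
  have hsub : Icc 0 S ⊆ Icc 0 T := Icc_subset_Icc_right hST
  have hxs0 := H.jet_xs 0 h0T
  have hNu0 : 𝒯.NH (u 0 - us 0) ≤ 1 / c * ((u 0 - us 0) ⬝ᵥ 𝒯.K 4 (xs 0) *ᵥ (u 0 - us 0)) := by
    rw [one_div_mul_eq_div, le_div_iff₀ hc, mul_comm]
    exact (hK 𝒯 hh (xs 0) hxs0 _).1
  have hG0 : 0 ≤ G := (dotProduct_M_self_nonneg hh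
    (fun P ξ hξ => goodJets_subset hμ (hxs0 P ξ hξ)) (du 0)).trans (hdu 0 h0T)
  have hNH0 : 𝒯.NH (x 0 - xs 0) = 0 := by
    rw [h0, sub_self, NH]
    have : ∀ P ξ, 𝒯.jet (0 : Fin 3 × Fin 𝒯.N → ℝ) P ξ = 0 := fun P ξ => map_zero (𝒯.jetL 3 P ξ)
    simp [this, SI]
  -- the maximum norm of the errors is controlled by the inverse estimate
  have hsmall : ∀ s, 𝒯.NH (x s - xs s) + 𝒯.NH (u s - us s) ≤ η → ∀ P, ∀ ξ ∈ refTriangle,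
      ‖𝒯.jet (x s - xs s) P ξ‖ ≤ δ ∧ ‖𝒯.jet (u s - us s) P ξ‖ ≤ δ := by
    intro s hs P ξ hξ
    have n1 := NH_nonneg (𝒯 := 𝒯) (x s - xs s)
    have n2 := NH_nonneg (𝒯 := 𝒯) (u s - us s)
    have key : ∀ {I N J : ℝ}, 0 < I → I ≤ I₃ + I₄ → N ≤ η → 0 ≤ J → 𝒯.h ^ 2 * J ^ 2 ≤ I * N → J ≤ δ := by
      intro I N J hI hI' hN hJ hle
      have h1 : I * N ≤ δ ^ 2 * 𝒯.h ^ 2 := by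
        calc I * N ≤ (I₃ + I₄) * η := by
              refine (mul_le_mul_of_nonneg_left hN hI.le).trans ?_
              gcongr
          _ = _ := by simp only [η]; field_simp
      have h2 : (𝒯.h * J) ^ 2 ≤ (𝒯.h * δ) ^ 2 := by rw [mul_pow, mul_pow]; linarith
      have h3 := abs_le_of_sq_le_sq h2 (by positivity)
      have h4 := (abs_le.1 h3).2
      exact le_of_mul_le_mul_left (by linarith) hh
    exact ⟨key hI₃ (by linarith) (by linarith) (norm_nonneg _) (hinv₃ 𝒯 hh _ P ξ hξ),
      key hI₄ (by linarith) (by linarith) (norm_nonneg _) (hinv₄ 𝒯 hh _ P ξ hξ)⟩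
  have hboot : ∀ s ∈ Icc 0 S, 𝒯.NH (x s - xs s) + 𝒯.NH (u s - us s) < η := by
    refine lt_of_bootstrap ?_ ?_ fun s hs hle => ?_
    · exact (continuousOn_NH isCompact_Icc (hcx.sub (H.continuousOn_xs.mono hsub))).add
        (continuousOn_NH isCompact_Icc (hcu.sub (H.continuousOn_us.mono hsub)))
    · rw [hNH0, zero_add]
      have h1 : 1 / c * ((u 0 - us 0) ⬝ᵥ 𝒯.K 4 (xs 0) *ᵥ (u 0 - us 0)) ≤ 1 / c * G := by gcongr
      have h2 : 1 / c * G ≤ B * G := by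
        have : 1 / c ≤ B := by
          have : 0 ≤ C₁ * (1 / c + 1 + T) + (1 + T) := by positivity
          simp only [B]; linarith
        gcongr
      linarith
    · have h1 := herr 𝒯 hh xs vs dv us us' du H S x v u hST hsol h0 hint s hs
        (fun r hr => hsmall r (hle r hr)) G
        (fun r hr => hdv r ⟨hr.1, (hr.2.trans hs.2).trans hST⟩)
      have n3 := NH_nonneg (𝒯 := 𝒯) (v s - vs s)
      have hsT : s ≤ T := hs.2.trans hST
      have hI : ∫ r in (0 : ℝ)..s, du r ⬝ᵥ 𝒯.M 4 (xs r) *ᵥ du r ≤ T * G := by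
        have hii : IntervalIntegrable (fun r => du r ⬝ᵥ 𝒯.M 4 (xs r) *ᵥ du r) volume 0 s :=
          (intervalIntegrable_iff_integrableOn_Icc_of_le hs.1).2
            (hint.mono_set (Icc_subset_Icc_right hsT))
        have := intervalIntegral.integral_mono_on hs.1 hii (intervalIntegrable_const (c := G))
          fun r hr => hdu r ⟨hr.1, hr.2.trans hsT⟩
        rw [intervalIntegral.integral_const, smul_eq_mul, sub_zero] at this
        exact this.trans (by gcongr)
      have h2 : 𝒯.NH (u 0 - us 0) ≤ 1 / c * G := hNu0.trans (by gcongr)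
      have h3 : C₁ * (𝒯.NH (u 0 - us 0) + G + ∫ r in (0 : ℝ)..s, du r ⬝ᵥ 𝒯.M 4 (xs r) *ᵥ du r) ≤
          C₁ * ((1 / c + 1 + T) * G) := by gcongr; linarith
      have h4 : C₁ * ((1 / c + 1 + T) * G) ≤ B * G := by
        have : 0 ≤ (1 / c + 1 + T) * G := by positivity
        simp only [B]; linarith
      linarith
  have hfin := herr 𝒯 hh xs vs dv us us' du H S x v u hST hsol h0 hint t ht
    (fun r hr => hsmall r (hboot r ⟨hr.1, hr.2.trans ht.2⟩).le) D hD
  have htT : t ∈ Icc 0 T := hsub ht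
  have b1 := (hK 𝒯 hh (xs t) (H.jet_xs t htT) (x t - xs t)).2
  have b2 := (hK 𝒯 hh (xs t) (H.jet_xs t htT) (v t - vs t)).2
  have b3 := (hK 𝒯 hh (xs t) (H.jet_xs t htT) (u t - us t)).2
  have hgood : ∀ s ∈ Icc 0 t, 𝒯.Good (xs s) := fun s hs P ξ hξ =>
    goodJets_subset hμ (H.jet_xs s ⟨hs.1, hs.2.trans htT.2⟩ P ξ hξ)
  have hI0 : 0 ≤ ∫ s in (0 : ℝ)..t, du s ⬝ᵥ 𝒯.M 4 (xs s) *ᵥ du s :=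
    intervalIntegral.integral_nonneg ht.1 fun s hs => dotProduct_M_self_nonneg hh (hgood s hs) _
  have hD0 : 0 ≤ D := by
    have hz : (0 : ℝ) ∈ Icc 0 t := ⟨le_rfl, ht.1⟩
    have h1 := two_mul_dotProduct_M_le hh (hgood 0 hz) (isUnit_det_K (d := 3) hh hk (hgood 0 hz) hμ
      (fun P ξ hξ => (hxs0 P ξ hξ).1) (fun P ξ hξ => (hxs0 P ξ hξ).2)) 0 (dv 0) one_pos
    simp only [zero_dotProduct, mul_zero, inv_one, one_mul, zero_add] at h1
    exact h1.trans (hD 0 hz)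
  have hE0 := dotProduct_K_self_nonneg hh (hgood 0 ⟨le_rfl, ht.1⟩) (u 0 - us 0)
  set E0 := (u 0 - us 0) ⬝ᵥ 𝒯.K 4 (xs 0) *ᵥ (u 0 - us 0)
  set I := ∫ s in (0 : ℝ)..t, du s ⬝ᵥ 𝒯.M 4 (xs s) *ᵥ du s
  have k1 : 𝒯.NH (u 0 - us 0) + D + I ≤ (1 / c + 1) * (E0 + D + I) := by
    have : 0 ≤ 1 / c * (D + I) := by positivity
    linarith
  have k2 := mul_le_mul_of_nonneg_left (hfin.trans (mul_le_mul_of_nonneg_left k1 hC₁.le)) hCK.le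
  linarith

end Triangulation

/-! ### The nearest point map of a smooth closed surface -/

lemma nearestPoint_spec {Γ : Set E3} (hc : IsCompact Γ) (hn : Γ.Nonempty) (x : E3) :
    nearestPoint Γ x ∈ Γ ∧ dist x (nearestPoint Γ x) = Metric.infDist x Γ := by
  obtain ⟨y, hy, h⟩ := hc.exists_infDist_eq_dist hn x
  exact Classical.epsilon_spec (p := fun y => y ∈ Γ ∧ dist x y = Metric.infDist x Γ) ⟨y, hy, h.symm⟩

lemma nearestPoint_mem {Γ : Set E3} (hc : IsCompact Γ) (hn : Γ.Nonempty) (x : E3) : nearestPoint Γ x ∈ Γ :=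
  (nearestPoint_spec hc hn x).1

lemma dist_nearestPoint_le {Γ : Set E3} (hc : IsCompact Γ) {q : E3} (hq : q ∈ Γ) (x : E3) :
    dist x (nearestPoint Γ x) ≤ dist x q :=
  (nearestPoint_spec hc ⟨q, hq⟩ x).2 ▸ Metric.infDist_le_dist_of_mem hq

lemma nearestPoint_of_mem {Γ : Set E3} (hc : IsCompact Γ) {p : E3} (hp : p ∈ Γ) : nearestPoint Γ p = p := by
  have h := dist_nearestPoint_le hc hp p
  rw [dist_self] at h
  exact (dist_le_zero.1 h).symm

/-- On a surface, the squared distance to `y` is critical at the nearest point. -/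
lemma exists_multiplier_nearestPoint {Γ U : Set E3} (hc : IsCompact Γ) (hn : Γ.Nonempty) {φ : E3 → ℝ}
    (hU : IsOpen U) (hφ : ContDiffOn ℝ 1 φ U) (hΓU : Γ ∩ U = {y ∈ U | φ y = 0}) {y : E3}
    (hq : nearestPoint Γ y ∈ U) (hne : fderiv ℝ φ (nearestPoint Γ y) ≠ 0) :
    ∃ a : ℝ, ∀ v, inner ℝ (y - nearestPoint Γ y) v = a * fderiv ℝ φ (nearestPoint Γ y) v := by
  set q := nearestPoint Γ y
  have hqΓ : q ∈ Γ := nearestPoint_mem hc hn y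
  have hφq : φ q = 0 := by
    have : q ∈ {y ∈ U | φ y = 0} := hΓU ▸ ⟨hqΓ, hq⟩
    exact this.2
  have hmin : IsLocalMinOn (fun x => ‖x - y‖ ^ 2) {x | φ x = φ q} q := by
    filter_upwards [inter_mem_nhdsWithin _ (hU.mem_nhds hq)] with x hx
    have hxΓ : x ∈ Γ := by
      have : x ∈ Γ ∩ U := hΓU.symm ▸ ⟨hx.2, by rw [← hφq]; exact hx.1⟩
      exact this.1
    have := dist_nearestPoint_le hc hxΓ y
    rw [dist_comm, dist_comm y x, dist_eq_norm, dist_eq_norm] at this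
    gcongr
  have h1 : HasStrictFDerivAt φ (fderiv ℝ φ q) q :=
    (hφ.contDiffAt (hU.mem_nhds hq)).hasStrictFDerivAt (by simp)
  have h2 : HasStrictFDerivAt (fun x : E3 => ‖x - y‖ ^ 2) (2 • (innerSL ℝ (q - y))) q :=
    (hasStrictFDerivAt_norm_sq (q - y)).comp (f := fun x => x - y) q ((hasStrictFDerivAt_id q).sub_const y)
  obtain ⟨a, b, hab, h⟩ := IsLocalExtrOn.exists_multipliers_of_hasStrictFDerivAt_1d (Or.inl hmin) h1 h2
  have h' : ∀ v, a * fderiv ℝ φ q v + b * (2 * inner ℝ (q - y) v) = 0 := fun v => by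
    have := DFunLike.congr_fun h v
    simpa [inner_sub_left] using this
  have hb : b ≠ 0 := by
    rintro rfl
    have ha : a ≠ 0 := fun ha => hab (by rw [ha]; rfl)
    refine hne (ContinuousLinearMap.ext fun v => ?_)
    have := h' v
    simpa [ha] using this
  refine ⟨a / (2 * b), fun v => ?_⟩
  have h3 := h' v
  rw [← neg_sub y q, inner_neg_left] at h3
  field_simp
  linarith

/-- The nearest point map of a smooth closed surface is smooth near the surface, and its derivative on the
surface is the orthogonal projection onto the tangent plane. It is the first component of a local
inverse of `(q, l) ↦ (q + l ∇φ(q), φ(q))`. -/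
lemma contDiffAt_nearestPoint {Γ : Set E3} (hΓ : IsSmoothClosedSurface Γ) {p : E3} (hp : p ∈ Γ) (n : ℕ) :
    ContDiffAt ℝ n (nearestPoint Γ) p ∧
      ∃ ν : E3, ‖ν‖ = 1 ∧ ∀ v, fderiv ℝ (nearestPoint Γ) p v = v - inner ℝ ν v • ν := by
  obtain ⟨hc, hn, hloc⟩ := hΓ
  obtain ⟨U, φ, hU, hpU, hφ, hφ', hΓU⟩ := hloc p hp
  set m : ℕ := n + 1
  have hm : ((m : ℕ) : WithTop ℕ∞) ≠ 0 := by simp [m]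
  set g : E3 → E3 := fun q => (InnerProductSpace.toDual ℝ E3).symm (fderiv ℝ φ q)
  have hg_inner : ∀ q v, inner ℝ (g q) v = fderiv ℝ φ q v := fun q v => by
    simp [g, InnerProductSpace.toDual_symm_apply]
  have hg0 : ∀ q ∈ U, g q ≠ 0 := fun q hq h => hφ' q hq (by simpa [g] using h)
  have hgc : ContDiffAt ℝ m g p := by
    have h1 : ContDiffOn ℝ m (fderiv ℝ φ) U := (hφ.of_le (m := (m + 1 : ℕ)) (by exact_mod_cast le_top)).fderiv_of_isOpen hU
      (by norm_cast)
    exact ((InnerProductSpace.toDual ℝ E3).symm.toContinuousLinearEquiv.contDiff.contDiffAt).comp p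
      (h1.contDiffAt (hU.mem_nhds hpU))
  have hφp : φ p = 0 := by
    have : p ∈ {y ∈ U | φ y = 0} := hΓU ▸ ⟨hp, hpU⟩
    exact this.2
  set G : E3 × ℝ → E3 × ℝ := fun x => (x.1 + x.2 • g x.1, φ x.1)
  have hG : ContDiffAt ℝ m G (p, 0) := by
    have h1 : ContDiffAt ℝ m (fun x : E3 × ℝ => g x.1) (p, 0) :=
      ContDiffAt.comp (p, (0 : ℝ)) (g := g) (f := Prod.fst) hgc contDiffAt_fst
    have h2 : ContDiffAt ℝ m (fun x : E3 × ℝ => φ x.1) (p, 0) :=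
      ((hφ.of_le (m := (m : ℕ)) (by exact_mod_cast le_top)).contDiffAt (hU.mem_nhds hpU)).comp (p, (0 : ℝ)) contDiffAt_fst
    exact (contDiffAt_fst.add (contDiffAt_snd.smul h1)).prodMk h2
  set D : E3 × ℝ →L[ℝ] E3 × ℝ :=
    (ContinuousLinearMap.fst ℝ E3 ℝ + (ContinuousLinearMap.snd ℝ E3 ℝ).smulRight (g p)).prod
      ((fderiv ℝ φ p).comp (ContinuousLinearMap.fst ℝ E3 ℝ))
  have hD : ∀ v l, D (v, l) = (v + l • g p, inner ℝ (g p) v) := fun v l => by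
    simp [D, hg_inner]
  have hinj : Function.Injective D := by
    rw [injective_iff_map_eq_zero]
    rintro ⟨v, l⟩ h
    rw [hD, Prod.mk_eq_zero] at h
    have h1 : inner ℝ (g p) (v + l • g p) = 0 := by rw [h.1, inner_zero_right]
    rw [inner_add_right, h.2, zero_add, inner_smul_right, mul_eq_zero,
      or_iff_left (inner_self_ne_zero.2 (hg0 p hpU))] at h1
    have h2 := h.1
    rw [h1, zero_smul, add_zero] at h2
    rw [h1, h2]; rfl
  set e : (E3 × ℝ) ≃L[ℝ] (E3 × ℝ) :=
    (LinearEquiv.ofInjectiveEndo D.toLinearMap hinj).toContinuousLinearEquiv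
  have he : ∀ x, e x = D x := fun x => rfl
  have hGD : HasFDerivAt G (e : E3 × ℝ →L[ℝ] E3 × ℝ) (p, 0) := by
    have h1 : HasFDerivAt (fun x : E3 × ℝ => g x.1)
        ((fderiv ℝ g p).comp (ContinuousLinearMap.fst ℝ E3 ℝ)) (p, 0) :=
      HasFDerivAt.comp (p, (0 : ℝ)) (g := g) (f := Prod.fst) (hgc.differentiableAt hm).hasFDerivAt hasFDerivAt_fst
    have h2 : HasFDerivAt (fun x : E3 × ℝ => φ x.1)
        ((fderiv ℝ φ p).comp (ContinuousLinearMap.fst ℝ E3 ℝ)) (p, 0) :=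
      (((hφ.contDiffAt (hU.mem_nhds hpU)).differentiableAt (by simp)).hasFDerivAt).comp
        (p, (0 : ℝ)) hasFDerivAt_fst
    refine ((hasFDerivAt_fst.add (hasFDerivAt_snd.smul h1)).prodMk h2).congr_fderiv ?_
    refine ContinuousLinearMap.ext fun x => ?_
    change _ = D x
    rw [← Prod.mk.eta (p := x), hD]
    simp [hg_inner]
  have hstrict : HasStrictFDerivAt G (e : E3 × ℝ →L[ℝ] E3 × ℝ) (p, 0) := hG.hasStrictFDerivAt' hGD hm
  set I := hG.localInverse hGD hm
  have hGp : G (p, 0) = (p, 0) := by simp [G, hφp]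
  have hI : ContDiffAt ℝ m I (p, 0) := by
    have := hG.to_localInverse hGD hm
    rwa [hGp] at this
  have hleft : ∀ᶠ x in 𝓝 (p, (0 : ℝ)), I (G x) = x := hstrict.eventually_left_inverse
  -- the nearest point of `y` and its multiplier tend to `(p, 0)`
  have htend : Tendsto (nearestPoint Γ) (𝓝 p) (𝓝 p) := by
    rw [tendsto_iff_dist_tendsto_zero]
    have h0 : Tendsto (fun y => 2 * dist y p) (𝓝 p) (𝓝 0) := by
      have h1 : Continuous fun y : E3 => 2 * dist y p := by fun_prop
      have h2 := h1.tendsto p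
      simpa using h2
    refine squeeze_zero (fun _ => dist_nonneg) (fun y => ?_) h0
    have h1 := dist_nearestPoint_le hc hp y
    have h2 := dist_triangle_left (nearestPoint Γ y) p y
    linarith
  have hgt : Tendsto (fun y => g (nearestPoint Γ y)) (𝓝 p) (𝓝 (g p)) :=
    hgc.continuousAt.tendsto.comp htend
  set lam : E3 → ℝ := fun y => inner ℝ (y - nearestPoint Γ y) (g (nearestPoint Γ y)) /
    inner ℝ (g (nearestPoint Γ y)) (g (nearestPoint Γ y))
  have hlam : Tendsto lam (𝓝 p) (𝓝 0) := by
    have h1 : Tendsto lam (𝓝 p) (𝓝 (inner ℝ (p - p) (g p) / inner ℝ (g p) (g p))) :=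
      ((tendsto_id.sub htend).inner (𝕜 := ℝ) hgt).div (hgt.inner (𝕜 := ℝ) hgt)
        (inner_self_ne_zero.2 (hg0 p hpU))
    rwa [sub_self, inner_zero_left, zero_div] at h1
  have hev : ∀ᶠ y in 𝓝 p, nearestPoint Γ y = (I (y, 0)).1 := by
    filter_upwards [(htend.prodMk_nhds hlam).eventually hleft, htend.eventually (hU.mem_nhds hpU)] with y h1 h2
    obtain ⟨a, ha⟩ := exists_multiplier_nearestPoint hc hn hU (hφ.of_le (by simp)) hΓU h2 (hφ' _ h2)
    set q := nearestPoint Γ y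
    have hq : y - q = a • g q := by
      refine ext_inner_right ℝ fun v => ?_
      rw [ha, inner_smul_left, hg_inner]; rfl
    have hla : lam y = a := by
      have h3 : inner ℝ (g q) (g q) ≠ 0 := inner_self_ne_zero.2 (hg0 q h2)
      change inner ℝ (y - q) (g q) / inner ℝ (g q) (g q) = a
      rw [hq, inner_smul_left, conj_trivial, mul_div_assoc, div_self h3, mul_one]
    have hφq : φ q = 0 := by
      have : q ∈ {y ∈ U | φ y = 0} := hΓU ▸ ⟨nearestPoint_mem hc hn y, h2⟩
      exact this.2
    have hGq : G (q, lam y) = (y, 0) := by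
      simp only [G, hla, hφq, ← hq, add_sub_cancel]
    rw [hGq] at h1
    rw [h1]
  have hinl : ContDiffAt ℝ m (fun y : E3 => (I (y, 0)).1) p :=
    (ContDiffAt.comp p (f := fun y : E3 => (y, (0 : ℝ))) (g := I) hI
      (contDiffAt_id.prodMk contDiffAt_const)).fst
  refine ⟨(hinl.congr_of_eventuallyEq hev).of_le (by norm_cast; simp [m]), ?_⟩
  have hId : HasFDerivAt I (e.symm : E3 × ℝ →L[ℝ] E3 × ℝ) (p, 0) := by
    have := hstrict.to_localInverse.hasFDerivAt
    rwa [hGp] at this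
  have hder : HasFDerivAt (nearestPoint Γ) ((ContinuousLinearMap.fst ℝ E3 ℝ).comp
      ((e.symm : E3 × ℝ →L[ℝ] E3 × ℝ).comp (ContinuousLinearMap.inl ℝ E3 ℝ))) p := by
    refine HasFDerivAt.congr_of_eventuallyEq ?_ hev
    have h1 : HasFDerivAt (fun y : E3 => (y, (0 : ℝ))) (ContinuousLinearMap.inl ℝ E3 ℝ) p :=
      hasFDerivAt_prodMk_left p 0
    exact (hasFDerivAt_fst.comp _ (HasFDerivAt.comp p (f := fun y : E3 => (y, (0 : ℝ))) hId h1))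
  refine ⟨‖g p‖⁻¹ • g p, norm_smul_inv_norm (𝕜 := ℝ) (hg0 p hpU), fun v => ?_⟩
  rw [hder.fderiv]
  change (e.symm (v, 0)).1 = _
  obtain ⟨⟨w, l⟩, hw⟩ := e.surjective (v, 0)
  rw [← hw, e.symm_apply_apply]
  rw [he, hD, Prod.mk.injEq] at hw
  have hgp : ‖g p‖ ≠ 0 := norm_ne_zero_iff.2 (hg0 p hpU)
  have h1 : inner ℝ (g p) v = l * ‖g p‖ ^ 2 := by
    rw [← hw.1, inner_add_right, hw.2, inner_smul_right, real_inner_self_eq_norm_sq, zero_add]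
  rw [inner_smul_left, h1, ← hw.1, smul_smul]
  have h2 : (starRingEnd ℝ) ‖g p‖⁻¹ * (l * ‖g p‖ ^ 2) * ‖g p‖⁻¹ = l := by
    simp only [conj_trivial]
    field_simp
  rw [h2, add_sub_cancel_right]

/-- A neighbourhood of a smooth closed surface where the nearest point map is of class `C^n`. -/
lemma exists_isOpen_contDiffOn_nearestPoint {Γ : Set E3} (hΓ : IsSmoothClosedSurface Γ) (n : ℕ) :
    ∃ O, IsOpen O ∧ Γ ⊆ O ∧ ContDiffOn ℝ n (nearestPoint Γ) O := by
  refine ⟨interior {y | ContDiffAt ℝ n (nearestPoint Γ) y}, isOpen_interior, fun p hp => ?_, fun y hy => ?_⟩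
  · rw [mem_interior_iff_mem_nhds]
    exact (contDiffAt_nearestPoint hΓ hp n).1.eventually (by simp)
  · have h : ContDiffAt ℝ n (nearestPoint Γ) y := interior_subset hy
    exact h.contDiffWithinAt

/-! ### Calculus on time slabs -/

/-- The part of `U` with times in `[0, T]`. -/
def slab {E : Type*} (U : Set (E × ℝ)) (T : ℝ) : Set (E × ℝ) := U ∩ univ ×ˢ Icc 0 T

lemma mem_slab {E : Type*} {U : Set (E × ℝ)} {T : ℝ} {x : E × ℝ} : x ∈ slab U T ↔ x ∈ U ∧ x.2 ∈ Icc 0 T := by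
  simp [slab]

lemma slab_mem_nhds {E : Type*} [TopologicalSpace E] {U : Set (E × ℝ)} {T : ℝ} (hU : IsOpen U) {y : E} {t : ℝ} (hy : (y, t) ∈ slab U T) :
    ∀ᶠ y' in 𝓝 y, (y', t) ∈ slab U T := by
  have h1 : ∀ᶠ y' in 𝓝 y, (y', t) ∈ U :=
    (Continuous.prodMk_left t).continuousAt.eventually (hU.mem_nhds (mem_slab.1 hy).1)
  filter_upwards [h1] with y' h
  exact mem_slab.2 ⟨h, (mem_slab.1 hy).2⟩

section Slab

variable {E F : Type*} [NormedAddCommGroup E] [NormedSpace ℝ E] [NormedAddCommGroup F] [NormedSpace ℝ F]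

lemma uniqueDiffOn_slab {U : Set (E × ℝ)} {T : ℝ} (hU : IsOpen U) (hT : 0 < T) : UniqueDiffOn ℝ (slab U T) := by
  rw [slab, inter_comm]
  exact (uniqueDiffOn_univ.prod (uniqueDiffOn_Icc hT)).inter hU

/-- The spatial derivative of a function on a time slab. -/
def dx (f : E × ℝ → F) (S : Set (E × ℝ)) (x : E × ℝ) : E →L[ℝ] F :=
  (fderivWithin ℝ f S x).comp (ContinuousLinearMap.inl ℝ E ℝ)

lemma contDiffOn_dx {f : E × ℝ → F} {U : Set (E × ℝ)} {T : ℝ} (hU : IsOpen U) (hT : 0 < T) {n : ℕ}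
    (hf : ContDiffOn ℝ (n + 1 : ℕ) f (slab U T)) : ContDiffOn ℝ n (dx f (slab U T)) (slab U T) :=
  (hf.fderivWithin (m := n) (uniqueDiffOn_slab hU hT) (by norm_cast)).clm_comp contDiffOn_const

lemma hasFDerivAt_dx {f : E × ℝ → F} {U : Set (E × ℝ)} {T : ℝ} (hU : IsOpen U) {y : E} {t : ℝ}
    (hf : DifferentiableWithinAt ℝ f (slab U T) (y, t)) (hy : (y, t) ∈ slab U T) :
    HasFDerivAt (fun y' => f (y', t)) (dx f (slab U T) (y, t)) y := by
  have h1 : HasFDerivWithinAt (fun y' : E => (y', t)) (ContinuousLinearMap.inl ℝ E ℝ)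
      ((fun y' : E => (y', t)) ⁻¹' slab U T) y := (hasFDerivAt_prodMk_left y t).hasFDerivWithinAt
  have h2 := HasFDerivWithinAt.comp y (g := f) (f := fun y' : E => (y', t)) hf.hasFDerivWithinAt h1
    (mapsTo_preimage _ _)
  exact h2.hasFDerivAt (slab_mem_nhds hU hy)

/-- Functions of class `C¹` on a slab are bounded and Lipschitz on compact subsets. -/
lemma exists_bound_lipschitz_slab {f : E × ℝ → F} {U : Set (E × ℝ)} {T : ℝ} (hU : IsOpen U)
    (hf : ContDiffOn ℝ 1 f (slab U T)) {K : Set (E × ℝ)} (hK : IsCompact K) (hKU : K ⊆ slab U T) :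
    ∃ C, 0 ≤ C ∧ (∀ x ∈ K, ‖f x‖ ≤ C) ∧ ∀ x ∈ K, ∀ y ∈ K, ‖f x - f y‖ ≤ C * ‖x - y‖ :=
  exists_bound_lipschitz hU (convex_univ.prod (convex_Icc 0 T)) hf hK hKU

lemma norm_sub_sub_le_of_lipschitz_deriv {f : E → F} {f' : E → E →L[ℝ] F} {q x : E} {C : ℝ} (hC : 0 ≤ C)
    (hf : ∀ z ∈ segment ℝ q x, HasFDerivAt f (f' z) z)
    (hL : ∀ z ∈ segment ℝ q x, ‖f' z - f' q‖ ≤ C * ‖z - q‖) :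
    ‖f x - f q - f' q (x - q)‖ ≤ C * ‖x - q‖ ^ 2 := by
  have h := (convex_segment q x).norm_image_sub_le_of_norm_hasFDerivWithin_le' (f := f) (f' := f') (φ := f' q)
    (C := C * ‖x - q‖) (fun z hz => (hf z hz).hasFDerivWithinAt) (fun z hz => (hL z hz).trans ?_)
    (left_mem_segment ℝ q x) (right_mem_segment ℝ q x)
  · rw [sq, ← mul_assoc]; exact h
  · have := norm_sub_le_of_mem_segment hz
    gcongr

/-- Second order Taylor expansion in space, uniformly near a compact set. -/
lemma exists_taylor_slab [ProperSpace E] {f : E × ℝ → F} {O : Set E} {T : ℝ} (hO : IsOpen O) (hT : 0 < T)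
    (hf : ContDiffOn ℝ 2 f (slab (O ×ˢ univ) T)) {K : Set E} (hK : IsCompact K) (hKO : K ⊆ O) :
    ∃ r > 0, ∃ C, 0 ≤ C ∧ ∀ q ∈ K, ∀ v, ‖v‖ ≤ r → ∀ t ∈ Icc 0 T, q + v ∈ O ∧
      ‖f (q + v, t) - f (q, t) - dx f (slab (O ×ˢ univ) T) (q, t) v‖ ≤ C * ‖v‖ ^ 2 := by
  obtain ⟨r, hr, hrO⟩ := hK.exists_cthickening_subset_open hO hKO
  have hU : IsOpen (O ×ˢ (univ : Set ℝ)) := hO.prod isOpen_univ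
  obtain ⟨C, hC, -, hl⟩ := exists_bound_lipschitz_slab hU (contDiffOn_dx (n := 1) hU hT (by exact_mod_cast hf))
    (hK.cthickening (r := r) |>.prod (isCompact_Icc (a := 0) (b := T)))
    (fun x hx => mem_slab.2 ⟨⟨hrO hx.1, mem_univ _⟩, hx.2⟩)
  refine ⟨r, hr, C, hC, fun q hq v hv t ht => ?_⟩
  have hmem : ∀ z ∈ segment ℝ q (q + v), z ∈ Metric.cthickening r K := by
    intro z hz
    refine Metric.mem_cthickening_of_dist_le z q r K hq ?_
    have := norm_sub_le_of_mem_segment hz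
    rw [dist_eq_norm]
    refine this.trans ?_
    simpa using hv
  have hmem' : ∀ z ∈ segment ℝ q (q + v), (z, t) ∈ slab (O ×ˢ univ) T := fun z hz =>
    mem_slab.2 ⟨⟨hrO (hmem z hz), mem_univ _⟩, ht⟩
  refine ⟨hrO (hmem _ (right_mem_segment ℝ _ _)), ?_⟩
  have h := norm_sub_sub_le_of_lipschitz_deriv (f := fun y => f (y, t)) (f' := fun y => dx f (slab (O ×ˢ univ) T) (y, t))
    (q := q) (x := q + v) hC
    (fun z hz => hasFDerivAt_dx hU ((hf.differentiableOn (by simp)) _ (hmem' z hz)) (hmem' z hz))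
    (fun z hz => by
      have h1 := hl (z, t) ⟨hmem z hz, ht⟩ (q, t) ⟨hmem q (left_mem_segment ℝ _ _), ht⟩
      rw [Prod.mk_sub_mk, sub_self, Prod.norm_mk, norm_zero, max_eq_left (norm_nonneg _)] at h1
      exact h1)
  simpa using h

/-- The implicit function theorem on sets which need not be open: a continuous solution of an implicit equation is as
smooth as the equation. -/
lemma contDiffOn_of_implicit {X : Type*} [NormedAddCommGroup X] [NormedSpace ℝ X] [FiniteDimensional ℝ E]
    [FiniteDimensional ℝ X]
    {G : E × X → E} {D : Set (E × X)} {S : Set X} {P : X → E} {n : ℕ} (hD : UniqueDiffOn ℝ D) (hS : UniqueDiffOn ℝ S)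
    (hG : ContDiffOn ℝ (n + 1 : ℕ) G D) (hP : ContinuousOn P S) (hmem : ∀ x ∈ S, (P x, x) ∈ D)
    (hzero : ∀ x ∈ S, G (P x, x) = 0)
    (hinj : ∀ x ∈ S, ∀ v, fderivWithin ℝ G D (P x, x) (v, 0) = 0 → v = 0) :
    ContDiffOn ℝ (n + 1 : ℕ) P S := by
  have : CompleteSpace E := FiniteDimensional.complete ℝ E
  have : CompleteSpace X := FiniteDimensional.complete ℝ X
  set Th : X → E × X →L[ℝ] E × X := fun x =>
    (fderivWithin ℝ G D (P x, x)).prod (ContinuousLinearMap.snd ℝ E X)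
  have hThinj : ∀ x ∈ S, Function.Injective (Th x) := by
    intro x hx
    rw [injective_iff_map_eq_zero]
    rintro ⟨v, w⟩ h
    have h1 : fderivWithin ℝ G D (P x, x) (v, w) = 0 := (Prod.mk.inj h).1
    have h2 : w = 0 := (Prod.mk.inj h).2
    subst h2
    rw [hinj x hx v h1]; rfl
  have hequiv : ∀ x ∈ S, ∃ e : (E × X) ≃L[ℝ] (E × X), (e : E × X →L[ℝ] E × X) = Th x := fun x hx =>
    ⟨(LinearEquiv.ofInjectiveEndo (Th x).toLinearMap (hThinj x hx)).toContinuousLinearEquiv,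
      ContinuousLinearMap.ext fun _ => rfl⟩
  set P' : X → X →L[ℝ] E := fun x =>
    (ContinuousLinearMap.fst ℝ E X).comp ((ContinuousLinearMap.inverse (Th x)).comp (ContinuousLinearMap.inr ℝ E X))
  have hder : ∀ x ∈ S, HasFDerivWithinAt P (P' x) S x := by
    intro x hx
    obtain ⟨e, he⟩ := hequiv x hx
    have hTh : HasFDerivWithinAt (fun z : E × X => (G z, z.2)) (e : E × X →L[ℝ] E × X) D (P x, x) := by
      rw [he]
      exact ((hG.differentiableOn (by simp)) _ (hmem x hx)).hasFDerivWithinAt.prodMk hasFDerivWithinAt_snd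
    set g : E × X → E × X := fun z => (P z.2, z.2)
    have hg : Tendsto g (𝓝[({0} : Set E) ×ˢ S] (0, x)) (𝓝[D] (P x, x)) := by
      refine tendsto_nhdsWithin_of_tendsto_nhds_of_eventually_within _ ?_ ?_
      · have hs : Tendsto (fun z : E × X => z.2) (𝓝[({0} : Set E) ×ˢ S] (0, x)) (𝓝[S] x) :=
          tendsto_nhdsWithin_of_tendsto_nhds_of_eventually_within _
            ((continuous_snd.tendsto (0, x)).mono_left inf_le_left)
            (eventually_nhdsWithin_of_forall fun z hz => hz.2)
        exact ((hP x hx).tendsto.comp hs).prodMk_nhds (hs.mono_right inf_le_left)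
      · exact eventually_nhdsWithin_of_forall fun z hz => hmem _ hz.2
    have hinv := HasFDerivWithinAt.of_local_left_inverse (f := fun z : E × X => (G z, z.2)) (g := g) (a := ((0 : E), x))
      (s := ({0} : Set E) ×ˢ S) (t := D) hg hTh ⟨rfl, hx⟩
      (eventually_nhdsWithin_of_forall fun z hz => by
        have h0 : z.1 = 0 := hz.1
        change (G (P z.2, z.2), z.2) = z
        rw [hzero _ hz.2, ← h0])
    have h1 : HasFDerivWithinAt (fun x' : X => ((0 : E), x')) (ContinuousLinearMap.inr ℝ E X) S x :=
      (hasFDerivAt_prodMk_right (0 : E) x).hasFDerivWithinAt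
    have h2 := hinv.comp x (f := fun x' : X => ((0 : E), x')) h1 (fun x' hx' => ⟨rfl, hx'⟩)
    have h3 := h2.fst
    refine h3.congr_fderiv ?_
    simp only [P', ← he, ContinuousLinearMap.inverse_equiv]
  have key : ∀ j : ℕ, j ≤ n + 1 → ContDiffOn ℝ j P S := by
    intro j
    induction j with
    | zero => intro _; exact_mod_cast contDiffOn_zero.2 hP
    | succ j ih =>
      intro hj
      have hPj := ih (by omega)
      rw [show ((j + 1 : ℕ) : WithTop ℕ∞) = (j : WithTop ℕ∞) + 1 by push_cast; rfl,
        contDiffOn_succ_iff_hasFDerivWithinAt_of_uniqueDiffOn hS]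
      refine ⟨by simp, P', fun x hx => ?_, hder⟩
      have h1 : ContDiffOn ℝ j (fun x => fderivWithin ℝ G D (P x, x)) S :=
        (hG.fderivWithin (m := j) hD (by exact_mod_cast hj)).comp (f := fun x => (P x, x))
          (hPj.prodMk contDiffOn_id) hmem
      have h2 : ContDiffOn ℝ j Th S := by
        have h5 : ContDiffOn ℝ j (fun x => (ContinuousLinearMap.inl ℝ E X).comp (fderivWithin ℝ G D (P x, x)) +
            (ContinuousLinearMap.inr ℝ E X).comp (ContinuousLinearMap.snd ℝ E X)) S :=
          (contDiffOn_const.clm_comp h1).add contDiffOn_const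
        refine h5.congr fun x _ => ?_
        ext z <;> simp [Th]
      obtain ⟨e, he⟩ := hequiv x hx
      have h3 : ContDiffWithinAt ℝ j (fun x => ContinuousLinearMap.inverse (Th x)) S x := by
        have h4 : ContDiffAt ℝ j ContinuousLinearMap.inverse (Th x) := he ▸ contDiffAt_map_inverse e
        exact h4.comp_contDiffWithinAt x (h2 x hx)
      exact contDiffWithinAt_const.clm_comp (h3.clm_comp contDiffWithinAt_const)
  exact key (n + 1) le_rfl

end Slab

/-! ### Nearest points on the evolving surface -/

lemma exists_pos_mul_norm_le {X E F : Type*} [TopologicalSpace X] [NormedAddCommGroup E] [NormedSpace ℝ E]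
    [ProperSpace E] [NormedAddCommGroup F] [NormedSpace ℝ F] {A : X → E →L[ℝ] F} {K : Set X} (hK : IsCompact K)
    (hA : ContinuousOn A K) (hinj : ∀ x ∈ K, ∀ v, A x v = 0 → v = 0) :
    ∃ c > 0, ∀ x ∈ K, ∀ v, c * ‖v‖ ≤ ‖A x v‖ := by
  have hK' : IsCompact (K ×ˢ Metric.sphere (0 : E) 1) := hK.prod (isCompact_sphere 0 1)
  have hc : ContinuousOn (fun p : X × E => ‖A p.1 p.2‖) (K ×ˢ Metric.sphere (0 : E) 1) :=
    ((hA.comp continuousOn_fst fun p hp => hp.1).clm_apply continuousOn_snd).norm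
  obtain ⟨c, hc0, hcle⟩ : ∃ c > 0, ∀ p ∈ K ×ˢ Metric.sphere (0 : E) 1, c ≤ ‖A p.1 p.2‖ := by
    refine hK'.exists_forall_le' hc (a := 0) fun p hp => norm_pos_iff.2 fun h => ?_
    have h1 := hinj p.1 hp.1 p.2 h
    have h2 : ‖p.2‖ = 1 := by simpa using hp.2
    rw [h1, norm_zero] at h2
    exact zero_ne_one h2
  refine ⟨c, hc0, fun x hx v => ?_⟩
  by_cases hv : v = 0
  · simp [hv]
  have hv' : 0 < ‖v‖ := norm_pos_iff.2 hv
  have h1 := hcle (x, ‖v‖⁻¹ • v) ⟨hx, by simp [norm_smul, hv'.ne']⟩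
  rw [map_smul, norm_smul, norm_inv, norm_norm] at h1
  calc c * ‖v‖ ≤ (‖v‖⁻¹ * ‖A x v‖) * ‖v‖ := by gcongr
    _ = ‖A x v‖ := by field_simp

/-- The Euclidean product of two copies of three-space. -/
abbrev E33 := EuclideanSpace ℝ (Fin 3 ⊕ Fin 3)

/-- The identification of pairs of vectors with elements of the Euclidean product. -/
def pair : E3 × E3 →L[ℝ] E33 :=
  LinearMap.toContinuousLinearMap
    { toFun := fun a => WithLp.toLp 2 (Sum.elim (fun i => a.1 i) (fun i => a.2 i))
      map_add' := fun a b => by ext (i | i) <;> rfl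
      map_smul' := fun c a => by ext (i | i) <;> rfl }

lemma inner_pair (a b : E3 × E3) : inner ℝ (pair a) (pair b) = inner ℝ a.1 b.1 + inner ℝ a.2 b.2 := by
  simp [pair, PiLp.inner_apply]

lemma norm_pair_sq (a : E3 × E3) : ‖pair a‖ ^ 2 = ‖a.1‖ ^ 2 + ‖a.2‖ ^ 2 := by
  simp only [← real_inner_self_eq_norm_sq, inner_pair]

lemma norm_pair_zero (a : E3) : ‖pair (a, 0)‖ = ‖a‖ := by
  have h := norm_pair_sq (a, 0)
  rw [norm_zero, zero_pow two_ne_zero, add_zero] at h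
  exact (pow_left_inj₀ (norm_nonneg _) (norm_nonneg _) two_ne_zero).1 h

lemma pair_eq_zero {a : E3 × E3} (h : pair a = 0) : a = 0 := by
  have h1 := norm_pair_sq a
  rw [h, norm_zero] at h1
  have h2 : ‖a.1‖ = 0 := by nlinarith [sq_nonneg ‖a.1‖, sq_nonneg ‖a.2‖]
  have h3 : ‖a.2‖ = 0 := by nlinarith [sq_nonneg ‖a.1‖, sq_nonneg ‖a.2‖]
  exact Prod.ext (norm_eq_zero.1 h2) (norm_eq_zero.1 h3)

attribute [irreducible] pair

namespace MeanCurvatureFlow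

variable {Γ₀ : Set E3} {T : ℝ} {m : ℕ} (F : MeanCurvatureFlow Γ₀ T m)

/-- The flow map, extended to a neighbourhood of the initial surface to be constant along its normals. -/
def Xe (x : E3 × ℝ) : E3 := F.X (nearestPoint Γ₀ x.1) x.2

/-- The extended flow map together with the normal displacement from the initial surface: an immersion of a
neighbourhood of the initial surface. -/
def emb (x : E3 × ℝ) : E33 := pair (F.Xe x, x.1 - nearestPoint Γ₀ x.1)

lemma Xe_of_mem (hc : IsCompact Γ₀) {q : E3} (hq : q ∈ Γ₀) (t : ℝ) : F.Xe (q, t) = F.X q t := by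
  rw [Xe, nearestPoint_of_mem hc hq]

lemma contDiffOn_Xe (hΓ : IsSmoothClosedSurface Γ₀) {O : Set E3}
    (hπ : ContDiffOn ℝ m (nearestPoint Γ₀) O) : ContDiffOn ℝ m F.Xe (slab (O ×ˢ univ) T) := by
  have h1 : ContDiffOn ℝ m (fun x : E3 × ℝ => (nearestPoint Γ₀ x.1, x.2)) (slab (O ×ˢ univ) T) :=
    (hπ.comp (f := Prod.fst) contDiffOn_fst fun _ hx => (mem_slab.1 hx).1.1).prodMk contDiffOn_snd
  exact F.contDiffOn.comp h1 fun x hx => ⟨nearestPoint_mem hΓ.1 hΓ.2.1 _, (mem_slab.1 hx).2⟩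

lemma contDiffOn_emb (hΓ : IsSmoothClosedSurface Γ₀) {O : Set E3}
    (hπ : ContDiffOn ℝ m (nearestPoint Γ₀) O) : ContDiffOn ℝ m F.emb (slab (O ×ˢ univ) T) :=
  pair.contDiff.comp_contDiffOn
    ((F.contDiffOn_Xe hΓ hπ).prodMk (contDiffOn_fst.sub
      (hπ.comp (f := Prod.fst) contDiffOn_fst fun _ hx => (mem_slab.1 hx).1.1)))

lemma mem_slab_of_mem {O : Set E3} (hΓO : Γ₀ ⊆ O) {q : E3} (hq : q ∈ Γ₀) {t : ℝ} (ht : t ∈ Icc 0 T) :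
    (q, t) ∈ slab (O ×ˢ univ) T := mem_slab.2 ⟨⟨hΓO hq, mem_univ _⟩, ht⟩

/-- On the initial surface, the derivative of the extended flow map is the tangential derivative after projection to the
tangent plane. -/
lemma dx_Xe_apply (hΓ : IsSmoothClosedSurface Γ₀) (hm : 1 ≤ m) {O : Set E3} (hO : IsOpen O)
    (hΓO : Γ₀ ⊆ O) (hπ : ContDiffOn ℝ m (nearestPoint Γ₀) O) {q : E3} (hq : q ∈ Γ₀) {t : ℝ} (ht : t ∈ Icc 0 T) (v : E3) :
    dx F.Xe (slab (O ×ˢ univ) T) (q, t) v =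
      fderivWithin ℝ (fun p => F.X p t) Γ₀ q (fderiv ℝ (nearestPoint Γ₀) q v) := by
  have hm' : ((m : ℕ) : WithTop ℕ∞) ≠ 0 := by norm_cast; omega
  have h1 : HasFDerivAt (fun y => F.Xe (y, t)) (dx F.Xe (slab (O ×ˢ univ) T) (q, t)) q :=
    hasFDerivAt_dx (hO.prod isOpen_univ) (((F.contDiffOn_Xe hΓ hπ).differentiableOn hm') _
      (mem_slab_of_mem hΓO hq ht)) (mem_slab_of_mem hΓO hq ht)
  have h2 : DifferentiableWithinAt ℝ (fun p => F.X p t) Γ₀ q :=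
    (F.contDiffOn.differentiableOn hm' (q, t) ⟨hq, ht⟩).comp q (f := fun p => (p, t))
      (differentiableWithinAt_id.prodMk (differentiableWithinAt_const t)) fun p hp => ⟨hp, ht⟩
  have h3 : HasFDerivAt (nearestPoint Γ₀) (fderiv ℝ (nearestPoint Γ₀) q) q :=
    ((hπ.contDiffAt (hO.mem_nhds (hΓO hq))).differentiableAt hm').hasFDerivAt
  have h2' := h2.hasFDerivWithinAt
  rw [← nearestPoint_of_mem hΓ.1 hq] at h2'
  have h4 := h2'.comp (s := univ) q h3.hasFDerivWithinAt fun p _ => nearestPoint_mem hΓ.1 hΓ.2.1 p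
  rw [hasFDerivWithinAt_univ, nearestPoint_of_mem hΓ.1 hq] at h4
  exact DFunLike.congr_fun (h1.unique h4) v

/-- Vectors in the image of the derivative of the nearest point map are tangent. -/
lemma fderiv_nearestPoint_mem_tangentConeAt (hΓ : IsSmoothClosedSurface Γ₀) {q : E3} (hq : q ∈ Γ₀) (v : E3) :
    fderiv ℝ (nearestPoint Γ₀) q v ∈ tangentConeAt ℝ Γ₀ q := by
  have h3 : HasFDerivAt (nearestPoint Γ₀) (fderiv ℝ (nearestPoint Γ₀) q) q :=
    ((contDiffAt_nearestPoint hΓ hq 1).1.differentiableAt (by simp)).hasFDerivAt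
  have h4 := (h3.hasFDerivWithinAt (s := univ)).mapsTo_tangent_cone (show v ∈ tangentConeAt ℝ univ q by
    rw [tangentConeAt_univ]; trivial)
  rw [nearestPoint_of_mem hΓ.1 hq] at h4
  exact tangentConeAt_mono (by rintro _ ⟨y, -, rfl⟩; exact nearestPoint_mem hΓ.1 hΓ.2.1 y) h4

lemma dx_emb_apply (hΓ : IsSmoothClosedSurface Γ₀) (hm : 1 ≤ m) {O : Set E3} (hO : IsOpen O)
    (hΓO : Γ₀ ⊆ O) (hπ : ContDiffOn ℝ m (nearestPoint Γ₀) O) {q : E3} (hq : q ∈ Γ₀) {t : ℝ} (ht : t ∈ Icc 0 T) (v : E3) :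
    dx F.emb (slab (O ×ˢ univ) T) (q, t) v = pair
      (dx F.Xe (slab (O ×ˢ univ) T) (q, t) v, v - fderiv ℝ (nearestPoint Γ₀) q v) := by
  have hm' : ((m : ℕ) : WithTop ℕ∞) ≠ 0 := by norm_cast; omega
  have hmem := mem_slab_of_mem (T := T) hΓO hq ht
  have h0 : HasFDerivAt (fun y => F.emb (y, t)) (dx F.emb (slab (O ×ˢ univ) T) (q, t)) q :=
    hasFDerivAt_dx (hO.prod isOpen_univ) (((F.contDiffOn_emb hΓ hπ).differentiableOn hm') _ hmem) hmem
  have h1 : HasFDerivAt (fun y => F.Xe (y, t)) (dx F.Xe (slab (O ×ˢ univ) T) (q, t)) q :=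
    hasFDerivAt_dx (hO.prod isOpen_univ) (((F.contDiffOn_Xe hΓ hπ).differentiableOn hm') _ hmem) hmem
  have h3 : HasFDerivAt (nearestPoint Γ₀) (fderiv ℝ (nearestPoint Γ₀) q) q :=
    ((hπ.contDiffAt (hO.mem_nhds (hΓO hq))).differentiableAt hm').hasFDerivAt
  have h5 : HasFDerivAt (fun y => (F.Xe (y, t), y - nearestPoint Γ₀ y))
      ((dx F.Xe (slab (O ×ˢ univ) T) (q, t)).prod (ContinuousLinearMap.id ℝ E3 - fderiv ℝ (nearestPoint Γ₀) q)) q :=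
    h1.prodMk ((hasFDerivAt_id q).fun_sub h3)
  have h4 := pair.hasFDerivAt.comp q h5
  rw [h0.unique h4, ContinuousLinearMap.comp_apply, ContinuousLinearMap.prod_apply, sub_apply, ContinuousLinearMap.id_apply]

lemma dx_emb_injective (hΓ : IsSmoothClosedSurface Γ₀) (hm : 1 ≤ m) {O : Set E3} (hO : IsOpen O)
    (hΓO : Γ₀ ⊆ O) (hπ : ContDiffOn ℝ m (nearestPoint Γ₀) O) {q : E3} (hq : q ∈ Γ₀) {t : ℝ} (ht : t ∈ Icc 0 T) (v : E3)
    (h : dx F.emb (slab (O ×ˢ univ) T) (q, t) v = 0) : v = 0 := by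
  rw [F.dx_emb_apply hΓ hm hO hΓO hπ hq ht] at h
  have h := pair_eq_zero h
  rw [Prod.mk_eq_zero, F.dx_Xe_apply hΓ hm hO hΓO hπ hq ht, sub_eq_zero] at h
  have h1 := fderiv_nearestPoint_mem_tangentConeAt hΓ hq v
  have h2 := F.immersion t ht q hq _ h1 h.1
  rw [h.2, h2]

/-- The flow map is uniformly bilipschitz from below. -/
lemma exists_mul_dist_le (hT : 0 < T) (hΓ : IsSmoothClosedSurface Γ₀) (hm : 2 ≤ m) :
    ∃ c > 0, ∀ t ∈ Icc 0 T, ∀ p ∈ Γ₀, ∀ q ∈ Γ₀, c * ‖p - q‖ ≤ ‖F.X p t - F.X q t‖ := by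
  obtain ⟨O, hO, hΓO, hπ⟩ := exists_isOpen_contDiffOn_nearestPoint hΓ m
  have hemb := F.contDiffOn_emb hΓ hπ
  have hU : IsOpen (O ×ˢ (univ : Set ℝ)) := hO.prod isOpen_univ
  have hK : IsCompact (Γ₀ ×ˢ Icc 0 T) := hΓ.1.prod isCompact_Icc
  have hdx := contDiffOn_dx (n := 1) hU hT (hemb.of_le (by exact_mod_cast hm))
  obtain ⟨c, hc, hcle⟩ := exists_pos_mul_norm_le hK
    (hdx.continuousOn.mono fun x hx => mem_slab_of_mem hΓO hx.1 hx.2)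
    (fun x hx v => F.dx_emb_injective hΓ (by omega) hO hΓO hπ hx.1 hx.2 v)
  obtain ⟨r, hr, C, hC, htay⟩ := exists_taylor_slab hO hT (hemb.of_le (by exact_mod_cast hm)) hΓ.1 hΓO
  have hdiff : ∀ t, ∀ p ∈ Γ₀, ∀ q ∈ Γ₀, ‖F.emb (p, t) - F.emb (q, t)‖ = ‖F.X p t - F.X q t‖ := by
    intro t p hp q hq
    rw [emb, emb, ← map_sub, Xe_of_mem F hΓ.1 hp, Xe_of_mem F hΓ.1 hq, nearestPoint_of_mem hΓ.1 hp,
      nearestPoint_of_mem hΓ.1 hq, Prod.mk_sub_mk, sub_self, sub_self, sub_zero, norm_pair_zero]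
  set ρ := min r (c / (2 * (C + 1)))
  have hρ : 0 < ρ := lt_min hr (by positivity)
  -- far apart points are separated by compactness
  obtain ⟨c₁, hc₁, hc₁le⟩ : ∃ c₁ > 0, ∀ x ∈ {x : (E3 × E3) × ℝ | (x.1.1 ∈ Γ₀ ∧ x.1.2 ∈ Γ₀ ∧ x.2 ∈ Icc 0 T) ∧ ρ ≤ ‖x.1.1 - x.1.2‖},
      c₁ ≤ ‖F.X x.1.1 x.2 - F.X x.1.2 x.2‖ := by
    have hcomp : IsCompact {x : (E3 × E3) × ℝ | (x.1.1 ∈ Γ₀ ∧ x.1.2 ∈ Γ₀ ∧ x.2 ∈ Icc 0 T) ∧ ρ ≤ ‖x.1.1 - x.1.2‖} := by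
      have h1 : IsCompact ((Γ₀ ×ˢ Γ₀) ×ˢ Icc 0 T) := (hΓ.1.prod hΓ.1).prod isCompact_Icc
      have h2 : IsClosed {x : (E3 × E3) × ℝ | ρ ≤ ‖x.1.1 - x.1.2‖} :=
        isClosed_le continuous_const (by fun_prop)
      convert h1.inter_right h2 using 1
      ext x; simp [and_assoc]
    refine hcomp.exists_forall_le' (a := 0) ?_ fun x hx => norm_pos_iff.2 fun h => ?_
    · refine ContinuousOn.norm (ContinuousOn.sub ?_ ?_)
      · exact F.contDiffOn.continuousOn.comp (f := fun x : (E3 × E3) × ℝ => (x.1.1, x.2)) (by fun_prop)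
          fun x hx => ⟨hx.1.1, hx.1.2.2⟩
      · exact F.contDiffOn.continuousOn.comp (f := fun x : (E3 × E3) × ℝ => (x.1.2, x.2)) (by fun_prop)
          fun x hx => ⟨hx.1.2.1, hx.1.2.2⟩
    · have := F.injOn x.2 hx.1.2.2 hx.1.1 hx.1.2.1 (sub_eq_zero.1 h)
      have h2 := hx.2
      rw [this, sub_self, norm_zero] at h2
      exact hρ.not_ge h2
  obtain ⟨R, hR, hRle⟩ := hΓ.1.isBounded.exists_pos_norm_le
  refine ⟨min (c / 2) (c₁ / (2 * R)), lt_min (by positivity) (by positivity), fun t ht p hp q hq => ?_⟩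
  rcases lt_or_ge ‖p - q‖ ρ with h | h
  · have h1 := (htay q hq (p - q) (h.le.trans (min_le_left _ _)) t ht).2
    rw [add_sub_cancel] at h1
    have h2 := hcle (q, t) ⟨hq, ht⟩ (p - q)
    rw [← hdiff t p hp q hq]
    have h3 := norm_sub_norm_le (dx F.emb (slab (O ×ˢ univ) T) (q, t) (p - q)) (F.emb (p, t) - F.emb (q, t))
    rw [norm_sub_rev (dx F.emb (slab (O ×ˢ univ) T) (q, t) (p - q))] at h3
    have h4 : C * ‖p - q‖ ^ 2 ≤ c / 2 * ‖p - q‖ := by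
      have h5 : ‖p - q‖ ≤ c / (2 * (C + 1)) := h.le.trans (min_le_right _ _)
      rw [le_div_iff₀ (by positivity)] at h5
      nlinarith [norm_nonneg (p - q)]
    have h6 : min (c / 2) (c₁ / (2 * R)) * ‖p - q‖ ≤ c / 2 * ‖p - q‖ := by gcongr; exact min_le_left _ _
    linarith
  · have h1 := hc₁le ((p, q), t) ⟨⟨hp, hq, ht⟩, h⟩
    refine le_trans ?_ h1
    have h2 : ‖p - q‖ ≤ 2 * R := (norm_sub_le _ _).trans (by linarith [hRle p hp, hRle q hq])
    calc min (c / 2) (c₁ / (2 * R)) * ‖p - q‖ ≤ c₁ / (2 * R) * (2 * R) := by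
          gcongr; exact min_le_right _ _
      _ = c₁ := by field_simp

end MeanCurvatureFlow

/-! ### Smoothness of the nearest point parameter -/

namespace MeanCurvatureFlow

variable {Γ₀ : Set E3} {T : ℝ} {m : ℕ} (F : MeanCurvatureFlow Γ₀ T m)

lemma continuousOn_X {t : ℝ} (ht : t ∈ Icc 0 T) : ContinuousOn (fun q => F.X q t) Γ₀ :=
  F.contDiffOn.continuousOn.comp (f := fun q => (q, t)) (by fun_prop) fun _ hq => ⟨hq, ht⟩

lemma isCompact_surface (hΓ : IsSmoothClosedSurface Γ₀) {t : ℝ} (ht : t ∈ Icc 0 T) : IsCompact (F.surface t) :=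
  hΓ.1.image_of_continuousOn (F.continuousOn_X ht)

lemma surface_nonempty (hΓ : IsSmoothClosedSurface Γ₀) (t : ℝ) : (F.surface t).Nonempty := hΓ.2.1.image _

/-- The parameter in the initial surface of the nearest point on the surface at time `x.2`. -/
def par (x : E3 × ℝ) : E3 :=
  Classical.epsilon fun q => q ∈ Γ₀ ∧ F.X q x.2 = nearestPoint (F.surface x.2) x.1

lemma par_spec (hΓ : IsSmoothClosedSurface Γ₀) {x : E3 × ℝ} (hx : x.2 ∈ Icc 0 T) :
    F.par x ∈ Γ₀ ∧ F.X (F.par x) x.2 = nearestPoint (F.surface x.2) x.1 := by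
  obtain ⟨q, hq, h⟩ := nearestPoint_mem (F.isCompact_surface hΓ hx) (F.surface_nonempty hΓ x.2) x.1
  exact Classical.epsilon_spec (p := fun q => q ∈ Γ₀ ∧ F.X q x.2 = nearestPoint (F.surface x.2) x.1) ⟨q, hq, h⟩

lemma norm_par_le (hΓ : IsSmoothClosedSurface Γ₀) {x : E3 × ℝ} (hx : x.2 ∈ Icc 0 T) {p : E3} (hp : p ∈ Γ₀) :
    ‖F.X (F.par x) x.2 - x.1‖ ≤ ‖F.X p x.2 - x.1‖ := by
  rw [(F.par_spec hΓ hx).2, ← dist_eq_norm, ← dist_eq_norm, dist_comm, dist_comm _ x.1]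
  exact dist_nearestPoint_le (F.isCompact_surface hΓ hx) (mem_image_of_mem _ hp) x.1

/-- A parameter of a nearest point is critical for the distance. -/
lemma inner_dx_Xe_eq_zero (hΓ : IsSmoothClosedSurface Γ₀) (hm : 1 ≤ m) {O : Set E3} (hO : IsOpen O)
    (hΓO : Γ₀ ⊆ O) (hπ : ContDiffOn ℝ m (nearestPoint Γ₀) O) {q : E3} (hq : q ∈ Γ₀) {t : ℝ} (ht : t ∈ Icc 0 T)
    {y : E3} (hmin : ∀ p ∈ Γ₀, ‖F.X q t - y‖ ≤ ‖F.X p t - y‖) (v : E3) :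
    inner ℝ (F.X q t - y) (dx F.Xe (slab (O ×ˢ univ) T) (q, t) v) = 0 := by
  have hm' : ((m : ℕ) : WithTop ℕ∞) ≠ 0 := by norm_cast; omega
  have hmem := mem_slab_of_mem (T := T) hΓO hq ht
  have h1 : HasFDerivAt (fun y => F.Xe (y, t)) (dx F.Xe (slab (O ×ˢ univ) T) (q, t)) q :=
    hasFDerivAt_dx (hO.prod isOpen_univ) (((F.contDiffOn_Xe hΓ hπ).differentiableOn hm') _ hmem) hmem
  have h2 := (h1.sub_const y).norm_sq
  have h3 : IsLocalMin (fun p => ‖F.Xe (p, t) - y‖ ^ 2) q := by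
    refine Eventually.of_forall fun p => ?_
    beta_reduce
    rw [F.Xe_of_mem hΓ.1 hq]
    exact pow_le_pow_left₀ (norm_nonneg _) (hmin _ (nearestPoint_mem hΓ.1 hΓ.2.1 p)) 2
  have h4 := DFunLike.congr_fun (h3.hasFDerivAt_eq_zero h2) v
  rw [F.Xe_of_mem hΓ.1 hq] at h4
  rw [inner_sub_left]
  simpa using h4

/-- Near the surfaces, the parameters of nearest points are unique. -/
lemma exists_unique_par (hT : 0 < T) (hΓ : IsSmoothClosedSurface Γ₀) (hm : 2 ≤ m) :
    ∃ r > 0, ∀ t ∈ Icc 0 T, ∀ y, ∀ q₁ ∈ Γ₀, ∀ q₂ ∈ Γ₀, (∀ p ∈ Γ₀, ‖F.X q₁ t - y‖ ≤ ‖F.X p t - y‖) →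
      (∀ p ∈ Γ₀, ‖F.X q₂ t - y‖ ≤ ‖F.X p t - y‖) → ‖F.X q₁ t - y‖ ≤ r → q₁ = q₂ := by
  obtain ⟨O, hO, hΓO, hπ⟩ := exists_isOpen_contDiffOn_nearestPoint hΓ m
  obtain ⟨c, hc, hcle⟩ := F.exists_mul_dist_le hT hΓ hm
  obtain ⟨r₀, hr₀, C, hC, htay⟩ := exists_taylor_slab hO hT ((F.contDiffOn_Xe hΓ hπ).of_le (by exact_mod_cast hm))
    hΓ.1 hΓO
  refine ⟨min (c * r₀ / 2) (c ^ 2 / (4 * (C + 1))), lt_min (by positivity) (by positivity),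
    fun t ht y q₁ hq₁ q₂ hq₂ h₁ h₂ hr => ?_⟩
  have hr1 := hr.trans (min_le_left _ _)
  have hr2 := hr.trans (min_le_right _ _)
  set d := ‖F.X q₁ t - y‖
  have hd : ‖F.X q₂ t - y‖ ≤ d := h₂ q₁ hq₁
  have hb := hcle t ht q₂ hq₂ q₁ hq₁
  have hX : ‖F.X q₂ t - F.X q₁ t‖ ≤ 2 * d := by
    have := norm_sub_le (F.X q₂ t - y) (F.X q₁ t - y)
    rw [sub_sub_sub_cancel_right] at this
    linarith
  have hv : ‖q₂ - q₁‖ ≤ r₀ := by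
    by_contra! hlt
    nlinarith
  have key : ∀ a ∈ Γ₀, ∀ b ∈ Γ₀, (∀ p ∈ Γ₀, ‖F.X a t - y‖ ≤ ‖F.X p t - y‖) → ‖F.X a t - y‖ ≤ d → ‖b - a‖ ≤ r₀ →
      -(d * (C * ‖b - a‖ ^ 2)) ≤ inner ℝ (F.X a t - y) (F.X b t - F.X a t) := by
    intro a ha b hb hmin hda hv
    have h := (htay a ha (b - a) hv t ht).2
    rw [add_sub_cancel, F.Xe_of_mem hΓ.1 ha, F.Xe_of_mem hΓ.1 hb] at h
    have h0 := F.inner_dx_Xe_eq_zero hΓ (by omega) hO hΓO hπ ha ht hmin (b - a)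
    have h3 := abs_real_inner_le_norm (F.X a t - y)
      (F.X b t - F.X a t - dx F.Xe (slab (O ×ˢ univ) T) (a, t) (b - a))
    rw [inner_sub_right, h0, sub_zero] at h3
    have h4 := neg_le_of_abs_le (h3.trans (mul_le_mul hda h (norm_nonneg _) (norm_nonneg _)))
    exact h4
  have k1 := key q₁ hq₁ q₂ hq₂ h₁ le_rfl hv
  have k2 := key q₂ hq₂ q₁ hq₁ h₂ hd (by rwa [norm_sub_rev])
  rw [norm_sub_rev q₁ q₂] at k2
  have k3 : ‖F.X q₂ t - F.X q₁ t‖ ^ 2 = -(inner ℝ (F.X q₁ t - y) (F.X q₂ t - F.X q₁ t)) -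
      inner ℝ (F.X q₂ t - y) (F.X q₁ t - F.X q₂ t) := by
    rw [← real_inner_self_eq_norm_sq, ← neg_sub (F.X q₂ t) (F.X q₁ t), inner_neg_right, sub_neg_eq_add,
      neg_add_eq_sub, ← inner_sub_left, sub_sub_sub_cancel_right]
  have k4 : (c * ‖q₂ - q₁‖) ^ 2 ≤ ‖F.X q₂ t - F.X q₁ t‖ ^ 2 := by gcongr
  have k5 : d * C ≤ c ^ 2 / 4 := by
    rw [le_div_iff₀ (by positivity)] at hr2
    nlinarith [norm_nonneg (F.X q₁ t - y)]
  have k6 : ‖q₂ - q₁‖ ^ 2 * c ^ 2 ≤ ‖q₂ - q₁‖ ^ 2 * (c ^ 2 / 2) := by nlinarith [sq_nonneg ‖q₂ - q₁‖]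
  have k7 : ‖q₂ - q₁‖ ^ 2 ≤ 0 := by
    by_contra! hpos
    have := le_of_mul_le_mul_left k6 hpos
    nlinarith [sq_pos_of_pos hc]
  have k8 : ‖q₂ - q₁‖ = 0 := by nlinarith [norm_nonneg (q₂ - q₁)]
  exact (sub_eq_zero.1 (norm_eq_zero.1 k8)).symm

/-- The points of space-time within distance `r` of the evolving surface (which stands still at times outside
`[0, T]`). -/
def tube (r : ℝ) : Set (E3 × ℝ) := ⋃ q ∈ Γ₀, {x | ‖F.X q (max 0 (min x.2 T)) - x.1‖ < r}

lemma isOpen_tube (hT : 0 < T) (r : ℝ) : IsOpen (F.tube r) := by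
  refine isOpen_biUnion fun q hq => isOpen_lt (Continuous.norm (Continuous.sub ?_ continuous_fst)) continuous_const
  have h : Continuous fun x : E3 × ℝ => (q, max 0 (min x.2 T)) := by fun_prop
  exact F.contDiffOn.continuousOn.comp_continuous h fun x =>
    ⟨hq, le_max_left _ _, max_le hT.le (min_le_right _ _)⟩

lemma mem_slab_tube {r : ℝ} {x : E3 × ℝ} :
    x ∈ slab (F.tube r) T ↔ (∃ q ∈ Γ₀, ‖F.X q x.2 - x.1‖ < r) ∧ x.2 ∈ Icc 0 T := by
  rw [mem_slab]
  refine and_congr_left fun hx => ?_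
  have : max 0 (min x.2 T) = x.2 := by rw [min_eq_left hx.2, max_eq_right hx.1]
  simp [tube, this]

lemma norm_par_lt (hΓ : IsSmoothClosedSurface Γ₀) {r : ℝ} {x : E3 × ℝ} (hx : x ∈ slab (F.tube r) T) :
    ‖F.X (F.par x) x.2 - x.1‖ < r := by
  obtain ⟨⟨q, hq, h⟩, hx2⟩ := F.mem_slab_tube.1 hx
  exact (F.norm_par_le hΓ hx2 hq).trans_lt h

lemma continuousOn_par (hΓ : IsSmoothClosedSurface Γ₀) {r : ℝ}
    (hr : ∀ t ∈ Icc 0 T, ∀ y, ∀ q₁ ∈ Γ₀, ∀ q₂ ∈ Γ₀, (∀ p ∈ Γ₀, ‖F.X q₁ t - y‖ ≤ ‖F.X p t - y‖) →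
      (∀ p ∈ Γ₀, ‖F.X q₂ t - y‖ ≤ ‖F.X p t - y‖) → ‖F.X q₁ t - y‖ ≤ r → q₁ = q₂) :
    ContinuousOn F.par (slab (F.tube r) T) := by
  intro x hx
  have hx2 := (mem_slab.1 hx).2
  refine hΓ.1.tendsto_nhds_of_unique_mapClusterPt
    (eventually_nhdsWithin_of_forall fun z hz => (F.par_spec hΓ (mem_slab.1 hz).2).1) fun q hq hcl => ?_
  refine (hr x.2 hx2 x.1 (F.par x) (F.par_spec hΓ hx2).1 q hq (fun p hp => F.norm_par_le hΓ hx2 hp) (fun p hp => ?_)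
    (F.norm_par_lt hΓ hx).le).symm
  obtain ⟨U, hU, hUq⟩ := mapClusterPt_iff_ultrafilter.1 hcl
  have hUS : ∀ᶠ z in (U : Filter (E3 × ℝ)), z ∈ slab (F.tube r) T := hU self_mem_nhdsWithin
  have hUx : Tendsto (fun z : E3 × ℝ => z) U (𝓝 x) := hU.trans inf_le_left
  have h2 : Tendsto (fun z : E3 × ℝ => z.2) U (𝓝 x.2) := (continuous_snd.tendsto x).comp hUx
  have hlim : ∀ (f : E3 × ℝ → E3) (a : E3), a ∈ Γ₀ → Tendsto f U (𝓝 a) → (∀ᶠ z in (U : Filter (E3 × ℝ)), f z ∈ Γ₀) →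
      Tendsto (fun z => ‖F.X (f z) z.2 - z.1‖) U (𝓝 ‖F.X a x.2 - x.1‖) := by
    intro f a ha hf hfm
    have h3 : Tendsto (fun z => (f z, z.2)) U (𝓝[Γ₀ ×ˢ Icc 0 T] (a, x.2)) :=
      tendsto_nhdsWithin_of_tendsto_nhds_of_eventually_within _ (hf.prodMk_nhds h2)
        (by filter_upwards [hfm, hUS] with z h4 h5 using ⟨h4, (mem_slab.1 h5).2⟩)
    have h4 : Tendsto (fun z => F.X (f z) z.2) U (𝓝 (F.X a x.2)) :=
      Tendsto.comp (g := Function.uncurry F.X) (F.contDiffOn.continuousOn (a, x.2) ⟨ha, hx2⟩) h3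
    have h5 : Tendsto (fun z : E3 × ℝ => z.1) U (𝓝 x.1) := (continuous_fst.tendsto x).comp hUx
    exact (h4.sub h5).norm
  refine le_of_tendsto_of_tendsto (hlim F.par q hq hUq ?_) (hlim (fun _ => p) p hp tendsto_const_nhds
    (Eventually.of_forall fun _ => hp)) ?_
  · filter_upwards [hUS] with z hz using (F.par_spec hΓ (mem_slab.1 hz).2).1
  · filter_upwards [hUS] with z hz using F.norm_par_le hΓ (mem_slab.1 hz).2 hp

/-- Near the surfaces, the parameter of the nearest point is a smooth function of space and time. It solves the
critical point equation for the distance, in which the normal displacement from the initial surface is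
added to make the equation regular. -/
lemma exists_contDiffOn_par (hT : 0 < T) (hΓ : IsSmoothClosedSurface Γ₀) {n : ℕ} (hn : 1 ≤ n) (hm : n + 2 ≤ m) :
    ∃ r > 0, ContDiffOn ℝ (n + 1 : ℕ) F.par (slab (F.tube r) T) := by
  obtain ⟨O, hO, hΓO, hπ⟩ := exists_isOpen_contDiffOn_nearestPoint hΓ m
  obtain ⟨r₁, hr₁, huniq⟩ := F.exists_unique_par hT hΓ (by omega)
  have hU : IsOpen (O ×ˢ (univ : Set ℝ)) := hO.prod isOpen_univ
  set S₀ := slab (O ×ˢ (univ : Set ℝ)) T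
  have hemb : ContDiffOn ℝ (n + 2 : ℕ) F.emb S₀ := (F.contDiffOn_emb hΓ hπ).of_le (by exact_mod_cast hm)
  have hdx : ContDiffOn ℝ (n + 1 : ℕ) (dx F.emb S₀) S₀ := contDiffOn_dx hU hT hemb
  have hddx : ContDiffOn ℝ n (dx (dx F.emb S₀) S₀) S₀ := contDiffOn_dx hU hT hdx
  have hK : IsCompact (Γ₀ ×ˢ Icc 0 T) := hΓ.1.prod isCompact_Icc
  have hKS : Γ₀ ×ˢ Icc 0 T ⊆ S₀ := fun x hx => mem_slab_of_mem hΓO hx.1 hx.2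
  obtain ⟨c, hc, hcle⟩ := exists_pos_mul_norm_le hK (hdx.continuousOn.mono hKS)
    (fun x hx v => F.dx_emb_injective hΓ (by omega) hO hΓO hπ hx.1 hx.2 v)
  obtain ⟨C, hC⟩ := hK.exists_bound_of_continuousOn (hddx.continuousOn.mono hKS)
  set r := min r₁ (c ^ 2 / (2 * (|C| + 1)))
  have hr : 0 < r := lt_min hr₁ (by positivity)
  refine ⟨r, hr, ?_⟩
  set D : Set (E3 × (E3 × ℝ)) := O ×ˢ (univ ×ˢ Icc 0 T)
  have hD : UniqueDiffOn ℝ D := hO.uniqueDiffOn.prod (uniqueDiffOn_univ.prod (uniqueDiffOn_Icc hT))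
  set G : E3 × (E3 × ℝ) → E3 := fun z => (InnerProductSpace.toDual ℝ E3).symm
    ((innerSL ℝ (F.emb (z.1, z.2.2) - pair (z.2.1, 0))).comp (dx F.emb S₀ (z.1, z.2.2)))
  have hGv : ∀ z v, inner ℝ (G z) v = inner ℝ (F.emb (z.1, z.2.2) - pair (z.2.1, 0)) (dx F.emb S₀ (z.1, z.2.2) v) := by
    intro z v
    simp only [G, InnerProductSpace.toDual_symm_apply]
    rfl
  have hproj : ContDiff ℝ (n + 1 : ℕ) fun z : E3 × (E3 × ℝ) => (z.1, z.2.2) := by fun_prop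
  have hmaps : ∀ z ∈ D, (z.1, z.2.2) ∈ S₀ := fun z hz => mem_slab.2 ⟨⟨hz.1, mem_univ _⟩, hz.2.2⟩
  have hG : ContDiffOn ℝ (n + 1 : ℕ) G D := by
    have h1 : ContDiffOn ℝ (n + 1 : ℕ) (fun z : E3 × (E3 × ℝ) => F.emb (z.1, z.2.2) - pair (z.2.1, 0)) D :=
      ((hemb.of_le (by norm_cast; omega)).comp hproj.contDiffOn hmaps).sub
        (pair.contDiff.comp (f := fun z : E3 × (E3 × ℝ) => (z.2.1, (0 : E3))) (by fun_prop)).contDiffOn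
    have h2 : ContDiffOn ℝ (n + 1 : ℕ) (fun z : E3 × (E3 × ℝ) => dx F.emb S₀ (z.1, z.2.2)) D :=
      hdx.comp hproj.contDiffOn hmaps
    exact ((InnerProductSpace.toDual ℝ E3).symm.toContinuousLinearEquiv.contDiff).comp_contDiffOn
      (((innerSL ℝ (E := E33)).contDiff.comp_contDiffOn h1).clm_comp h2)
  have hS : UniqueDiffOn ℝ (slab (F.tube r) T) := uniqueDiffOn_slab (F.isOpen_tube hT r) hT
  have hmem : ∀ x ∈ slab (F.tube r) T, (F.par x, x) ∈ D := fun x hx =>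
    ⟨hΓO (F.par_spec hΓ (mem_slab.1 hx).2).1, mem_univ _, (mem_slab.1 hx).2⟩
  have hembP : ∀ x ∈ slab (F.tube r) T, F.emb (F.par x, x.2) - pair (x.1, 0) = pair (F.X (F.par x) x.2 - x.1, 0) := by
    intro x hx
    have hq := (F.par_spec hΓ (mem_slab.1 hx).2).1
    rw [emb, ← map_sub, F.Xe_of_mem hΓ.1 hq, nearestPoint_of_mem hΓ.1 hq, Prod.mk_sub_mk, sub_self, sub_zero]
  refine contDiffOn_of_implicit hD hS hG (F.continuousOn_par hΓ fun t ht y q₁ h₁ q₂ h₂ m₁ m₂ h =>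
    huniq t ht y q₁ h₁ q₂ h₂ m₁ m₂ (h.trans (min_le_left _ _))) hmem (fun x hx => ?_) (fun x hx v hv => ?_)
  · have hx2 := (mem_slab.1 hx).2
    have hq := (F.par_spec hΓ hx2).1
    refine ext_inner_right ℝ fun v => ?_
    rw [hGv, hembP x hx, F.dx_emb_apply hΓ (by omega) hO hΓO hπ hq hx2, inner_pair, inner_zero_left, inner_zero_left,
      add_zero]
    exact F.inner_dx_Xe_eq_zero hΓ (by omega) hO hΓO hπ hq hx2 (fun p hp => F.norm_par_le hΓ hx2 hp) v
  · have hx2 := (mem_slab.1 hx).2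
    have hq := (F.par_spec hΓ hx2).1
    set q := F.par x
    have hqS : (q, x.2) ∈ S₀ := hKS ⟨hq, hx2⟩
    have hline : HasDerivAt (fun s : ℝ => q + s • v) v 0 := by
      simpa using ((hasDerivAt_id (0 : ℝ)).smul_const v).const_add q
    have h0 : q + (0 : ℝ) • v = q := by simp
    -- the derivative of `G` in the direction `v`, computed in two ways
    have d1 : HasDerivAt (fun s : ℝ => inner ℝ (G (q + s • v, x)) v) 0 0 := by
      have e1 : HasFDerivWithinAt G (fderivWithin ℝ G D (q, x)) D (q, x) :=
        ((hG.differentiableOn (by simp)) _ (hmem x hx)).hasFDerivWithinAt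
      have e2 : HasDerivAt (fun s : ℝ => (q + s • v, x)) (v, 0) 0 := hline.prodMk (hasDerivAt_const _ _)
      rw [← h0] at e1
      have e3 := e1.comp_hasDerivWithinAt (s := (fun s : ℝ => (q + s • v, x)) ⁻¹' D) (0 : ℝ)
        (e2.hasDerivWithinAt) (mapsTo_preimage _ _)
      have e4 : (fun s : ℝ => (q + s • v, x)) ⁻¹' D ∈ 𝓝 (0 : ℝ) := by
        have e5 : ∀ᶠ s : ℝ in 𝓝 0, q + s • v ∈ O :=
          hline.continuousAt.eventually (hO.mem_nhds (show q + (0 : ℝ) • v ∈ O by rw [h0]; exact hΓO hq))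
        filter_upwards [e5] with s hs using ⟨hs, mem_univ _, hx2⟩
      have e6 := e3.hasDerivAt e4
      rw [h0, hv] at e6
      have e7 := HasDerivAt.inner ℝ e6 (hasDerivAt_const (0 : ℝ) v)
      simpa using e7
    have d2 : HasDerivAt (fun s : ℝ => inner ℝ (F.emb (q + s • v, x.2) - pair (x.1, 0)) (dx F.emb S₀ (q + s • v, x.2) v))
        (inner ℝ (F.emb (q, x.2) - pair (x.1, 0)) (dx (dx F.emb S₀) S₀ (q, x.2) v v) +
          inner ℝ (dx F.emb S₀ (q, x.2) v) (dx F.emb S₀ (q, x.2) v)) 0 := by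
      have e1 : HasFDerivAt (fun y => F.emb (y, x.2)) (dx F.emb S₀ (q, x.2)) (q + (0 : ℝ) • v) := by
        rw [h0]; exact hasFDerivAt_dx hU (hemb.differentiableOn (by simp) _ hqS) hqS
      have e2 : HasFDerivAt (fun y => dx F.emb S₀ (y, x.2)) (dx (dx F.emb S₀) S₀ (q, x.2)) (q + (0 : ℝ) • v) := by
        rw [h0]; exact hasFDerivAt_dx hU (hdx.differentiableOn (by simp) _ hqS) hqS
      have e3 : HasDerivAt (fun s : ℝ => F.emb (q + s • v, x.2) - pair (x.1, 0)) (dx F.emb S₀ (q, x.2) v) 0 :=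
        (e1.comp_hasDerivAt (0 : ℝ) hline).sub_const (pair (x.1, 0))
      have e4 : HasDerivAt (fun s : ℝ => dx F.emb S₀ (q + s • v, x.2)) (dx (dx F.emb S₀) S₀ (q, x.2) v) 0 :=
        HasFDerivAt.comp_hasDerivAt (l := fun y => dx F.emb S₀ (y, x.2)) (f := fun s : ℝ => q + s • v) (0 : ℝ) e2 hline
      have e4' : HasDerivAt (fun s : ℝ => dx F.emb S₀ (q + s • v, x.2) v) (dx (dx F.emb S₀) S₀ (q, x.2) v v) 0 := by
        have := e4.clm_apply (hasDerivAt_const (0 : ℝ) v)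
        rwa [map_zero, add_zero] at this
      have e5 := HasDerivAt.inner ℝ e3 e4'
      rw [h0] at e5
      exact e5
    have d3 := d1.unique (by simpa only [hGv] using d2)
    rw [hembP x hx, real_inner_self_eq_norm_sq] at d3
    have h1 := abs_real_inner_le_norm (pair (F.X q x.2 - x.1, 0)) (dx (dx F.emb S₀) S₀ (q, x.2) v v)
    have h2 := neg_le_of_abs_le h1
    rw [norm_pair_zero] at h2
    have h3 : ‖dx (dx F.emb S₀) S₀ (q, x.2) v v‖ ≤ |C| * ‖v‖ * ‖v‖ :=
      ((dx (dx F.emb S₀) S₀ (q, x.2)).le_opNorm₂ v v).trans (by gcongr; exact (hC (q, x.2) ⟨hq, hx2⟩).trans (le_abs_self C))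
    have h4 : ‖F.X q x.2 - x.1‖ ≤ c ^ 2 / (2 * (|C| + 1)) := (F.norm_par_lt hΓ hx).le.trans (min_le_right _ _)
    have h5 := pow_le_pow_left₀ (by positivity) (hcle (q, x.2) ⟨hq, hx2⟩ v) 2
    have h6 : ‖F.X q x.2 - x.1‖ * ‖dx (dx F.emb S₀) S₀ (q, x.2) v v‖ ≤ c ^ 2 / (2 * (|C| + 1)) * (|C| * ‖v‖ * ‖v‖) := by
      gcongr
    have h7 : c ^ 2 / (2 * (|C| + 1)) * (|C| * ‖v‖ * ‖v‖) ≤ c ^ 2 / 2 * ‖v‖ ^ 2 := by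
      rw [show c ^ 2 / (2 * (|C| + 1)) * (|C| * ‖v‖ * ‖v‖) = c ^ 2 / 2 * ‖v‖ ^ 2 * (|C| / (|C| + 1)) by field_simp]
      exact mul_le_of_le_one_right (by positivity) ((div_le_one (by positivity)).2 (by linarith))
    have h8 : c ^ 2 * ‖v‖ ^ 2 ≤ 0 := by nlinarith
    have h9 : ‖v‖ = 0 := by
      by_contra hne
      have : 0 < ‖v‖ := lt_of_le_of_ne (norm_nonneg _) (Ne.symm hne)
      have : 0 < c ^ 2 * ‖v‖ ^ 2 := by positivity
      linarith
    exact norm_eq_zero.1 h9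

end MeanCurvatureFlow

/-! ### Smoothness of the outer normal and the mean curvature -/

/-- The vector product of three-space. -/
def cross (a b : E3) : E3 := !₂[a 1 * b 2 - a 2 * b 1, a 2 * b 0 - a 0 * b 2, a 0 * b 1 - a 1 * b 0]

lemma inner_E3 (a b : E3) : inner ℝ a b = a 0 * b 0 + a 1 * b 1 + a 2 * b 2 := by
  simp [PiLp.inner_apply, Fin.sum_univ_three]; ring

lemma inner_cross_left (a b : E3) : inner ℝ a (cross a b) = 0 := by
  simp [inner_E3, cross]; ring

lemma inner_cross_right (a b : E3) : inner ℝ b (cross a b) = 0 := by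
  simp [inner_E3, cross]; ring

lemma contDiff_cross {n : WithTop ℕ∞} : ContDiff ℝ n fun p : E3 × E3 => cross p.1 p.2 := by
  have h1 : ∀ i : Fin 3, ContDiff ℝ n fun p : E3 × E3 => p.1 i := fun i =>
    (contDiff_euclidean.1 (contDiff_fst (𝕜 := ℝ) (E := E3) (F := E3)) i)
  have h2 : ∀ i : Fin 3, ContDiff ℝ n fun p : E3 × E3 => p.2 i := fun i =>
    (contDiff_euclidean.1 (contDiff_snd (𝕜 := ℝ) (E := E3) (F := E3)) i)
  rw [contDiff_euclidean]
  intro i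
  fin_cases i
  · exact ((h1 1).mul (h2 2)).sub ((h1 2).mul (h2 1))
  · exact ((h1 2).mul (h2 0)).sub ((h1 0).mul (h2 2))
  · exact ((h1 0).mul (h2 1)).sub ((h1 1).mul (h2 0))

/-- Vectors orthogonal to `a` and `b` are parallel to the vector product. -/
lemma smul_eq_of_orthogonal {a b n : E3} (ha : inner ℝ n a = 0) (hb : inner ℝ n b = 0) :
    ‖cross a b‖ ^ 2 • n = inner ℝ n (cross a b) • cross a b := by
  rw [inner_E3] at ha hb
  rw [← real_inner_self_eq_norm_sq, inner_E3, inner_E3]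
  ext i
  fin_cases i <;> simp [cross]
  · linear_combination (-((a 1 * b 2 - a 2 * b 1) * 0) + (a 0 * (b 1 ^ 2 + b 2 ^ 2) - b 0 * (a 1 * b 1 + a 2 * b 2))) * ha + (b 0 * (a 1 ^ 2 + a 2 ^ 2) - a 0 * (a 1 * b 1 + a 2 * b 2)) * hb
  · linear_combination (a 1 * (b 0 ^ 2 + b 2 ^ 2) - b 1 * (a 0 * b 0 + a 2 * b 2)) * ha + (b 1 * (a 0 ^ 2 + a 2 ^ 2) - a 1 * (a 0 * b 0 + a 2 * b 2)) * hb
  · linear_combination (a 2 * (b 0 ^ 2 + b 1 ^ 2) - b 2 * (a 0 * b 0 + a 1 * b 1)) * ha + (b 2 * (a 0 ^ 2 + a 1 ^ 2) - a 2 * (a 0 * b 0 + a 1 * b 1)) * hb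

lemma inner_mul_inner_sub (a b : E3) :
    inner ℝ a a * inner ℝ b b - inner ℝ a b ^ 2 = ‖cross a b‖ ^ 2 := by
  rw [← real_inner_self_eq_norm_sq, inner_E3, inner_E3, inner_E3, inner_E3]
  simp [cross]; ring

/-- There are two orthogonal vectors orthogonal to a given unit vector. -/
lemma exists_orthogonal_pair {ν : E3} (hν : ‖ν‖ = 1) :
    ∃ a b : E3, a ≠ 0 ∧ b ≠ 0 ∧ inner ℝ a b = 0 ∧ inner ℝ ν a = 0 ∧ inner ℝ ν b = 0 := by
  have hνν : inner ℝ ν ν = 1 := by rw [real_inner_self_eq_norm_sq, hν]; norm_num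
  obtain ⟨e, he⟩ : ∃ e, cross ν e ≠ 0 := by
    by_contra! h
    have h0 := h (EuclideanSpace.single 0 1)
    have h1 := h (EuclideanSpace.single 1 1)
    have e1 := congrArg (fun v : E3 => v 1) h0
    have e2 := congrArg (fun v : E3 => v 2) h0
    have e3 := congrArg (fun v : E3 => v 2) h1
    simp [cross] at e1 e2 e3
    rw [inner_E3, e1, e2, e3] at hνν
    norm_num at hνν
  refine ⟨cross ν e, cross ν (cross ν e), he, fun h => he ?_, inner_cross_right _ _, inner_cross_left _ _,
    inner_cross_left _ _⟩
  have h1 := inner_mul_inner_sub ν (cross ν e)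
  rw [h, norm_zero, hνν, inner_cross_left] at h1
  have h2 : inner ℝ (cross ν e) (cross ν e) = 0 := by linarith
  exact inner_self_eq_zero.1 h2

namespace MeanCurvatureFlow

variable {Γ₀ : Set E3} {T : ℝ} {m : ℕ} (F : MeanCurvatureFlow Γ₀ T m)

/-- Compact sets which avoid the surface at one time avoid it at nearby times. -/
lemma eventually_disjoint_surface (hΓ : IsSmoothClosedSurface Γ₀) {t₀ : ℝ} (ht₀ : t₀ ∈ Icc 0 T) {K : Set E3}
    (hK : IsClosed K) (h : Disjoint K (F.surface t₀)) : ∀ᶠ t in 𝓝 t₀, t ∈ Icc 0 T → Disjoint K (F.surface t) := by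
  have h1 : ∀ᶠ t in 𝓝 t₀, ∀ q ∈ Γ₀, t ∈ Icc 0 T → q ∈ Γ₀ → F.X q t ∉ K := by
    refine hΓ.1.eventually_forall_of_forall_eventually fun q hq => ?_
    have h2 : ∀ᶠ z in 𝓝[Γ₀ ×ˢ Icc 0 T] (q, t₀), F.X z.1 z.2 ∈ Kᶜ :=
      (F.contDiffOn.continuousOn (q, t₀) ⟨hq, ht₀⟩).eventually
        (hK.isOpen_compl.mem_nhds fun hmem => disjoint_left.1 h hmem (mem_image_of_mem _ hq))
    rw [eventually_nhdsWithin_iff] at h2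
    have h3 := (continuous_swap.tendsto (t₀, q)).eventually h2
    filter_upwards [h3] with z hz h4 h5 using hz ⟨h5, h4⟩
  filter_upwards [h1] with t ht htI
  rw [disjoint_right]
  rintro _ ⟨q, hq, rfl⟩
  exact ht q hq htI hq

/-- Points outside the surface at one time have a neighbourhood which is outside at nearby times. -/
lemma exists_ball_subset_outside (hΓ : IsSmoothClosedSurface Γ₀) {t₀ : ℝ} (ht₀ : t₀ ∈ Icc 0 T) {z₀ : E3}
    (hz₀ : z₀ ∈ outside (F.surface t₀)) :
    ∃ ε > 0, ∀ᶠ t in 𝓝 t₀, t ∈ Icc 0 T → Metric.ball z₀ ε ⊆ outside (F.surface t) := by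
  obtain ⟨R, hR, hRle⟩ : ∃ R > 0, ∀ q ∈ Γ₀, ∀ t ∈ Icc 0 T, ‖F.X q t‖ ≤ R := by
    obtain ⟨R, hR, h⟩ := ((hΓ.1.prod isCompact_Icc).image_of_continuousOn F.contDiffOn.continuousOn).isBounded.exists_pos_norm_le
    exact ⟨R, hR, fun q hq t ht => h _ ⟨(q, t), ⟨hq, ht⟩, rfl⟩⟩
  have hopen : IsOpen (F.surface t₀)ᶜ := (F.isCompact_surface hΓ ht₀).isClosed.isOpen_compl
  set C := connectedComponentIn (F.surface t₀)ᶜ z₀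
  have hCo : IsOpen C := hopen.connectedComponentIn
  have hCc : IsConnected C := isConnected_connectedComponentIn_iff.2 hz₀.1
  have hz₀C : z₀ ∈ C := mem_connectedComponentIn hz₀.1
  have hCs : C ⊆ (F.surface t₀)ᶜ := connectedComponentIn_subset _ _
  obtain ⟨w, hwC, hw⟩ : ∃ w ∈ C, R < ‖w‖ := by
    by_contra! h
    exact hz₀.2 ((Metric.isBounded_closedBall (x := (0 : E3)) (r := R)).subset fun w hw => by simpa using h w hw)
  obtain ⟨γ, hγ⟩ := (hCo.isConnected_iff_isPathConnected.1 hCc).joinedIn z₀ hz₀C w hwC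
  obtain ⟨ε, hε, hεC⟩ := Metric.nhds_basis_closedBall.mem_iff.1 (hCo.mem_nhds hz₀C)
  have hK : IsClosed (Metric.closedBall z₀ ε ∪ range γ) :=
    Metric.isClosed_closedBall.union (isCompact_range γ.continuous).isClosed
  have hdisj : Disjoint (Metric.closedBall z₀ ε ∪ range γ) (F.surface t₀) := by
    rw [← subset_compl_iff_disjoint_right]
    exact (union_subset hεC (by rintro _ ⟨s, rfl⟩; exact hγ s)).trans hCs
  refine ⟨ε, hε, ?_⟩
  filter_upwards [F.eventually_disjoint_surface hΓ ht₀ hK hdisj] with t ht htI z hz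
  have hd := ht htI
  rw [← subset_compl_iff_disjoint_right, union_subset_iff] at hd
  set ray : Set E3 := (fun r : ℝ => r • w) '' Ici 1
  have hray : ray ⊆ (F.surface t)ᶜ := by
    rintro _ ⟨r, hr, rfl⟩ ⟨q, hq, h⟩
    have h1 := hRle q hq t htI
    beta_reduce at h
    rw [h, norm_smul, Real.norm_eq_abs, abs_of_nonneg (zero_le_one.trans hr)] at h1
    have hr' : 1 ≤ r := hr
    nlinarith [norm_nonneg w]
  set A := (Metric.ball z₀ ε ∪ range γ) ∪ ray
  have hA : IsPreconnected A := by
    refine IsPreconnected.union w (Or.inr ⟨1, γ.target⟩) ⟨1, self_mem_Ici, one_smul _ _⟩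
      (IsPreconnected.union z₀ (Metric.mem_ball_self hε) ⟨0, γ.source⟩ (convex_ball z₀ ε).isPreconnected
        (isPreconnected_range γ.continuous)) ?_
    exact isPreconnected_Ici.image _ (by fun_prop)
  have hAs : A ⊆ (F.surface t)ᶜ :=
    union_subset (union_subset (Metric.ball_subset_closedBall.trans hd.1) hd.2) hray
  have hzA : z ∈ A := Or.inl (Or.inl hz)
  refine ⟨hAs hzA, fun hb => ?_⟩
  have hb' := hb.subset (subset_union_right.trans (hA.subset_connectedComponentIn hzA hAs))
  obtain ⟨M, hM, hMle⟩ := hb'.exists_pos_norm_le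
  have hw0 : 0 < ‖w‖ := hR.trans hw
  have h1 := hMle ((M / ‖w‖ + 1) • w) ⟨M / ‖w‖ + 1, by simpa using (by positivity : 0 ≤ M / ‖w‖), rfl⟩
  rw [norm_smul, Real.norm_eq_abs, abs_of_nonneg (by positivity), add_mul, div_mul_cancel₀ _ hw0.ne'] at h1
  linarith

/-- Derivatives of the flow map along the initial surface are tangent to the surface. -/
lemma inner_dx_Xe_of_normal (hΓ : IsSmoothClosedSurface Γ₀) (hm : 1 ≤ m) {O : Set E3} (hO : IsOpen O)
    (hΓO : Γ₀ ⊆ O) (hπ : ContDiffOn ℝ m (nearestPoint Γ₀) O) {q : E3} (hq : q ∈ Γ₀) {t : ℝ} (ht : t ∈ Icc 0 T)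
    (v : E3) : inner ℝ (F.ν t (F.X q t)) (dx F.Xe (slab (O ×ˢ univ) T) (q, t) v) = 0 := by
  have hm' : ((m : ℕ) : WithTop ℕ∞) ≠ 0 := by norm_cast; omega
  have hmem := mem_slab_of_mem (T := T) hΓO hq ht
  have h1 : HasFDerivAt (fun y => F.Xe (y, t)) (dx F.Xe (slab (O ×ˢ univ) T) (q, t)) q :=
    hasFDerivAt_dx (hO.prod isOpen_univ) (((F.contDiffOn_Xe hΓ hπ).differentiableOn hm') _ hmem) hmem
  refine (F.normal t ht _ (mem_image_of_mem _ hq)).orthogonal _ ?_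
  have h4 := (h1.hasFDerivWithinAt (s := univ)).mapsTo_tangent_cone (show v ∈ tangentConeAt ℝ univ q by
    rw [tangentConeAt_univ]; trivial)
  rw [F.Xe_of_mem hΓ.1 hq] at h4
  refine tangentConeAt_mono ?_ h4
  rintro _ ⟨y, -, rfl⟩
  exact mem_image_of_mem _ (nearestPoint_mem hΓ.1 hΓ.2.1 y)

/-- The normal segments of some length uniform in the parameters meet the surface only at their base points. -/
lemma exists_normal_segment (hT : 0 < T) (hΓ : IsSmoothClosedSurface Γ₀) (hm : 2 ≤ m) {O : Set E3} (hO : IsOpen O)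
    (hΓO : Γ₀ ⊆ O) (hπ : ContDiffOn ℝ m (nearestPoint Γ₀) O) :
    ∃ s₁ > (0 : ℝ), ∀ t ∈ Icc 0 T, ∀ q ∈ Γ₀, ∀ n : E3, ‖n‖ = 1 →
      (∀ v, inner ℝ n (dx F.Xe (slab (O ×ˢ univ) T) (q, t) v) = 0) → ∀ s ∈ Ioc 0 s₁, F.X q t + s • n ∉ F.surface t := by
  obtain ⟨c, hc, hcle⟩ := F.exists_mul_dist_le hT hΓ hm
  obtain ⟨r₀, hr₀, C, hC, htay⟩ := exists_taylor_slab hO hT ((F.contDiffOn_Xe hΓ hπ).of_le (by exact_mod_cast hm))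
    hΓ.1 hΓO
  refine ⟨min (c * r₀) (c ^ 2 / (2 * (C + 1))), lt_min (by positivity) (by positivity), ?_⟩
  rintro t ht q hq n hn hort s ⟨hs, hs₁⟩ ⟨p, hp, h⟩
  have hs1 := hs₁.trans (min_le_left _ _)
  have hs2 := hs₁.trans (min_le_right _ _)
  beta_reduce at h
  have hd : F.X p t - F.X q t = s • n := by rw [h, add_sub_cancel_left]
  have h1 := hcle t ht p hp q hq
  rw [hd, norm_smul, hn, mul_one, Real.norm_eq_abs, abs_of_pos hs] at h1
  have hv : ‖p - q‖ ≤ r₀ := by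
    by_contra! hlt
    nlinarith
  have h2 := (htay q hq (p - q) hv t ht).2
  rw [add_sub_cancel, F.Xe_of_mem hΓ.1 hp, F.Xe_of_mem hΓ.1 hq, hd] at h2
  have h3 := abs_real_inner_le_norm n (s • n - dx F.Xe (slab (O ×ˢ univ) T) (q, t) (p - q))
  rw [inner_sub_right, hort, inner_smul_right, real_inner_self_eq_norm_sq, hn, one_pow, mul_one, sub_zero, one_mul,
    abs_of_pos hs] at h3
  have h4 : s ≤ C * ‖p - q‖ ^ 2 := h3.trans h2
  rw [le_div_iff₀ (by positivity)] at hs2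
  have h5 : (c * ‖p - q‖) ^ 2 ≤ s ^ 2 := by gcongr
  have h6 : c ^ 2 * s ≤ C * s ^ 2 := by nlinarith
  have h7 : c ^ 2 ≤ C * s := by
    have : s * c ^ 2 ≤ s * (C * s) := by nlinarith
    exact le_of_mul_le_mul_left this hs
  nlinarith [sq_pos_of_pos hc]

/-- The outer unit normal is as smooth as the derivative of the flow map. Locally it is, up to a sign, the normalized
vector product of two tangent vectors; the sign is constant because being outside of the surface is stable. -/
lemma contDiffOn_normal (hT : 0 < T) (hΓ : IsSmoothClosedSurface Γ₀) {n : ℕ} (hn : 1 ≤ n) (hm : n + 1 ≤ m) :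
    ContDiffOn ℝ n (fun x : E3 × ℝ => F.ν x.2 (F.X x.1 x.2)) (Γ₀ ×ˢ Icc 0 T) := by
  obtain ⟨O, hO, hΓO, hπ⟩ := exists_isOpen_contDiffOn_nearestPoint hΓ m
  obtain ⟨s₁, hs₁, hseg⟩ := F.exists_normal_segment hT hΓ (by omega) hO hΓO hπ
  have hU : IsOpen (O ×ˢ (univ : Set ℝ)) := hO.prod isOpen_univ
  set S₀ := slab (O ×ˢ (univ : Set ℝ)) T
  have hX : ContDiffOn ℝ (n + 1 : ℕ) F.Xe S₀ := (F.contDiffOn_Xe hΓ hπ).of_le (by exact_mod_cast hm)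
  have hL : ContDiffOn ℝ n (dx F.Xe S₀) S₀ := contDiffOn_dx hU hT hX
  have hKS : Γ₀ ×ˢ Icc 0 T ⊆ S₀ := fun x hx => mem_slab_of_mem hΓO hx.1 hx.2
  rintro ⟨q₀, t₀⟩ ⟨hq₀, ht₀⟩
  obtain ⟨-, ν₀, hν₀, hDπ⟩ := contDiffAt_nearestPoint hΓ hq₀ 1
  obtain ⟨a, b, ha, hb, hab, hνa, hνb⟩ := exists_orthogonal_pair hν₀
  have htan : ∀ v, inner ℝ ν₀ v = 0 → dx F.Xe S₀ (q₀, t₀) v = 0 → v = 0 := by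
    intro v h1 h2
    rw [F.dx_Xe_apply hΓ (by omega) hO hΓO hπ hq₀ ht₀] at h2
    have h3 := F.immersion t₀ ht₀ q₀ hq₀ _ (fderiv_nearestPoint_mem_tangentConeAt hΓ hq₀ v) h2
    rwa [hDπ, h1, zero_smul, sub_zero] at h3
  set N : E3 × ℝ → E3 := fun x => cross (dx F.Xe S₀ x a) (dx F.Xe S₀ x b)
  have hNc : ContDiffOn ℝ n N S₀ :=
    contDiff_cross.comp_contDiffOn ((hL.clm_apply contDiffOn_const).prodMk (hL.clm_apply contDiffOn_const))
  have hN0 : N (q₀, t₀) ≠ 0 := by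
    intro h
    set La := dx F.Xe S₀ (q₀, t₀) a
    set Lb := dx F.Xe S₀ (q₀, t₀) b
    have h1 := inner_mul_inner_sub La Lb
    rw [show cross La Lb = 0 from h, norm_zero, zero_pow two_ne_zero] at h1
    have h2 : inner ℝ Lb Lb • a - inner ℝ La Lb • b = 0 := by
      refine htan _ (by rw [inner_sub_right, inner_smul_right, inner_smul_right, hνa, hνb]; ring) ?_
      rw [map_sub, map_smul, map_smul]
      refine (inner_self_eq_zero (𝕜 := ℝ)).1 ?_
      change inner ℝ (inner ℝ Lb Lb • La - inner ℝ La Lb • Lb) (inner ℝ Lb Lb • La - inner ℝ La Lb • Lb) = (0 : ℝ)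
      simp only [inner_sub_left, inner_sub_right, real_inner_smul_left, real_inner_smul_right, real_inner_comm La Lb]
      linear_combination inner ℝ Lb Lb * h1
    have h3 : inner ℝ Lb Lb * inner ℝ a a = 0 := by
      have h4 := congrArg (fun v => inner ℝ v a) h2
      simpa [inner_sub_left, real_inner_smul_left, real_inner_comm a b, hab] using h4
    rcases mul_eq_zero.1 h3 with h4 | h4
    · exact hb (htan b hνb (inner_self_eq_zero.1 h4))
    · exact ha (inner_self_eq_zero.1 h4)
  set n₀ := F.ν t₀ (F.X q₀ t₀)
  have hn₀ := F.normal t₀ ht₀ _ (mem_image_of_mem (fun p => F.X p t₀) hq₀)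
  -- the continuous normal field which agrees with the outer normal at the base point
  set σ : ℝ := inner ℝ n₀ (N (q₀, t₀)) / ‖N (q₀, t₀)‖
  set M : E3 × ℝ → E3 := fun x => (σ / ‖N x‖) • N x
  have hort : ∀ x ∈ Γ₀ ×ˢ Icc 0 T, ‖N x‖ ^ 2 • F.ν x.2 (F.X x.1 x.2) = inner ℝ (F.ν x.2 (F.X x.1 x.2)) (N x) • N x :=
    fun x hx => smul_eq_of_orthogonal
      (F.inner_dx_Xe_of_normal hΓ (by omega) hO hΓO hπ hx.1 hx.2 a) (F.inner_dx_Xe_of_normal hΓ (by omega) hO hΓO hπ hx.1 hx.2 b)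
  have hM0 : M (q₀, t₀) = n₀ := by
    have h1 := hort (q₀, t₀) ⟨hq₀, ht₀⟩
    have h2 : ‖N (q₀, t₀)‖ ≠ 0 := norm_ne_zero_iff.2 hN0
    have h3 : n₀ = (‖N (q₀, t₀)‖ ^ 2)⁻¹ • (inner ℝ n₀ (N (q₀, t₀)) • N (q₀, t₀)) := by
      rw [← h1, smul_smul, inv_mul_cancel₀ (by positivity), one_smul]
    change (inner ℝ n₀ (N (q₀, t₀)) / ‖N (q₀, t₀)‖ / ‖N (q₀, t₀)‖) • N (q₀, t₀) = n₀
    conv_rhs => rw [h3, smul_smul]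
    congr 1
    field_simp
  have hNne : ∀ᶠ x in 𝓝[S₀] (q₀, t₀), N x ≠ 0 :=
    (hNc.continuousOn _ (hKS ⟨hq₀, ht₀⟩)).eventually (isOpen_ne.mem_nhds hN0)
  have hσ : |σ| = 1 := by
    have h1 : ‖M (q₀, t₀)‖ = 1 := by rw [hM0]; exact hn₀.norm_eq_one
    rwa [norm_smul, norm_div, norm_norm, div_mul_cancel₀ _ (norm_ne_zero_iff.2 hN0), Real.norm_eq_abs] at h1
  have hMc : ContDiffWithinAt ℝ n M S₀ (q₀, t₀) := by
    have h1 := hNc _ (hKS ⟨hq₀, ht₀⟩)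
    exact (contDiffWithinAt_const.div (h1.norm ℝ hN0) (norm_ne_zero_iff.2 hN0)).smul h1
  -- a point on the outer normal
  have hout : ∀ᶠ s in 𝓝[>] (0 : ℝ), s ≤ s₁ := by
    filter_upwards [Ioc_mem_nhdsGT hs₁] with s hs using hs.2
  obtain ⟨s₂, ⟨hs₂out, hs₂le⟩, hs₂⟩ := ((hn₀.outward.and hout).and self_mem_nhdsWithin).exists
  obtain ⟨ε, hε, hball⟩ := F.exists_ball_subset_outside hΓ ht₀ hs₂out.1
  have hcont : ∀ᶠ x in 𝓝[Γ₀ ×ˢ Icc 0 T] (q₀, t₀), F.X x.1 x.2 + s₂ • M x ∈ Metric.ball (F.X q₀ t₀ + s₂ • n₀) ε := by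
    have h1 : ContinuousWithinAt (fun x : E3 × ℝ => F.X x.1 x.2 + s₂ • M x) (Γ₀ ×ˢ Icc 0 T) (q₀, t₀) :=
      (F.contDiffOn.continuousOn (q₀, t₀) ⟨hq₀, ht₀⟩).add ((hMc.continuousWithinAt.mono hKS).const_smul s₂)
    refine h1.eventually (Metric.isOpen_ball.mem_nhds ?_)
    change F.X q₀ t₀ + s₂ • M (q₀, t₀) ∈ _
    rw [hM0]
    exact Metric.mem_ball_self hε
  refine (hMc.mono hKS).congr_of_eventuallyEq_of_mem ?_ ⟨hq₀, ht₀⟩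
  have hball' : ∀ᶠ x in 𝓝[Γ₀ ×ˢ Icc 0 T] (q₀, t₀), x.2 ∈ Icc 0 T →
      Metric.ball (F.X q₀ t₀ + s₂ • n₀) ε ⊆ outside (F.surface x.2) :=
    ((continuous_snd.tendsto (q₀, t₀)).eventually hball).filter_mono inf_le_left
  filter_upwards [hcont, hball', hNne.filter_mono (nhdsWithin_mono _ hKS), self_mem_nhdsWithin] with x h1 h2 h3 hx
  set ν := F.ν x.2 (F.X x.1 x.2)
  have hνx := F.normal x.2 hx.2 _ (mem_image_of_mem (fun p => F.X p x.2) hx.1)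
  have hMn : ‖M x‖ = 1 := by
    rw [norm_smul, norm_div, norm_norm, div_mul_cancel₀ _ (norm_ne_zero_iff.2 h3), Real.norm_eq_abs, hσ]
  have hpar : ν = inner ℝ ν (M x) • M x := by
    have h4 := hort x hx
    have h5 : ‖N x‖ ≠ 0 := norm_ne_zero_iff.2 h3
    have h6 : ν = (‖N x‖ ^ 2)⁻¹ • (inner ℝ ν (N x) • N x) := by
      rw [← h4, smul_smul, inv_mul_cancel₀ (by positivity), one_smul]
    have hσ2 : σ ^ 2 = 1 := by rw [← sq_abs, hσ, one_pow]
    conv_lhs => rw [h6]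
    rw [real_inner_smul_right, smul_smul, smul_smul]
    congr 1
    field_simp
    rw [hσ2, mul_one]
  have habs : |inner ℝ ν (M x)| = 1 := by
    have h4 : ‖ν‖ = 1 := hνx.norm_eq_one
    rwa [hpar, norm_smul, hMn, mul_one, Real.norm_eq_abs] at h4
  rcases (abs_eq zero_le_one).1 habs with h4 | h4
  · change ν = M x
    rw [hpar, h4, one_smul]
  · exfalso
    have hνM : ν = -M x := by rw [hpar, h4, neg_one_smul]
    obtain ⟨s, ⟨hs, hs2⟩, hs0⟩ := ((hνx.outward.and (show ∀ᶠ s in 𝓝[>] (0 : ℝ), s ≤ s₂ by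
      filter_upwards [Ioc_mem_nhdsGT hs₂] with s hs using hs.2)).and self_mem_nhdsWithin).exists
    have hin := hs.2
    change F.X x.1 x.2 - s • ν ∈ _ at hin
    rw [hνM, smul_neg, sub_neg_eq_add] at hin
    have ho := h2 hx.2 h1
    have hMort : ∀ v, inner ℝ (M x) (dx F.Xe S₀ x v) = 0 := by
      intro v
      have h5 := F.inner_dx_Xe_of_normal hΓ (by omega) hO hΓO hπ hx.1 hx.2 v
      change inner ℝ ν _ = 0 at h5
      rw [hνM, inner_neg_left, neg_eq_zero] at h5
      exact h5
    set A : Set E3 := (fun r : ℝ => F.X x.1 x.2 + r • M x) '' Ioc 0 s₂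
    have hA : IsPreconnected A := isPreconnected_Ioc.image _ (by fun_prop)
    have hAs : A ⊆ (F.surface x.2)ᶜ := by
      rintro _ ⟨r, hr, rfl⟩
      exact hseg x.2 hx.2 x.1 hx.1 (M x) hMn hMort r ⟨hr.1, hr.2.trans hs₂le⟩
    have hsA : F.X x.1 x.2 + s • M x ∈ A := ⟨s, ⟨hs0, hs2⟩, rfl⟩
    have hs₂A : F.X x.1 x.2 + s₂ • M x ∈ A := ⟨s₂, ⟨hs₂, le_rfl⟩, rfl⟩
    have h6 := connectedComponentIn_eq (hA.subset_connectedComponentIn hsA hAs hs₂A)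
    exact ho.2 (h6 ▸ hin.2)

/-- The time derivative of the flow map determines the mean curvature. -/
lemma H_eq (hT : 0 < T) (hΓ : IsSmoothClosedSurface Γ₀) (hm : 1 ≤ m) {O : Set E3}
    (hΓO : Γ₀ ⊆ O) (hπ : ContDiffOn ℝ m (nearestPoint Γ₀) O) {q : E3} (hq : q ∈ Γ₀) {t : ℝ} (ht : t ∈ Icc 0 T) :
    F.H t (F.X q t) = -inner ℝ (fderivWithin ℝ F.Xe (slab (O ×ˢ univ) T) (q, t) (0, 1)) (F.ν t (F.X q t)) := by
  have hm' : ((m : ℕ) : WithTop ℕ∞) ≠ 0 := by norm_cast; omega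
  have h1 : HasFDerivWithinAt F.Xe (fderivWithin ℝ F.Xe (slab (O ×ˢ univ) T) (q, t)) (slab (O ×ˢ univ) T) (q, t) :=
    ((F.contDiffOn_Xe hΓ hπ).differentiableOn hm' _ (mem_slab_of_mem hΓO hq ht)).hasFDerivWithinAt
  have h2 : HasDerivWithinAt (fun s : ℝ => (q, s)) (0, 1) (Icc 0 T) t :=
    (hasDerivWithinAt_const t (Icc 0 T) q).prodMk (hasDerivWithinAt_id t _)
  have h3 : HasDerivWithinAt (fun s => F.Xe (q, s)) (fderivWithin ℝ F.Xe (slab (O ×ˢ univ) T) (q, t) (0, 1))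
      (Icc 0 T) t := h1.comp_hasDerivWithinAt t h2 fun s hs => mem_slab_of_mem hΓO hq hs
  have h4 : HasDerivWithinAt (F.X q) (fderivWithin ℝ F.Xe (slab (O ×ˢ univ) T) (q, t) (0, 1)) (Icc 0 T) t := by
    simpa only [F.Xe_of_mem hΓ.1 hq] using h3
  have h5 : HasDerivWithinAt (F.X q) (-(F.H t (F.X q t)) • F.ν t (F.X q t)) (Icc 0 T) t := F.velocity t ht q hq
  rw [(uniqueDiffOn_Icc hT t ht).eq_deriv _ h4 h5, real_inner_smul_left, real_inner_self_eq_norm_sq,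
    (F.normal t ht _ (mem_image_of_mem (fun p => F.X p t) hq)).norm_eq_one]
  ring

lemma contDiffOn_u (hT : 0 < T) (hΓ : IsSmoothClosedSurface Γ₀) {n : ℕ} (hn : 1 ≤ n) (hm : n + 1 ≤ m) :
    ContDiffOn ℝ n (fun x : E3 × ℝ => F.u x.2 (F.X x.1 x.2)) (Γ₀ ×ˢ Icc 0 T) := by
  have hν := F.contDiffOn_normal hT hΓ hn hm
  have hνi := contDiffOn_euclidean.1 hν
  obtain ⟨O, hO, hΓO, hπ⟩ := exists_isOpen_contDiffOn_nearestPoint hΓ m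
  have hKS : Γ₀ ×ˢ Icc 0 T ⊆ slab (O ×ˢ univ) T := fun x hx => mem_slab_of_mem hΓO hx.1 hx.2
  have hX : ContDiffOn ℝ (n + 1 : ℕ) F.Xe (slab (O ×ˢ univ) T) := (F.contDiffOn_Xe hΓ hπ).of_le (by exact_mod_cast hm)
  have hD : ContDiffOn ℝ n (fderivWithin ℝ F.Xe (slab (O ×ˢ univ) T)) (slab (O ×ˢ univ) T) :=
    hX.fderivWithin (m := n) (uniqueDiffOn_slab (hO.prod isOpen_univ) hT) (by norm_cast)
  have hH : ContDiffOn ℝ n (fun x : E3 × ℝ => F.H x.2 (F.X x.1 x.2)) (Γ₀ ×ˢ Icc 0 T) :=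
    (((hD.mono hKS).clm_apply contDiffOn_const).inner ℝ hν).neg.congr fun x hx =>
      F.H_eq hT hΓ (by omega) hΓO hπ hx.1 hx.2
  rw [contDiffOn_pi]
  intro i
  fin_cases i
  · exact hνi 0
  · exact hνi 1
  · exact hνi 2
  · exact hH

/-- Near the surfaces, the nearest point map and the composition of `u = (ν, H)` with it are smooth functions of space
and time. -/
lemma exists_contDiffOn_lift (hT : 0 < T) (hΓ : IsSmoothClosedSurface Γ₀) {n : ℕ} (hn : 1 ≤ n) (hm : n + 2 ≤ m) :
    ∃ V, IsOpen V ∧ (∀ t ∈ Icc 0 T, ∀ q ∈ Γ₀, (F.X q t, t) ∈ V) ∧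
      ContDiffOn ℝ n (fun x => nearestPoint (F.surface x.2) x.1) (slab V T) ∧
      ContDiffOn ℝ n (fun x => F.u x.2 (nearestPoint (F.surface x.2) x.1)) (slab V T) := by
  obtain ⟨r, hr, hpar⟩ := F.exists_contDiffOn_par hT hΓ hn hm
  have hpar' : ContDiffOn ℝ n (fun x => (F.par x, x.2)) (slab (F.tube r) T) :=
    (hpar.of_le (by norm_cast; omega)).prodMk contDiffOn_snd
  have hmaps : ∀ x ∈ slab (F.tube r) T, (F.par x, x.2) ∈ Γ₀ ×ˢ Icc 0 T := fun x hx =>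
    ⟨(F.par_spec hΓ (mem_slab.1 hx).2).1, (mem_slab.1 hx).2⟩
  refine ⟨F.tube r, F.isOpen_tube hT r, fun t ht q hq => ?_, ?_, ?_⟩
  · exact (mem_slab.1 (F.mem_slab_tube.2 ⟨⟨q, hq, by simpa using hr⟩, ht⟩)).1
  · exact ((F.contDiffOn.of_le (by norm_cast; omega)).comp hpar' hmaps).congr fun x hx =>
      (F.par_spec hΓ (mem_slab.1 hx).2).2.symm
  · refine ((F.contDiffOn_u hT hΓ hn (by omega)).comp hpar' hmaps).congr fun x hx => ?_
    rw [← (F.par_spec hΓ (mem_slab.1 hx).2).2]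
    rfl

end MeanCurvatureFlow

/-! ### Bounded Lipschitz functions of time -/

section LipBdd

variable {E F : Type*} [NormedAddCommGroup E] [NormedAddCommGroup F]

/-- On `[0, T]`, the function `f` is bounded by `C` and Lipschitz continuous with constant `C`. -/
def LipBdd (T C : ℝ) (f : ℝ → E) : Prop :=
  (∀ t ∈ Icc 0 T, ‖f t‖ ≤ C) ∧ ∀ t ∈ Icc 0 T, ∀ s ∈ Icc 0 T, ‖f t - f s‖ ≤ C * |t - s|

lemma LipBdd.mono {T C C' : ℝ} {f : ℝ → E} (h : LipBdd T C f) (hC : C ≤ C') : LipBdd T C' f :=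
  ⟨fun t ht => (h.1 t ht).trans hC, fun t ht s hs => (h.2 t ht s hs).trans (by gcongr)⟩

lemma LipBdd.congr {T C : ℝ} {f g : ℝ → E} (h : LipBdd T C f) (hfg : ∀ t ∈ Icc 0 T, g t = f t) : LipBdd T C g :=
  ⟨fun t ht => by rw [hfg t ht]; exact h.1 t ht, fun t ht s hs => by rw [hfg t ht, hfg s hs]; exact h.2 t ht s hs⟩

lemma LipBdd.nonneg {T C : ℝ} (hT : 0 < T) {f : ℝ → E} (h : LipBdd T C f) : 0 ≤ C :=
  (norm_nonneg _).trans (h.1 0 ⟨le_rfl, hT.le⟩)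

lemma LipBdd.add {T C C' : ℝ} {f g : ℝ → E} (hf : LipBdd T C f) (hg : LipBdd T C' g) :
    LipBdd T (C + C') fun t => f t + g t :=
  ⟨fun t ht => (norm_add_le _ _).trans (add_le_add (hf.1 t ht) (hg.1 t ht)), fun t ht s hs => by
    rw [add_sub_add_comm, add_mul]
    exact (norm_add_le _ _).trans (add_le_add (hf.2 t ht s hs) (hg.2 t ht s hs))⟩

lemma LipBdd.neg {T C : ℝ} {f : ℝ → E} (hf : LipBdd T C f) : LipBdd T C fun t => -f t :=
  ⟨fun t ht => by rw [norm_neg]; exact hf.1 t ht, fun t ht s hs => by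
    rw [neg_sub_neg, norm_sub_rev]; exact hf.2 t ht s hs⟩

lemma LipBdd.sub {T C C' : ℝ} {f g : ℝ → E} (hf : LipBdd T C f) (hg : LipBdd T C' g) :
    LipBdd T (C + C') fun t => f t - g t := by
  simpa only [sub_eq_add_neg] using hf.add hg.neg

lemma lipBdd_const {T C : ℝ} {c : E} (h : ‖c‖ ≤ C) : LipBdd T C fun _ => c :=
  ⟨fun _ _ => h, fun t _ s _ => by
    rw [sub_self, norm_zero]; exact mul_nonneg ((norm_nonneg _).trans h) (abs_nonneg _)⟩

/-- Composition with a smooth field on a time slab maps bounded Lipschitz functions of time to such functions, and is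
Lipschitz in this norm. -/
lemma exists_lipBdd_comp [NormedSpace ℝ E] [NormedSpace ℝ F] [ProperSpace E] {T : ℝ} (hT : 0 < T) {Φ : E × ℝ → F} {V : Set (E × ℝ)} (hV : IsOpen V)
    (hΦ : ContDiffOn ℝ 2 Φ (slab V T)) {K : Set (E × ℝ)} (hK : IsCompact K) (hKV : K ⊆ slab V T) :
    ∃ C, 0 ≤ C ∧ ∀ (Y₁ Y₂ : ℝ → E) (B δ : ℝ), LipBdd T B Y₁ → LipBdd T B Y₂ → LipBdd T δ (fun t => Y₁ t - Y₂ t) →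
      (∀ t ∈ Icc 0 T, ∀ z ∈ segment ℝ (Y₁ t) (Y₂ t), (z, t) ∈ K) →
      LipBdd T (C * (1 + B)) (fun t => Φ (Y₁ t, t)) ∧
        LipBdd T (C * (1 + B) * δ) (fun t => Φ (Y₁ t, t) - Φ (Y₂ t, t)) := by
  obtain ⟨C₀, hC₀, hb₀, hl₀⟩ := exists_bound_lipschitz_slab hV (hΦ.of_le (by norm_num)) hK hKV
  obtain ⟨C₁, hC₁, hb₁, hl₁⟩ := exists_bound_lipschitz_slab hV (contDiffOn_dx (n := 1) hV hT (by exact_mod_cast hΦ)) hK hKV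
  have hpair : ∀ (a b : E) (t s B : ℝ), 0 ≤ B → ‖a - b‖ ≤ B * |t - s| → ‖(a, t) - (b, s)‖ ≤ (1 + B) * |t - s| := by
    intro a b t s B hB h
    rw [Prod.mk_sub_mk, Prod.norm_mk, Real.norm_eq_abs]
    have := mul_nonneg hB (abs_nonneg (t - s))
    exact max_le (by linarith [abs_nonneg (t - s)]) (by linarith)
  refine ⟨C₀ + 2 * C₁, by positivity, fun Y₁ Y₂ B δ h₁ h₂ hδ hseg => ⟨?_, ?_⟩⟩
  · have hB := h₁.nonneg hT
    have hmem : ∀ t ∈ Icc 0 T, (Y₁ t, t) ∈ K := fun t ht => hseg t ht _ (left_mem_segment ℝ _ _)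
    refine LipBdd.mono (C := C₀ * (1 + B)) ⟨fun t ht => (hb₀ _ (hmem t ht)).trans (by nlinarith), fun t ht s hs => ?_⟩
      (by nlinarith)
    refine (hl₀ _ (hmem t ht) _ (hmem s hs)).trans ?_
    rw [mul_assoc]
    gcongr
    exact hpair _ _ _ _ _ hB (h₁.2 t ht s hs)
  · have hB := h₁.nonneg hT
    have hδ0 := hδ.nonneg hT
    set z : ℝ → ℝ → E := fun t r => Y₂ t + r • (Y₁ t - Y₂ t)
    have hz : ∀ t ∈ Icc 0 T, ∀ r ∈ Icc (0 : ℝ) 1, (z t r, t) ∈ K := fun t ht r hr => by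
      refine hseg t ht _ ?_
      rw [segment_symm, segment_eq_image']
      exact ⟨r, hr, rfl⟩
    have hd : ∀ t ∈ Icc 0 T, ∀ r ∈ Icc (0 : ℝ) 1, HasDerivAt (fun r => Φ (z t r, t))
        (dx Φ (slab V T) (z t r, t) (Y₁ t - Y₂ t)) r := by
      intro t ht r hr
      have h3 := hasFDerivAt_dx hV (hΦ.differentiableOn (by simp) _ (hKV (hz t ht r hr))) (hKV (hz t ht r hr))
      have h4 : HasDerivAt (z t) (Y₁ t - Y₂ t) r := by
        have h5 := ((hasDerivAt_id r).smul_const (Y₁ t - Y₂ t)).const_add (Y₂ t)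
        rw [one_smul] at h5
        exact h5
      exact HasFDerivAt.comp_hasDerivAt (l := fun y => Φ (y, t)) (f := z t) r h3 h4
    have hz0 : ∀ t, z t 0 = Y₂ t := fun t => by simp [z]
    have hz1 : ∀ t, z t 1 = Y₁ t := fun t => by simp [z]
    have hbd : ∀ t ∈ Icc 0 T, ∀ r ∈ Icc (0 : ℝ) 1, ‖dx Φ (slab V T) (z t r, t) (Y₁ t - Y₂ t)‖ ≤ C₁ * δ := fun t ht r hr =>
      (ContinuousLinearMap.le_opNorm _ _).trans (mul_le_mul (hb₁ _ (hz t ht r hr)) (hδ.1 t ht) (norm_nonneg _) hC₁)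
    have hCB : C₁ * δ ≤ C₁ * (1 + B) * δ := by
      have := mul_nonneg (mul_nonneg hC₁ hB) hδ0
      nlinarith
    refine LipBdd.mono (C := 2 * (C₁ * (1 + B) * δ)) ⟨fun t ht => ?_, fun t ht s hs => ?_⟩ (by
      have := mul_nonneg (mul_nonneg hC₀ (by positivity : 0 ≤ 1 + B)) hδ0
      nlinarith)
    · have h3 := norm_image_sub_le_of_norm_deriv_le_segment_01' (f := fun r => Φ (z t r, t))
        (fun r hr => (hd t ht r hr).hasDerivWithinAt) (fun r hr => hbd t ht r ⟨hr.1, hr.2.le⟩)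
      beta_reduce at h3
      rw [hz0, hz1] at h3
      have := mul_nonneg hC₁ hδ0
      linarith
    · have h3 := norm_image_sub_le_of_norm_deriv_le_segment_01' (f := fun r => Φ (z t r, t) - Φ (z s r, s))
        (C := 2 * (C₁ * (1 + B) * δ) * |t - s|)
        (fun r hr => ((hd t ht r hr).sub (hd s hs r hr)).hasDerivWithinAt) (fun r hr => ?_)
      · beta_reduce at h3
        rw [hz0, hz1, hz0, hz1] at h3
        rw [sub_sub_sub_comm]
        exact h3
      · have hr' : r ∈ Icc (0 : ℝ) 1 := ⟨hr.1, hr.2.le⟩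
        have h4 : dx Φ (slab V T) (z t r, t) (Y₁ t - Y₂ t) - dx Φ (slab V T) (z s r, s) (Y₁ s - Y₂ s) =
            (dx Φ (slab V T) (z t r, t) - dx Φ (slab V T) (z s r, s)) (Y₁ t - Y₂ t) +
              dx Φ (slab V T) (z s r, s) ((Y₁ t - Y₂ t) - (Y₁ s - Y₂ s)) := by
          rw [sub_apply, map_sub _ (Y₁ t - Y₂ t)]; abel
        rw [h4]
        have h5 : ‖z t r - z s r‖ ≤ B * |t - s| := by
          have h6 : z t r - z s r = (1 - r) • (Y₂ t - Y₂ s) + r • (Y₁ t - Y₁ s) := by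
            simp only [z]; module
          rw [h6]
          refine (norm_add_le _ _).trans ?_
          rw [norm_smul, norm_smul, Real.norm_eq_abs, Real.norm_eq_abs, abs_of_nonneg (by linarith [hr.2]),
            abs_of_nonneg hr.1]
          nlinarith [h₁.2 t ht s hs, h₂.2 t ht s hs, hr.1, hr.2]
        have h6 : ‖dx Φ (slab V T) (z t r, t) - dx Φ (slab V T) (z s r, s)‖ ≤ C₁ * ((1 + B) * |t - s|) :=
          (hl₁ _ (hz t ht r hr') _ (hz s hs r hr')).trans (by gcongr; exact hpair _ _ _ _ _ hB h5)
        have h7 := (ContinuousLinearMap.le_opNorm (dx Φ (slab V T) (z t r, t) - dx Φ (slab V T) (z s r, s))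
          (Y₁ t - Y₂ t)).trans (mul_le_mul h6 (hδ.1 t ht) (norm_nonneg _) (by positivity))
        have h8 := (ContinuousLinearMap.le_opNorm (dx Φ (slab V T) (z s r, s)) ((Y₁ t - Y₂ t) - (Y₁ s - Y₂ s))).trans
          (mul_le_mul (hb₁ _ (hz s hs r hr')) (hδ.2 t ht s hs) (norm_nonneg _) hC₁)
        refine (norm_add_le _ _).trans ((add_le_add h7 h8).trans ?_)
        have h9 := mul_le_mul_of_nonneg_right hCB (abs_nonneg (t - s))
        nlinarith

end LipBdd

/-! ### Jets of fields along patches -/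

/-- The value (for `i = 0`) and the scaled partial derivatives (for `i = 1, 2`) of a patch with a given jet. -/
def jetPart (i : Fin 3) : Jet 3 →L[ℝ] E3 :=
  LinearMap.toContinuousLinearMap
    { toFun := fun X => WithLp.toLp 2 fun ℓ => X (ℓ, i)
      map_add' := fun _ _ => rfl
      map_smul' := fun _ _ => rfl }

lemma jetPart_apply (i : Fin 3) (X : Jet 3) (ℓ : Fin 3) : jetPart i X ℓ = X (ℓ, i) := rfl

lemma norm_jetPart_le (i : Fin 3) (X : Jet 3) : ‖jetPart i X‖ ≤ ‖X‖ := by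
  refine le_of_sq_le_sq ?_ (norm_nonneg _)
  rw [Jet.norm_sq_eq, EuclideanSpace.norm_sq_eq]
  refine Finset.sum_le_sum fun ℓ _ => ?_
  rw [jetPart_apply, Real.norm_eq_abs, sq_abs]
  have h0 := sq_nonneg (X (ℓ, 0))
  have h1 := sq_nonneg (X (ℓ, 1))
  have h2 := sq_nonneg (X (ℓ, 2))
  fin_cases i <;> simp <;> linarith

/-- A bound of a jet by a bound for its entries. -/
lemma Jet.norm_le {d : ℕ} {X : Jet d} {B : ℝ} (h : ∀ q, |X q| ≤ B) : ‖X‖ ≤ (d * 3 : ℕ) * B := by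
  have h1 : X = ∑ q, X q • EuclideanSpace.single q (1 : ℝ) := by
    ext q
    simp [Pi.single_apply]
  rw [h1]
  refine (norm_sum_le _ _).trans ((Finset.sum_le_card_nsmul _ _ B fun q _ => ?_).trans ?_)
  · rw [norm_smul, PiLp.norm_single, norm_one, mul_one]; exact h q
  · simp

/-- The jet of the composition of the field `Φ` with a patch, as a function of the jet of the patch and the
time. -/
def liftJ {d : ℕ} (Φ : E3 × ℝ → Fin d → ℝ) (S : Set (E3 × ℝ)) (p : Jet 3 × ℝ) : Jet d :=
  mkJet (Φ (jetPart 0 p.1, p.2)) (dx Φ S (jetPart 0 p.1, p.2) (jetPart 1 p.1))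
    (dx Φ S (jetPart 0 p.1, p.2) (jetPart 2 p.1))

lemma contDiff_jetPart_zero_prod {n : WithTop ℕ∞} :
    ContDiff ℝ n fun p : Jet 3 × ℝ => ((jetPart 0 p.1, p.2) : E3 × ℝ) :=
  ((jetPart 0).contDiff.comp contDiff_fst).prodMk contDiff_snd

lemma contDiffOn_liftJ {d : ℕ} {Φ : E3 × ℝ → Fin d → ℝ} {V : Set (E3 × ℝ)} {T : ℝ} (hV : IsOpen V) (hT : 0 < T) {n : ℕ}
    (hΦ : ContDiffOn ℝ (n + 1 : ℕ) Φ (slab V T)) :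
    ContDiffOn ℝ n (liftJ Φ (slab V T)) (slab ((fun p : Jet 3 × ℝ => (jetPart 0 p.1, p.2)) ⁻¹' V) T) := by
  have hmaps : MapsTo (fun p : Jet 3 × ℝ => ((jetPart 0 p.1, p.2) : E3 × ℝ))
      (slab ((fun p : Jet 3 × ℝ => (jetPart 0 p.1, p.2)) ⁻¹' V) T) (slab V T) := fun p hp =>
    mem_slab.2 ⟨(mem_slab.1 hp).1, (mem_slab.1 hp).2⟩
  have h1 := (hΦ.of_le (m := (n : WithTop ℕ∞)) (by norm_cast; omega)).comp contDiff_jetPart_zero_prod.contDiffOn hmaps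
  have h2 := (contDiffOn_dx hV hT hΦ).comp contDiff_jetPart_zero_prod.contDiffOn hmaps
  have h3 : ∀ i, ContDiffOn ℝ n (fun p : Jet 3 × ℝ => dx Φ (slab V T) (jetPart 0 p.1, p.2) (jetPart i p.1))
      (slab ((fun p : Jet 3 × ℝ => (jetPart 0 p.1, p.2)) ⁻¹' V) T) := fun i =>
    h2.clm_apply ((jetPart i).contDiff.comp contDiff_fst).contDiffOn
  exact contDiff_mkJet (fun ℓ => contDiffOn_pi.1 h1 ℓ) (fun ℓ => contDiffOn_pi.1 (h3 1) ℓ)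
    (fun ℓ => contDiffOn_pi.1 (h3 2) ℓ)

/-- The jet of the composition of a field with a patch. -/
lemma jetOf_comp {d : ℕ} {Φ : E3 × ℝ → Fin d → ℝ} {V : Set (E3 × ℝ)} {T : ℝ} (hV : IsOpen V)
    (hΦ : ContDiffOn ℝ 1 Φ (slab V T)) {Y : Plane → E3} {ξ : Plane} (hY : DifferentiableAt ℝ Y ξ) {t : ℝ}
    (hmem : (Y ξ, t) ∈ slab V T) (h : ℝ) :
    (∀ ℓ, DifferentiableAt ℝ (fun η => Φ (Y η, t) ℓ) ξ) ∧
      jetOf h (fun ℓ η => Φ (Y η, t) ℓ) ξ = liftJ Φ (slab V T) (jetOf h (fun ℓ η => Y η ℓ) ξ, t) := by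
  have h1 : HasFDerivAt (fun η => Φ (Y η, t)) ((dx Φ (slab V T) (Y ξ, t)).comp (fderiv ℝ Y ξ)) ξ :=
    HasFDerivAt.comp ξ (g := fun y => Φ (y, t)) (f := Y)
      (hasFDerivAt_dx hV (hΦ.differentiableOn (by simp) _ hmem) hmem) hY.hasFDerivAt
  have h2 := fun ℓ => (hasFDerivAt_pi'.1 h1) ℓ
  refine ⟨fun ℓ => (h2 ℓ).differentiableAt, ?_⟩
  have h0 : jetPart 0 (jetOf h (fun ℓ η => Y η ℓ) ξ) = Y ξ := rfl
  have h3 : ∀ a : Fin 2, jetPart a.succ (jetOf h (fun ℓ η => Y η ℓ) ξ) = h⁻¹ • fderiv ℝ Y ξ (Pi.single a 1) := by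
    intro a
    ext ℓ
    have h4 := patchDeriv_apply hY a ℓ
    rw [patchDeriv] at h4
    rw [jetPart_apply, PiLp.smul_apply, h4, smul_eq_mul]
    fin_cases a <;> rfl
  have h4 := h3 0
  have h5 := h3 1
  simp only [Fin.succ_zero_eq_one, Fin.succ_one_eq_two] at h4 h5
  rw [liftJ, h0, h4, h5]
  refine Jet.ext' fun ℓ => ⟨rfl, ?_, ?_⟩
  · simp only [jetOf, mkJet_one]
    rw [(h2 ℓ).fderiv]
    simp
  · simp only [jetOf, mkJet_two]
    rw [(h2 ℓ).fderiv]
    simp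

/-- A family of functions of time indexed by points of the reference triangle, which is bounded and Lipschitz
continuous in time and whose oscillation over the triangle is of order `h`. -/
def JetReg {W : Type*} [NormedAddCommGroup W] (T C h : ℝ) (J : Plane → ℝ → W) : Prop :=
  ∀ ξ ∈ refTriangle, LipBdd T C (J ξ) ∧ ∀ η ∈ refTriangle, LipBdd T (C * h) fun t => J ξ t - J η t

lemma JetReg.mono {W : Type*} [NormedAddCommGroup W] {T C C' h : ℝ} (hh : 0 ≤ h) {J : Plane → ℝ → W}
    (hJ : JetReg T C h J) (hC : C ≤ C') : JetReg T C' h J := fun ξ hξ =>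
  ⟨(hJ ξ hξ).1.mono hC, fun η hη => ((hJ ξ hξ).2 η hη).mono (by gcongr)⟩

/-- Families of order `h` close to a regular family are regular. -/
lemma JetReg.of_close {W : Type*} [NormedAddCommGroup W] {T C C' h : ℝ} (hC' : 0 ≤ C') (hh1 : h ≤ 1)
    {J J' : Plane → ℝ → W} (hJ : JetReg T C h J) (hd : ∀ ξ ∈ refTriangle, LipBdd T (C' * h) fun t => J' ξ t - J ξ t) :
    JetReg T (C + 2 * C') h J' := by
  intro ξ hξ
  constructor
  · refine (((hJ ξ hξ).1.add (hd ξ hξ)).mono ?_).congr fun t _ => by abel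
    nlinarith
  · intro η hη
    refine ((((hJ ξ hξ).2 η hη).add ((hd ξ hξ).sub (hd η hη))).mono (by linarith)).congr fun t _ => by abel

/-- The points at distance at most `r` from the moving points `β q`. -/
def tubeK (Γ : Set E3) (β : E3 → ℝ → E3) (T r : ℝ) : Set (E3 × ℝ) :=
  {x | x.2 ∈ Icc 0 T ∧ ∃ q ∈ Γ, ‖x.1 - β q x.2‖ ≤ r}

lemma isCompact_tubeK {Γ : Set E3} (hΓ : IsCompact Γ) {β : E3 → ℝ → E3} {T : ℝ}
    (hβ : ContinuousOn (Function.uncurry β) (Γ ×ˢ Icc 0 T)) (r : ℝ) : IsCompact (tubeK Γ β T r) := by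
  have h1 : IsCompact (Metric.closedBall (0 : E3) r ×ˢ (Γ ×ˢ Icc 0 T)) :=
    (isCompact_closedBall 0 r).prod (hΓ.prod isCompact_Icc)
  have h2 : ContinuousOn (fun x : E3 × (E3 × ℝ) => (β x.2.1 x.2.2 + x.1, x.2.2))
      (Metric.closedBall (0 : E3) r ×ˢ (Γ ×ˢ Icc 0 T)) :=
    ((hβ.comp (f := Prod.snd) continuousOn_snd fun x hx => hx.2).add continuousOn_fst).prodMk
      (continuous_snd.comp continuous_snd).continuousOn
  convert h1.image_of_continuousOn h2 using 1
  ext ⟨y, t⟩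
  constructor
  · rintro ⟨ht, q, hq, h⟩
    exact ⟨(y - β q t, (q, t)), ⟨by simpa using h, hq, ht⟩, by simp⟩
  · rintro ⟨⟨v, q, s⟩, ⟨hv, hq, hs⟩, h⟩
    obtain ⟨rfl, rfl⟩ := Prod.mk.inj h
    exact ⟨hs, q, hq, by simpa using hv⟩

lemma exists_tubeK_subset {Γ : Set E3} (hΓ : IsCompact Γ) {β : E3 → ℝ → E3} {T : ℝ}
    (hβ : ContinuousOn (Function.uncurry β) (Γ ×ˢ Icc 0 T)) {V : Set (E3 × ℝ)} (hV : IsOpen V)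
    (h : ∀ t ∈ Icc 0 T, ∀ q ∈ Γ, (β q t, t) ∈ V) : ∃ r > 0, tubeK Γ β T r ⊆ slab V T := by
  have hc : IsCompact ((fun x : E3 × ℝ => (β x.1 x.2, x.2)) '' (Γ ×ˢ Icc 0 T)) :=
    (hΓ.prod isCompact_Icc).image_of_continuousOn (ContinuousOn.prodMk (f := fun x : E3 × ℝ => β x.1 x.2) hβ continuousOn_snd)
  obtain ⟨r, hr, hrV⟩ := hc.exists_cthickening_subset_open hV (by rintro _ ⟨x, hx, rfl⟩; exact h _ hx.2 _ hx.1)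
  refine ⟨r, hr, fun x hx => mem_slab.2 ⟨hrV ?_, hx.1⟩⟩
  obtain ⟨ht, q, hq, hle⟩ := hx
  refine Metric.mem_cthickening_of_dist_le x (β q x.2, x.2) r _ ⟨(q, x.2), ⟨hq, ht⟩, rfl⟩ ?_
  rw [dist_eq_norm, show x - (β q x.2, x.2) = (x.1 - β q x.2, 0) by ext <;> simp, Prod.norm_mk, norm_zero,
    max_eq_left (norm_nonneg _)]
  exact hle

/-- Composition of regular patches with a smooth field gives regular families. -/
lemma exists_jetReg_liftJ {Γ : Set E3} (hΓ : IsCompact Γ) {β : E3 → ℝ → E3} {T : ℝ} (hT : 0 < T)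
    (hβ : ContinuousOn (Function.uncurry β) (Γ ×ˢ Icc 0 T)) {V : Set (E3 × ℝ)} (hV : IsOpen V) {r : ℝ}
    (hr : tubeK Γ β T r ⊆ slab V T) {d : ℕ} {Φ : E3 × ℝ → Fin d → ℝ} (hΦ : ContDiffOn ℝ 3 Φ (slab V T)) (R : ℝ) :
    ∃ C, 0 ≤ C ∧ ∀ (h : ℝ) (Y : Plane → ℝ → Jet 3), 0 ≤ h → JetReg T R h Y →
      (∃ q ∈ Γ, ∀ t ∈ Icc 0 T, ∀ ξ ∈ refTriangle, ‖jetPart 0 (Y ξ t) - β q t‖ ≤ r) →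
      JetReg T C h fun ξ t => liftJ Φ (slab V T) (Y ξ t, t) := by
  set V' : Set (Jet 3 × ℝ) := (fun p : Jet 3 × ℝ => (jetPart 0 p.1, p.2)) ⁻¹' V
  have hcont : Continuous fun p : Jet 3 × ℝ => ((jetPart 0 p.1, p.2) : E3 × ℝ) :=
    (contDiff_jetPart_zero_prod (n := 0)).continuous
  have hV' : IsOpen V' := hV.preimage hcont
  set K : Set (Jet 3 × ℝ) := (Metric.closedBall 0 R ×ˢ Icc 0 T) ∩ (fun p : Jet 3 × ℝ => (jetPart 0 p.1, p.2)) ⁻¹' tubeK Γ β T r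
  have hK : IsCompact K := ((isCompact_closedBall _ _).prod isCompact_Icc).inter_right
    ((isCompact_tubeK hΓ hβ r).isClosed.preimage hcont)
  have hKV : K ⊆ slab V' T := fun p hp => mem_slab.2 ⟨(mem_slab.1 (hr hp.2)).1, hp.1.2⟩
  obtain ⟨C, hC, h⟩ := exists_lipBdd_comp hT hV' (contDiffOn_liftJ (n := 2) hV hT (by exact_mod_cast hΦ)) hK hKV
  refine ⟨C * (1 + |R|) * (1 + |R|), by positivity, fun h' Y hh hY hq ξ hξ => ?_⟩
  obtain ⟨q, hq, hqr⟩ := hq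
  have hR : 0 ≤ R := (hY ξ hξ).1.nonneg hT
  rw [abs_of_nonneg hR]
  have hseg : ∀ η ∈ refTriangle, ∀ t ∈ Icc 0 T, ∀ z ∈ segment ℝ (Y ξ t) (Y η t), (z, t) ∈ K := by
    intro η hη t ht z hz
    refine ⟨⟨(convex_closedBall (0 : Jet 3) R).segment_subset ?_ ?_ hz, ht⟩, ht, q, hq, ?_⟩
    · simpa using (hY ξ hξ).1.1 t ht
    · simpa using (hY η hη).1.1 t ht
    · have h1 : jetPart 0 z ∈ Metric.closedBall (β q t) r := by
        refine (convex_closedBall (β q t) r).segment_subset (x := jetPart 0 (Y ξ t)) (y := jetPart 0 (Y η t)) ?_ ?_ ?_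
        · rw [mem_closedBall_iff_norm]; exact hqr t ht ξ hξ
        · rw [mem_closedBall_iff_norm]; exact hqr t ht η hη
        · have := mem_image_of_mem (jetPart 0).toLinearMap.toAffineMap hz
          rw [image_segment] at this
          exact this
      rwa [mem_closedBall_iff_norm] at h1
  constructor
  · refine ((h (Y ξ) (Y ξ) R 0 (hY ξ hξ).1 (hY ξ hξ).1 ?_ (hseg ξ hξ)).1).mono ?_
    · simpa using lipBdd_const (T := T) (C := 0) (c := (0 : Jet 3)) (by simp)
    · have : 0 ≤ C * (1 + R) := by positivity
      nlinarith
  · intro η hη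
    refine ((h (Y ξ) (Y η) R (R * h') (hY ξ hξ).1 (hY η hη).1 ((hY ξ hξ).2 η hη) (hseg η hη)).2).mono ?_
    have : 0 ≤ C * (1 + R) * h' := by positivity
    nlinarith

/-! ### Interpolation estimates -/

lemma jetOf_sub {d : ℕ} (h : ℝ) {f g : Fin d → Plane → ℝ} {ξ : Plane} (hf : ∀ ℓ, DifferentiableAt ℝ (f ℓ) ξ)
    (hg : ∀ ℓ, DifferentiableAt ℝ (g ℓ) ξ) :
    jetOf h (fun ℓ η => f ℓ η - g ℓ η) ξ = jetOf h f ξ - jetOf h g ξ := by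
  refine Jet.ext' fun ℓ => ?_
  simp only [jetOf, mkJet_zero, mkJet_one, mkJet_two, PiLp.sub_apply]
  rw [fderiv_fun_sub (hf ℓ) (hg ℓ)]
  simp [mul_sub]

/-- Lagrange interpolation on the reference triangle approximates a function and its derivative up to the oscillation of
the derivative. -/
lemma exists_interpolation_bound {k : ℕ} (hk : 1 ≤ k) : ∃ C, 0 ≤ C ∧ ∀ (g : Plane → ℝ) (κ : ℝ),
    (∀ ξ ∈ refTriangle, DifferentiableAt ℝ g ξ) →
    (∀ ξ ∈ refTriangle, ∀ η ∈ refTriangle, ∀ a : Fin 2,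
      |fderiv ℝ g ξ (Pi.single a 1) - fderiv ℝ g η (Pi.single a 1)| ≤ κ) →
    ∀ ξ ∈ refTriangle, |lag k (fun α => g (refNode k α)) ξ - g ξ| ≤ C * κ ∧
      ∀ a : Fin 2, |dlag k (fun α => g (refNode k α)) a ξ - fderiv ℝ g ξ (Pi.single a 1)| ≤ C * κ := by
  have hb : ∀ f : LagIdx k → Plane → ℝ, (∀ α, Continuous (f α)) → ∃ C, 0 ≤ C ∧ ∀ ξ ∈ refTriangle, ∑ α, |f α ξ| ≤ C := by
    intro f hf
    obtain ⟨C, hC⟩ := isCompact_refTriangle.exists_bound_of_continuousOn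
      (continuous_finsetSum Finset.univ fun α _ => (hf α).abs).continuousOn
    exact ⟨|C|, abs_nonneg _, fun ξ hξ => (le_abs_self _).trans ((hC ξ hξ).trans (le_abs_self C))⟩
  obtain ⟨C₀, hC₀, h₀⟩ := hb (shape k) (continuous_shape k)
  obtain ⟨C₁, hC₁, h₁⟩ := hb (fun α => dshape k α 0) (fun α => continuous_dshape k α 0)
  obtain ⟨C₂, hC₂, h₂⟩ := hb (fun α => dshape k α 1) (fun α => continuous_dshape k α 1)
  refine ⟨2 * C₀ + 2 * C₁ + 2 * C₂ + 2, by positivity, fun g κ hg hκ ξ hξ => ?_⟩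
  have hκ0 : 0 ≤ κ := (abs_nonneg _).trans (hκ ξ hξ ξ hξ 0)
  set D := fderiv ℝ g 0
  -- the remainder of the first order expansion at a vertex
  set e : Plane → ℝ := fun η => g η - (g 0 + D η)
  have hop : ∀ η ∈ refTriangle, ‖fderiv ℝ g η - D‖ ≤ 2 * κ := by
    intro η hη
    refine ContinuousLinearMap.opNorm_le_bound _ (by positivity) fun v => ?_
    conv_lhs => rw [plane_eq v]
    rw [map_add, map_smul, map_smul, Real.norm_eq_abs]
    have e0 := hκ η hη 0 zero_mem_refTriangle 0
    have e1 := hκ η hη 0 zero_mem_refTriangle 1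
    have n0 := norm_le_pi_norm v 0
    have n1 := norm_le_pi_norm v 1
    rw [Real.norm_eq_abs] at n0 n1
    refine (abs_add_le _ _).trans ?_
    rw [smul_eq_mul, smul_eq_mul, abs_mul, abs_mul, sub_apply, sub_apply]
    have := mul_le_mul n0 e0 (abs_nonneg _) (norm_nonneg _)
    have := mul_le_mul n1 e1 (abs_nonneg _) (norm_nonneg _)
    linarith
  have he : ∀ η ∈ refTriangle, |e η| ≤ 2 * κ := by
    intro η hη
    have h3 := convex_refTriangle.norm_image_sub_le_of_norm_hasFDerivWithin_le' (f := g) (f' := fderiv ℝ g) (φ := D)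
      (C := 2 * κ) (fun z hz => (hg z hz).hasFDerivAt.hasFDerivWithinAt) hop zero_mem_refTriangle hη
    rw [sub_zero, Real.norm_eq_abs] at h3
    have h4 : e η = g η - g 0 - D η := by simp only [e]; ring
    rw [h4]
    exact h3.trans (mul_le_of_le_one_right (by positivity) (norm_le_of_mem_refTriangle hη))
  have haff : lag k (fun α => g 0 + D (refNode k α)) = fun η => g 0 + D η := by
    funext η
    simp only [lag, add_mul, Finset.sum_add_distrib, ← Finset.mul_sum, sum_shape, mul_one]
    congr 1
    conv_rhs => rw [← sum_shape_smul_refNode hk η, map_sum]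
    exact Finset.sum_congr rfl fun α _ => by rw [map_smul, smul_eq_mul, mul_comm]
  have hdaff : ∀ a, dlag k (fun α => g 0 + D (refNode k α)) a ξ = D (Pi.single a 1) := by
    intro a
    rw [← fderiv_lag_single, haff]
    have : HasFDerivAt (fun η => g 0 + D η) D ξ := D.hasFDerivAt.const_add _
    rw [this.fderiv]
  have hsplit : ∀ α, g (refNode k α) = (g 0 + D (refNode k α)) + e (refNode k α) := fun α => by simp [e]
  have hsum : ∀ f : LagIdx k → ℝ, ∀ C, ∑ α, |f α| ≤ C → |∑ α, e (refNode k α) * f α| ≤ 2 * κ * C := by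
    intro f C hf
    refine (Finset.abs_sum_le_sum_abs _ _).trans ?_
    calc ∑ α, |e (refNode k α) * f α| ≤ ∑ α, 2 * κ * |f α| := Finset.sum_le_sum fun α _ => by
          rw [abs_mul]; gcongr; exact he _ (refNode_mem hk α)
      _ ≤ 2 * κ * C := by rw [← Finset.mul_sum]; gcongr
  have hx1 : 0 ≤ κ * C₀ := by positivity
  have hx2 : 0 ≤ κ * C₁ := by positivity
  have hx3 : 0 ≤ κ * C₂ := by positivity
  constructor
  · have h3 : lag k (fun α => g (refNode k α)) ξ - g ξ = ∑ α, e (refNode k α) * shape k α ξ - e ξ := by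
      have h4 : lag k (fun α => g (refNode k α)) ξ =
          lag k (fun α => g 0 + D (refNode k α)) ξ + ∑ α, e (refNode k α) * shape k α ξ := by
        simp only [lag, ← Finset.sum_add_distrib, ← add_mul, ← hsplit]
      rw [h4, haff]
      simp only [e]; ring
    rw [h3]
    have h5 := hsum (fun α => shape k α ξ) C₀ (h₀ ξ hξ)
    have h6 := he ξ hξ
    refine (abs_sub _ _).trans ?_
    linarith
  · have h7 : ∀ a : Fin 2, ∀ C, ∑ α, |dshape k α a ξ| ≤ C →
        |dlag k (fun α => g (refNode k α)) a ξ - fderiv ℝ g ξ (Pi.single a 1)| ≤ 2 * κ * C + κ := by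
      intro a C hC
      have h4 : dlag k (fun α => g (refNode k α)) a ξ =
          dlag k (fun α => g 0 + D (refNode k α)) a ξ + ∑ α, e (refNode k α) * dshape k α a ξ := by
        simp only [dlag, ← Finset.sum_add_distrib, ← add_mul, ← hsplit]
      rw [h4, hdaff]
      have h5 := hsum (fun α => dshape k α a ξ) C hC
      have h6 := hκ 0 zero_mem_refTriangle ξ hξ a
      have h8 : D (Pi.single a 1) + ∑ α, e (refNode k α) * dshape k α a ξ - fderiv ℝ g ξ (Pi.single a 1) =
        (∑ α, e (refNode k α) * dshape k α a ξ) + (D (Pi.single a 1) - fderiv ℝ g ξ (Pi.single a 1)) := by ring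
      rw [h8]
      exact (abs_add_le _ _).trans (add_le_add h5 h6)
    rw [Fin.forall_fin_two]
    constructor
    · have := h7 0 C₁ (h₁ ξ hξ); linarith
    · have := h7 1 C₂ (h₂ ξ hξ); linarith

/-! ### Interpolation along a patch -/

/-- Interpolation of functions with slowly varying jets, in terms of jets. -/
lemma exists_interpolation_jet {k : ℕ} (hk : 1 ≤ k) (d : ℕ) : ∃ C, 0 ≤ C ∧ ∀ {Γ : Set E3} (𝒯 : Triangulation Γ k),
    0 < 𝒯.h → 𝒯.h ≤ 1 → ∀ (P : Fin 𝒯.n) (w : Fin d × Fin 𝒯.N → ℝ) (f : Fin d → Plane → ℝ),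
    (∀ ℓ, ∀ ξ ∈ refTriangle, DifferentiableAt ℝ (f ℓ) ξ) → (∀ ℓ α, w (ℓ, 𝒯.loc P α) = f ℓ (refNode k α)) →
    ∀ K, (∀ ξ ∈ refTriangle, ∀ η ∈ refTriangle, ‖jetOf 𝒯.h f ξ - jetOf 𝒯.h f η‖ ≤ K) →
    ∀ ξ ∈ refTriangle, ‖𝒯.jet w P ξ - jetOf 𝒯.h f ξ‖ ≤ C * K := by
  obtain ⟨C, hC, hint⟩ := exists_interpolation_bound hk
  refine ⟨(d * 3 : ℕ) * C, by positivity, fun {Γ} 𝒯 hh hh1 P w f hf hw K hK ξ hξ => ?_⟩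
  have hK0 : 0 ≤ K := (norm_nonneg _).trans (hK ξ hξ ξ hξ)
  have hcoord : ∀ (X : Jet d) q, |X q| ≤ ‖X‖ := fun X q => by
    have := PiLp.norm_apply_le X q
    rwa [Real.norm_eq_abs] at this
  have hκ : ∀ ℓ, ∀ ξ ∈ refTriangle, ∀ η ∈ refTriangle, ∀ a : Fin 2,
      |fderiv ℝ (f ℓ) ξ (Pi.single a 1) - fderiv ℝ (f ℓ) η (Pi.single a 1)| ≤ 𝒯.h * K := by
    intro ℓ ξ hξ η hη
    have h1 : ∀ a b : ℝ, |𝒯.h⁻¹ * a - 𝒯.h⁻¹ * b| ≤ K → |a - b| ≤ 𝒯.h * K := by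
      intro a b h
      rw [← mul_sub, abs_mul, abs_of_pos (inv_pos.2 hh)] at h
      rwa [inv_mul_le_iff₀ hh] at h
    rw [Fin.forall_fin_two]
    exact ⟨h1 _ _ ((hcoord _ (ℓ, 1)).trans (hK ξ hξ η hη)), h1 _ _ ((hcoord _ (ℓ, 2)).trans (hK ξ hξ η hη))⟩
  rw [mul_assoc]
  refine Jet.norm_le ?_
  rintro ⟨ℓ, i⟩
  have h2 := hint (f ℓ) _ (hf ℓ) (hκ ℓ) ξ hξ
  simp only [← hw] at h2
  have h3 : ∀ a : Fin 2, |𝒯.h⁻¹ * dlag k (fun α => w (ℓ, 𝒯.loc P α)) a ξ - 𝒯.h⁻¹ * fderiv ℝ (f ℓ) ξ (Pi.single a 1)| ≤ C * K := by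
    intro a
    rw [← mul_sub, abs_mul, abs_of_pos (inv_pos.2 hh), inv_mul_le_iff₀ hh]
    refine (h2.2 a).trans_eq (by ring)
  rw [Triangulation.jet_eq, PiLp.sub_apply]
  fin_cases i
  · refine (h2.1).trans ?_
    rw [← mul_assoc, mul_comm C, mul_assoc]
    exact mul_le_of_le_one_left (by positivity) hh1
  · exact h3 0
  · exact h3 1

/-- Interpolation of time dependent functions with slowly varying jets. -/
lemma exists_interpolation_lipBdd {k : ℕ} (hk : 1 ≤ k) (d : ℕ) : ∃ C, 0 ≤ C ∧ ∀ {Γ : Set E3} (𝒯 : Triangulation Γ k),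
    0 < 𝒯.h → 𝒯.h ≤ 1 → ∀ (P : Fin 𝒯.n) (T : ℝ) (w : ℝ → Fin d × Fin 𝒯.N → ℝ) (f : ℝ → Fin d → Plane → ℝ),
    (∀ t ∈ Icc 0 T, ∀ ℓ, ∀ ξ ∈ refTriangle, DifferentiableAt ℝ (f t ℓ) ξ) →
    (∀ t ∈ Icc 0 T, ∀ ℓ α, w t (ℓ, 𝒯.loc P α) = f t ℓ (refNode k α)) →
    ∀ δ, (∀ ξ ∈ refTriangle, ∀ η ∈ refTriangle, LipBdd T δ fun t => jetOf 𝒯.h (f t) ξ - jetOf 𝒯.h (f t) η) →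
    ∀ ξ ∈ refTriangle, LipBdd T (C * δ) fun t => 𝒯.jet (w t) P ξ - jetOf 𝒯.h (f t) ξ := by
  obtain ⟨C, hC, h⟩ := exists_interpolation_jet hk d
  refine ⟨C, hC, fun {Γ} 𝒯 hh hh1 P T w f hf hw δ hδ ξ hξ => ⟨fun t ht => ?_, fun t ht s hs => ?_⟩⟩
  · exact h 𝒯 hh hh1 P (w t) (f t) (hf t ht) (hw t ht) δ (fun ξ hξ η hη => (hδ ξ hξ η hη).1 t ht) ξ hξ
  · have h1 : ∀ ξ ∈ refTriangle, jetOf 𝒯.h (fun ℓ η => f t ℓ η - f s ℓ η) ξ = jetOf 𝒯.h (f t) ξ - jetOf 𝒯.h (f s) ξ :=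
      fun ξ hξ => jetOf_sub 𝒯.h (fun ℓ => hf t ht ℓ ξ hξ) (fun ℓ => hf s hs ℓ ξ hξ)
    have h2 := h 𝒯 hh hh1 P (w t - w s) (fun ℓ η => f t ℓ η - f s ℓ η) (fun ℓ ξ hξ => (hf t ht ℓ ξ hξ).sub (hf s hs ℓ ξ hξ))
      (fun ℓ α => by rw [Pi.sub_apply, hw t ht, hw s hs]) (δ * |t - s|) (fun ξ hξ η hη => by
        rw [h1 ξ hξ, h1 η hη, sub_sub_sub_comm]
        exact (hδ ξ hξ η hη).2 t ht s hs) ξ hξ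
    rw [h1 ξ hξ, Triangulation.jet_sub, sub_sub_sub_comm] at h2
    rw [mul_assoc]
    exact h2

/-! ### The flat triangles -/

namespace Triangulation

variable {Γ : Set E3} {k : ℕ} (𝒯 : Triangulation Γ k)

/-- The linear part of the affine parametrization of a flat triangle. -/
def triL (P : Fin 𝒯.n) : Plane →L[ℝ] E3 :=
  (ContinuousLinearMap.proj (R := ℝ) (φ := fun _ : Fin 2 => ℝ) 0).smulRight (𝒯.vertex P 1 - 𝒯.vertex P 0) +
    (ContinuousLinearMap.proj (R := ℝ) (φ := fun _ : Fin 2 => ℝ) 1).smulRight (𝒯.vertex P 2 - 𝒯.vertex P 0)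

lemma triL_apply (P : Fin 𝒯.n) (η : Plane) :
    𝒯.triL P η = η 0 • (𝒯.vertex P 1 - 𝒯.vertex P 0) + η 1 • (𝒯.vertex P 2 - 𝒯.vertex P 0) := rfl

/-- The affine parametrization of a flat triangle. -/
def tri (P : Fin 𝒯.n) (ξ : Plane) : E3 := 𝒯.vertex P 0 + 𝒯.triL P ξ

lemma tri_zero (P : Fin 𝒯.n) : 𝒯.tri P 0 = 𝒯.vertex P 0 := by simp [tri]

lemma tri_sub (P : Fin 𝒯.n) (ξ η : Plane) : 𝒯.tri P ξ - 𝒯.tri P η = 𝒯.triL P (ξ - η) := by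
  rw [tri, tri, add_sub_add_left_eq_sub, map_sub]

lemma hasFDerivAt_tri (P : Fin 𝒯.n) (ξ : Plane) : HasFDerivAt (𝒯.tri P) (𝒯.triL P) ξ :=
  (𝒯.triL P).hasFDerivAt.const_add _

lemma flatNode_eq (P : Fin 𝒯.n) (α : LagIdx k) : 𝒯.flatNode (𝒯.loc P α) = 𝒯.tri P (refNode k α) := by
  rw [𝒯.flatNode_loc, tri, triL_apply, add_assoc]
  rfl

lemma image_tri (P : Fin 𝒯.n) : 𝒯.tri P '' refTriangle = convexHull ℝ (range (𝒯.vertex P)) := by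
  apply Subset.antisymm
  · rintro _ ⟨ξ, ⟨h0, h1, h2⟩, rfl⟩
    have h : 𝒯.tri P ξ = (1 - ξ 0 - ξ 1) • 𝒯.vertex P 0 + ξ 0 • 𝒯.vertex P 1 + ξ 1 • 𝒯.vertex P 2 := by
      rw [tri, triL_apply]; module
    have h3 := (convex_convexHull ℝ (range (𝒯.vertex P))).sum_mem (t := Finset.univ)
      (w := ![1 - ξ 0 - ξ 1, ξ 0, ξ 1]) (z := 𝒯.vertex P)
      (fun i _ => by fin_cases i <;> simp <;> linarith) (by simp [Fin.sum_univ_three]; ring)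
      (fun i _ => subset_convexHull ℝ _ (mem_range_self i))
    rw [h]
    simpa [Fin.sum_univ_three] using h3
  · refine convexHull_min ?_ ?_
    · rintro _ ⟨i, rfl⟩
      fin_cases i
      · exact ⟨0, zero_mem_refTriangle, 𝒯.tri_zero P⟩
      · exact ⟨Pi.single 0 1, by simp [refTriangle], by simp [tri, triL_apply]⟩
      · exact ⟨Pi.single 1 1, by simp [refTriangle], by simp [tri, triL_apply]⟩
    · have h := (convex_refTriangle.linear_image (𝒯.triL P).toLinearMap).translate (𝒯.vertex P 0)
      rwa [image_image] at h

lemma tri_mem (P : Fin 𝒯.n) {ξ : Plane} (hξ : ξ ∈ refTriangle) : 𝒯.tri P ξ ∈ convexHull ℝ (range (𝒯.vertex P)) :=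
  𝒯.image_tri P ▸ mem_image_of_mem _ hξ

lemma triL_injective (P : Fin 𝒯.n) : Function.Injective (𝒯.triL P) := by
  rw [injective_iff_map_eq_zero]
  intro η h
  have h1 := (affineIndependent_iff.1 (𝒯.affineIndependent P)) Finset.univ ![-η 0 - η 1, η 0, η 1]
    (by simp [Fin.sum_univ_three]; ring) (by
      rw [Fin.sum_univ_three, ← h, triL_apply]
      change (-η 0 - η 1) • 𝒯.vertex P 0 + η 0 • 𝒯.vertex P 1 + η 1 • 𝒯.vertex P 2 = _
      module)
  ext i
  fin_cases i
  · exact h1 1 (Finset.mem_univ _)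
  · exact h1 2 (Finset.mem_univ _)

lemma dist_le_h (P : Fin 𝒯.n) {x y : E3} (hx : x ∈ convexHull ℝ (range (𝒯.vertex P)))
    (hy : y ∈ convexHull ℝ (range (𝒯.vertex P))) : dist x y ≤ 𝒯.h := by
  have hb : Bornology.IsBounded (convexHull ℝ (range (𝒯.vertex P))) :=
    isBounded_convexHull.2 (finite_range _).isBounded
  exact (Metric.dist_le_diam_of_mem hb hx hy).trans (le_ciSup (f := fun P => Metric.diam (convexHull ℝ (range (𝒯.vertex P))))
    (finite_range _).bddAbove P)

lemma norm_tri_sub_le (P : Fin 𝒯.n) {ξ η : Plane} (hξ : ξ ∈ refTriangle) (hη : η ∈ refTriangle) :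
    ‖𝒯.tri P ξ - 𝒯.tri P η‖ ≤ 𝒯.h := by
  rw [← dist_eq_norm]; exact 𝒯.dist_le_h P (𝒯.tri_mem P hξ) (𝒯.tri_mem P hη)

lemma norm_triL_single_le (P : Fin 𝒯.n) (a : Fin 2) : ‖𝒯.triL P (Pi.single a 1)‖ ≤ 𝒯.h := by
  have h : (Pi.single a 1 : Plane) ∈ refTriangle := by fin_cases a <;> simp [refTriangle]
  have := 𝒯.norm_tri_sub_le P h zero_mem_refTriangle
  rwa [tri_sub, sub_zero] at this

lemma h_pos (hΓ : Γ.Nonempty) : 0 < 𝒯.h := by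
  obtain ⟨y, hy⟩ := hΓ
  obtain ⟨x, hx, -⟩ := 𝒯.bijOn.surjOn hy
  obtain ⟨P, -⟩ := mem_iUnion.1 hx
  have h1 := 𝒯.norm_triL_single_le P 0
  refine lt_of_lt_of_le (norm_pos_iff.2 fun h => ?_) h1
  have h2 := 𝒯.triL_injective P (h.trans (map_zero _).symm)
  have h3 := congrFun h2 0
  simp at h3

/-- Admissible triangles are not degenerate. -/
lemma IsAdmissible.le_norm_triL {𝒯 : Triangulation Γ k} {σ : ℝ} (hσ : 0 < σ) (h : 𝒯.IsAdmissible σ) (hh : 0 < 𝒯.h)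
    (P : Fin 𝒯.n) (η : Plane) : 2 * (𝒯.h / σ) * ‖η‖ ≤ ‖𝒯.triL P η‖ := by
  by_cases hη : η = 0
  · simp [hη]
  have hL : 0 < ‖𝒯.triL P η‖ := norm_pos_iff.2 fun h0 => hη (𝒯.triL_injective P (h0.trans (map_zero _).symm))
  obtain ⟨c, hc, hdisc⟩ := h P
  have hρ : 0 < 𝒯.h / σ := by positivity
  set s := 𝒯.h / σ / ‖𝒯.triL P η‖
  have hdir : 𝒯.triL P η ∈ (affineSpan ℝ (range (𝒯.vertex P))).direction := by
    rw [triL_apply]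
    have hv : ∀ i, 𝒯.vertex P i - 𝒯.vertex P 0 ∈ (affineSpan ℝ (range (𝒯.vertex P))).direction := fun i =>
      AffineSubspace.vsub_mem_direction (subset_affineSpan ℝ _ (mem_range_self i)) (subset_affineSpan ℝ _ (mem_range_self 0))
    exact Submodule.add_mem _ (Submodule.smul_mem _ _ (hv 1)) (Submodule.smul_mem _ _ (hv 2))
  have hmem : ∀ r : ℝ, |r| = s → ∃ ξ ∈ refTriangle, 𝒯.tri P ξ = r • 𝒯.triL P η + c := by
    intro r hr
    have h1 : r • 𝒯.triL P η + c ∈ convexHull ℝ (range (𝒯.vertex P)) := by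
      refine hdisc _ (AffineSubspace.vadd_mem_of_mem_direction (Submodule.smul_mem _ r hdir) hc) ?_
      rw [dist_eq_norm, add_sub_cancel_right, norm_smul, Real.norm_eq_abs, hr, div_mul_cancel₀ _ hL.ne']
    rw [← image_tri] at h1
    exact h1
  have hs : 0 < s := by positivity
  obtain ⟨ξ, hξ, h1⟩ := hmem s (abs_of_pos hs)
  obtain ⟨ζ, hζ, h2⟩ := hmem (-s) (by rw [abs_neg, abs_of_pos hs])
  have h3 : 𝒯.triL P (ξ - ζ) = 𝒯.triL P ((2 * s) • η) := by
    rw [← tri_sub, h1, h2, map_smul]; module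
  have h4 := 𝒯.triL_injective P h3
  have h5 : ‖ξ - ζ‖ ≤ 1 := by
    rw [pi_norm_le_iff_of_nonneg zero_le_one]
    intro i
    have ha := refTriangle_subset hξ
    have hb := refTriangle_subset hζ
    have a1 := ha.1 i
    have a2 := ha.2 i
    have b1 := hb.1 i
    have b2 := hb.2 i
    simp only [Pi.zero_apply, Pi.one_apply] at a1 a2 b1 b2
    rw [Pi.sub_apply, Real.norm_eq_abs, abs_le]
    constructor <;> linarith
  rw [h4, norm_smul, Real.norm_eq_abs, abs_of_pos (by positivity)] at h5
  calc 2 * (𝒯.h / σ) * ‖η‖ = 2 * s * ‖η‖ * ‖𝒯.triL P η‖ := by simp only [s]; field_simp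
    _ ≤ ‖𝒯.triL P η‖ := mul_le_of_le_one_left hL.le h5

/-- The jets of the affine parametrizations of the triangles. -/
lemma jetOf_tri (P : Fin 𝒯.n) (ξ : Plane) : jetOf 𝒯.h (fun ℓ η => 𝒯.tri P η ℓ) ξ =
    mkJet (fun ℓ => 𝒯.tri P ξ ℓ) (fun ℓ => 𝒯.h⁻¹ * 𝒯.triL P (Pi.single 0 1) ℓ)
      (fun ℓ => 𝒯.h⁻¹ * 𝒯.triL P (Pi.single 1 1) ℓ) := by
  have h1 : ∀ a ℓ, fderiv ℝ (fun η => 𝒯.tri P η ℓ) ξ (Pi.single a 1) = 𝒯.triL P (Pi.single a 1) ℓ := by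
    intro a ℓ
    rw [← patchDeriv_apply (𝒯.hasFDerivAt_tri P ξ).differentiableAt, patchDeriv, (𝒯.hasFDerivAt_tri P ξ).fderiv]
  simp only [jetOf, h1]

lemma jetReg_tri (hh : 0 < 𝒯.h) (hh1 : 𝒯.h ≤ 1) {R : ℝ} (hR : ∀ p ∈ Γ, ‖p‖ ≤ R) (T : ℝ) (P : Fin 𝒯.n) :
    JetReg T (9 * (R + 1)) 𝒯.h fun ξ _ => jetOf 𝒯.h (fun ℓ η => 𝒯.tri P η ℓ) ξ := by
  have hR0 : 0 ≤ R := (norm_nonneg _).trans (hR _ (𝒯.vertex_mem P 0))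
  have hcoord : ∀ (v : E3) i, |v i| ≤ ‖v‖ := fun v i => by
    have := PiLp.norm_apply_le v i
    rwa [Real.norm_eq_abs] at this
  intro ξ hξ
  constructor
  · refine lipBdd_const ?_
    rw [jetOf_tri]
    have h9 : ((3 * 3 : ℕ) : ℝ) * (R + 1) = 9 * (R + 1) := by norm_num
    rw [← h9]
    refine Jet.norm_le ?_
    have hd : ∀ a ℓ, |𝒯.h⁻¹ * 𝒯.triL P (Pi.single a 1) ℓ| ≤ R + 1 := by
      intro a ℓ
      rw [abs_mul, abs_of_pos (inv_pos.2 hh)]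
      have := inv_mul_le_of_le_mul₀ hh.le zero_le_one (((hcoord _ ℓ).trans (𝒯.norm_triL_single_le P a)).trans_eq (mul_one _).symm)
      linarith
    rintro ⟨ℓ, i⟩
    fin_cases i
    · refine (hcoord (𝒯.tri P ξ) ℓ).trans ?_
      have h1 := 𝒯.norm_tri_sub_le P hξ zero_mem_refTriangle
      have h2 := hR _ (𝒯.vertex_mem P 0)
      rw [← tri_zero] at h2
      have h3 := norm_le_norm_add_norm_sub' (𝒯.tri P ξ) (𝒯.tri P 0)
      linarith
    · exact hd 0 ℓ
    · exact hd 1 ℓ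
  · intro η hη
    refine lipBdd_const ?_
    rw [jetOf_tri, jetOf_tri]
    have h9 : ((3 * 3 : ℕ) : ℝ) * 𝒯.h ≤ 9 * (R + 1) * 𝒯.h := by push_cast; nlinarith
    refine le_trans ?_ h9
    refine Jet.norm_le ?_
    rintro ⟨ℓ, i⟩
    rw [PiLp.sub_apply]
    fin_cases i
    · exact (hcoord (𝒯.tri P ξ - 𝒯.tri P η) ℓ).trans (𝒯.norm_tri_sub_le P hξ hη)
    · simpa using hh.le
    · simpa using hh.le

end Triangulation

/-- A lower bound for the area element of a patch. -/
lemma le_dd {X : Jet 3} {m : ℝ} (hm : 0 < m) (h : ∀ η : Plane, m * ‖η‖ ≤ ‖η 0 • jetPart 1 X + η 1 • jetPart 2 X‖) :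
    m ^ 4 ≤ dd X := by
  have hsq : ∀ a b : ℝ, ‖a • jetPart 1 X + b • jetPart 2 X‖ ^ 2 = a ^ 2 * EE X + 2 * a * b * FF X + b ^ 2 * GG X := by
    intro a b
    rw [EuclideanSpace.norm_sq_eq, EE, FF, GG, Finset.mul_sum, Finset.mul_sum, Finset.mul_sum, ← Finset.sum_add_distrib,
      ← Finset.sum_add_distrib]
    refine Finset.sum_congr rfl fun ℓ _ => ?_
    rw [PiLp.add_apply, PiLp.smul_apply, PiLp.smul_apply, jetPart_apply, jetPart_apply, Real.norm_eq_abs, sq_abs,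
      smul_eq_mul, smul_eq_mul]
    ring
  have hlow : ∀ η : Plane, ∀ i, (m * |η i|) ^ 2 ≤ η 0 ^ 2 * EE X + 2 * η 0 * η 1 * FF X + η 1 ^ 2 * GG X := by
    intro η i
    rw [← hsq]
    have h1 := norm_le_pi_norm η i
    rw [Real.norm_eq_abs] at h1
    have h2 := h η
    have h3 : m * |η i| ≤ ‖η 0 • jetPart 1 X + η 1 • jetPart 2 X‖ := le_trans (by gcongr) h2
    gcongr
  have hG : m ^ 2 ≤ GG X := by simpa using hlow ![0, 1] 1
  have hGpos : 0 < GG X := lt_of_lt_of_le (by positivity) hG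
  have h1 := hlow ![1, -(FF X / GG X)] 0
  simp only [Matrix.cons_val_zero, Matrix.cons_val_one, Matrix.cons_val_fin_one, abs_one, mul_one, one_pow, one_mul] at h1
  have h2 : EE X + 2 * -(FF X / GG X) * FF X + (-(FF X / GG X)) ^ 2 * GG X = dd X / GG X := by
    rw [dd]; field_simp; ring
  rw [h2, le_div_iff₀ hGpos] at h1
  nlinarith [sq_nonneg m]

/-! ### The interpolated surface -/

/-- Interpolation of the values of a smooth field on regular patches. -/
lemma exists_field_interpolation {k : ℕ} (hk : 1 ≤ k) {Γ : Set E3} (hΓ : IsCompact Γ) {β : E3 → ℝ → E3} {T : ℝ}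
    (hT : 0 < T) (hβ : ContinuousOn (Function.uncurry β) (Γ ×ˢ Icc 0 T)) {V : Set (E3 × ℝ)} (hV : IsOpen V) {r : ℝ}
    (hr : tubeK Γ β T r ⊆ slab V T) {d : ℕ} {Φ : E3 × ℝ → Fin d → ℝ} (hΦ : ContDiffOn ℝ 3 Φ (slab V T)) (R : ℝ) :
    ∃ C, 0 ≤ C ∧ ∀ {Γ' : Set E3} (𝒯 : Triangulation Γ' k), 0 < 𝒯.h → 𝒯.h ≤ 1 → ∀ (P : Fin 𝒯.n) (y : ℝ → Plane → E3),
      (∀ t ∈ Icc 0 T, ∀ ξ ∈ refTriangle, DifferentiableAt ℝ (y t) ξ) →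
      JetReg T R 𝒯.h (fun ξ t => jetOf 𝒯.h (fun ℓ η => y t η ℓ) ξ) →
      (∃ q ∈ Γ, ∀ t ∈ Icc 0 T, ∀ ξ ∈ refTriangle, ‖y t ξ - β q t‖ ≤ r) →
      ∀ w : ℝ → Fin d × Fin 𝒯.N → ℝ, (∀ t ∈ Icc 0 T, ∀ ℓ α, w t (ℓ, 𝒯.loc P α) = Φ (y t (refNode k α), t) ℓ) →
        JetReg T C 𝒯.h (fun ξ t => 𝒯.jet (w t) P ξ) ∧
        ∀ ξ ∈ refTriangle, LipBdd T (C * 𝒯.h) fun t =>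
          𝒯.jet (w t) P ξ - jetOf 𝒯.h (fun ℓ η => Φ (y t η, t) ℓ) ξ := by
  obtain ⟨C₁, hC₁, h₁⟩ := exists_jetReg_liftJ hΓ hT hβ hV hr hΦ R
  obtain ⟨C₂, hC₂, h₂⟩ := exists_interpolation_lipBdd hk d
  refine ⟨C₁ + 2 * (C₂ * C₁), by positivity, fun {Γ'} 𝒯 hh hh1 P y hy hreg hq w hw => ?_⟩
  have hmem : ∀ t ∈ Icc 0 T, ∀ ξ ∈ refTriangle, (y t ξ, t) ∈ slab V T := fun t ht ξ hξ =>
    hr ⟨ht, hq.imp fun q hq => ⟨hq.1, hq.2 t ht ξ hξ⟩⟩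
  have hcomp := fun t ht ξ hξ => jetOf_comp hV (hΦ.of_le (by norm_num)) (hy t ht ξ hξ) (hmem t ht ξ hξ) 𝒯.h
  have hJ : JetReg T C₁ 𝒯.h fun ξ t => jetOf 𝒯.h (fun ℓ η => Φ (y t η, t) ℓ) ξ := by
    have h := h₁ 𝒯.h _ hh.le hreg hq
    exact fun ξ hξ => ⟨(h ξ hξ).1.congr fun t ht => (hcomp t ht ξ hξ).2, fun η hη =>
      ((h ξ hξ).2 η hη).congr fun t ht => congrArg₂ (· - ·) (hcomp t ht ξ hξ).2 (hcomp t ht η hη).2⟩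
  have hd := h₂ 𝒯 hh hh1 P T w (fun t ℓ η => Φ (y t η, t) ℓ) (fun t ht ℓ ξ hξ => (hcomp t ht ξ hξ).1 ℓ) hw (C₁ * 𝒯.h)
    fun ξ hξ η hη => (hJ ξ hξ).2 η hη
  have hd' : ∀ ξ ∈ refTriangle, LipBdd T (C₂ * C₁ * 𝒯.h) fun t =>
      𝒯.jet (w t) P ξ - jetOf 𝒯.h (fun ℓ η => Φ (y t η, t) ℓ) ξ := fun ξ hξ => by rw [mul_assoc]; exact hd ξ hξ
  refine ⟨hJ.of_close (by positivity) hh1 hd', fun ξ hξ => (hd' ξ hξ).mono ?_⟩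
  have := mul_nonneg hC₂ hC₁
  gcongr
  linarith

lemma Triangulation.norm_triL_le {Γ : Set E3} {k : ℕ} (𝒯 : Triangulation Γ k) (P : Fin 𝒯.n) {E : Type*}
    [NormedAddCommGroup E] [NormedSpace ℝ E] (A : E3 →L[ℝ] E) {B : ℝ}
    (hA : ∀ i, ‖A (𝒯.vertex P i - 𝒯.vertex P 0)‖ ≤ B) (η : Plane) : ‖A (𝒯.triL P η)‖ ≤ 2 * B * ‖η‖ := by
  rw [triL_apply, map_add, map_smul, map_smul]
  have h0 := norm_le_pi_norm η 0
  have h1 := norm_le_pi_norm η 1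
  have hB : 0 ≤ B := (norm_nonneg _).trans (hA 0)
  refine (norm_add_le _ _).trans ?_
  rw [norm_smul, norm_smul]
  have h2 : ‖η 0‖ * ‖A (𝒯.vertex P 1 - 𝒯.vertex P 0)‖ ≤ ‖η‖ * B := mul_le_mul h0 (hA 1) (norm_nonneg _) (norm_nonneg _)
  have h3 : ‖η 1‖ * ‖A (𝒯.vertex P 2 - 𝒯.vertex P 0)‖ ≤ ‖η‖ * B := mul_le_mul h1 (hA 2) (norm_nonneg _) (norm_nonneg _)
  linarith

lemma Triangulation.norm_vertex_sub_le {Γ : Set E3} {k : ℕ} (𝒯 : Triangulation Γ k) (P : Fin 𝒯.n) (i : Fin 3) :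
    ‖𝒯.vertex P i - 𝒯.vertex P 0‖ ≤ 𝒯.h := by
  rw [← dist_eq_norm]
  exact 𝒯.dist_le_h P (subset_convexHull ℝ _ (mem_range_self i)) (subset_convexHull ℝ _ (mem_range_self 0))

namespace MeanCurvatureFlow

variable {Γ₀ : Set E3} {T : ℝ} {m : ℕ} (F : MeanCurvatureFlow Γ₀ T m)

/-- The exact flow does not collapse the planes of the triangles: these are nearly tangent to the initial surface, because
their vertices lie on it and they are shape regular. -/
lemma exists_mul_norm_le_dx_Xe (hT : 0 < T) (hΓ : IsSmoothClosedSurface Γ₀) (hm : 2 ≤ m) {O : Set E3} (hO : IsOpen O)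
    (hΓO : Γ₀ ⊆ O) (hπ : ContDiffOn ℝ m (nearestPoint Γ₀) O) {σ : ℝ} (hσ : 0 < σ) :
    ∃ c > 0, ∃ h₀ > 0, ∀ {k : ℕ} (𝒯 : Triangulation Γ₀ k), 𝒯.IsAdmissible σ → 0 < 𝒯.h → 𝒯.h ≤ h₀ →
      ∀ P, ∀ t ∈ Icc 0 T, ∀ η,
        c * 𝒯.h * ‖η‖ ≤ ‖dx F.Xe (slab (O ×ˢ univ) T) (𝒯.vertex P 0, t) (𝒯.triL P η)‖ := by
  have hm1 : 1 ≤ m := by omega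
  have hemb := F.contDiffOn_emb hΓ hπ
  have hU : IsOpen (O ×ˢ (univ : Set ℝ)) := hO.prod isOpen_univ
  have hcont : ContinuousOn (dx F.emb (slab (O ×ˢ univ) T)) (Γ₀ ×ˢ Icc 0 T) :=
    (contDiffOn_dx (n := 0) hU hT (hemb.of_le (by exact_mod_cast hm1))).continuousOn.mono
      fun x hx => mem_slab_of_mem hΓO hx.1 hx.2
  obtain ⟨c₀, hc₀, hcoer⟩ := exists_pos_mul_norm_le (hΓ.1.prod isCompact_Icc) hcont
    fun x hx v => F.dx_emb_injective hΓ hm1 hO hΓO hπ hx.1 hx.2 v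
  obtain ⟨r, hr, C, hC, htay⟩ := exists_taylor_slab hO hT (hemb.of_le (by exact_mod_cast hm)) hΓ.1 hΓO
  have hsnd : ∀ a : E3 × E3, ‖a.2‖ ≤ ‖pair a‖ := fun a => by
    refine le_of_sq_le_sq ?_ (norm_nonneg _)
    rw [norm_pair_sq]; linarith [sq_nonneg ‖a.1‖]
  have hle : ∀ a : E3 × E3, ‖pair a‖ ≤ ‖a.1‖ + ‖a.2‖ := fun a => by
    refine le_of_sq_le_sq ?_ (by positivity)
    rw [norm_pair_sq]; nlinarith [mul_nonneg (norm_nonneg a.1) (norm_nonneg a.2)]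
  refine ⟨c₀ / σ, by positivity, min r (c₀ / (2 * σ * (C + 1))), by positivity, ?_⟩
  intro k 𝒯 hadm hh hh₀ P t ht η
  have hv := 𝒯.vertex_mem P
  -- the edges are tangent to the surface up to quadratic terms
  have hQ : ∀ i, ‖(ContinuousLinearMap.id ℝ E3 - fderiv ℝ (nearestPoint Γ₀) (𝒯.vertex P 0)) (𝒯.vertex P i - 𝒯.vertex P 0)‖
      ≤ C * 𝒯.h ^ 2 := by
    intro i
    have hd := 𝒯.norm_vertex_sub_le P i
    have h1 := (htay _ (hv 0) _ (hd.trans (hh₀.trans (min_le_left _ _))) t ht).2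
    rw [add_sub_cancel, F.dx_emb_apply hΓ hm1 hO hΓO hπ (hv 0) ht, emb, emb, ← map_sub, ← map_sub] at h1
    have h2 := (hsnd _).trans h1
    simp only [Prod.snd_sub, nearestPoint_of_mem hΓ.1 (hv i), nearestPoint_of_mem hΓ.1 (hv 0), sub_self, zero_sub,
      norm_neg] at h2
    exact h2.trans (by gcongr)
  have h3 := 𝒯.norm_triL_le P _ hQ η
  have h4 := hcoer (𝒯.vertex P 0, t) ⟨hv 0, ht⟩ (𝒯.triL P η)
  rw [F.dx_emb_apply hΓ hm1 hO hΓO hπ (hv 0) ht] at h4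
  have h5 := h4.trans (hle _)
  have h6 := hadm.le_norm_triL hσ hh P η
  have h7 : 𝒯.h * (2 * σ * (C + 1)) ≤ c₀ := (le_div_iff₀ (by positivity)).1 (hh₀.trans (min_le_right _ _))
  simp only [sub_apply, ContinuousLinearMap.id_apply] at h3
  have h8 : 2 * (C * 𝒯.h ^ 2) * ‖η‖ ≤ c₀ / σ * 𝒯.h * ‖η‖ := by
    refine mul_le_mul_of_nonneg_right ?_ (norm_nonneg _)
    rw [div_mul_eq_mul_div, le_div_iff₀ hσ]
    have : 2 * σ * C * 𝒯.h ≤ c₀ := by nlinarith [mul_pos hh hσ]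
    nlinarith
  have h9 : c₀ * (2 * (𝒯.h / σ) * ‖η‖) = 2 * (c₀ / σ * 𝒯.h * ‖η‖) := by ring
  have h10 := mul_le_mul_of_nonneg_left h6 hc₀.le
  linarith

/-- The nodal vector of the values of `u` at the nodes of the moving surface. -/
def uNodal {k : ℕ} (𝒯 : Triangulation Γ₀ k) (t : ℝ) : Fin 4 × Fin 𝒯.N → ℝ :=
  fun q => F.u t (F.X (𝒯.node q.2) t) q.1

/-- The jets of the interpolated surface are uniformly regular and nondegenerate, and close to those of the flat triangles
moved by the flow. -/
lemma exists_jetReg_xStar (hT : 0 < T) (hΓ : IsSmoothClosedSurface Γ₀) (hm : 3 ≤ m) {O : Set E3} (hO : IsOpen O)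
    (hΓO : Γ₀ ⊆ O) (hπ : ContDiffOn ℝ m (nearestPoint Γ₀) O) {σ : ℝ} (hσ : 0 < σ) {k : ℕ} (hk : 1 ≤ k) :
    ∃ h₀ > 0, h₀ ≤ 1 ∧ ∃ C, 0 ≤ C ∧ ∃ L, 0 ≤ L ∧ ∃ μ > 0, ∀ 𝒯 : Triangulation Γ₀ k, 𝒯.IsAdmissible σ → 0 < 𝒯.h → 𝒯.h ≤ h₀ →
      ∀ P, JetReg T C 𝒯.h (fun ξ t => 𝒯.jet (xStar F 𝒯 t) P ξ) ∧
        (∀ t ∈ Icc 0 T, ∀ ξ ∈ refTriangle, 𝒯.jet (xStar F 𝒯 t) P ξ ∈ goodJets L μ) ∧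
        ∀ t ∈ Icc 0 T, ∀ ξ ∈ refTriangle, ‖𝒯.patch (xStar F 𝒯 t) P ξ - F.X (𝒯.vertex P 0) t‖ ≤ C * 𝒯.h := by
  have hU : IsOpen (O ×ˢ (univ : Set ℝ)) := hO.prod isOpen_univ
  have hXe := F.contDiffOn_Xe hΓ hπ
  have hΦ : ContDiffOn ℝ 3 (fun x ℓ => F.Xe x ℓ) (slab (O ×ˢ univ) T) :=
    contDiffOn_pi.2 fun ℓ => contDiffOn_euclidean.1 (hXe.of_le (by exact_mod_cast hm)) ℓ
  have hβ : ContinuousOn (Function.uncurry fun (q : E3) (_ : ℝ) => q) (Γ₀ ×ˢ Icc 0 T) := continuousOn_fst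
  obtain ⟨r, hr, htube⟩ := exists_tubeK_subset hΓ.1 hβ hU fun t ht q hq => (mem_slab_of_mem hΓO hq ht).1
  obtain ⟨R, hR⟩ := hΓ.1.isBounded.exists_norm_le
  obtain ⟨C, hC, hint⟩ := exists_field_interpolation hk hΓ.1 hT hβ hU htube hΦ (9 * (R + 1))
  obtain ⟨c, hc, h₁, hh₁, hlow⟩ := F.exists_mul_norm_le_dx_Xe hT hΓ (by omega) hO hΓO hπ hσ
  obtain ⟨δ, hδ, hδ1, hpert⟩ := exists_goodJets_perturbation (C + C) (pow_pos hc 4)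
  refine ⟨min (min 1 r) (min h₁ (δ / (2 * C + 1))), by positivity, (min_le_left _ _).trans (min_le_left _ _), 2 * C, by positivity,
    C + C + 1, by positivity, c ^ 4 / 2, by positivity, ?_⟩
  intro 𝒯 hadm hh hh₀ P
  have hhr : 𝒯.h ≤ r := hh₀.trans ((min_le_left _ _).trans (min_le_right _ _))
  have hh1 : 𝒯.h ≤ 1 := hh₀.trans ((min_le_left _ _).trans (min_le_left _ _))
  have hhδ : 2 * C * 𝒯.h ≤ δ := by
    have h1 := hh₀.trans ((min_le_right _ _).trans (min_le_right _ _))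
    rw [le_div_iff₀ (by positivity)] at h1
    nlinarith
  have htri : ∀ ξ, DifferentiableAt ℝ (𝒯.tri P) ξ := fun ξ => (𝒯.hasFDerivAt_tri P ξ).differentiableAt
  have hnear : ∀ ξ ∈ refTriangle, ‖𝒯.tri P ξ - 𝒯.vertex P 0‖ ≤ r := fun ξ hξ => by
    have := 𝒯.norm_tri_sub_le P hξ zero_mem_refTriangle
    rw [𝒯.tri_zero] at this
    exact this.trans hhr
  obtain ⟨hreg, hclose⟩ := hint 𝒯 hh hh1 P (fun _ => 𝒯.tri P) (fun _ _ ξ _ => htri ξ)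
    (𝒯.jetReg_tri hh hh1 hR T P) ⟨_, 𝒯.vertex_mem P 0, fun t _ ξ hξ => hnear ξ hξ⟩ (xStar F 𝒯)
    (fun t _ ℓ α => by rw [xStar, Triangulation.node, 𝒯.flatNode_eq, Xe])
  have hdist : ∀ t ∈ Icc 0 T, ∀ ξ ∈ refTriangle,
      ‖𝒯.jet (xStar F 𝒯 t) P ξ - jetOf 𝒯.h (fun ℓ η => F.Xe (𝒯.tri P η, t) ℓ) 0‖ ≤ 2 * C * 𝒯.h := fun t ht ξ hξ => by
    have h1 := ((hreg ξ hξ).2 0 zero_mem_refTriangle).1 t ht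
    have h2 := (hclose 0 zero_mem_refTriangle).1 t ht
    have h3 := norm_add_le_of_le h1 h2
    rw [sub_add_sub_cancel] at h3
    linarith
  refine ⟨hreg.mono hh.le (by linarith), fun t ht ξ hξ => ?_, fun t ht ξ hξ => ?_⟩
  · refine hpert _ _ ⟨?_, ?_⟩ ((hdist t ht ξ hξ).trans hhδ)
    · have h1 := (hreg 0 zero_mem_refTriangle).1.1 t ht
      have h2 := (hclose 0 zero_mem_refTriangle).1 t ht
      have h3 := norm_sub_le_of_le h1 h2
      rw [sub_sub_cancel] at h3
      nlinarith
    · have hmem : (𝒯.vertex P 0, t) ∈ slab (O ×ˢ univ) T := mem_slab_of_mem hΓO (𝒯.vertex_mem P 0) ht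
      have hd := hasFDerivAt_dx hU ((hXe.differentiableOn (by norm_cast; omega)) _ hmem) hmem
      rw [← 𝒯.tri_zero] at hd
      have hD := HasFDerivAt.comp (f := 𝒯.tri P) (g := fun y => F.Xe (y, t)) (0 : Plane) hd (𝒯.hasFDerivAt_tri P 0)
      have hpart : ∀ a : Fin 2, jetPart a.succ (jetOf 𝒯.h (fun ℓ η => F.Xe (𝒯.tri P η, t) ℓ) 0) =
          𝒯.h⁻¹ • dx F.Xe (slab (O ×ˢ univ) T) (𝒯.tri P 0, t) (𝒯.triL P (Pi.single a 1)) := by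
        intro a
        ext ℓ
        have h1 : jetPart a.succ (jetOf 𝒯.h (fun ℓ η => F.Xe (𝒯.tri P η, t) ℓ) 0) ℓ =
            𝒯.h⁻¹ * fderiv ℝ (fun η => F.Xe (𝒯.tri P η, t) ℓ) 0 (Pi.single a 1) := by fin_cases a <;> rfl
        rw [h1, ← patchDeriv_apply (Y := fun η => F.Xe (𝒯.tri P η, t)) hD.differentiableAt, patchDeriv]
        exact congrArg (fun A : Plane →L[ℝ] E3 => 𝒯.h⁻¹ * A (Pi.single a 1) ℓ) hD.fderiv
      refine le_dd hc fun η => ?_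
      have h1 := hlow 𝒯 hadm hh (hh₀.trans ((min_le_right _ _).trans (min_le_left _ _))) P t ht η
      have h2 : η 0 • jetPart 1 (jetOf 𝒯.h (fun ℓ η => F.Xe (𝒯.tri P η, t) ℓ) 0) +
          η 1 • jetPart 2 (jetOf 𝒯.h (fun ℓ η => F.Xe (𝒯.tri P η, t) ℓ) 0) =
          𝒯.h⁻¹ • dx F.Xe (slab (O ×ˢ univ) T) (𝒯.tri P 0, t) (𝒯.triL P η) := by
        conv_rhs => rw [plane_eq η]
        rw [map_add, map_add, map_smul, map_smul, map_smul, map_smul, smul_add, smul_comm _ (η 0), smul_comm _ (η 1)]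
        exact congrArg₂ (· + ·) (congrArg _ (hpart 0)) (congrArg _ (hpart 1))
      rw [h2, 𝒯.tri_zero, norm_smul, norm_inv, Real.norm_of_nonneg hh.le, ← div_eq_inv_mul, le_div_iff₀ hh]
      linarith
  · have h1 := (norm_jetPart_le 0 _).trans (hdist t ht ξ hξ)
    rw [map_sub] at h1
    have h2 : F.X (𝒯.vertex P 0) t = F.Xe (𝒯.tri P 0, t) := by
      rw [𝒯.tri_zero, F.Xe_of_mem hΓ.1 (𝒯.vertex_mem P 0)]
    rw [h2]
    exact h1

end MeanCurvatureFlow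

/-! ### Regularity of the interpolated reference values -/

namespace MeanCurvatureFlow

variable {Γ₀ : Set E3} {T : ℝ} {m : ℕ} (F : MeanCurvatureFlow Γ₀ T m)

lemma patch_xStar_refNode {k : ℕ} (hk : 1 ≤ k) (𝒯 : Triangulation Γ₀ k) (t : ℝ) (P : Fin 𝒯.n) (α : LagIdx k) :
    𝒯.patch (xStar F 𝒯 t) P (refNode k α) = F.X (𝒯.node (𝒯.loc P α)) t := by
  ext ℓ
  exact lag_refNode hk (fun α => xStar F 𝒯 t (ℓ, 𝒯.loc P α)) α

/-- The interpolated positions, velocities and normals and curvatures have uniformly regular jets, which differ little from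
those of the lifted surface and of the exact normals and curvatures on it. -/
lemma exists_reference_regularity (hT : 0 < T) (hΓ : IsSmoothClosedSurface Γ₀) (hm : 5 ≤ m) {σ : ℝ} (hσ : 0 < σ)
    {k : ℕ} (hk : 1 ≤ k) : ∃ V, IsOpen V ∧
    ContDiffOn ℝ 3 (fun x ℓ => nearestPoint (F.surface x.2) x.1 ℓ) (slab V T) ∧
    ContDiffOn ℝ 3 (fun x => F.u x.2 (nearestPoint (F.surface x.2) x.1)) (slab V T) ∧
    ∃ h₀ > 0, h₀ ≤ 1 ∧ ∃ L, 0 ≤ L ∧ ∃ μ > 0, ∀ 𝒯 : Triangulation Γ₀ k, 𝒯.IsAdmissible σ → 0 < 𝒯.h → 𝒯.h ≤ h₀ →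
      ∀ P, ∀ ξ ∈ refTriangle,
        (∀ t ∈ Icc 0 T, 𝒯.jet (xStar F 𝒯 t) P ξ ∈ goodJets L μ ∧ (𝒯.patch (xStar F 𝒯 t) P ξ, t) ∈ slab V T) ∧
        LipBdd T L (fun t => 𝒯.jet (xStar F 𝒯 t) P ξ) ∧ LipBdd T L (fun t => 𝒯.jet (vStar F 𝒯 t) P ξ) ∧
        LipBdd T L (fun t => 𝒯.jet (F.uNodal 𝒯 t) P ξ) ∧
        LipBdd T (L * 𝒯.h) (fun t => 𝒯.jet (xStar F 𝒯 t) P ξ - jetOf 𝒯.h (fun ℓ η => liftedPatch F 𝒯 t P η ℓ) ξ) ∧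
        LipBdd T (L * 𝒯.h) (fun t => 𝒯.jet (F.uNodal 𝒯 t) P ξ -
          jetOf 𝒯.h (fun ℓ η => F.u t (liftedPatch F 𝒯 t P η) ℓ) ξ) := by
  obtain ⟨O, hO, hΓO, hπ⟩ := exists_isOpen_contDiffOn_nearestPoint hΓ m
  obtain ⟨V, hV, hmemV, hΦx', hΦu⟩ := F.exists_contDiffOn_lift hT hΓ (n := 3) (by norm_num) hm
  have hΦx : ContDiffOn ℝ 3 (fun x ℓ => nearestPoint (F.surface x.2) x.1 ℓ) (slab V T) :=
    contDiffOn_pi.2 fun ℓ => contDiffOn_euclidean.1 hΦx' ℓ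
  have hΦv : ContDiffOn ℝ 3 (fun x (ℓ : Fin 3) => -(F.u x.2 (nearestPoint (F.surface x.2) x.1) 3) *
      F.u x.2 (nearestPoint (F.surface x.2) x.1) ℓ.castSucc) (slab V T) :=
    contDiffOn_pi.2 fun ℓ => (contDiffOn_pi.1 hΦu 3).neg.mul (contDiffOn_pi.1 hΦu _)
  have hβ : ContinuousOn (Function.uncurry F.X) (Γ₀ ×ˢ Icc 0 T) := F.contDiffOn.continuousOn
  obtain ⟨r, hr, htube⟩ := exists_tubeK_subset hΓ.1 hβ hV hmemV
  obtain ⟨h₁, hh₁, hh₁1, C, hC, L, hL, μ, hμ, hx⟩ := F.exists_jetReg_xStar hT hΓ (by omega) hO hΓO hπ hσ hk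
  obtain ⟨Cx, hCx, hix⟩ := exists_field_interpolation hk hΓ.1 hT hβ hV htube hΦx C
  obtain ⟨Cu, hCu, hiu⟩ := exists_field_interpolation hk hΓ.1 hT hβ hV htube hΦu C
  obtain ⟨Cv, hCv, hiv⟩ := exists_field_interpolation hk hΓ.1 hT hβ hV htube hΦv C
  refine ⟨V, hV, hΦx, hΦu, min h₁ (r / (C + 1)), by positivity, (min_le_left _ _).trans hh₁1,
    L + C + Cx + Cu + Cv, by positivity, μ, hμ, ?_⟩
  intro 𝒯 hadm hh hh₀ P
  have hh1 : 𝒯.h ≤ 1 := hh₀.trans ((min_le_left _ _).trans hh₁1)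
  obtain ⟨hreg, hgood, hnear⟩ := hx 𝒯 hadm hh (hh₀.trans (min_le_left _ _)) P
  have hhr : C * 𝒯.h ≤ r := by
    have h1 := hh₀.trans (min_le_right _ _)
    rw [le_div_iff₀ (by positivity)] at h1
    nlinarith
  have hq : ∃ q ∈ Γ₀, ∀ t ∈ Icc 0 T, ∀ ξ ∈ refTriangle, ‖𝒯.patch (xStar F 𝒯 t) P ξ - F.X q t‖ ≤ r :=
    ⟨_, 𝒯.vertex_mem P 0, fun t ht ξ hξ => (hnear t ht ξ hξ).trans hhr⟩
  have hval : ∀ t ∈ Icc 0 T, ∀ α, nearestPoint (F.surface t) (𝒯.patch (xStar F 𝒯 t) P (refNode k α)) =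
      F.X (𝒯.node (𝒯.loc P α)) t := fun t ht α => by
    rw [F.patch_xStar_refNode hk]
    exact nearestPoint_of_mem (F.isCompact_surface hΓ ht) (mem_image_of_mem _ (nearestPoint_mem hΓ.1 hΓ.2.1 _))
  have hdiff : ∀ t ∈ Icc 0 T, ∀ ξ ∈ refTriangle, DifferentiableAt ℝ (𝒯.patch (xStar F 𝒯 t) P) ξ :=
    fun t _ ξ _ => 𝒯.differentiable_patch _ P ξ
  have rx := hix 𝒯 hh hh1 P (fun t => 𝒯.patch (xStar F 𝒯 t) P) hdiff hreg hq (xStar F 𝒯)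
    fun t ht ℓ α => by rw [hval t ht]; rfl
  have ru := hiu 𝒯 hh hh1 P (fun t => 𝒯.patch (xStar F 𝒯 t) P) hdiff hreg hq (F.uNodal 𝒯)
    fun t ht ℓ α => by rw [hval t ht]; rfl
  have rv := hiv 𝒯 hh hh1 P (fun t => 𝒯.patch (xStar F 𝒯 t) P) hdiff hreg hq (vStar F 𝒯)
    fun t ht ℓ α => by rw [hval t ht]; fin_cases ℓ <;> rfl
  intro ξ hξ
  refine ⟨fun t ht => ⟨goodJets_mono (by linarith) le_rfl (hgood t ht ξ hξ), htube ⟨ht, hq.imp fun q h => ⟨h.1, h.2 t ht ξ hξ⟩⟩⟩,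
    (hreg ξ hξ).1.mono (by linarith), (rv.1 ξ hξ).1.mono (by linarith), (ru.1 ξ hξ).1.mono (by linarith),
    (rx.2 ξ hξ).mono (by gcongr; linarith), (ru.2 ξ hξ).mono (by gcongr; linarith)⟩

end MeanCurvatureFlow

/-! ### The number of triangles -/

lemma hausdorffMeasure_le_of_le_norm {E G : Type*} [NormedAddCommGroup E] [MeasurableSpace E] [BorelSpace E]
    [NormedAddCommGroup G] [MeasurableSpace G] [BorelSpace G] {f : E → G} {s : Set E} {c : ℝ} (hc : 0 < c)
    (h : ∀ x ∈ s, ∀ y ∈ s, c * ‖x - y‖ ≤ ‖f x - f y‖) :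
    μH[2] s ≤ (c⁻¹.toNNReal : ENNReal) ^ (2 : ℝ) * μH[2] (f '' s) := by
  have hinj : InjOn f s := fun x hx y hy hxy => by
    have h1 := h x hx y hy
    rw [hxy, sub_self, norm_zero] at h1
    exact sub_eq_zero.1 (norm_le_zero_iff.1 (nonpos_of_mul_nonpos_right h1 hc))
  have hLip : LipschitzOnWith c⁻¹.toNNReal (Function.invFunOn f s) (f '' s) := by
    refine LipschitzOnWith.of_dist_le_mul ?_
    rintro _ ⟨x, hx, rfl⟩ _ ⟨y, hy, rfl⟩
    rw [hinj.leftInvOn_invFunOn hx, hinj.leftInvOn_invFunOn hy, Real.coe_toNNReal _ (by positivity), dist_eq_norm, dist_eq_norm,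
      ← div_eq_inv_mul, le_div_iff₀ hc, mul_comm]
    exact h x hx y hy
  have h1 := hLip.hausdorffMeasure_image_le (d := 2) (by norm_num)
  rwa [image_image, image_congr (fun x hx => hinj.leftInvOn_invFunOn hx), image_id'] at h1

/-- A smooth closed surface has finite area: locally it is a Lipschitz graph over a coordinate plane. -/
lemma hausdorffMeasure_surface_lt_top {Γ : Set E3} (hΓ : IsSmoothClosedSurface Γ) : μH[2] Γ < ⊤ := by
  refine hΓ.1.measure_lt_top_of_nhdsWithin fun p hp => ?_
  obtain ⟨hC, ν, hν, hD⟩ := contDiffAt_nearestPoint hΓ hp 1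
  obtain ⟨i, hi⟩ : ∃ i, ν i ≠ 0 := by
    by_contra! h
    have : ν = 0 := by ext i; exact h i
    rw [this, norm_zero] at hν
    exact zero_ne_one hν
  let A : E3 →L[ℝ] Plane := ContinuousLinearMap.pi fun j => EuclideanSpace.proj (i.succAbove j)
  obtain ⟨c, hc, hcoer⟩ := exists_pos_mul_norm_le (X := Unit) (A := fun _ => A.prod (innerSL ℝ ν)) isCompact_univ
    continuousOn_const (fun _ _ v hv => by
      obtain ⟨h1, h2⟩ := Prod.mk.inj hv
      have h3 : ∀ j, v (i.succAbove j) = 0 := fun j => congrFun h1 j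
      have h4 : inner ℝ ν v = 0 := h2
      rw [PiLp.inner_apply, Fin.sum_univ_succAbove _ i] at h4
      simp [h3, hi] at h4
      ext j
      rcases Fin.eq_self_or_eq_succAbove i j with rfl | ⟨j, rfl⟩
      · exact h4
      · exact h3 j)
  have hs := (hC.hasStrictFDerivAt (by simp)).isLittleO.def (c := c / 2) (by positivity)
  rw [nhds_prod_eq] at hs
  obtain ⟨t, ht, hlip⟩ := (eventually_prod_self_iff (r := fun x y => ‖nearestPoint Γ x - nearestPoint Γ y -
    fderiv ℝ (nearestPoint Γ) p (x - y)‖ ≤ c / 2 * ‖x - y‖)).1 hs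
  refine ⟨Γ ∩ (t ∩ Metric.ball p 1), inter_mem_nhdsWithin _ (inter_mem ht (Metric.ball_mem_nhds p one_pos)), ?_⟩
  refine (hausdorffMeasure_le_of_le_norm hc (f := A) ?_).trans_lt ?_
  · rintro x ⟨hx, hxt, -⟩ y ⟨hy, hyt, -⟩
    have h1 := hlip x hxt y hyt
    have h2 := hcoer () (mem_univ _) (x - y)
    simp only [nearestPoint_of_mem hΓ.1 hx, nearestPoint_of_mem hΓ.1 hy, hD, sub_sub_cancel, norm_smul, hν, mul_one] at h1
    rw [ContinuousLinearMap.prod_apply, Prod.norm_mk, le_max_iff, map_sub] at h2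
    rcases h2 with h2 | h2
    · exact h2
    · have h3 : c * ‖x - y‖ ≤ c / 2 * ‖x - y‖ := h2.trans h1
      have h4 : ‖x - y‖ ≤ 0 := by nlinarith
      rw [norm_le_zero_iff.1 h4]
      simp
  · have hb : Bornology.IsBounded (A '' (Γ ∩ (t ∩ Metric.ball p 1))) :=
      (A.lipschitz.isBounded_image (Metric.isBounded_ball.subset fun x hx => hx.2.2))
    have hv : (μH[2] : Measure Plane) = volume := by
      have := hausdorffMeasure_pi_real (ι := Fin 2)
      simpa using this
    rw [hv]
    exact ENNReal.mul_lt_top (by simp) hb.measure_lt_top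

namespace Triangulation

variable {Γ : Set E3} {k : ℕ} (𝒯 : Triangulation Γ k)

lemma tri_injective (P : Fin 𝒯.n) : Function.Injective (𝒯.tri P) := fun _ _ h =>
  𝒯.triL_injective P (add_left_cancel h)

/-- Points in the interior of a triangle do not belong to the other triangles. -/
lemma tri_ne_tri {P P' : Fin 𝒯.n} (hP : P ≠ P') {ξ ξ' : Plane} (h0 : 0 < ξ 0) (h1 : 0 < ξ 1) (h2 : ξ 0 + ξ 1 < 1)
    (hξ' : ξ' ∈ refTriangle) : 𝒯.tri P ξ ≠ 𝒯.tri P' ξ' := by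
  intro heq
  have hmem : 𝒯.tri P ξ ∈ convexHull ℝ (range (𝒯.vertex P) ∩ range (𝒯.vertex P')) := by
    rw [← 𝒯.conforming P P' hP]
    exact ⟨𝒯.tri_mem P ⟨h0.le, h1.le, h2.le⟩, heq ▸ 𝒯.tri_mem P' hξ'⟩
  obtain ⟨i, hi⟩ : ∃ i, 𝒯.vertex P i ∉ range (𝒯.vertex P') := by
    by_contra! h
    refine hP (𝒯.distinct ?_)
    refine Set.eq_of_subset_of_ncard_le (by rintro _ ⟨i, rfl⟩; exact h i) ?_ (finite_range _)
    change (range (𝒯.vertex P')).ncard ≤ (range (𝒯.vertex P)).ncard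
    rw [← image_univ, ← image_univ, ncard_image_of_injective _ (𝒯.affineIndependent P).injective,
      ncard_image_of_injective _ (𝒯.affineIndependent P').injective]
  have key : ∀ H : Set Plane, Convex ℝ H → (∀ j, j ≠ i → 𝒯.vertex P j ∈ 𝒯.tri P '' H) → ξ ∈ H := by
    intro H hH hj
    have hc : Convex ℝ (𝒯.tri P '' H) := by
      have h := (hH.linear_image (𝒯.triL P).toLinearMap).translate (𝒯.vertex P 0)
      rwa [image_image] at h
    have hsub : range (𝒯.vertex P) ∩ range (𝒯.vertex P') ⊆ 𝒯.tri P '' H := by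
      rintro _ ⟨⟨j, rfl⟩, hj'⟩
      exact hj j fun h => hi (h ▸ hj')
    exact (𝒯.tri_injective P).mem_set_image.1 (convexHull_min hsub hc hmem)
  have v0 : 𝒯.tri P 0 = 𝒯.vertex P 0 := 𝒯.tri_zero P
  have v1 : 𝒯.tri P (Pi.single 0 1) = 𝒯.vertex P 1 := by simp [tri, triL_apply]
  have v2 : 𝒯.tri P (Pi.single 1 1) = 𝒯.vertex P 2 := by simp [tri, triL_apply]
  have hlin : ∀ (a b c : ℝ), Convex ℝ {ζ : Plane | a * ζ 0 + b * ζ 1 = c} := by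
    intro a b c x hx y hy s t _ _ hst
    simp only [mem_ofPred_eq, Pi.add_apply, Pi.smul_apply, smul_eq_mul] at hx hy ⊢
    linear_combination s * hx + t * hy + c * hst
  fin_cases i
  · have h := key _ (hlin 1 1 1) fun j hj => by
      fin_cases j
      · exact absurd rfl hj
      · exact ⟨_, by simp, v1⟩
      · exact ⟨_, by simp, v2⟩
    simp only [mem_ofPred_eq] at h
    linarith
  · have h := key _ (hlin 1 0 0) fun j hj => by
      fin_cases j
      · exact ⟨_, by simp, v0⟩
      · exact absurd rfl hj
      · exact ⟨_, by simp, v2⟩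
    simp only [mem_ofPred_eq] at h
    linarith
  · have h := key _ (hlin 0 1 0) fun j hj => by
      fin_cases j
      · exact ⟨_, by simp, v0⟩
      · exact ⟨_, by simp, v1⟩
      · exact absurd rfl hj
    simp only [mem_ofPred_eq] at h
    linarith

end Triangulation

/-- The number of triangles is of order `h⁻²`: the projections of the triangles to the surface have disjoint interiors and
areas bounded below by a multiple of `h²`. -/
lemma MeanCurvatureFlow.exists_card_le {Γ₀ : Set E3} {T : ℝ} {m : ℕ} (F : MeanCurvatureFlow Γ₀ T m) (hT : 0 < T)
    (hΓ : IsSmoothClosedSurface Γ₀) (hm : 2 ≤ m) {σ : ℝ} (hσ : 0 < σ) :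
    ∃ C, 0 ≤ C ∧ ∃ h₀ > 0, ∀ {k : ℕ} (𝒯 : Triangulation Γ₀ k), 𝒯.IsAdmissible σ → 0 < 𝒯.h → 𝒯.h ≤ h₀ →
      𝒯.n * 𝒯.h ^ 2 ≤ C := by
  obtain ⟨O, hO, hΓO, hπ⟩ := exists_isOpen_contDiffOn_nearestPoint hΓ m
  obtain ⟨c, hc, h₁, hh₁, hlow⟩ := F.exists_mul_norm_le_dx_Xe hT hΓ hm hO hΓO hπ hσ
  have hm1 : 1 ≤ m := by omega
  have hfd : ContDiffOn ℝ 1 (fderiv ℝ (nearestPoint Γ₀)) O :=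
    (hπ.of_le (m := 2) (by exact_mod_cast hm)).fderiv_of_isOpen hO (by norm_num)
  obtain ⟨r, hr, hrO⟩ := hΓ.1.exists_cthickening_subset_open hO hΓO
  obtain ⟨B, hB, -, hlip⟩ := exists_bound_lipschitz_of_isOpen hO hfd hΓ.1.cthickening hrO
  have h0T : (0 : ℝ) ∈ Icc 0 T := ⟨le_rfl, hT.le⟩
  have hU : IsOpen (O ×ˢ (univ : Set ℝ)) := hO.prod isOpen_univ
  -- at the initial time the extended flow map is the projection to the surface
  have hXe0 : (fun y => F.Xe (y, 0)) = nearestPoint Γ₀ := funext fun y => F.initial _ (nearestPoint_mem hΓ.1 hΓ.2.1 y)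
  have hdx : ∀ q ∈ Γ₀, dx F.Xe (slab (O ×ˢ univ) T) (q, 0) = fderiv ℝ (nearestPoint Γ₀) q := fun q hq => by
    have h := hasFDerivAt_dx hU (((F.contDiffOn_Xe hΓ hπ).differentiableOn (by norm_cast; omega)) _
      (mem_slab_of_mem hΓO hq h0T)) (mem_slab_of_mem hΓO hq h0T)
    rw [hXe0] at h
    exact h.fderiv.symm
  have hstrict : ∀ q ∈ Γ₀, ∀ ρ ≤ r, ∀ x ∈ Metric.closedBall q ρ, ∀ y ∈ Metric.closedBall q ρ,
      ‖nearestPoint Γ₀ x - nearestPoint Γ₀ y - fderiv ℝ (nearestPoint Γ₀) q (x - y)‖ ≤ B * ρ * ‖x - y‖ := by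
    intro q hq ρ hρ x hx y hy
    have hK : ∀ z ∈ Metric.closedBall q ρ, z ∈ Metric.cthickening r Γ₀ := fun z hz =>
      Metric.mem_cthickening_of_dist_le z q r Γ₀ hq ((Metric.mem_closedBall.1 hz).trans hρ)
    refine (convex_closedBall q ρ).norm_image_sub_le_of_norm_hasFDerivWithin_le' (f' := fderiv ℝ (nearestPoint Γ₀))
      (fun z hz => ?_) (fun z hz => ?_) hy hx
    · exact ((hπ.differentiableOn (by norm_cast; omega)).differentiableAt (hO.mem_nhds (hrO (hK z hz)))).hasFDerivAt.hasFDerivWithinAt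
    · refine (hlip z (hK z hz) q (hK q (Metric.mem_closedBall_self (dist_nonneg.trans hx)))).trans ?_
      rw [← dist_eq_norm]
      exact mul_le_mul_of_nonneg_left hz hB
  refine ⟨64 * (c / 2)⁻¹ ^ 2 * (μH[2] Γ₀).toReal, by positivity, min h₁ (min r (c / (4 * (B + 1)))), by positivity, ?_⟩
  intro k 𝒯 hadm hh hh₀
  set D : Set Plane := Icc (fun _ => 1 / 8) (fun _ => 1 / 4)
  have hD : ∀ ξ ∈ D, 0 < ξ 0 ∧ 0 < ξ 1 ∧ ξ 0 + ξ 1 < 1 := fun ξ hξ => by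
    have a0 := hξ.1 0
    have a1 := hξ.1 1
    have b0 := hξ.2 0
    have b1 := hξ.2 1
    simp only at a0 a1 b0 b1
    refine ⟨?_, ?_, ?_⟩ <;> linarith
  have hDr : D ⊆ refTriangle := fun ξ hξ => ⟨(hD ξ hξ).1.le, (hD ξ hξ).2.1.le, (hD ξ hξ).2.2.le⟩
  have hanti : ∀ P, ∀ ξ ∈ D, ∀ η ∈ D, c / 2 * 𝒯.h * ‖ξ - η‖ ≤ ‖nearestPoint Γ₀ (𝒯.tri P ξ) - nearestPoint Γ₀ (𝒯.tri P η)‖ := by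
    intro P ξ hξ η hη
    have hv := 𝒯.vertex_mem P 0
    have hball : ∀ ζ ∈ D, 𝒯.tri P ζ ∈ Metric.closedBall (𝒯.vertex P 0) 𝒯.h := fun ζ hζ => by
      have := 𝒯.norm_tri_sub_le P (hDr hζ) zero_mem_refTriangle
      rwa [𝒯.tri_zero, ← dist_eq_norm] at this
    have h1 := hstrict _ hv 𝒯.h (hh₀.trans ((min_le_right _ _).trans (min_le_left _ _))) _ (hball ξ hξ) _ (hball η hη)
    have h2 := hlow 𝒯 hadm hh (hh₀.trans (min_le_left _ _)) P 0 h0T (ξ - η)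
    have h3 := 𝒯.norm_triL_le P (ContinuousLinearMap.id ℝ E3) (fun i => 𝒯.norm_vertex_sub_le P i) (ξ - η)
    rw [ContinuousLinearMap.id_apply] at h3
    rw [hdx _ hv] at h2
    rw [𝒯.tri_sub, norm_sub_rev] at h1
    have h4 := norm_sub_norm_le (fderiv ℝ (nearestPoint Γ₀) (𝒯.vertex P 0) (𝒯.triL P (ξ - η)))
      (nearestPoint Γ₀ (𝒯.tri P ξ) - nearestPoint Γ₀ (𝒯.tri P η))
    have h5 : 𝒯.h * (4 * (B + 1)) ≤ c :=
      (le_div_iff₀ (by positivity)).1 (hh₀.trans ((min_le_right _ _).trans (min_le_right _ _)))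
    have h6 : B * 𝒯.h * ‖𝒯.triL P (ξ - η)‖ ≤ c / 2 * 𝒯.h * ‖ξ - η‖ := by
      calc B * 𝒯.h * ‖𝒯.triL P (ξ - η)‖ ≤ B * 𝒯.h * (2 * 𝒯.h * ‖ξ - η‖) := by gcongr
        _ = (2 * B * 𝒯.h) * 𝒯.h * ‖ξ - η‖ := by ring
        _ ≤ c / 2 * 𝒯.h * ‖ξ - η‖ := by gcongr; nlinarith
    linarith
  have hcont : ∀ P, ContinuousOn (fun ξ => nearestPoint Γ₀ (𝒯.tri P ξ)) D := fun P =>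
    hπ.continuousOn.comp ((𝒯.triL P).continuous.const_add _).continuousOn fun ξ hξ => hrO (Metric.mem_cthickening_of_dist_le _ _ r Γ₀
      (𝒯.vertex_mem P 0) (by
        have := 𝒯.norm_tri_sub_le P (hDr hξ) zero_mem_refTriangle
        rw [𝒯.tri_zero, ← dist_eq_norm] at this
        exact this.trans (hh₀.trans ((min_le_right _ _).trans (min_le_left _ _)))))
  have hmeas : ∀ P, MeasurableSet ((fun ξ => nearestPoint Γ₀ (𝒯.tri P ξ)) '' D) := fun P =>
    (isCompact_Icc.image_of_continuousOn (hcont P)).measurableSet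
  have hin : ∀ P, ∀ ξ ∈ D, 𝒯.tri P ξ ∈ ⋃ P, convexHull ℝ (range (𝒯.vertex P)) := fun P ξ hξ =>
    mem_iUnion.2 ⟨P, 𝒯.tri_mem P (hDr hξ)⟩
  have hdisj : Pairwise (Function.onFun Disjoint fun P => (fun ξ => nearestPoint Γ₀ (𝒯.tri P ξ)) '' D) := by
    intro P P' hP
    rw [Function.onFun, Set.disjoint_left]
    rintro _ ⟨ξ, hξ, rfl⟩ ⟨ξ', hξ', h⟩
    obtain ⟨h0, h1, h2⟩ := hD ξ hξ
    exact 𝒯.tri_ne_tri hP h0 h1 h2 (hDr hξ') (𝒯.bijOn.injOn (hin P ξ hξ) (hin P' ξ' hξ') h.symm)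
  have hsum : ∑ P, μH[2] ((fun ξ => nearestPoint Γ₀ (𝒯.tri P ξ)) '' D) ≤ μH[2] Γ₀ := by
    rw [← tsum_fintype (L := SummationFilter.unconditional _), ← measure_iUnion hdisj hmeas]
    refine measure_mono (iUnion_subset fun P => ?_)
    rintro _ ⟨ξ, hξ, rfl⟩
    exact nearestPoint_mem hΓ.1 hΓ.2.1 _
  have hvol : (μH[2] : Measure Plane) D = ENNReal.ofReal (1 / 64) := by
    have h1 := hausdorffMeasure_pi_real (ι := Fin 2)
    rw [Fintype.card_fin, Nat.cast_ofNat] at h1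
    rw [h1, Real.volume_Icc_pi, Fin.prod_univ_two, ← ENNReal.ofReal_mul (by norm_num)]
    norm_num
  set a := (c / 2 * 𝒯.h)⁻¹
  have ha : 0 < a := by positivity
  have hone : ∀ P, ENNReal.ofReal (1 / 64) ≤
      ENNReal.ofReal a ^ 2 * μH[2] ((fun ξ => nearestPoint Γ₀ (𝒯.tri P ξ)) '' D) := fun P => by
    have h1 := hausdorffMeasure_le_of_le_norm (by positivity) (hanti P)
    rw [hvol] at h1
    exact_mod_cast h1
  have hfin := (hausdorffMeasure_surface_lt_top hΓ).ne
  have htot : (𝒯.n : ENNReal) * ENNReal.ofReal (1 / 64) ≤ ENNReal.ofReal a ^ 2 * μH[2] Γ₀ := by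
    calc (𝒯.n : ENNReal) * ENNReal.ofReal (1 / 64) = ∑ _P : Fin 𝒯.n, ENNReal.ofReal (1 / 64) := by simp
      _ ≤ ∑ P, ENNReal.ofReal a ^ 2 * μH[2] ((fun ξ => nearestPoint Γ₀ (𝒯.tri P ξ)) '' D) :=
        Finset.sum_le_sum fun P _ => hone P
      _ ≤ ENNReal.ofReal a ^ 2 * μH[2] Γ₀ := by rw [← Finset.mul_sum]; gcongr
  have hreal := ENNReal.toReal_mono (ENNReal.mul_ne_top (by simp) hfin) htot
  rw [ENNReal.toReal_mul, ENNReal.toReal_mul, ENNReal.toReal_natCast, ENNReal.toReal_ofReal (by norm_num), ENNReal.toReal_pow,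
    ENNReal.toReal_ofReal ha.le] at hreal
  have ha2 : a ^ 2 * 𝒯.h ^ 2 = (c / 2)⁻¹ ^ 2 := by simp only [a]; field_simp
  calc 𝒯.n * 𝒯.h ^ 2 = 64 * (𝒯.n * (1 / 64)) * 𝒯.h ^ 2 := by ring
    _ ≤ 64 * (a ^ 2 * (μH[2] Γ₀).toReal) * 𝒯.h ^ 2 := by gcongr
    _ = 64 * (a ^ 2 * 𝒯.h ^ 2) * (μH[2] Γ₀).toReal := by ring
    _ = _ := by rw [ha2]

/-! ### The Ritz projection -/

lemma kV_smul {d : ℕ} (X : Jet 3) (c : ℝ) (W : Jet d) : kV X (c • W) = c • kV X W := by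
  refine Jet.ext' fun ℓ => ?_
  simp only [kV, mV, aV, mkJet_zero, mkJet_one, mkJet_two, PiLp.add_apply, PiLp.smul_apply, Pi.zero_apply, smul_eq_mul]
  refine ⟨?_, ?_, ?_⟩ <;> ring

lemma exists_norm_kV_sub_le {d : ℕ} (L : ℝ) {μ : ℝ} (hμ : 0 < μ) : ∃ C, 0 ≤ C ∧ ∀ X ∈ goodJets L μ, ∀ Y ∈ goodJets L μ,
    ∀ W : Jet d, ‖kV X W - kV Y W‖ ≤ C * ‖X - Y‖ * ‖W‖ := by
  obtain ⟨C, hC, h⟩ := exists_lipschitz_integrand (contDiffOn_kV (d := d)) (max L 1) hμ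
  refine ⟨C, hC, fun X hX Y hY W => ?_⟩
  by_cases hW : W = 0
  · have h0 : ∀ X : Jet 3, kV X (0 : Jet d) = 0 := fun X => by simpa using kV_smul X 0 (0 : Jet d)
    rw [hW, h0, h0]
    simp
  have hn : 0 < ‖W‖ := norm_pos_iff.2 hW
  have hg := goodJets_mono (le_max_left L 1) (le_refl μ)
  have h1 : ‖‖W‖⁻¹ • W‖ ≤ max L 1 := by
    rw [norm_smul, norm_inv, norm_norm, inv_mul_cancel₀ hn.ne']; exact le_max_right _ _
  have h2 := (h X (hg hX) Y (hg hY) _ _ h1 h1).2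
  rw [sub_self, norm_zero, add_zero, kV_smul, kV_smul, ← smul_sub, norm_smul, norm_inv, norm_norm,
    inv_mul_le_iff₀ hn] at h2
  linarith

lemma LipBdd.prodMk {E F : Type*} [NormedAddCommGroup E] [NormedAddCommGroup F] {T C : ℝ} {f : ℝ → E} {g : ℝ → F}
    (hf : LipBdd T C f) (hg : LipBdd T C g) : LipBdd T C fun t => (f t, g t) :=
  ⟨fun t ht => max_le (hf.1 t ht) (hg.1 t ht), fun t ht s hs => max_le (hf.2 t ht s hs) (hg.2 t ht s hs)⟩

/-- Perturbations of nondegenerate patches change the integrand of the `H¹` inner product by a quantity of the same order. -/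
lemma exists_lipBdd_kV {T : ℝ} (hT : 0 < T) (L : ℝ) {μ : ℝ} (hμ : 0 < μ) : ∃ ε > 0, ∃ C, 0 ≤ C ∧
    ∀ (X X' : ℝ → Jet 3) (U U' : ℝ → Jet 4) (δ : ℝ), δ ≤ ε → (∀ t ∈ Icc 0 T, X t ∈ goodJets L μ) → LipBdd T L X → LipBdd T L U →
      LipBdd T δ (fun t => X t - X' t) → LipBdd T δ (fun t => U t - U' t) →
      (∀ t ∈ Icc 0 T, X' t ∈ goodJets (L + 1) (μ / 2)) ∧ LipBdd T (C * δ) fun t => kV (X t) (U t) - kV (X' t) (U' t) := by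
  obtain ⟨ε, hε, hε1, hpert⟩ := exists_goodJets_perturbation L hμ
  have hV : IsOpen (goodPairs 4 ×ˢ (univ : Set ℝ)) := (isOpen_goodPairs 4).prod isOpen_univ
  have hΦ : ContDiffOn ℝ 2 (fun p : (Jet 3 × Jet 4) × ℝ => kV p.1.1 p.1.2) (slab (goodPairs 4 ×ˢ univ) T) :=
    ((contDiffOn_kV (d := 4)).of_le (by norm_cast)).comp (f := fun p : (Jet 3 × Jet 4) × ℝ => p.1) contDiff_fst.contDiffOn
      fun p hp => hp.1.1
  have hK : IsCompact ((goodJets (L + 1) (μ / 2) ×ˢ Metric.closedBall (0 : Jet 4) (L + 1)) ×ˢ Icc 0 T) :=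
    ((isCompact_goodJets _ _).prod (isCompact_closedBall _ _)).prod isCompact_Icc
  obtain ⟨C, hC, h⟩ := exists_lipBdd_comp hT hV hΦ hK fun p hp =>
    mem_slab.2 ⟨⟨goodJets_subset (by positivity) hp.1.1, mem_univ _⟩, hp.2⟩
  refine ⟨ε, hε, C * (1 + max (L + 1) 0), by positivity, fun X X' U U' δ hδ hX hLX hLU hdX hdU => ?_⟩
  have hsub : ∀ {E : Type} [NormedAddCommGroup E] {f g : ℝ → E}, LipBdd T L f → LipBdd T δ (fun t => f t - g t) →
      LipBdd T (max (L + 1) 0) g := fun hf hd =>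
    ((hf.sub hd).mono ((by linarith : L + δ ≤ L + 1).trans (le_max_left _ _))).congr fun t _ => by abel
  have hX' : ∀ t ∈ Icc 0 T, ∀ Y ∈ Metric.closedBall (X t) ε, Y ∈ goodJets (L + 1) (μ / 2) := fun t ht Y hY =>
    hpert _ _ (hX t ht) (by rwa [← dist_eq_norm])
  have hclose : ∀ t ∈ Icc 0 T, X' t ∈ Metric.closedBall (X t) ε := fun t ht => by
    rw [Metric.mem_closedBall', dist_eq_norm]; exact (hdX.1 t ht).trans hδ
  have hB : L ≤ max (L + 1) 0 := (by linarith : L ≤ L + 1).trans (le_max_left _ _)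
  refine ⟨fun t ht => hX' t ht _ (hclose t ht), ?_⟩
  refine (h (fun t => (X t, U t)) (fun t => (X' t, U' t)) (max (L + 1) 0) δ ((hLX.prodMk hLU).mono hB)
    ((hsub hLX hdX).prodMk (hsub hLU hdU)) (hdX.prodMk hdU) fun t ht z hz => ?_).2
  have hconv := ((convex_closedBall (X t) ε).prod (convex_closedBall (0 : Jet 4) (L + 1))).segment_subset
    (x := (X t, U t)) (y := (X' t, U' t))
    ⟨Metric.mem_closedBall_self hε.le, mem_closedBall_zero_iff.2 ((hLU.1 t ht).trans (by linarith))⟩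
    ⟨hclose t ht, mem_closedBall_zero_iff.2 (by
      have := norm_sub_le_of_le (hLU.1 t ht) (hdU.1 t ht)
      rw [sub_sub_cancel] at this
      linarith)⟩ hz
  exact ⟨⟨hX' t ht _ hconv.1, hconv.2⟩, ht⟩

namespace Triangulation

variable {Γ : Set E3} {k : ℕ} {𝒯 : Triangulation Γ k}

lemma SI_le_of_le {F : Fin 𝒯.n → Plane → ℝ} (hF : ∀ P, ContinuousOn (F P) refTriangle) {B N : ℝ} (hB : 0 ≤ B)
    (h : ∀ P, ∀ ξ ∈ refTriangle, F P ξ ≤ B) (hN : 𝒯.n * 𝒯.h ^ 2 ≤ N) : 𝒯.SI F ≤ N * B := by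
  refine (SI_mono hF (fun _ => continuousOn_const) h).trans ?_
  have h1 : ∀ _P : Fin 𝒯.n, ∫ _ in refTriangle, B ≤ B := fun _ => by
    rw [setIntegral_const, smul_eq_mul]
    exact mul_le_of_le_one_left hB (ENNReal.toReal_le_of_le_ofReal zero_le_one (by simpa using volume_refTriangle_le))
  calc 𝒯.SI (fun _ _ => B) ≤ 𝒯.h ^ 2 * ∑ _P : Fin 𝒯.n, B :=
        mul_le_mul_of_nonneg_left (Finset.sum_le_sum fun P _ => h1 P) (sq_nonneg _)
    _ = 𝒯.n * 𝒯.h ^ 2 * B := by rw [Finset.sum_const, Finset.card_univ, Fintype.card_fin, nsmul_eq_mul]; ring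
    _ ≤ N * B := by gcongr

lemma NH_le_of_le_SI_inner {d : ℕ} {w : Fin d × Fin 𝒯.N → ℝ} {E : Fin 𝒯.n → Plane → Jet d}
    (hE : ∀ P, ContinuousOn (E P) refTriangle) {c : ℝ} (hc : 0 < c)
    (h : c * 𝒯.NH w ≤ 𝒯.SI fun P ξ => inner ℝ (E P ξ) (𝒯.jet w P ξ)) :
    𝒯.NH w ≤ c⁻¹ ^ 2 * 𝒯.SI fun P ξ => ‖E P ξ‖ ^ 2 := by
  have hj : ∀ P, ContinuousOn (fun ξ => ‖𝒯.jet w P ξ‖ ^ 2) refTriangle := fun P => (𝒯.continuous_normSq_jet w P).continuousOn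
  have hE2 : ∀ P, ContinuousOn (fun ξ => ‖E P ξ‖ ^ 2) refTriangle := fun P => (hE P).norm.fun_pow 2
  have h1 : (𝒯.SI fun P ξ => inner ℝ (E P ξ) (𝒯.jet w P ξ)) ≤
      𝒯.SI fun P ξ => (2 * c)⁻¹ * ‖E P ξ‖ ^ 2 + c / 2 * ‖𝒯.jet w P ξ‖ ^ 2 := by
    refine SI_mono (fun P => (hE P).inner (𝒯.continuous_jet_right w P).continuousOn)
      (fun P => (continuousOn_const.fun_mul (hE2 P)).fun_add (continuousOn_const.fun_mul (hj P))) fun P ξ _ => ?_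
    refine (real_inner_le_norm _ _).trans ?_
    have h2 := sq_nonneg (‖E P ξ‖ - c * ‖𝒯.jet w P ξ‖)
    have h3 : (2 * c)⁻¹ * ‖E P ξ‖ ^ 2 + c / 2 * ‖𝒯.jet w P ξ‖ ^ 2 - ‖E P ξ‖ * ‖𝒯.jet w P ξ‖ =
        (2 * c)⁻¹ * (‖E P ξ‖ - c * ‖𝒯.jet w P ξ‖) ^ 2 := by field_simp; ring
    have h4 : 0 ≤ (2 * c)⁻¹ * (‖E P ξ‖ - c * ‖𝒯.jet w P ξ‖) ^ 2 := by positivity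
    linarith
  rw [SI_add (fun P => continuousOn_const.fun_mul (hE2 P)) (fun P => continuousOn_const.fun_mul (hj P)), SI_const_mul, SI_const_mul] at h1
  change _ ≤ _ + c / 2 * 𝒯.NH w at h1
  have h2 : c / 2 * 𝒯.NH w ≤ (2 * c)⁻¹ * 𝒯.SI fun P ξ => ‖E P ξ‖ ^ 2 := by linarith
  calc 𝒯.NH w = (c / 2)⁻¹ * (c / 2 * 𝒯.NH w) := by field_simp
    _ ≤ (c / 2)⁻¹ * ((2 * c)⁻¹ * 𝒯.SI fun P ξ => ‖E P ξ‖ ^ 2) := by gcongr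
    _ = _ := by field_simp

/-- The finite element functions representing the exact solution in the `H¹` inner product have bounded jets which are Lipschitz
continuous in time, because they differ from the interpolation by a quantity of order `h`, of which the inverse estimate
bounds the jets. -/
lemma exists_lipBdd_ritz {k : ℕ} (hk : 1 ≤ k) {T : ℝ} (hT : 0 < T) (L : ℝ) {μ N : ℝ} (hμ : 0 < μ) (hN : 0 ≤ N) :
    ∃ h₀ > 0, ∃ C, 0 ≤ C ∧ ∀ {Γ : Set E3} (𝒯 : Triangulation Γ k), 0 < 𝒯.h → 𝒯.h ≤ h₀ → 𝒯.n * 𝒯.h ^ 2 ≤ N →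
      ∀ (xs : ℝ → Fin 3 × Fin 𝒯.N → ℝ) (ui us : ℝ → Fin 4 × Fin 𝒯.N → ℝ) (X : ℝ → Fin 𝒯.n → Plane → Jet 3)
        (U : ℝ → Fin 𝒯.n → Plane → Jet 4),
      (∀ P, ∀ ξ ∈ refTriangle, (∀ t ∈ Icc 0 T, 𝒯.jet (xs t) P ξ ∈ goodJets L μ) ∧ LipBdd T L (fun t => 𝒯.jet (xs t) P ξ) ∧
        LipBdd T L (fun t => 𝒯.jet (ui t) P ξ) ∧ LipBdd T (L * 𝒯.h) (fun t => 𝒯.jet (xs t) P ξ - X t P ξ) ∧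
        LipBdd T (L * 𝒯.h) (fun t => 𝒯.jet (ui t) P ξ - U t P ξ)) →
      (∀ t ∈ Icc 0 T, ∀ P, ContinuousOn (X t P) refTriangle ∧ ContinuousOn (U t P) refTriangle) →
      ((∀ t ∈ Icc 0 T, ∀ P, ∀ ξ ∈ refTriangle, X t P ξ ∈ goodJets (L + 1) (μ / 2)) → ∀ t ∈ Icc 0 T, ∀ z,
        z ⬝ᵥ 𝒯.K 4 (xs t) *ᵥ us t = 𝒯.SI fun P ξ => inner ℝ (kV (X t P ξ) (U t P ξ)) (𝒯.jet z P ξ)) →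
      (∀ t ∈ Icc 0 T, ∀ P, ∀ ξ ∈ refTriangle, X t P ξ ∈ goodJets (L + 1) (μ / 2)) ∧
      ∀ P, ∀ ξ ∈ refTriangle, LipBdd T C fun t => 𝒯.jet (us t) P ξ := by
  obtain ⟨ε, hε, C₁, hC₁, hkV⟩ := exists_lipBdd_kV hT L hμ
  obtain ⟨C₂, hC₂, hdiff⟩ := exists_norm_kV_sub_le (d := 4) L hμ
  obtain ⟨c, hc, _, _, hcoer⟩ := exists_inner_kV_bounds L hμ
  obtain ⟨I, hI, hinv⟩ := exists_inverse_estimate_jet hk 4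
  set B := C₁ * |L|
  set A₁ := c⁻¹ ^ 2 * (N * B ^ 2)
  set A₂ := c⁻¹ ^ 2 * (2 * (N * B ^ 2) + 2 * (C₂ * |L|) ^ 2 * A₁)
  refine ⟨ε / (|L| + 1), by positivity, √(I * A₁) + √(I * A₂) + |L|, by positivity, ?_⟩
  intro Γ 𝒯 hh hh₀ hn xs ui us X U hreg hcont hK
  have hδ : L * 𝒯.h ≤ ε := by
    rw [le_div_iff₀ (by positivity)] at hh₀
    nlinarith [le_abs_self L]
  have hkV' := fun P ξ hξ => hkV (fun t => 𝒯.jet (xs t) P ξ) (fun t => X t P ξ) (fun t => 𝒯.jet (ui t) P ξ) (fun t => U t P ξ)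
    (L * 𝒯.h) hδ (hreg P ξ hξ).1 (hreg P ξ hξ).2.1 (hreg P ξ hξ).2.2.1 (hreg P ξ hξ).2.2.2.1 (hreg P ξ hξ).2.2.2.2
  have hX : ∀ t ∈ Icc 0 T, ∀ P, ∀ ξ ∈ refTriangle, X t P ξ ∈ goodJets (L + 1) (μ / 2) := fun t ht P ξ hξ => (hkV' P ξ hξ).1 t ht
  refine ⟨hX, ?_⟩
  replace hK := hK hX
  have hgood : ∀ t ∈ Icc 0 T, 𝒯.Good (xs t) := fun t ht P ξ hξ => goodJets_subset hμ ((hreg P ξ hξ).1 t ht)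
  set ρ : ℝ → Fin 4 × Fin 𝒯.N → ℝ := fun t => us t - ui t
  set E : ℝ → Fin 𝒯.n → Plane → Jet 4 := fun t P ξ => kV (X t P ξ) (U t P ξ) - kV (𝒯.jet (xs t) P ξ) (𝒯.jet (ui t) P ξ)
  have hEb : ∀ P, ∀ ξ ∈ refTriangle, LipBdd T (B * 𝒯.h) fun t => E t P ξ := fun P ξ hξ => by
    refine ((hkV' P ξ hξ).2.neg.mono ?_).congr fun t _ => by simp only [E, neg_sub]
    rw [mul_assoc]
    gcongr
    exact le_abs_self L
  have hkXU : ∀ t ∈ Icc 0 T, ∀ P, ContinuousOn (fun ξ => kV (X t P ξ) (U t P ξ)) refTriangle := fun t ht P =>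
    (contDiffOn_kV.continuousOn).comp (f := fun ξ => (X t P ξ, U t P ξ)) ((hcont t ht P).1.prodMk (hcont t ht P).2)
      fun ξ hξ => goodJets_subset (by positivity) (hX t ht P ξ hξ)
  have hkx : ∀ t ∈ Icc 0 T, ∀ (w : Fin 4 × Fin 𝒯.N → ℝ) P,
      ContinuousOn (fun ξ => kV (𝒯.jet (xs t) P ξ) (𝒯.jet w P ξ)) refTriangle :=
    fun t ht w P => (hgood t ht).continuousOn contDiffOn_kV w P
  have hEc : ∀ t ∈ Icc 0 T, ∀ P, ContinuousOn (E t P) refTriangle := fun t ht P => (hkXU t ht P).sub (hkx t ht _ P)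
  have hj : ∀ (z : Fin 4 × Fin 𝒯.N → ℝ) P, ContinuousOn (𝒯.jet z P) refTriangle := fun z P =>
    (𝒯.continuous_jet_right z P).continuousOn
  -- the equation for the difference of the representing function and the interpolation
  have hKρ : ∀ t ∈ Icc 0 T, ∀ z, z ⬝ᵥ 𝒯.K 4 (xs t) *ᵥ ρ t = 𝒯.SI fun P ξ => inner ℝ (E t P ξ) (𝒯.jet z P ξ) := by
    intro t ht z
    rw [Matrix.mulVec_sub, dotProduct_sub, hK t ht, dotProduct_K hh (hgood t ht),
      ← SI_sub (fun P => (hkXU t ht P).inner (hj z P)) (fun P => (hkx t ht _ P).inner (hj z P))]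
    simp only [E, inner_sub_left]
  have h1 : ∀ t ∈ Icc 0 T, 𝒯.NH (ρ t) ≤ A₁ * 𝒯.h ^ 2 := by
    intro t ht
    have h := NH_le_of_le_SI_inner (hEc t ht) hc
      (((hcoer 𝒯 hh (xs t) (fun P ξ hξ => (hreg P ξ hξ).1 t ht) (ρ t)).1).trans_eq (hKρ t ht _))
    refine h.trans ?_
    have h2 := SI_le_of_le (fun P => (hEc t ht P).norm.fun_pow 2) (by positivity)
      (fun P ξ hξ => pow_le_pow_left₀ (norm_nonneg _) ((hEb P ξ hξ).1 t ht) 2) hn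
    calc _ ≤ c⁻¹ ^ 2 * (N * (B * 𝒯.h) ^ 2) := by gcongr
      _ = _ := by simp only [A₁]; ring
  have h2 : ∀ t ∈ Icc 0 T, ∀ s ∈ Icc 0 T, 𝒯.NH (ρ t - ρ s) ≤ A₂ * 𝒯.h ^ 2 * |t - s| ^ 2 := by
    intro t ht s hs
    set E' : Fin 𝒯.n → Plane → Jet 4 := fun P ξ => E t P ξ - E s P ξ -
      (kV (𝒯.jet (xs t) P ξ) (𝒯.jet (ρ s) P ξ) - kV (𝒯.jet (xs s) P ξ) (𝒯.jet (ρ s) P ξ))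
    have hc1 : ∀ P, ContinuousOn (fun ξ => E t P ξ - E s P ξ) refTriangle := fun P => (hEc t ht P).sub (hEc s hs P)
    have hc2 : ∀ P, ContinuousOn (fun ξ => kV (𝒯.jet (xs t) P ξ) (𝒯.jet (ρ s) P ξ) - kV (𝒯.jet (xs s) P ξ) (𝒯.jet (ρ s) P ξ))
      refTriangle := fun P => (hkx t ht _ P).sub (hkx s hs _ P)
    have hE'c : ∀ P, ContinuousOn (E' P) refTriangle := fun P => (hc1 P).sub (hc2 P)
    have heq : (ρ t - ρ s) ⬝ᵥ 𝒯.K 4 (xs t) *ᵥ (ρ t - ρ s) = 𝒯.SI fun P ξ => inner ℝ (E' P ξ) (𝒯.jet (ρ t - ρ s) P ξ) := by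
      have e1 := hKρ t ht (ρ t - ρ s)
      have e2 := hKρ s hs (ρ t - ρ s)
      rw [dotProduct_K hh (hgood s hs)] at e2
      rw [Matrix.mulVec_sub, dotProduct_sub, e1, dotProduct_K hh (hgood t ht)]
      simp only [E', inner_sub_left (𝕜 := ℝ)]
      rw [SI_sub (fun P => ((hEc t ht P).inner (hj _ P)).fun_sub ((hEc s hs P).inner (hj _ P)))
        (fun P => ((hkx t ht _ P).inner (hj _ P)).fun_sub ((hkx s hs _ P).inner (hj _ P))),
        SI_sub (fun P => (hEc t ht P).inner (hj _ P)) (fun P => (hEc s hs P).inner (hj _ P)),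
        SI_sub (fun P => (hkx t ht _ P).inner (hj _ P)) (fun P => (hkx s hs _ P).inner (hj _ P)), ← e2]
      ring
    have h := NH_le_of_le_SI_inner hE'c hc
      (((hcoer 𝒯 hh (xs t) (fun P ξ hξ => (hreg P ξ hξ).1 t ht) _).1).trans_eq heq)
    have hb : (𝒯.SI fun P ξ => ‖E' P ξ‖ ^ 2) ≤ 𝒯.SI fun P ξ => 2 * ‖E t P ξ - E s P ξ‖ ^ 2 +
        2 * (C₂ * |L| * |t - s|) ^ 2 * ‖𝒯.jet (ρ s) P ξ‖ ^ 2 := by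
      refine SI_mono (fun P => (hE'c P).norm.fun_pow 2) (fun P => (continuousOn_const.fun_mul ((hc1 P).norm.fun_pow 2)).fun_add
        (continuousOn_const.fun_mul ((hj _ P).norm.fun_pow 2))) fun P ξ hξ => ?_
      have b1 := hdiff _ ((hreg P ξ hξ).1 t ht) _ ((hreg P ξ hξ).1 s hs) (𝒯.jet (ρ s) P ξ)
      have b2 : ‖𝒯.jet (xs t) P ξ - 𝒯.jet (xs s) P ξ‖ ≤ |L| * |t - s| :=
        ((hreg P ξ hξ).2.1.2 t ht s hs).trans (by gcongr; exact le_abs_self L)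
      have b3 : ‖kV (𝒯.jet (xs t) P ξ) (𝒯.jet (ρ s) P ξ) - kV (𝒯.jet (xs s) P ξ) (𝒯.jet (ρ s) P ξ)‖ ≤
          C₂ * |L| * |t - s| * ‖𝒯.jet (ρ s) P ξ‖ := by
        refine b1.trans ?_
        rw [mul_assoc C₂ |L|]
        gcongr
      have b4 := (norm_sub_le (E t P ξ - E s P ξ) _).trans (add_le_add_right b3 _)
      calc ‖E' P ξ‖ ^ 2 ≤ (‖E t P ξ - E s P ξ‖ + C₂ * |L| * |t - s| * ‖𝒯.jet (ρ s) P ξ‖) ^ 2 := by gcongr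
        _ ≤ 2 * (‖E t P ξ - E s P ξ‖ ^ 2 + (C₂ * |L| * |t - s| * ‖𝒯.jet (ρ s) P ξ‖) ^ 2) := add_sq_le
        _ = _ := by ring
    rw [SI_add (fun P => continuousOn_const.fun_mul ((hc1 P).norm.fun_pow 2))
      (fun P => continuousOn_const.fun_mul ((hj _ P).norm.fun_pow 2)), SI_const_mul, SI_const_mul] at hb
    have h3 := SI_le_of_le (fun P => (hc1 P).norm.fun_pow 2) (by positivity)
      (fun P ξ hξ => pow_le_pow_left₀ (norm_nonneg _) ((hEb P ξ hξ).2 t ht s hs) 2) hn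
    have h4 : 2 * (C₂ * |L| * |t - s|) ^ 2 * 𝒯.NH (ρ s) ≤ 2 * (C₂ * |L| * |t - s|) ^ 2 * (A₁ * 𝒯.h ^ 2) :=
      mul_le_mul_of_nonneg_left (h1 s hs) (by positivity)
    refine h.trans ?_
    calc _ ≤ c⁻¹ ^ 2 * (2 * (N * (B * 𝒯.h * |t - s|) ^ 2) + 2 * (C₂ * |L| * |t - s|) ^ 2 * (A₁ * 𝒯.h ^ 2)) := by
          refine mul_le_mul_of_nonneg_left (hb.trans (add_le_add (by gcongr) h4)) (by positivity)
      _ = _ := by simp only [A₂]; ring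
  have hroot : ∀ (w : Fin 4 × Fin 𝒯.N → ℝ) (A τ : ℝ), 0 ≤ τ → 0 ≤ A → 𝒯.NH w ≤ A * 𝒯.h ^ 2 * τ ^ 2 → ∀ P, ∀ ξ ∈ refTriangle,
      ‖𝒯.jet w P ξ‖ ≤ √(I * A) * τ := by
    intro w A τ hτ hA hw P ξ hξ
    have h3 := (hinv 𝒯 hh w P ξ hξ).trans (mul_le_mul_of_nonneg_left hw hI.le)
    have h4 : ‖𝒯.jet w P ξ‖ ^ 2 ≤ I * A * τ ^ 2 :=
      le_of_mul_le_mul_left (h3.trans_eq (by ring : _ = 𝒯.h ^ 2 * (I * A * τ ^ 2))) (by positivity)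
    refine le_of_sq_le_sq ?_ (by positivity)
    rwa [mul_pow, Real.sq_sqrt (by positivity)]
  intro P ξ hξ
  have hρ : LipBdd T (√(I * A₁) + √(I * A₂)) fun t => 𝒯.jet (ρ t) P ξ := by
    constructor
    · intro t ht
      have := hroot (ρ t) A₁ 1 zero_le_one (by positivity) (by simpa using h1 t ht) P ξ hξ
      rw [mul_one] at this
      exact this.trans (by linarith [Real.sqrt_nonneg (I * A₂)])
    · intro t ht s hs
      rw [← jet_sub]
      refine (hroot _ A₂ _ (abs_nonneg _) (by positivity) (h2 t ht s hs) P ξ hξ).trans ?_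
      gcongr
      linarith [Real.sqrt_nonneg (I * A₁)]
  exact (hρ.add ((hreg P ξ hξ).2.2.1.mono (le_abs_self L))).congr fun t _ => by simp only [ρ, jet_sub, sub_add_cancel]

end Triangulation

/-! ### The Ritz projection as a solution of a linear system -/

/-- Solutions of linear systems with differentiable coefficients are differentiable, by Cramer's rule. -/
lemma differentiableAt_of_mulVec_eq {n : Type*} [Fintype n] [DecidableEq n] {A : ℝ → Matrix n n ℝ} {b u : ℝ → n → ℝ} {t : ℝ}
    (hA : ∀ i j, DifferentiableAt ℝ (fun s => A s i j) t) (hb : ∀ i, DifferentiableAt ℝ (fun s => b s i) t)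
    (h : ∀ᶠ s in 𝓝 t, IsUnit (A s).det ∧ A s *ᵥ u s = b s) : DifferentiableAt ℝ u t := by
  have hdet : ∀ M : ℝ → Matrix n n ℝ, (∀ i j, DifferentiableAt ℝ (fun s => M s i j) t) →
      DifferentiableAt ℝ (fun s => (M s).det) t := fun M hM => by
    simp only [Matrix.det_apply']
    exact DifferentiableAt.fun_sum fun σ _ => (DifferentiableAt.fun_finsetProd fun i _ => hM _ _).const_mul _
  rw [differentiableAt_pi]
  intro i
  have h1 : DifferentiableAt ℝ (fun s => ((A s).updateCol i (b s)).det / (A s).det) t := by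
    refine (hdet _ fun j l => ?_).fun_div (hdet A hA) h.self_of_nhds.1.ne_zero
    by_cases hl : l = i
    · subst hl; simpa using hb j
    · simpa [hl] using hA j l
  refine h1.congr_of_eventuallyEq (h.mono fun s hs => ?_)
  have h3 : (A s).det • u s = Matrix.cramer (A s) (b s) := by
    refine Matrix.mulVec_injective_of_isUnit ((Matrix.isUnit_iff_isUnit_det _).2 hs.1) ?_
    rw [Matrix.mulVec_cramer, Matrix.mulVec_smul, hs.2]
  change u s i = ((A s).updateCol i (b s)).det / (A s).det
  rw [← Matrix.cramer_apply, ← h3, Pi.smul_apply, smul_eq_mul, mul_div_cancel_left₀ _ hs.1.ne_zero]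

namespace Triangulation

variable {Γ : Set E3} {k : ℕ} {𝒯 : Triangulation Γ k}

lemma differentiableAt_SI_inner {xs : ℝ → Fin 3 × Fin 𝒯.N → ℝ} {t : ℝ} (hx : DifferentiableAt ℝ xs t) {d e : ℕ}
    {O : Set ((Jet 3 × ℝ) × Jet e)} (hO : IsOpen O) {G : (Jet 3 × ℝ) × Jet e → Jet d} (hG : ContDiffOn ℝ 1 G O)
    (w : Fin e × Fin 𝒯.N → ℝ) (z : Fin d × Fin 𝒯.N → ℝ)
    (hmem : ∀ P, ∀ ξ ∈ refTriangle, ((𝒯.jet (xs t) P ξ, t), 𝒯.jet w P ξ) ∈ O) :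
    DifferentiableAt ℝ (fun s => 𝒯.SI fun P ξ => inner ℝ (G ((𝒯.jet (xs s) P ξ, s), 𝒯.jet w P ξ)) (𝒯.jet z P ξ)) t := by
  set Z := ((Fin 3 × Fin 𝒯.N → ℝ) × ℝ) × (Fin e × Fin 𝒯.N → ℝ) × (Fin d × Fin 𝒯.N → ℝ)
  let Lam : Fin 𝒯.n → Plane → (((Fin 3 × Fin 𝒯.N → ℝ) × ℝ) × (Fin e × Fin 𝒯.N → ℝ)) × (Fin d × Fin 𝒯.N → ℝ) →L[ℝ]
      ((Jet 3 × ℝ) × Jet e) × Jet d := fun P ξ =>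
    (((𝒯.jetL 3 P ξ).prodMap (ContinuousLinearMap.id ℝ ℝ)).prodMap (𝒯.jetL e P ξ)).prodMap (𝒯.jetL d P ξ)
  have hLam : ∀ P, Continuous (Lam P) := fun P => continuous_clm_apply.2 fun y =>
    (((𝒯.continuous_jet_right _ P).prodMk continuous_const).prodMk (𝒯.continuous_jet_right _ P)).prodMk
      (𝒯.continuous_jet_right _ P)
  have hG' : ContDiffOn ℝ 1 (fun p : ((Jet 3 × ℝ) × Jet e) × Jet d => inner ℝ (G p.1) p.2) (O ×ˢ univ) :=
    (hG.comp (f := Prod.fst) contDiff_fst.contDiffOn fun p hp => hp.1).inner ℝ contDiff_snd.contDiffOn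
  have hO' : IsOpen (O ×ˢ (univ : Set (Jet d))) := hO.prod isOpen_univ
  have hz : HasDerivAt (fun s => (((xs s, s), w), z)) (((deriv xs t, 1), 0), 0) t :=
    (((hx.hasDerivAt.prodMk (hasDerivAt_id t)).prodMk (hasDerivAt_const t w)).prodMk (hasDerivAt_const t z))
  have hm : ∀ P, ∀ ξ ∈ refTriangle, Lam P ξ (((xs t, t), w), z) ∈ O ×ˢ (univ : Set (Jet d)) := fun P ξ hξ =>
    ⟨hmem P ξ hξ, mem_univ _⟩
  exact (hasDerivAt_SI hLam hO' hG' hz hm fun P ξ hξ =>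
    (((hG'.contDiffAt (hO'.mem_nhds (hm P ξ hξ))).differentiableAt one_ne_zero).hasFDerivAt.comp_hasDerivAt
      (f := fun s => Lam P ξ (((xs s, s), w), z)) t ((Lam P ξ).hasFDerivAt.comp_hasDerivAt
        (f := fun s => (((xs s, s), w), z)) t hz))).1.differentiableAt

/-- The `H¹` inner product on a surface made up of patches, written in terms of jets. -/
lemma sum_forms_eq_SI {Y : Fin 𝒯.n → Plane → E3} (hY : ∀ P, ∀ ξ ∈ refTriangle, DifferentiableAt ℝ (Y P) ξ)
    (w : Fin 4 → Fin 𝒯.n → Plane → ℝ)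
    (hX : ∀ P, ∀ ξ ∈ refTriangle, 0 < dd (jetOf 𝒯.h (fun ℓ ξ => Y P ξ ℓ) ξ))
    (hXc : ∀ P, ContinuousOn (jetOf 𝒯.h (fun ℓ ξ => Y P ξ ℓ)) refTriangle)
    (hW : ∀ P, ContinuousOn (jetOf 𝒯.h (fun ℓ => w ℓ P)) refTriangle) (hh : 0 < 𝒯.h) (z : Fin 4 × Fin 𝒯.N → ℝ) :
    ∑ ℓ, (stiffnessForm Y (w ℓ) (𝒯.comp z ℓ) + massForm Y (w ℓ) (𝒯.comp z ℓ)) =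
      𝒯.SI fun P ξ => inner ℝ (kV (jetOf 𝒯.h (fun ℓ ξ => Y P ξ ℓ) ξ) (jetOf 𝒯.h (fun ℓ => w ℓ P) ξ)) (𝒯.jet z P ξ) := by
  set zc : Fin 4 → Fin 4 × Fin 𝒯.N → ℝ := fun ℓ q => if q.1 = ℓ then z q else 0
  have hz : ∀ ℓ P ξ, jetOf 𝒯.h (fun m => if m = ℓ then 𝒯.comp z ℓ P else 0) ξ = 𝒯.jet (zc ℓ) P ξ := by
    intro ℓ P ξ
    rw [jet]
    congr 1
    funext m
    by_cases hm : m = ℓ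
    · subst hm; simp [zc, comp]
    · simp only [zc, hm, if_false]
      funext η
      simp [fe]
  have hsum : ∑ ℓ, zc ℓ = z := by
    ext q
    simp [zc, Finset.sum_apply]
  have hmaps : ∀ P, MapsTo (fun ξ => (jetOf 𝒯.h (fun ℓ ξ => Y P ξ ℓ) ξ, jetOf 𝒯.h (fun ℓ => w ℓ P) ξ)) refTriangle (goodPairs 4) :=
    fun P ξ hξ => hX P ξ hξ
  have hcont : ∀ {V : Jet 3 → Jet 4 → Jet 4}, ContDiffOn ℝ ∞ (fun p : Jet 3 × Jet 4 => V p.1 p.2) (goodPairs 4) →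
      ∀ ℓ P, ContinuousOn (fun ξ => inner ℝ (V (jetOf 𝒯.h (fun ℓ ξ => Y P ξ ℓ) ξ) (jetOf 𝒯.h (fun ℓ => w ℓ P) ξ)) (𝒯.jet (zc ℓ) P ξ))
        refTriangle := fun hV ℓ P =>
    (hV.continuousOn.comp ((hXc P).prodMk (hW P)) (hmaps P)).inner (𝒯.continuous_jet_right _ P).continuousOn
  calc _ = ∑ ℓ, 𝒯.SI fun P ξ =>
        inner ℝ (kV (jetOf 𝒯.h (fun ℓ ξ => Y P ξ ℓ) ξ) (jetOf 𝒯.h (fun ℓ => w ℓ P) ξ)) (𝒯.jet (zc ℓ) P ξ) := by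
        refine Finset.sum_congr rfl fun ℓ _ => ?_
        rw [𝒯.stiffnessForm_eq hh hY ℓ w, 𝒯.massForm_eq hh hY ℓ w]
        simp only [hz]
        rw [← SI_add (hcont contDiffOn_aV ℓ) (hcont contDiffOn_mV ℓ)]
        simp only [kV, inner_add_left, add_comm]
    _ = _ := by
        rw [← SI_sum _ fun ℓ _ => hcont contDiffOn_kV ℓ]
        refine SI_congr fun P ξ _ => ?_
        rw [← inner_sum]
        simp only [← jetL_apply]
        rw [← map_sum, hsum]

end Triangulation

/-! ### The reference solution -/

lemma LipBdd.continuousOn {E : Type*} [NormedAddCommGroup E] {T C : ℝ} {f : ℝ → E} (h : LipBdd T C f) :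
    ContinuousOn f (Icc 0 T) :=
  (LipschitzOnWith.of_dist_le' (K := C) fun t ht s hs => by
    rw [dist_eq_norm, dist_eq_norm]; exact h.2 t ht s hs).continuousOn

lemma Triangulation.continuousOn_of_lipBdd_jet {Γ : Set E3} {k : ℕ} (hk : 1 ≤ k) (𝒯 : Triangulation Γ k) {T C : ℝ} {d : ℕ}
    {w : ℝ → Fin d × Fin 𝒯.N → ℝ} (h : ∀ P, ∀ ξ ∈ refTriangle, LipBdd T C fun t => 𝒯.jet (w t) P ξ) :
    ContinuousOn w (Icc 0 T) := by
  rw [continuousOn_pi]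
  rintro ⟨ℓ, j⟩
  obtain ⟨P, α, rfl⟩ := 𝒯.loc_surjective j
  have h1 : ContinuousOn (fun t => 𝒯.jet (w t) P (refNode k α) (ℓ, 0)) (Icc 0 T) :=
    (contDiff_coord (ℓ, 0)).continuous.comp_continuousOn (h P _ (refNode_mem hk α)).continuousOn
  refine h1.congr fun t _ => ?_
  change _ = 𝒯.jet (w t) P (refNode k α) (ℓ, 0)
  rw [Triangulation.jet_eq, mkJet_zero, lag_refNode hk]

namespace MeanCurvatureFlow

variable {Γ₀ : Set E3} {T : ℝ} {m : ℕ} (F : MeanCurvatureFlow Γ₀ T m)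

lemma hasDerivWithinAt_xStar (hΓ : IsSmoothClosedSurface Γ₀) {k : ℕ} (𝒯 : Triangulation Γ₀ k) {t : ℝ} (ht : t ∈ Icc 0 T) :
    HasDerivWithinAt (xStar F 𝒯) (vStar F 𝒯 t) (Icc 0 T) t :=
  hasDerivWithinAt_pi.2 fun q => (EuclideanSpace.proj q.1 : E3 →L[ℝ] ℝ).hasFDerivAt.comp_hasDerivWithinAt t
    (F.velocity t ht _ (nearestPoint_mem hΓ.1 hΓ.2.1 _))

/-- The nodal values of the exact positions and velocities and of the Ritz projection satisfy the assumptions of the stability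
estimate, uniformly in the triangulation. -/
lemma exists_isReference (hT : 0 < T) (hΓ : IsSmoothClosedSurface Γ₀) (hm : 5 ≤ m) {σ : ℝ} (hσ : 0 < σ) {k : ℕ} (hk : 1 ≤ k) :
    ∃ h₀ > 0, ∃ L, ∃ μ > 0, ∀ 𝒯 : Triangulation Γ₀ k, 𝒯.IsAdmissible σ → 𝒯.h ≤ h₀ →
      ∀ (us : ℝ → Fin 4 × Fin 𝒯.N → ℝ) (dv : ℝ → Fin 3 × Fin 𝒯.N → ℝ) (du : ℝ → Fin 4 × Fin 𝒯.N → ℝ),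
        (∀ t ∈ Icc 0 T, IsRitzProjection F 𝒯 t (us t)) → AreDefects F 𝒯 us dv du →
        𝒯.IsReference L μ T (xStar F 𝒯) (vStar F 𝒯) us (deriv us) dv du := by
  obtain ⟨V, hV, hΦx, hΦu, h₁, hh₁, -, L, hL, μ, hμ, hreg⟩ := F.exists_reference_regularity hT hΓ hm hσ hk
  obtain ⟨N, hN, h₂, hh₂, hcard⟩ := F.exists_card_le hT hΓ (by omega) hσ
  obtain ⟨h₃, hh₃, C, hC, hritz⟩ := Triangulation.exists_lipBdd_ritz hk hT L hμ hN
  refine ⟨min h₁ (min h₂ h₃), by positivity, L + C, μ, hμ, ?_⟩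
  intro 𝒯 hadm hh₀ us dv du hus hdef
  have hh : 0 < 𝒯.h := 𝒯.h_pos hΓ.2.1
  have hr := hreg 𝒯 hadm hh (hh₀.trans (min_le_left _ _))
  set Φx : E3 × ℝ → Fin 3 → ℝ := fun x ℓ => nearestPoint (F.surface x.2) x.1 ℓ
  set Φu : E3 × ℝ → Fin 4 → ℝ := fun x => F.u x.2 (nearestPoint (F.surface x.2) x.1)
  have hcx := fun t (ht : t ∈ Icc 0 T) P ξ (hξ : ξ ∈ refTriangle) => jetOf_comp hV (hΦx.of_le (by norm_num))
    (𝒯.differentiable_patch (xStar F 𝒯 t) P ξ) ((hr P ξ hξ).1 t ht).2 𝒯.h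
  have hcu := fun t (ht : t ∈ Icc 0 T) P ξ (hξ : ξ ∈ refTriangle) => jetOf_comp hV (hΦu.of_le (by norm_num))
    (𝒯.differentiable_patch (xStar F 𝒯 t) P ξ) ((hr P ξ hξ).1 t ht).2 𝒯.h
  simp only [Triangulation.jetOf_patch] at hcx hcu
  set S' : Set (Jet 3 × ℝ) := (fun p : Jet 3 × ℝ => ((jetPart 0 p.1, p.2) : E3 × ℝ)) ⁻¹' V
  have hlx : ContDiffOn ℝ 2 (liftJ Φx (slab V T)) (slab S' T) := contDiffOn_liftJ hV hT (n := 2) hΦx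
  have hlu : ContDiffOn ℝ 2 (liftJ Φu (slab V T)) (slab S' T) := contDiffOn_liftJ hV hT (n := 2) hΦu
  have hS' : ∀ t ∈ Icc 0 T, ∀ P, ∀ ξ ∈ refTriangle, (𝒯.jet (xStar F 𝒯 t) P ξ, t) ∈ slab S' T := fun t ht P ξ hξ =>
    mem_slab.2 ⟨((hr P ξ hξ).1 t ht).2.1, ht⟩
  have hjc : ∀ t P, ContinuousOn (fun ξ => (𝒯.jet (xStar F 𝒯 t) P ξ, t)) refTriangle := fun t P =>
    ((𝒯.continuous_jet_right _ P).prodMk continuous_const).continuousOn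
  have hXc : ∀ t ∈ Icc 0 T, ∀ P, ContinuousOn (jetOf 𝒯.h fun ℓ η => liftedPatch F 𝒯 t P η ℓ) refTriangle := fun t ht P =>
    (hlx.continuousOn.comp (hjc t P) (hS' t ht P)).congr fun ξ hξ => (hcx t ht P ξ hξ).2
  have hUc : ∀ t ∈ Icc 0 T, ∀ P, ContinuousOn (jetOf 𝒯.h fun ℓ η => F.u t (liftedPatch F 𝒯 t P η) ℓ) refTriangle :=
    fun t ht P => (hlu.continuousOn.comp (hjc t P) (hS' t ht P)).congr fun ξ hξ => (hcu t ht P ξ hξ).2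
  have hgood : ∀ t ∈ Icc 0 T, 𝒯.Good (xStar F 𝒯 t) := fun t ht P ξ hξ => goodJets_subset hμ ((hr P ξ hξ).1 t ht).1
  -- the Ritz projection represents the exact solution in the `H¹` inner product
  have hrep : (∀ t ∈ Icc 0 T, ∀ P, ∀ ξ ∈ refTriangle,
        jetOf 𝒯.h (fun ℓ η => liftedPatch F 𝒯 t P η ℓ) ξ ∈ goodJets (L + 1) (μ / 2)) → ∀ t ∈ Icc 0 T, ∀ z,
      z ⬝ᵥ 𝒯.K 4 (xStar F 𝒯 t) *ᵥ us t = 𝒯.SI fun P ξ => inner ℝ (kV (jetOf 𝒯.h (fun ℓ η => liftedPatch F 𝒯 t P η ℓ) ξ)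
        (jetOf 𝒯.h (fun ℓ η => F.u t (liftedPatch F 𝒯 t P η) ℓ) ξ)) (𝒯.jet z P ξ) := by
    intro hX t ht z
    rw [Triangulation.dotProduct_K hh (hgood t ht)]
    have h1 := hus t ht z
    rw [Triangulation.sum_forms_eq_SI (fun P ξ _ => 𝒯.differentiable_patch _ P ξ) (𝒯.comp (us t)) (fun P ξ hξ => hgood t ht P ξ hξ)
        (fun P => (𝒯.continuous_jet_right (xStar F 𝒯 t) P).continuousOn) (fun P => (𝒯.continuous_jet_right (us t) P).continuousOn) hh,
      Triangulation.sum_forms_eq_SI (Y := liftedPatch F 𝒯 t) (fun P ξ hξ => differentiableAt_euclidean.2 (hcx t ht P ξ hξ).1)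
        (fun ℓ P ξ => F.u t (liftedPatch F 𝒯 t P ξ) ℓ) (fun P ξ hξ => goodJets_subset (by positivity) (hX t ht P ξ hξ))
        (hXc t ht) (hUc t ht) hh] at h1
    exact h1
  obtain ⟨hX, hLus⟩ := hritz 𝒯 hh (hh₀.trans ((min_le_right _ _).trans (min_le_right _ _)))
    (hcard 𝒯 hadm hh (hh₀.trans ((min_le_right _ _).trans (min_le_left _ _)))) (xStar F 𝒯) (F.uNodal 𝒯) us
    (fun t P => jetOf 𝒯.h fun ℓ η => liftedPatch F 𝒯 t P η ℓ) (fun t P => jetOf 𝒯.h fun ℓ η => F.u t (liftedPatch F 𝒯 t P η) ℓ)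
    (fun P ξ hξ => ⟨fun t ht => ((hr P ξ hξ).1 t ht).1, (hr P ξ hξ).2.1, (hr P ξ hξ).2.2.2⟩)
    (fun t ht P => ⟨hXc t ht P, hUc t ht P⟩) hrep
  replace hrep := hrep hX
  have hnhds : ∀ t ∈ Ioo 0 T, Icc 0 T ∈ 𝓝 t := fun t ht => Icc_mem_nhds ht.1 ht.2
  have hxs : ∀ t ∈ Ioo 0 T, HasDerivAt (xStar F 𝒯) (vStar F 𝒯 t) t := fun t ht =>
    (F.hasDerivWithinAt_xStar hΓ 𝒯 (Ioo_subset_Icc_self ht)).hasDerivAt (hnhds t ht)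
  have hd : ∀ t ∈ Ioo 0 T, DifferentiableAt ℝ us t := by
    intro t ht
    refine differentiableAt_of_mulVec_eq (A := fun s => 𝒯.K 4 (xStar F 𝒯 s)) (b := fun s => 𝒯.K 4 (xStar F 𝒯 s) *ᵥ us s)
      (fun i j => ?_) (fun i => ?_) ?_
    · have h1 := Triangulation.differentiableAt_SI_inner (d := 4) (hxs t ht).differentiableAt
        (O := (fun p : (Jet 3 × ℝ) × Jet 4 => (p.1.1, p.2)) ⁻¹' goodPairs 4)
        ((isOpen_goodPairs 4).preimage (by fun_prop)) (G := fun p => kV p.1.1 p.2)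
        ((contDiffOn_kV.of_le (by norm_cast)).comp (f := fun p : (Jet 3 × ℝ) × Jet 4 => (p.1.1, p.2))
          (by fun_prop) fun p hp => hp) (Pi.single j 1) (Pi.single i 1)
        fun P ξ hξ => hgood t (Ioo_subset_Icc_self ht) P ξ hξ
      refine h1.congr_of_eventuallyEq ?_
      filter_upwards [hnhds t ht] with s hs
      rw [← Triangulation.dotProduct_K hh (hgood s hs)]
      simp
    · set O : Set (Jet 3 × ℝ) := (S' ∩ univ ×ˢ Ioo 0 T) ∩ liftJ Φx (slab V T) ⁻¹' {X | 0 < dd X}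
      have hS'o : IsOpen S' := hV.preimage (contDiff_jetPart_zero_prod (n := 0)).continuous
      have hsub : S' ∩ univ ×ˢ Ioo 0 T ⊆ slab S' T := fun p hp => mem_slab.2 ⟨hp.1, Ioo_subset_Icc_self hp.2.2⟩
      have hO : IsOpen O := (hlx.continuousOn.mono hsub).isOpen_inter_preimage (hS'o.inter (isOpen_univ.prod isOpen_Ioo)) isOpen_dd_pos
      have hG : ContDiffOn ℝ 1 (fun p => kV (liftJ Φx (slab V T) p) (liftJ Φu (slab V T) p)) O :=
        (contDiffOn_kV.of_le (by norm_cast)).comp (f := fun p => (liftJ Φx (slab V T) p, liftJ Φu (slab V T) p))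
          (((hlx.of_le (by norm_num)).prodMk (hlu.of_le (by norm_num))).mono fun p hp => hsub hp.1) fun p hp => hp.2
      have h1 := Triangulation.differentiableAt_SI_inner (d := 4) (e := 0) (hxs t ht).differentiableAt
        (O := Prod.fst ⁻¹' O) (hO.preimage continuous_fst)
        (G := fun p => kV (liftJ Φx (slab V T) p.1) (liftJ Φu (slab V T) p.1))
        (hG.comp (f := Prod.fst) contDiff_fst.contDiffOn fun p hp => hp) 0 (Pi.single i 1)
        fun P ξ hξ => ⟨⟨(hS' t (Ioo_subset_Icc_self ht) P ξ hξ).1, mem_univ _, ht⟩, by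
          have := goodJets_subset (by positivity) (hX t (Ioo_subset_Icc_self ht) P ξ hξ)
          rw [mem_preimage, ← (hcx t (Ioo_subset_Icc_self ht) P ξ hξ).2]
          exact this⟩
      refine h1.congr_of_eventuallyEq ?_
      filter_upwards [hnhds t ht] with s hs
      have h2 := hrep s hs (Pi.single i 1)
      rw [single_one_dotProduct] at h2
      rw [h2]
      refine Triangulation.SI_congr fun P ξ hξ => ?_
      rw [← (hcx s hs P ξ hξ).2, ← (hcu s hs P ξ hξ).2]
      rfl
    · filter_upwards [hnhds t ht] with s hs
      exact ⟨Triangulation.isUnit_det_K hh hk (hgood s hs) hμ (fun P ξ hξ => ((hr P ξ hξ).1 s hs).1.1)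
        (fun P ξ hξ => ((hr P ξ hξ).1 s hs).1.2), rfl⟩
  exact
    { jet_xs := fun t ht P ξ hξ => goodJets_mono (by linarith) le_rfl ((hr P ξ hξ).1 t ht).1
      jet_vs := fun t ht P ξ hξ => ((hr P ξ hξ).2.2.1.1 t ht).trans (by linarith)
      jet_us := fun t ht P ξ hξ => ((hLus P ξ hξ).1 t ht).trans (by linarith)
      jet_us' := fun t ht P ξ hξ => by
        have h1 : HasDerivAt (fun s => 𝒯.jet (us s) P ξ) (𝒯.jet (deriv us t) P ξ) t :=
          (𝒯.jetL 4 P ξ).hasFDerivAt.comp_hasDerivAt t (hd t ht).hasDerivAt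
        refine (h1.le_of_lip' hC ?_).trans (by linarith)
        filter_upwards [hnhds t ht] with s hs
        exact (hLus P ξ hξ).2 s hs t (Ioo_subset_Icc_self ht)
      continuousOn_xs := fun t ht => (F.hasDerivWithinAt_xStar hΓ 𝒯 ht).continuousWithinAt
      continuousOn_us := 𝒯.continuousOn_of_lipBdd_jet hk hLus
      hasDerivAt_xs := hxs
      hasDerivAt_us := fun t ht => (hd t ht).hasDerivAt
      velocity := hdef.velocity
      geometry := fun t ht => by
        rw [← derivWithin_of_mem_nhds (hnhds t ht)]
        exact hdef.geometry t (Ioo_subset_Icc_self ht) }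

end MeanCurvatureFlow

end ESFEM

end

theorem proposition7p1 (k : ℕ) (Γ₀ : Set E3) (hΓ₀ : IsSmoothClosedSurface Γ₀) (T : ℝ) (hT : 0 < T)
    (F : MeanCurvatureFlow Γ₀ T (k + 4)) (σ : ℝ) (hσ : 0 < σ) :
    ∃ C : ℝ, ∀ κ c : ℝ, 1 < κ → κ ≤ k → ∃ h₀ : ℝ, 0 < h₀ ∧
      ∀ 𝒯 : Triangulation Γ₀ k, 𝒯.IsAdmissible σ → 𝒯.h ≤ h₀ →
      ∀ (us : ℝ → Fin 4 × Fin 𝒯.N → ℝ) (dv : ℝ → Fin 3 × Fin 𝒯.N → ℝ)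
        (du : ℝ → Fin 4 × Fin 𝒯.N → ℝ),
      (∀ t ∈ Icc 0 T, IsRitzProjection F 𝒯 t (us t)) → AreDefects F 𝒯 us dv du →
      (∀ t ∈ Icc 0 T, normStar F 𝒯 t (dv t) ≤ c * 𝒯.h ^ κ) →
      (∀ t ∈ Icc 0 T, normM F 𝒯 t (du t) ≤ c * 𝒯.h ^ κ) →
      ∀ (S : ℝ) (x v : ℝ → Fin 3 × Fin 𝒯.N → ℝ) (u : ℝ → Fin 4 × Fin 𝒯.N → ℝ),
      0 < S → S ≤ T → 𝒯.IsSemidiscreteSolution S x v u →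
      normK F 𝒯 0 (u 0 - us 0) ≤ c * 𝒯.h ^ κ →
      ∀ t ∈ Icc 0 S,
        normK F 𝒯 t (x t - xStar F 𝒯 t) ^ 2 + normK F 𝒯 t (v t - vStar F 𝒯 t) ^ 2 +
            normK F 𝒯 t (u t - us t) ^ 2 ≤
          C * normK F 𝒯 0 (u 0 - us 0) ^ 2 +
          C * sSup ((fun s => normStar F 𝒯 s (dv s) ^ 2) '' Icc 0 t) +
          C * ∫ s in (0 : ℝ)..t, normM F 𝒯 s (du s) ^ 2 := by
  by_cases hk : 1 ≤ k
  swap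
  · refine ⟨0, fun κ c hκ hκk => ?_⟩
    have h0 : k = 0 := by omega
    rw [h0, Nat.cast_zero] at hκk
    linarith
  obtain ⟨h₁, hh₁, L, μ, hμ, href⟩ := F.exists_isReference hT hΓ₀ (by omega) hσ hk
  obtain ⟨C, hC, b, hb, hstab⟩ := Triangulation.exists_stability_bound k hk L hμ hT
  refine ⟨C, fun κ c hκ hκk => ?_⟩
  have hexp : 0 < 2 * κ - 2 := by linarith
  -- for `h ≤ h₀` the squares of the assumed bounds are small compared with `h²`; this uses `κ > 1`
  refine ⟨min h₁ ((b / (c ^ 2 + 1)) ^ (2 * κ - 2)⁻¹), by positivity, ?_⟩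
  intro 𝒯 hadm hh₀ us dv du hus hdef hdv hdu S x v u hS hST hsol hu0 t ht
  have hh : 0 < 𝒯.h := 𝒯.h_pos hΓ₀.2.1
  have H := href 𝒯 hadm (hh₀.trans (min_le_left _ _)) us dv du hus hdef
  have hG : (c * 𝒯.h ^ κ) ^ 2 ≤ b * 𝒯.h ^ 2 := by
    have h1 : 𝒯.h ^ (2 * κ - 2) ≤ b / (c ^ 2 + 1) := by
      refine (Real.rpow_le_rpow hh.le (hh₀.trans (min_le_right _ _)) hexp.le).trans_eq ?_
      rw [← Real.rpow_mul (by positivity), inv_mul_cancel₀ hexp.ne', Real.rpow_one]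
    rw [le_div_iff₀ (by positivity)] at h1
    have h2 : (𝒯.h ^ κ) ^ 2 = 𝒯.h ^ (2 * κ - 2) * 𝒯.h ^ 2 := by
      rw [← Real.rpow_natCast, ← Real.rpow_natCast, ← Real.rpow_mul hh.le, ← Real.rpow_add hh]
      congr 1
      push_cast
      ring
    rw [mul_pow, h2, ← mul_assoc]
    gcongr
    nlinarith [Real.rpow_nonneg hh.le (2 * κ - 2)]
  have hgood : ∀ s ∈ Icc 0 T, 𝒯.Good (xStar F 𝒯 s) := fun s hs P ξ hξ => goodJets_subset hμ (H.jet_xs s hs P ξ hξ)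
  have hK : ∀ {d : ℕ} s, s ∈ Icc 0 T → ∀ w : Fin d × Fin 𝒯.N → ℝ, normK F 𝒯 s w ^ 2 = w ⬝ᵥ 𝒯.K d (xStar F 𝒯 s) *ᵥ w :=
    fun s hs w => Real.sq_sqrt (Triangulation.dotProduct_K_self_nonneg hh (hgood s hs) w)
  have hM : ∀ s ∈ Icc 0 T, ∀ w : Fin 4 × Fin 𝒯.N → ℝ, normM F 𝒯 s w ^ 2 = w ⬝ᵥ 𝒯.M 4 (xStar F 𝒯 s) *ᵥ w :=
    fun s hs w => Real.sq_sqrt (Triangulation.dotProduct_M_self_nonneg hh (hgood s hs) w)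
  have hsqrt : ∀ {a r : ℝ}, √a ≤ r → a ≤ r ^ 2 := fun h => (Real.sqrt_le_iff.1 h).2
  have h0 : (0 : ℝ) ∈ Icc 0 T := ⟨le_rfl, hT.le⟩
  have htT : t ∈ Icc 0 T := ⟨ht.1, ht.2.trans hST⟩
  have hsub : Icc 0 t ⊆ Icc 0 T := Icc_subset_Icc_right htT.2
  have hx0 : x 0 = xStar F 𝒯 0 := by
    rw [hsol.initial]
    funext q
    rw [xStar, F.initial (𝒯.node q.2) (nearestPoint_mem hΓ₀.1 hΓ₀.2.1 _)]
  have hbdd : BddAbove ((fun s => normStar F 𝒯 s (dv s) ^ 2) '' Icc 0 t) := by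
    refine ⟨(c * 𝒯.h ^ κ) ^ 2, ?_⟩
    rintro _ ⟨s, hs, rfl⟩
    exact pow_le_pow_left₀ (Real.sqrt_nonneg _) (hdv s (hsub hs)) 2
  have hmain := hstab 𝒯 hh _ _ _ _ _ _ H _ hG (fun s hs => hsqrt (hdv s hs)) (fun s hs => hsqrt (hdu s hs)) S x v u hST hsol hx0
    (hsqrt hu0) t ht (sSup ((fun s => normStar F 𝒯 s (dv s) ^ 2) '' Icc 0 t))
    fun s hs => (hsqrt le_rfl).trans (le_csSup hbdd (mem_image_of_mem _ hs))
  have hint : ∫ s in (0 : ℝ)..t, normM F 𝒯 s (du s) ^ 2 = ∫ s in (0 : ℝ)..t, du s ⬝ᵥ 𝒯.M 4 (xStar F 𝒯 s) *ᵥ du s :=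
    intervalIntegral.integral_congr fun s hs => hM s (hsub (by rwa [uIcc_of_le ht.1] at hs)) _
  rw [hK t htT, hK t htT, hK t htT, hK 0 h0, hint]
  linarith
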